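/- Let $n\ge 4$ be an integer, $M,T>0$, let $X=[0,M]$ with periodic boundary conditions, and let $H^s=H^s(X)$ denote the Sobolev spaces of $M$-periodic real functions. Consider the initial value problem $$u_t=a(x,t)u_{xxx}+b(x,t)u_{xx}+c(x,t)u_x+d(x,t)u+e(x,t),\qquad u(\cdot,0)=u_0, \tag{1}$$ with $M$-periodic real coefficients satisfying $$(A_n)\quad a\in C([0,T];C^{n+3}),\ a_t\in C([0,T];C^n),\ b\in C([0,T];C^{n+2}),\ b_t\in C([0,T];C^n),\ c,d\in C([0,T];C^n),\ e\in L^\infty([0,T];H^n).$$ Suppose there are $a_0,\delta_0>0$ with $|a(x,t)|\ge a_0$ for all $x\in X$, $t\in[0,T]$, and $$\bar\delta(t):=\frac1M\int_0^M\frac{b(y,t)}{|a(y,t)|}\,dy\ \ge\ \delta_0\qquad\text{for all }t\in[0,T].$$ Then for every $u_0\in H^n$ the problem (1), understood in the time-integrated sense $u(x,t)=u_0(x)+\int_0^t(au_{xxx}+bu_{xx}+cu_x+du+e)(x,s)\,ds$, has exactly one solution $u=:\Psi(u_0)$ in $L^\infty([0,T];H^n)$, and $\Psi(u_0)\in L^2([0,T];H^{n+1})$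 with $$\|\Psi(u_0)\|_{L^2([0,T];H^{n+1})}\le K\left(\|u_0\|_{H^n}+1\right),$$ and, if $e\equiv0$, $$\|\Psi(u_0)\|_{L^2([0,T];H^{n+1})}\le K\|u_0\|_{H^n}.$$ Here $K>0$ depends only on $n$, on $\delta_0$, and on an upper bound $R$ for $M$, $T$, $\|a\|_{L^\infty_TW^{n+3,\infty}}$, $\|a_t\|_{L^\infty_TW^{1,\infty}}$, $\|a^{-1}\|_{L^\infty_TL^\infty}$, $\|b\|_{L^\infty_TW^{n,\infty}}$, $\|b_t\|_{L^\infty_TL^\infty}$, $\|c\|_{L^\infty_TW^{n,\infty}}$, $\|d\|_{L^\infty_TW^{n,\infty}}$ and $\|e\|_{L^\infty_TH^n}$ (where $L^\infty_TB:=L^\infty([0,T];B)$). Moreover, if $(A_n)$ also holds with $n$ replaced by $n+1$, then for every $u_0\in H^n$, $$\Psi(u_0)\in C([0,T];H^n)\cap C((0,T];H^{n'})\qquad\text{for all real } n'\in[0,n+1).$$ -/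

import Mathlib

open MeasureTheory Set Filter Topology

noncomputable section

namespace DispersivePDE

/-! Functions on the periodic interval `X = [0, M]` are `M`-periodic functions `ℝ → ℝ`; functions of
time and space are `u : ℝ → ℝ → ℝ`, with `u t x` the value at time `t` and position `x`; only the
values for `t` in `[0, T]` matter. -/

/-- The `k`-th Fourier coefficient of the function `f` on `[0, M]`. -/
def perCoeff (M : ℝ) (f : ℝ → ℝ) (k : ℤ) : ℂ :=
  (1 / M : ℝ) • ∫ x in (0 : ℝ)..M, Complex.exp (-(2 * Real.pi * Complex.I * k * x / M)) * (f x : ℂ)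

/-- `perCoeff` agrees with the Fourier coefficients of Mathlib. -/
theorem perCoeff_eq_fourierCoeffOn {M : ℝ} (hM : 0 < M) (f : ℝ → ℝ) (k : ℤ) :
    perCoeff M f k = fourierCoeffOn hM (fun x => (f x : ℂ)) k := by
  rw [fourierCoeffOn_eq_integral, perCoeff, sub_zero]
  congr 1
  apply intervalIntegral.integral_congr
  intro x _
  simp only [smul_eq_mul, fourier_coe_apply]
  congr 2
  push_cast
  ring

/-- The Fourier weight `(1 + |ξ_k|²)^s`, where `ξ_k = 2πk/M`. -/
def sobWeight (M s : ℝ) (k : ℤ) : ℝ := (1 + (2 * Real.pi * k / M) ^ 2) ^ s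

/-- `f` belongs to the periodic Sobolev space `H^s(X)`, for real `s ≥ 0`. -/
structure MemH (M s : ℝ) (f : ℝ → ℝ) : Prop where
  periodic : Function.Periodic f M
  memLp : MemLp f 2 (volume.restrict (Ioc 0 M))
  summable : Summable fun k : ℤ => sobWeight M s k * ‖perCoeff M f k‖ ^ 2

/-- The norm of `H^s(X)`; the factor `M` makes `s = 0` the norm of `L²([0, M])`. -/
def normH (M s : ℝ) (f : ℝ → ℝ) : ℝ :=
  Real.sqrt (M * ∑' k : ℤ, sobWeight M s k * ‖perCoeff M f k‖ ^ 2)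

/-- `u ∈ C(S; H^s)` for a set `S` of times. -/
structure ContH (M s : ℝ) (S : Set ℝ) (u : ℝ → ℝ → ℝ) : Prop where
  mem : ∀ t ∈ S, MemH M s (u t)
  tendsto : ∀ t₀ ∈ S, Tendsto (fun t => normH M s (fun x => u t x - u t₀ x)) (𝓝[S] t₀) (𝓝 0)

/-- `u` is a strongly measurable function of `t ∈ [0, T]` with values in `H^s`. As `H^s` is a
separable Hilbert space in which the trigonometric functions span a dense subspace, strong
measurability is measurability of all Fourier coefficients (Pettis). -/
structure MeasH (M T s : ℝ) (u : ℝ → ℝ → ℝ) : Prop where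
  mem : ∀ᵐ t ∂(volume.restrict (Icc 0 T)), MemH M s (u t)
  meas : ∀ k : ℤ, AEStronglyMeasurable (fun t => perCoeff M (u t) k) (volume.restrict (Icc 0 T))

/-- `u ∈ L^∞([0, T]; H^s)`. -/
structure MemLinftyH (M T s : ℝ) (u : ℝ → ℝ → ℝ) : Prop extends MeasH M T s u where
  bound : ∃ C : ℝ, ∀ᵐ t ∂(volume.restrict (Icc 0 T)), normH M s (u t) ≤ C

/-- `u ∈ L²([0, T]; H^s)`. -/
structure MemL2H (M T s : ℝ) (u : ℝ → ℝ → ℝ) : Prop extends MeasH M T s u where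
  integrable : IntegrableOn (fun t => normH M s (u t) ^ 2) (Icc 0 T)

/-- The norm of `L²([0, T]; H^s)`. -/
def normL2H (M T s : ℝ) (u : ℝ → ℝ → ℝ) : ℝ :=
  Real.sqrt (∫ t in Icc 0 T, normH M s (u t) ^ 2)

/-- `f ∈ C([0, T]; C^k(X))`: the map `t ↦ f t` is continuous for the `C^k` norm. -/
structure ContCk (M T : ℝ) (k : ℕ) (f : ℝ → ℝ → ℝ) : Prop where
  periodic : ∀ t ∈ Icc 0 T, Function.Periodic (f t) M
  contDiff : ∀ t ∈ Icc 0 T, ContDiff ℝ k (f t)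
  tendsto : ∀ t₀ ∈ Icc 0 T, ∀ j ≤ k,
    TendstoUniformly (fun t => iteratedDeriv j (f t)) (iteratedDeriv j (f t₀)) (𝓝[Icc 0 T] t₀)

/-- The time derivative on `[0, T]`, one-sided at the end points. -/
def timeDeriv (T : ℝ) (f : ℝ → ℝ → ℝ) : ℝ → ℝ → ℝ :=
  fun t x => derivWithin (fun s => f s x) (Icc 0 T) t

/-- `f_t` exists on `[0, T]` and `f_t ∈ C([0, T]; C^k(X))`. -/
structure TimeDerivContCk (M T : ℝ) (k : ℕ) (f : ℝ → ℝ → ℝ) : Prop where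
  differentiable : ∀ x, DifferentiableOn ℝ (fun s => f s x) (Icc 0 T)
  contCk : ContCk M T k (timeDeriv T f)

/-- The regularity of the coefficients. An element `e` of `L^∞([0, T]; H^n)` with `n ≥ 1` is
represented so that `e t` is a continuous function of `x`. -/
structure Regular (M T : ℝ) (n : ℕ) (a b c d e : ℝ → ℝ → ℝ) : Prop where
  a_reg : ContCk M T (n + 3) a
  a_t_reg : TimeDerivContCk M T n a
  b_reg : ContCk M T (n + 2) b
  b_t_reg : TimeDerivContCk M T n b
  c_reg : ContCk M T n c
  d_reg : ContCk M T n d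
  e_reg : MemLinftyH M T n e
  e_cont : ∀ᵐ t ∂(volume.restrict (Icc 0 T)), Continuous (e t)

/-- The dispersion does not degenerate. -/
def NonDegenerate (T : ℝ) (a : ℝ → ℝ → ℝ) : Prop :=
  ∃ a₀ : ℝ, 0 < a₀ ∧ ∀ t ∈ Icc 0 T, ∀ x, a₀ ≤ |a t x|

/-- The average modified diffusion. -/
def avgDiffusion (M : ℝ) (a b : ℝ → ℝ → ℝ) (t : ℝ) : ℝ :=
  (1 / M) * ∫ y in (0 : ℝ)..M, b t y / |a t y|

/-- `‖f‖_{L^∞([0, T]; W^{k,∞})} ≤ R`, for `f ∈ C([0, T]; C^k)`. -/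
def BoundWk (T : ℝ) (k : ℕ) (R : ℝ) (f : ℝ → ℝ → ℝ) : Prop :=
  ∀ t ∈ Icc 0 T, ∀ x, ∀ j ≤ k, |iteratedDeriv j (f t) x| ≤ R

/-- `R` bounds all the quantities on which constants may depend: `M`, `T`, and the norms of
the coefficients. -/
structure DataBound (M T : ℝ) (n : ℕ) (R : ℝ) (a b c d e : ℝ → ℝ → ℝ) : Prop where
  M_le : M ≤ R
  T_le : T ≤ R
  a_le : BoundWk T (n + 3) R a
  a_t_le : BoundWk T 1 R (timeDeriv T a)
  a_inv_le : ∀ t ∈ Icc 0 T, ∀ x, |(a t x)⁻¹| ≤ R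
  b_le : BoundWk T n R b
  b_t_le : BoundWk T 0 R (timeDeriv T b)
  c_le : BoundWk T n R c
  d_le : BoundWk T n R d
  e_le : ∀ᵐ t ∂(volume.restrict (Icc 0 T)), normH M n (e t) ≤ R

/-- The right-hand side `a u_xxx + b u_xx + c u_x + d u + e`. -/
def rhs (a b c d e u : ℝ → ℝ → ℝ) (t x : ℝ) : ℝ :=
  a t x * iteratedDeriv 3 (u t) x + b t x * iteratedDeriv 2 (u t) x + c t x * deriv (u t) x
    + d t x * u t x + e t x

/-- `u ∈ L^∞([0, T]; H^n)` (with `n ≥ 4`, so that `u t` is taken to be a `C^3` function) solves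
`u_t = a u_xxx + b u_xx + c u_x + d u + e` on `[0, T]` with `u(·, 0) = u₀`. As `e` is only bounded
and measurable in time, the equation is integrated in time. -/
structure IsSolution (M T : ℝ) (n : ℕ) (a b c d e : ℝ → ℝ → ℝ) (u₀ : ℝ → ℝ)
    (u : ℝ → ℝ → ℝ) : Prop where
  memLinftyH : MemLinftyH M T n u
  periodic : ∀ t ∈ Icc 0 T, Function.Periodic (u t) M
  contDiff : ∀ t ∈ Icc 0 T, ContDiff ℝ 3 (u t)
  integrable : ∀ x, IntegrableOn (fun s => rhs a b c d e u s x) (Icc 0 T)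
  eqn : ∀ t ∈ Icc 0 T, ∀ x, u t x = u₀ x + ∫ s in (0 : ℝ)..t, rhs a b c d e u s x

/-- An element of `H^n(X)`, `n ≥ 1`, given by its continuous representative. -/
def InitialData (M : ℝ) (n : ℕ) (u₀ : ℝ → ℝ) : Prop := MemH M n u₀ ∧ Continuous u₀

/-- `Ψ` is the solution map: `Ψ u₀` solves the initial value problem for every `u₀ ∈ H^n`, and it is
the only solution. -/
def IsSolutionMap (M T : ℝ) (n : ℕ) (a b c d e : ℝ → ℝ → ℝ)
    (Ψ : (ℝ → ℝ) → ℝ → ℝ → ℝ) : Prop :=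
  ∀ u₀, InitialData M n u₀ →
    IsSolution M T n a b c d e u₀ (Ψ u₀) ∧
    ∀ v, IsSolution M T n a b c d e u₀ v → ∀ t ∈ Icc 0 T, ∀ x, v t x = Ψ u₀ t x

end DispersivePDE

end

open scoped RealInnerProductSpace ContDiff

noncomputable section

/-! ### Linear ordinary differential equations in a Banach space. -/

namespace DispersivePDE

/-! Differentiating the equation `n` times, the top-order part for `w = ∂ⁿu` is `a w_xxx + (n a_x +
b) w_xx + ...`. The diffusion coefficient has no sign, so the plain `L²` energy is not controlled.
The remedy is a weight: in the energy `∫ e^r w²` the third-order term produces `-(3/2) ∫ (e^r a)_x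
w_x²`-type contributions, and `r` can be chosen to redistribute the diffusion over the circle.
Demanding that the quadratic form in `w_x` have coefficient proportional to `a` determines `r_x` up
to a constant `m`, and `r` is periodic exactly when `m` is the mean of `b / a`. As `a` has constant
sign, `m a` equals the average modified diffusion times `|a|`, which is bounded below. So the
averaged hypothesis suffices for genuine parabolic smoothing: the energy inequality carries `∫ w_x²`
on its good side, which is the gain of one derivative. The weight is `Coeffs.exists_weight`, the
algebra is `weighted_energy_identity`, and the estimate of order `n` is `Coeffs.energy_le`.

Existence uses a Galerkin scheme adapted to the weight. A function in `H^n` is encoded by `w ∈ L²`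
through `u = integ M n w`, that is, `∂ⁿu = w - mean w` and `mean u = mean w`; the dual operation on
smooth test functions is `sharp`. The weak equation for `w` then lives in `L²`, with all derivatives
on the test function (`dualOp`). The Galerkin ansatz is `w = Q v` with `Q` multiplication by
`e^{-r}` and `v` in the span of the test functions. Testing with `v` itself is then allowed and
gives exactly the weighted energy `⟪Q v, v⟫ = ∫ e^r w²`, so the estimate survives the
discretization. This is abstracted in `EvolutionForm`; `EvolutionForm.exists_galerkin` and
`EvolutionForm.exists_solution` give the approximations and their weak limit, whose dissipation
bound follows by lower semicontinuity. Testing with smooth approximations of point evaluations turns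
the weak limit into a pointwise solution (`exists_solvesOn`), with constants depending only on `n`,
`R`, `δ`.

Uniqueness (`Coeffs.unique`) is the same weighted estimate at order zero, where the diffusion
coefficient is `b` and a second weight is used. The equation holds only in integrated form, so the
evolution of the energy is derived by absolute continuity in time. The bound without the additive
constant for a vanishing source follows by solving again with source bound zero and invoking
uniqueness.

For continuity in time, almost every time `τ` has `u(τ) ∈ H^{n+1}`. Restarting there with the theory
at level `n + 1`, and identifying solutions by uniqueness, bounds `u` in `H^{n+1}` on `[τ, T]`.
Together with continuity of each Fourier coefficient this gives continuity in every weaker norm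
(`tendsto_normH_sub`). At `t = 0` the initial datum is approximated by smooth ones and the a priori
bound is applied to the difference. -/

/-- Global solvability of linear ordinary differential equations in a Banach space. -/
theorem exists_linear_ode {E : Type*} [NormedAddCommGroup E] [NormedSpace ℝ E] [CompleteSpace E]
    {τ T : ℝ} (hτ : τ ≤ T) {Γ : ℝ → E →L[ℝ] E} {g : ℝ → E}
    (hΓ : ContinuousOn Γ (Icc τ T)) (hg : ContinuousOn g (Icc τ T)) (x₀ : E) :
    ∃ x : ℝ → E, Continuous x ∧ x τ = x₀ ∧
      ∀ t ∈ Ioo τ T, HasDerivAt x (Γ t (x t) + g t) t := by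
  -- Extended by constants beyond the end points, so that all integrands are continuous on the whole
  -- line.
  set Γ' : ℝ → E →L[ℝ] E := IccExtend hτ ((Icc τ T).domRestrict Γ) with hΓ'
  set g' : ℝ → E := IccExtend hτ ((Icc τ T).domRestrict g) with hg'
  have cΓ : Continuous Γ' := (continuousOn_iff_continuous_domRestrict.1 hΓ).Icc_extend'
  have cg : Continuous g' := (continuousOn_iff_continuous_domRestrict.1 hg).Icc_extend'
  obtain ⟨K, hK⟩ := isCompact_Icc.exists_bound_of_continuousOn hΓ
  have hK' : ∀ t, ‖Γ' t‖ ≤ max K 0 := fun t =>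
    (hK _ (projIcc τ T hτ t).2).trans (le_max_left _ _)
  set k : ℝ := max K 0 with hk
  have hk0 : 0 ≤ k := le_max_right _ _
  -- The fixed point is sought for `z t = exp (-l (t - τ)) • x t`. In this scaling the Picard map
  -- has Lipschitz constant `k / l ≤ 1 / 2` on the whole interval, so no continuation argument is
  -- needed.
  set l : ℝ := 2 * k + 1 with hl
  have hl0 : 0 < l := by positivity
  have cint : ∀ z : C(Icc τ T, E), Continuous fun s =>
      Γ' s (Real.exp (l * (s - τ)) • z (projIcc τ T hτ s)) + g' s := by
    intro z
    have : Continuous fun s => z (projIcc τ T hτ s) := z.continuous.comp continuous_projIcc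
    exact (cΓ.clm_apply ((by fun_prop : Continuous fun s => Real.exp (l * (s - τ))).smul this)).add cg
  let Φ : C(Icc τ T, E) → C(Icc τ T, E) := fun z =>
    ⟨fun t => Real.exp (-(l * (t - τ))) • (x₀ + ∫ s in τ..t,
      (Γ' s (Real.exp (l * (s - τ)) • z (projIcc τ T hτ s)) + g' s)), by
      have h1 := intervalIntegral.continuous_primitive (μ := volume)
        (fun a b => (cint z).intervalIntegrable a b) τ
      exact (by fun_prop : Continuous fun t : Icc τ T => Real.exp (-(l * ((t : ℝ) - τ)))).smul
        (continuous_const.add (h1.comp continuous_subtype_val))⟩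
  have hΦ : ContractingWith (1 / 2) Φ := by
    refine ⟨by norm_num, LipschitzWith.of_dist_le_mul fun z z' => ?_⟩
    have hr : 0 ≤ ((1 / 2 : NNReal) : ℝ) * dist z z' := by positivity
    rw [ContinuousMap.dist_le hr]
    intro t
    have ht := t.2
    simp only [Φ, ContinuousMap.coe_mk, dist_eq_norm, ← smul_sub, add_sub_add_left_eq_sub]
    rw [← intervalIntegral.integral_sub ((cint z).intervalIntegrable _ _)
      ((cint z').intervalIntegrable _ _), norm_smul, Real.norm_of_nonneg (Real.exp_nonneg _)]
    have hb : ‖∫ s in τ..(t : ℝ), ((Γ' s (Real.exp (l * (s - τ)) • z (projIcc τ T hτ s)) + g' s) -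
        (Γ' s (Real.exp (l * (s - τ)) • z' (projIcc τ T hτ s)) + g' s))‖ ≤
        ∫ s in τ..(t : ℝ), k * ‖z - z'‖ * Real.exp (l * (s - τ)) := by
      refine intervalIntegral.norm_integral_le_of_norm_le ht.1 (ae_of_all _ fun s _ => ?_)
        (Continuous.intervalIntegrable (by fun_prop) _ _)
      rw [add_sub_add_right_eq_sub, ← map_sub, ← smul_sub]
      refine ((Γ' s).le_opNorm _).trans ?_
      rw [norm_smul, Real.norm_of_nonneg (Real.exp_nonneg _)]
      have h1 : ‖z (projIcc τ T hτ s) - z' (projIcc τ T hτ s)‖ ≤ ‖z - z'‖ :=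
        (z - z').norm_coe_le_norm _
      calc _ ≤ k * (Real.exp (l * (s - τ)) * ‖z - z'‖) := by gcongr; exact hK' s
        _ = _ := by ring
    have hI : ∫ s in τ..(t : ℝ), Real.exp (l * (s - τ)) = (Real.exp (l * (t - τ)) - 1) / l := by
      have hd : ∀ s ∈ uIcc τ (t : ℝ), HasDerivAt (fun s => Real.exp (l * (s - τ)) / l)
          (Real.exp (l * (s - τ))) s := by
        intro s _
        have := (((hasDerivAt_id s).sub_const τ).const_mul l).exp.div_const l
        convert! this using 1
        simp; field_simp
      rw [intervalIntegral.integral_eq_sub_of_hasDerivAt hd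
        (Continuous.intervalIntegrable (by fun_prop) _ _)]
      simp; ring
    rw [intervalIntegral.integral_const_mul, hI] at hb
    have hexp : Real.exp (-(l * ((t : ℝ) - τ))) * Real.exp (l * ((t : ℝ) - τ)) = 1 := by
      rw [← Real.exp_add]; simp
    calc _ ≤ Real.exp (-(l * ((t : ℝ) - τ))) *
          (k * ‖z - z'‖ * ((Real.exp (l * (t - τ)) - 1) / l)) := by gcongr
      _ = k * ‖z - z'‖ / l * (1 - Real.exp (-(l * ((t : ℝ) - τ)))) := by
          have : Real.exp (-(l * ((t : ℝ) - τ))) * (k * ‖z - z'‖ * ((Real.exp (l * (t - τ)) - 1) / l))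
            = k * ‖z - z'‖ / l * (Real.exp (-(l * ((t : ℝ) - τ))) * Real.exp (l * ((t : ℝ) - τ)) -
              Real.exp (-(l * ((t : ℝ) - τ)))) := by ring
          rw [this, hexp]
      _ ≤ k * ‖z - z'‖ / l * 1 := by
          gcongr; linarith [Real.exp_pos (-(l * ((t : ℝ) - τ)))]
      _ ≤ 1 / 2 * ‖z - z'‖ := by
          rw [mul_one, div_le_iff₀ hl0]; nlinarith [norm_nonneg (z - z')]
      _ = _ := by norm_num
  have : Nonempty (Icc τ T) := ⟨⟨τ, left_mem_Icc.2 hτ⟩⟩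
  set z := ContractingWith.fixedPoint Φ hΦ
  have hz : Φ z = z := ContractingWith.fixedPoint_isFixedPt hΦ
  set x : ℝ → E := fun t => x₀ + ∫ s in τ..t,
      (Γ' s (Real.exp (l * (s - τ)) • z (projIcc τ T hτ s)) + g' s) with hx
  have hxz : ∀ t ∈ Icc τ T, x t = Real.exp (l * (t - τ)) • z (projIcc τ T hτ t) := by
    intro t ht
    have h1 := congrArg (fun f : C(Icc τ T, E) => f (projIcc τ T hτ t)) hz
    simp only [Φ, ContinuousMap.coe_mk] at h1
    rw [← h1, projIcc_of_mem hτ ht, smul_smul, ← Real.exp_add]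
    simp [hx]
  refine ⟨x, ?_, by simp [hx], fun t ht => ?_⟩
  · exact continuous_const.add
      (intervalIntegral.continuous_primitive (fun a b => (cint z).intervalIntegrable a b) τ)
  · have h1 := (intervalIntegral.integral_hasDerivAt_right ((cint z).intervalIntegrable τ t)
      (cint z).stronglyMeasurable.stronglyMeasurableAtFilter (cint z).continuousAt).const_add x₀
    have ht' := Ioo_subset_Icc_self ht
    rw [← hxz t ht', hΓ', hg', IccExtend_of_mem hτ _ ht', IccExtend_of_mem hτ _ ht'] at h1
    exact h1

end DispersivePDE

/-! ### Gronwall's inequality and the abstract dissipative evolution problem. -/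

namespace DispersivePDE

/-- The primitive of a function continuous on `[τ, T]` is differentiable in the interior. -/
theorem hasDerivAt_primitive {τ T : ℝ} {f : ℝ → ℝ} (hf : ContinuousOn f (Icc τ T)) {t : ℝ}
    (ht : t ∈ Ioo τ T) : HasDerivAt (fun s => ∫ r in τ..s, f r) (f t) t := by
  have h1 : IntervalIntegrable f volume τ t := by
    apply ContinuousOn.intervalIntegrable
    rw [uIcc_of_le ht.1.le]; exact hf.mono (Icc_subset_Icc_right ht.2.le)
  exact intervalIntegral.integral_hasDerivAt_right h1
    ((hf.mono Ioo_subset_Icc_self).stronglyMeasurableAtFilter isOpen_Ioo t ht)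
    (hf.continuousAt (Icc_mem_nhds ht.1 ht.2))

theorem continuousOn_primitive {τ T : ℝ} (hτ : τ ≤ T) {f : ℝ → ℝ} (hf : ContinuousOn f (Icc τ T)) :
    ContinuousOn (fun s => ∫ r in τ..s, f r) (Icc τ T) := by
  have := intervalIntegral.continuousOn_primitive_interval (μ := volume) (f := f) (a := τ) (b := T)
    (by rw [uIcc_of_le hτ]; exact hf.integrableOn_Icc)
  rwa [uIcc_of_le hτ] at this

/-- Gronwall's inequality with a dissipation term. -/
theorem gronwall_dissipation {τ T : ℝ} {E E' D γ : ℝ → ℝ} {κ : ℝ} (hκ : 0 ≤ κ)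
    (hE : ContinuousOn E (Icc τ T)) (hE0 : ∀ t ∈ Icc τ T, 0 ≤ E t)
    (hE' : ∀ t ∈ Ioo τ T, HasDerivAt E (E' t) t)
    (hD : ContinuousOn D (Icc τ T)) (hD0 : ∀ t ∈ Icc τ T, 0 ≤ D t)
    (hγ : ContinuousOn γ (Icc τ T)) (hγ0 : ∀ t ∈ Icc τ T, 0 ≤ γ t)
    (h : ∀ t ∈ Ioo τ T, E' t ≤ κ * E t - D t + γ t) {t : ℝ} (ht : t ∈ Icc τ T) :
    E t + ∫ s in τ..t, D s ≤ Real.exp (κ * (T - τ)) * (E τ + ∫ s in τ..T, γ s) := by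
  have hτ : τ ≤ T := ht.1.trans ht.2
  set w : ℝ → ℝ := fun s => Real.exp (-(κ * (s - τ))) with hw
  have wc : Continuous w := by fun_prop
  have hwd : ∀ s, HasDerivAt w (-κ * w s) s := by
    intro s
    have := (((hasDerivAt_id s).sub_const τ).const_mul κ).neg.exp
    convert! this using 1
    simp [hw]; ring
  have cD : ContinuousOn (fun s => w s * (D s - γ s)) (Icc τ T) :=
    wc.continuousOn.mul (hD.sub hγ)
  -- Integrating factor: the hypothesis says that the derivative of this function is nonpositive.
  -- The weight `w` lies between `m` and `1`, so it can be removed from `D` and `γ` at the cost of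
  -- the final exponential.
  have anti : AntitoneOn (fun s => w s * E s + ∫ r in τ..s, w r * (D r - γ r)) (Icc τ T) := by
    apply antitoneOn_of_hasDerivWithinAt_nonpos (convex_Icc τ T)
      (f' := fun s => (-κ * w s) * E s + w s * E' s + w s * (D s - γ s))
    · exact (wc.continuousOn.mul hE).add (continuousOn_primitive hτ cD)
    · intro s hs
      rw [interior_Icc] at hs
      exact (((hwd s).mul (hE' s hs)).add (hasDerivAt_primitive cD hs)).hasDerivWithinAt
    · intro s hs
      rw [interior_Icc] at hs
      have h1 := h s hs
      have : 0 ≤ w s := (Real.exp_pos _).le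
      nlinarith
  have hle := anti (left_mem_Icc.2 hτ) ht ht.1
  have hwτ : w τ = 1 := by simp [hw]
  simp only [hwτ, one_mul, intervalIntegral.integral_same, add_zero] at hle
  have hsub : Icc τ t ⊆ Icc τ T := Icc_subset_Icc_right ht.2
  have iD : IntervalIntegrable D volume τ t := by
    apply ContinuousOn.intervalIntegrable; rw [uIcc_of_le ht.1]; exact hD.mono hsub
  have iγ : IntervalIntegrable γ volume τ t := by
    apply ContinuousOn.intervalIntegrable; rw [uIcc_of_le ht.1]; exact hγ.mono hsub
  have iγ' : IntervalIntegrable γ volume τ T := by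
    apply ContinuousOn.intervalIntegrable; rwa [uIcc_of_le hτ]
  have iD' : IntervalIntegrable (fun s => w s * (D s - γ s)) volume τ t := by
    apply ContinuousOn.intervalIntegrable; rw [uIcc_of_le ht.1]; exact cD.mono hsub
  set m := Real.exp (-(κ * (T - τ))) with hm
  have hmw : ∀ s ∈ Icc τ T, m ≤ w s := fun s hs => by
    apply Real.exp_le_exp.2; have := mul_le_mul_of_nonneg_left hs.2 hκ; linarith
  have hw1 : ∀ s ∈ Icc τ T, w s ≤ 1 := fun s hs => by
    apply Real.exp_le_one_iff.2; have := mul_nonneg hκ (sub_nonneg.2 hs.1); linarith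
  have hm0 : 0 < m := Real.exp_pos _
  have h2 : m * (∫ s in τ..t, D s) - ∫ s in τ..t, γ s ≤ ∫ r in τ..t, w r * (D r - γ r) := by
    rw [← intervalIntegral.integral_const_mul, ← intervalIntegral.integral_sub (iD.const_mul _) iγ]
    apply intervalIntegral.integral_mono_on ht.1 ((iD.const_mul _).sub iγ) iD'
    intro s hs
    have hs' := hsub hs
    nlinarith [hmw s hs', hw1 s hs', hD0 s hs', hγ0 s hs']
  have h3 : ∫ s in τ..t, γ s ≤ ∫ s in τ..T, γ s := by
    apply intervalIntegral.integral_mono_interval le_rfl ht.1 ht.2 _ iγ'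
    filter_upwards [ae_restrict_mem measurableSet_Ioc] with s hs using hγ0 s (Ioc_subset_Icc_self hs)
  have h4 : m * E t ≤ w t * E t := mul_le_mul_of_nonneg_right (hmw t ht) (hE0 t ht)
  have h5 : m * (E t + ∫ s in τ..t, D s) ≤ E τ + ∫ s in τ..T, γ s := by linarith
  have h6 : Real.exp (κ * (T - τ)) * m = 1 := by rw [hm, ← Real.exp_add]; simp
  calc _ = Real.exp (κ * (T - τ)) * (m * (E t + ∫ s in τ..t, D s)) := by
        rw [← mul_assoc, h6, one_mul]
    _ ≤ _ := by gcongr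

/-- A linear evolution problem `⟪w, ι ψ⟫' = ⟪w, A ψ⟫ + F ψ` for all test vectors `ψ`, together with
a family `Q` of positive symmetric weights for which it is dissipative. -/
structure EvolutionForm {H 𝒟 κ : Type*} [NormedAddCommGroup H] [InnerProductSpace ℝ H]
    [AddCommGroup 𝒟] [Module ℝ 𝒟] (ι : 𝒟 →ₗ[ℝ] H) (τ T q₀ q₁ C : ℝ) (Q Q' A : ℝ → 𝒟 →ₗ[ℝ] H)
    (g : κ → H) : Prop where
  injective : Function.Injective ι
  symm : ∀ t ∈ Icc τ T, ∀ v w, ⟪Q t v, ι w⟫ = ⟪Q t w, ι v⟫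
  lower : ∀ t ∈ Icc τ T, ∀ v, q₀ * ‖ι v‖ ^ 2 ≤ ⟪Q t v, ι v⟫
  -- In this form a bound on the energy bounds the unknown `w = Q v` itself, rather than `v`.
  upper : ∀ t ∈ Icc τ T, ∀ v, ‖Q t v‖ ^ 2 ≤ q₁ * ⟪Q t v, ι v⟫
  cont : ∀ v, ContinuousOn (fun t => Q t v) (Icc τ T)
  cont' : ∀ v, ContinuousOn (fun t => Q' t v) (Icc τ T)
  contA : ∀ v, ContinuousOn (fun t => A t v) (Icc τ T)
  deriv : ∀ t ∈ Ioo τ T, ∀ v w, HasDerivAt (fun s => ⟪Q s v, ι w⟫) ⟪Q' t v, ι w⟫ t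
  -- For `w = Q v` tested with `v`, symmetry gives `(⟪Q v, v⟫)' = 2 ⟪(Q v)', v⟫ - ⟪Q' v, v⟫`, which
  -- explains the sign of `Q'`. The sum over finite subfamilies of `g` is the dissipation, written
  -- through bounded functionals so that it passes to weak limits.
  energy : ∀ t ∈ Ioo τ T, ∀ v, ∀ s : Finset κ,
    2 * ⟪Q t v, A t v⟫ - ⟪Q' t v, ι v⟫ + ∑ i ∈ s, ⟪Q t v, g i⟫ ^ 2 ≤ C * ⟪Q t v, ι v⟫

/-- Injectivity of `ι` lets an orthonormal basis of the span of `ι '' S` be pulled back to `𝒟`. In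
the resulting coordinates `‖ι ·‖` is the Euclidean norm, although `𝒟` carries no norm. -/
theorem exists_orthonormal_preimage {H 𝒟 : Type*} [NormedAddCommGroup H] [InnerProductSpace ℝ H]
    [AddCommGroup 𝒟] [Module ℝ 𝒟] (ι : 𝒟 →ₗ[ℝ] H) (hι : Function.Injective ι) (S : Finset 𝒟) :
    ∃ (m : ℕ) (b : Fin m → 𝒟), Orthonormal ℝ (fun i => ι (b i)) ∧
      ∀ ψ ∈ S, ∃ y : EuclideanSpace ℝ (Fin m), ψ = ∑ i, y i • b i := by
  classical
  set W : Submodule ℝ H := Submodule.span ℝ (ι '' (S : Set 𝒟)) with hW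
  have : FiniteDimensional ℝ W :=
    FiniteDimensional.span_of_finite ℝ (S.finite_toSet.image ι)
  have hWr : W ≤ LinearMap.range ι := by
    rw [hW, Submodule.span_le]; rintro _ ⟨x, _, rfl⟩; exact ⟨x, rfl⟩
  set o := stdOrthonormalBasis ℝ W
  choose b hb using fun i => hWr (o i).2
  refine ⟨_, b, ?_, fun ψ hψ => ?_⟩
  · have h1 : (fun i => ι (b i)) = fun i => W.subtypeₗᵢ (o i) := funext fun i => hb i
    rw [h1]
    exact o.orthonormal.comp_linearIsometry W.subtypeₗᵢ
  · have hm : ι ψ ∈ W := Submodule.subset_span ⟨ψ, hψ, rfl⟩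
    refine ⟨o.repr ⟨ι ψ, hm⟩, hι ?_⟩
    have h2 := congrArg Subtype.val (o.sum_repr ⟨ι ψ, hm⟩)
    simp only [Submodule.coe_sum, Submodule.coe_smul] at h2
    refine h2.symm.trans ?_
    rw [map_sum]
    simp [hb]

end DispersivePDE

/-! ### Galerkin approximation. -/

namespace DispersivePDE

/-- Approximation of a bounded measurable function by continuous ones. -/
theorem exists_continuous_approx {X : Type*} [NormedAddCommGroup X] [NormedSpace ℝ X]
    [FiniteDimensional ℝ X] {τ T : ℝ} (hτ : τ ≤ T)
    {f : ℝ → X} (hf : AEStronglyMeasurable f (volume.restrict (Icc τ T))) {B : ℝ}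
    (hfB : ∀ᵐ t ∂(volume.restrict (Icc τ T)), ‖f t‖ ≤ B) {ε : ℝ} (hε : 0 < ε) :
    ∃ g : ℝ → X, Continuous g ∧ (∫ t in τ..T, ‖g t‖ ^ 2) ≤ 2 * B ^ 2 * (T - τ) + 2 * ε ^ 2 ∧
      IntervalIntegrable (fun t => f t - g t) volume τ T ∧
      (∫ t in τ..T, ‖f t - g t‖) ≤ ε * (1 + (T - τ)) := by
  have hmem : MemLp f 2 (volume.restrict (Icc τ T)) :=
    MemLp.of_bound hf B hfB
  obtain ⟨g, hg, gm⟩ := hmem.exists_boundedContinuous_eLpNorm_sub_le (by simp)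
    (ε := ENNReal.ofReal ε) (by simpa using hε)
  have hsub : MemLp (f - ⇑g) 2 (volume.restrict (Icc τ T)) := hmem.sub gm
  have hI : (∫ t in Icc τ T, ‖f t - g t‖ ^ 2) ≤ ε ^ 2 := by
    rw [hsub.eLpNorm_eq_integral_rpow_norm (by simp) (by simp)] at hg
    have h0 : 0 ≤ ∫ t in Icc τ T, ‖(f - ⇑g) t‖ ^ (2 : ℝ) := integral_nonneg fun t => by positivity
    have h1 := (ENNReal.ofReal_le_ofReal_iff hε.le).1 hg
    simp only [ENNReal.toReal_ofNat] at h1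
    have h2 : ((∫ t in Icc τ T, ‖(f - ⇑g) t‖ ^ (2 : ℝ)) ^ (2 : ℝ)⁻¹) ^ (2 : ℕ) ≤ ε ^ 2 :=
      pow_le_pow_left₀ (by positivity) h1 2
    rw [← Real.rpow_natCast, ← Real.rpow_mul h0] at h2
    norm_num at h2
    simpa using h2
  have iI : IntegrableOn (fun t => ‖f t - g t‖ ^ 2) (Icc τ T) := by
    exact hsub.integrable_norm_pow (by simp : (2 : ℕ) ≠ 0)
  have iF : IntegrableOn (fun t => f t - g t) (Icc τ T) := by
    exact hsub.integrable (by simp)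
  refine ⟨g, g.continuous, ?_, ?_, ?_⟩
  · rw [intervalIntegral.integral_of_le hτ, ← integral_Icc_eq_integral_Ioc]
    have hc : (∫ _t in Icc τ T, 2 * B ^ 2) = 2 * B ^ 2 * (T - τ) := by
      rw [setIntegral_const, Real.volume_real_Icc_of_le hτ, smul_eq_mul, mul_comm]
    have : (∫ t in Icc τ T, ‖g t‖ ^ 2) ≤ ∫ t in Icc τ T, (2 * B ^ 2 + 2 * ‖f t - g t‖ ^ 2) := by
      apply integral_mono_ae
      · exact (g.continuous.norm.pow 2).continuousOn.integrableOn_Icc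
      · exact (integrable_const _).add (iI.const_mul 2)
      · filter_upwards [hfB] with t ht
        have h1 : ‖g t‖ ≤ ‖f t‖ + ‖f t - g t‖ := by
          have := norm_sub_le (f t) (f t - g t); simpa using this
        have h2 : ‖g t‖ ≤ B + ‖f t - g t‖ := by linarith
        nlinarith [norm_nonneg (g t), norm_nonneg (f t - g t), sq_nonneg (B - ‖f t - g t‖)]
    rw [integral_add (integrable_const _) (iI.const_mul 2), hc, integral_const_mul] at this
    linarith
  · rw [intervalIntegrable_iff_integrableOn_Icc_of_le hτ]; exact iF
  · rw [intervalIntegral.integral_of_le hτ, ← integral_Icc_eq_integral_Ioc]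
    have hc : (∫ _t in Icc τ T, ε) = ε * (T - τ) := by
      rw [setIntegral_const, Real.volume_real_Icc_of_le hτ, smul_eq_mul, mul_comm]
    -- The pointwise inequality `s ≤ ε + s² / ε` converts closeness in `L²` into closeness in `L¹`.
    have : (∫ t in Icc τ T, ‖f t - g t‖) ≤ ∫ t in Icc τ T, (ε + ε⁻¹ * ‖f t - g t‖ ^ 2) := by
      apply integral_mono
      · exact iF.norm
      · exact (integrable_const _).add (iI.const_mul _)
      · intro t
        have : ‖f t - g t‖ * ε ≤ ε * ε + ‖f t - g t‖ ^ 2 := by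
          nlinarith [sq_nonneg (‖f t - g t‖ - ε), norm_nonneg (f t - g t)]
        calc ‖f t - g t‖ = ε⁻¹ * (‖f t - g t‖ * ε) := by field_simp
          _ ≤ ε⁻¹ * (ε * ε + ‖f t - g t‖ ^ 2) := by gcongr
          _ = _ := by field_simp
    rw [integral_add (integrable_const _) (iI.const_mul _), hc, integral_const_mul] at this
    have h3 : ε⁻¹ * (∫ t in Icc τ T, ‖f t - g t‖ ^ 2) ≤ ε⁻¹ * ε ^ 2 := by gcongr
    have h4 : ε⁻¹ * ε ^ 2 = ε := by field_simp
    linarith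

variable {H 𝒟 κ : Type*} [NormedAddCommGroup H] [InnerProductSpace ℝ H] [CompleteSpace H]
  [AddCommGroup 𝒟] [Module ℝ 𝒟] {ι : 𝒟 →ₗ[ℝ] H} {τ T q₀ q₁ C : ℝ} {Q Q' A : ℝ → 𝒟 →ₗ[ℝ] H}
  {g : κ → H}

/-- Galerkin approximation on the span of a finite set of test vectors. -/
theorem EvolutionForm.exists_galerkin (h : EvolutionForm ι τ T q₀ q₁ C Q Q' A g) (hτ : τ < T)
    (hq₀ : 0 < q₀) (hC : 0 ≤ C) (ℓ : 𝒟 →ₗ[ℝ] ℝ) {B₀ : ℝ} (hℓ : ∀ v, |ℓ v| ≤ B₀ * ‖ι v‖)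
    (F : ℝ → 𝒟 →ₗ[ℝ] ℝ)
    (hFm : ∀ v, AEStronglyMeasurable (fun t => F t v) (volume.restrict (Icc τ T)))
    {B : ℝ} (hB : 0 ≤ B) (hF : ∀ᵐ t ∂(volume.restrict (Icc τ T)), ∀ v, |F t v| ≤ B * ‖ι v‖)
    (S : Finset 𝒟) {ε : ℝ} (hε : 0 < ε) :
    ∃ v : ℝ → 𝒟, ContinuousOn (fun t => Q t (v t)) (Icc τ T) ∧
      (∀ t ∈ Icc τ T, ∀ s : Finset κ,
        ⟪Q t (v t), ι (v t)⟫ + (∫ r in τ..t, ∑ i ∈ s, ⟪Q r (v r), g i⟫ ^ 2) ≤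
          Real.exp ((C + 1) * (T - τ)) *
            (B₀ ^ 2 / q₀ + (2 * B ^ 2 * (T - τ) + 2 * ε ^ 2) / q₀)) ∧
      ∀ ψ ∈ S, ∀ t ∈ Icc τ T,
        |⟪Q t (v t), ι ψ⟫ - (ℓ ψ + ∫ s in τ..t, (⟪Q s (v s), A s ψ⟫ + F s ψ))| ≤
          ‖ι ψ‖ * (ε * (1 + (T - τ))) := by
  obtain ⟨m, b, hb, hS⟩ := exists_orthonormal_preimage ι h.injective S
  let V : EuclideanSpace ℝ (Fin m) →ₗ[ℝ] 𝒟 :=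
    { toFun := fun x => ∑ i, x i • b i
      map_add' := fun x y => by simp [add_smul, Finset.sum_add_distrib]
      map_smul' := fun c x => by simp [mul_smul, Finset.smul_sum] }
  have hVn : ∀ x y : EuclideanSpace ℝ (Fin m), ⟪ι (V x), ι (V y)⟫ = ⟪x, y⟫ := by
    intro x y
    simp only [V, LinearMap.coe_mk, AddHom.coe_mk, map_sum, map_smul]
    rw [hb.inner_sum]
    simp [PiLp.inner_apply, mul_comm]
  have hVnorm : ∀ x : EuclideanSpace ℝ (Fin m), ‖ι (V x)‖ = ‖x‖ := by
    intro x
    rw [← sq_eq_sq₀ (norm_nonneg _) (norm_nonneg _), ← real_inner_self_eq_norm_sq,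
      ← real_inner_self_eq_norm_sq, hVn]
  let toL : (𝒟 →ₗ[ℝ] H) → (EuclideanSpace ℝ (Fin m) →L[ℝ] H) := fun L => LinearMap.toContinuousLinearMap (L ∘ₗ V)
  have toL_apply : ∀ L x, toL L x = L (V x) := fun L x => rfl
  have toL_cont : ∀ L : ℝ → 𝒟 →ₗ[ℝ] H, (∀ v, ContinuousOn (fun t => L t v) (Icc τ T)) →
      ContinuousOn (fun t => toL (L t)) (Icc τ T) := by
    intro L hL
    rw [continuousOn_clm_apply]
    exact fun x => hL (V x)
  -- With unknown `Q t (V (x t))` and test vectors `V y`, the projected equation is `(G x)' = N x +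
  -- f`, that is, `G x' = (N - G') x + f`. The Gram operator `G` is inverted using the lower bound
  -- on `Q`.
  let G : ℝ → EuclideanSpace ℝ (Fin m) →L[ℝ] EuclideanSpace ℝ (Fin m) := fun t => (ContinuousLinearMap.adjoint (toL ι)) ∘L toL (Q t)
  let G' : ℝ → EuclideanSpace ℝ (Fin m) →L[ℝ] EuclideanSpace ℝ (Fin m) := fun t => (ContinuousLinearMap.adjoint (toL ι)) ∘L toL (Q' t)
  let N : ℝ → EuclideanSpace ℝ (Fin m) →L[ℝ] EuclideanSpace ℝ (Fin m) := fun t => (ContinuousLinearMap.adjoint (toL (A t))) ∘L toL (Q t)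
  have hG : ∀ t x y, ⟪G t x, y⟫ = ⟪Q t (V x), ι (V y)⟫ := fun t x y => by
    simp only [G, ContinuousLinearMap.comp_apply, ContinuousLinearMap.adjoint_inner_left, toL_apply]
  have hG' : ∀ t x y, ⟪G' t x, y⟫ = ⟪Q' t (V x), ι (V y)⟫ := fun t x y => by
    simp only [G', ContinuousLinearMap.comp_apply, ContinuousLinearMap.adjoint_inner_left, toL_apply]
  have hN : ∀ t x y, ⟪N t x, y⟫ = ⟪Q t (V x), A t (V y)⟫ := fun t x y => by
    simp only [N, ContinuousLinearMap.comp_apply, ContinuousLinearMap.adjoint_inner_left, toL_apply]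
  have cG : ContinuousOn G (Icc τ T) := continuousOn_const.clm_comp (toL_cont Q h.cont)
  have cG' : ContinuousOn G' (Icc τ T) := continuousOn_const.clm_comp (toL_cont Q' h.cont')
  have cN : ContinuousOn N (Icc τ T) :=
    (ContinuousLinearMap.adjoint.continuous.comp_continuousOn (toL_cont A h.contA)).clm_comp
      (toL_cont Q h.cont)
  have uG : ∀ t ∈ Icc τ T, IsUnit (G t) := by
    intro t ht
    rw [ContinuousLinearMap.isUnit_iff_bijective]
    have hinj : Function.Injective (G t).toLinearMap := by
      rw [injective_iff_map_eq_zero]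
      intro x hx
      have h1 := h.lower t ht (V x)
      have h3 : (G t) x = 0 := hx
      have h2 := hG t x x
      rw [h3, inner_zero_left] at h2
      rw [← h2, hVnorm] at h1
      have : ‖x‖ ^ 2 ≤ 0 := by nlinarith [sq_nonneg ‖x‖]
      exact norm_eq_zero.1 (by simpa using this)
    exact ⟨hinj, LinearMap.injective_iff_surjective.1 hinj⟩
  have cinv : ContinuousOn (fun t => Ring.inverse (G t)) (Icc τ T) := by
    intro t ht
    obtain ⟨u, hu⟩ := uG t ht
    have h1 := NormedRing.inverse_continuousAt u
    rw [hu] at h1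
    exact h1.comp_continuousWithinAt (cG t ht)
  have ginv : ∀ t ∈ Icc τ T, ∀ x, G t (Ring.inverse (G t) x) = x := by
    intro t ht x
    have := Ring.mul_inverse_cancel _ (uG t ht)
    exact congrArg (fun L : EuclideanSpace ℝ (Fin m) →L[ℝ] EuclideanSpace ℝ (Fin m) => L x) this
  let f : ℝ → EuclideanSpace ℝ (Fin m) := fun t => WithLp.toLp 2 fun i => F t (b i)
  have hf : ∀ t y, ⟪f t, y⟫ = F t (V y) := by
    intro t y
    simp [f, V, PiLp.inner_apply]
  have fm : AEStronglyMeasurable f (volume.restrict (Icc τ T)) := by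
    have : AEStronglyMeasurable (fun t => fun i => F t (b i)) (volume.restrict (Icc τ T)) := by
      apply AEMeasurable.aestronglyMeasurable
      exact aemeasurable_pi_lambda _ fun i => (hFm (b i)).aemeasurable
    exact (PiLp.continuous_toLp 2 _).comp_aestronglyMeasurable this
  have fB : ∀ᵐ t ∂(volume.restrict (Icc τ T)), ‖f t‖ ≤ B := by
    filter_upwards [hF] with t ht
    have h1 := ht (V (f t))
    rw [← hf, real_inner_self_eq_norm_sq, hVnorm, abs_of_nonneg (by positivity)] at h1
    by_contra hlt
    push Not at hlt
    have : 0 < ‖f t‖ := hB.trans_lt hlt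
    nlinarith
  -- The source is only measurable in time whereas `exists_linear_ode` needs continuity. Replacing
  -- `f` by `p` is the sole origin of the error `ε` in the approximate weak equation.
  obtain ⟨p, pc, hp2, hpi, hp1⟩ := exists_continuous_approx hτ.le fm fB hε
  let x₀ : EuclideanSpace ℝ (Fin m) := Ring.inverse (G τ) (WithLp.toLp 2 fun i => ℓ (b i))
  have τm : τ ∈ Icc τ T := left_mem_Icc.2 hτ.le
  have hx₀ : ∀ y, ⟪Q τ (V x₀), ι (V y)⟫ = ℓ (V y) := by
    intro y
    rw [← hG, ginv τ τm]
    simp [V, PiLp.inner_apply]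
  obtain ⟨x, xc, xτ, hx⟩ := exists_linear_ode hτ.le
    (Γ := fun t => Ring.inverse (G t) ∘L (N t - G' t)) (g := fun t => Ring.inverse (G t) (p t))
    (cinv.clm_comp (cN.sub cG')) (cinv.clm_apply pc.continuousOn) x₀
  set x' : ℝ → EuclideanSpace ℝ (Fin m) := fun t => (Ring.inverse (G t) ∘L (N t - G' t)) (x t) + Ring.inverse (G t) (p t)
    with hx'
  have hode : ∀ t ∈ Ioo τ T, ∀ y, ⟪Q t (V (x' t)), ι (V y)⟫ + ⟪Q' t (V (x t)), ι (V y)⟫ =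
      ⟪Q t (V (x t)), A t (V y)⟫ + ⟪p t, y⟫ := by
    intro t ht y
    have ht' := Ioo_subset_Icc_self ht
    have : G t (x' t) = (N t - G' t) (x t) + p t := by
      simp only [hx', map_add, ContinuousLinearMap.comp_apply, ginv t ht']
    rw [← hG, this, inner_add_left, _root_.sub_apply, inner_sub_left, hN, hG']
    ring
  have Qsum : ∀ (L : 𝒟 →ₗ[ℝ] H) (y : EuclideanSpace ℝ (Fin m)), L (V y) = ∑ i, y i • L (b i) := by
    intro L y
    simp [V, map_sum]
  have hxi : ∀ t ∈ Ioo τ T, ∀ i, HasDerivAt (fun s => x s i) (x' t i) t := by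
    intro t ht i
    exact (EuclideanSpace.proj (𝕜 := ℝ) i : EuclideanSpace ℝ (Fin m) →L[ℝ] ℝ).hasFDerivAt.comp_hasDerivAt t (hx t ht)
  have hQd : ∀ t ∈ Ioo τ T, ∀ ψ, HasDerivAt (fun s => ⟪Q s (V (x s)), ι ψ⟫)
      (⟪Q t (V (x' t)), ι ψ⟫ + ⟪Q' t (V (x t)), ι ψ⟫) t := by
    intro t ht ψ
    have h1 : HasDerivAt (fun s => ∑ i, x s i * ⟪Q s (b i), ι ψ⟫)
        (∑ i, (x' t i * ⟪Q t (b i), ι ψ⟫ + x t i * ⟪Q' t (b i), ι ψ⟫)) t := by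
      apply HasDerivAt.fun_sum
      intro i _
      exact (hxi t ht i).mul (h.deriv t ht (b i) ψ)
    have h2 : (fun s => ⟪Q s (V (x s)), ι ψ⟫) = fun s => ∑ i, x s i * ⟪Q s (b i), ι ψ⟫ := by
      funext s
      rw [Qsum, sum_inner]
      simp [real_inner_smul_left]
    rw [h2]
    convert h1 using 1
    rw [Finset.sum_add_distrib, Qsum, Qsum, sum_inner, sum_inner]
    simp [real_inner_smul_left]
  have cQ : ContinuousOn (fun t => Q t (V (x t))) (Icc τ T) :=
    (toL_cont Q h.cont).clm_apply xc.continuousOn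
  have cV : Continuous fun t => ι (V (x t)) := (toL ι).continuous.comp xc
  refine ⟨fun t => V (x t), cQ, fun t ht s => ?_, fun ψ hψ t ht => ?_⟩
  · set E : ℝ → ℝ := fun t => ⟪Q t (V (x t)), ι (V (x t))⟫ with hE
    -- Both slots are differentiated. Symmetry of `Q` identifies the two terms containing `x'`, and
    -- the projected equation tested with `x` itself eliminates them.
    have hEd : ∀ t ∈ Ioo τ T, HasDerivAt E (2 * ⟪Q t (V (x t)), A t (V (x t))⟫ -
        ⟪Q' t (V (x t)), ι (V (x t))⟫ + 2 * ⟪p t, x t⟫) t := by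
      intro t ht
      have h1 : HasDerivAt (fun s => ∑ i, x s i * ⟪Q s (V (x s)), ι (b i)⟫)
          (∑ i, (x' t i * ⟪Q t (V (x t)), ι (b i)⟫ + x t i *
            (⟪Q t (V (x' t)), ι (b i)⟫ + ⟪Q' t (V (x t)), ι (b i)⟫))) t := by
        apply HasDerivAt.fun_sum
        intro i _
        exact (hxi t ht i).mul (hQd t ht (b i))
      have h2 : E = fun s => ∑ i, x s i * ⟪Q s (V (x s)), ι (b i)⟫ := by
        funext s
        simp only [hE]
        rw [Qsum ι, inner_sum]
        simp [real_inner_smul_right]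
      rw [h2]
      convert h1 using 1
      have h3 : (∑ i, (x' t i * ⟪Q t (V (x t)), ι (b i)⟫ + x t i *
            (⟪Q t (V (x' t)), ι (b i)⟫ + ⟪Q' t (V (x t)), ι (b i)⟫))) =
          ⟪Q t (V (x t)), ι (V (x' t))⟫ +
            (⟪Q t (V (x' t)), ι (V (x t))⟫ + ⟪Q' t (V (x t)), ι (V (x t))⟫) := by
        rw [Qsum ι (x' t), Qsum ι (x t), inner_sum, inner_sum, inner_sum, ← Finset.sum_add_distrib,
          ← Finset.sum_add_distrib]
        refine Finset.sum_congr rfl fun i _ => ?_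
        simp only [real_inner_smul_right]
        ring
      rw [h3, h.symm t (Ioo_subset_Icc_self ht)]
      have := hode t ht (x t)
      linarith
    -- From `E ≤ B₀ ‖ι (V x₀)‖` and `q₀ ‖ι (V x₀)‖² ≤ E`.
    have hE0 : E τ ≤ B₀ ^ 2 / q₀ := by
      have h1 : E τ = ℓ (V x₀) := by simp only [hE, xτ, hx₀]
      have h2 := hℓ (V x₀)
      have h3 := h.lower τ τm (V x₀)
      rw [hx₀, ← h1] at h3
      rw [← h1] at h2
      rw [le_div_iff₀ hq₀]
      have h4 := le_abs_self (E τ)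
      have h5 : 0 ≤ E τ := (by positivity : (0 : ℝ) ≤ q₀ * ‖ι (V x₀)‖ ^ 2).trans h3
      by_contra hlt
      push Not at hlt
      nlinarith [sq_nonneg (B₀ - q₀ * ‖ι (V x₀)‖), norm_nonneg (ι (V x₀))]
    -- The rate is `C + 1`: the additional `1` absorbs the part `q₀ ‖x‖² ≤ E` of the source term
    -- after Young's inequality.
    have key := gronwall_dissipation (τ := τ) (T := T) (E := E)
      (D := fun r => ∑ i ∈ s, ⟪Q r (V (x r)), g i⟫ ^ 2) (γ := fun r => ‖p r‖ ^ 2 / q₀)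
      (κ := C + 1) (by linarith) (cQ.inner cV.continuousOn)
      (fun t ht => (by positivity : (0 : ℝ) ≤ q₀ * ‖ι (V (x t))‖ ^ 2).trans (h.lower t ht _)) hEd
      (continuousOn_finsetSum _ fun i _ => (cQ.inner continuousOn_const).pow 2)
      (fun t _ => Finset.sum_nonneg fun i _ => sq_nonneg _)
      (by fun_prop) (fun t _ => by positivity) (fun t ht => by
        have h1 := h.energy t ht (V (x t)) s
        have h2 := h.lower t (Ioo_subset_Icc_self ht) (V (x t))
        rw [hVnorm] at h2
        have h3 : 2 * ⟪p t, x t⟫ ≤ q₀ * ‖x t‖ ^ 2 + ‖p t‖ ^ 2 / q₀ := by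
          have h4 := real_inner_le_norm (p t) (x t)
          have h5 : q₀ * ‖x t‖ ^ 2 + ‖p t‖ ^ 2 / q₀ - 2 * (‖p t‖ * ‖x t‖) =
            (q₀ * ‖x t‖ - ‖p t‖) ^ 2 / q₀ := by field_simp; ring
          have : 0 ≤ (q₀ * ‖x t‖ - ‖p t‖) ^ 2 / q₀ := by positivity
          linarith
        simp only [hE]
        linarith) ht
    refine key.trans ?_
    rw [intervalIntegral.integral_div]
    gcongr
  · obtain ⟨y, hy⟩ := hS ψ hψ
    have hyV : ψ = V y := hy
    have hab : ∀ {f : ℝ → ℝ}, ContinuousOn f (Icc τ T) → IntervalIntegrable f volume τ t := by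
      intro f hf
      apply ContinuousOn.intervalIntegrable
      rw [uIcc_of_le ht.1]; exact hf.mono (Icc_subset_Icc_right ht.2)
    have cR : ContinuousOn (fun s => ⟪Q s (V (x s)), A s ψ⟫) (Icc τ T) := cQ.inner (h.contA ψ)
    have h1 : ∫ s in τ..t, (⟪Q s (V (x s)), A s ψ⟫ + ⟪p s, y⟫) =
        ⟪Q t (V (x t)), ι ψ⟫ - ⟪Q τ (V (x τ)), ι ψ⟫ := by
      apply intervalIntegral.integral_eq_sub_of_hasDerivAt_of_le ht.1
        ((cQ.inner continuousOn_const).mono (Icc_subset_Icc_right ht.2))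
      · intro s hs
        have hs' : s ∈ Ioo τ T := ⟨hs.1, hs.2.trans_le ht.2⟩
        have := hQd s hs' ψ
        rw [hyV] at this ⊢
        rwa [hode s hs' y] at this
      · exact hab (cR.add (pc.inner continuous_const).continuousOn)
    have hpt : IntervalIntegrable (fun s => f s - p s) volume τ t :=
      hpi.mono_set (by rw [uIcc_of_le ht.1, uIcc_of_le hτ.le]; exact Icc_subset_Icc_right ht.2)
    have hFi : IntervalIntegrable (fun s => ⟪f s - p s, y⟫) volume τ t := by
      rw [intervalIntegrable_iff] at hpt ⊢
      exact hpt.inner_const y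
    have hRi : IntervalIntegrable (fun s => ⟪Q s (V (x s)), A s ψ⟫ + ⟪p s, y⟫) volume τ t :=
      hab (cR.add (pc.inner continuous_const).continuousOn)
    have h2 : ∫ s in τ..t, (⟪Q s (V (x s)), A s ψ⟫ + F s ψ) =
        (∫ s in τ..t, (⟪Q s (V (x s)), A s ψ⟫ + ⟪p s, y⟫)) + ∫ s in τ..t, ⟪f s - p s, y⟫ := by
      rw [← intervalIntegral.integral_add hRi hFi]
      congr 1; funext s
      rw [inner_sub_left, hf, ← hyV]; ring
    have h3 : ⟪Q τ (V (x τ)), ι ψ⟫ = ℓ ψ := by rw [xτ, hyV, hx₀]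
    have h4 : ⟪Q t (V (x t)), ι ψ⟫ - (ℓ ψ + ∫ s in τ..t, (⟪Q s (V (x s)), A s ψ⟫ + F s ψ)) =
        - ∫ s in τ..t, ⟪f s - p s, y⟫ := by
      rw [h2, h1, h3]; ring
    rw [h4, abs_neg, hyV, hVnorm, mul_comm]
    calc |∫ s in τ..t, ⟪f s - p s, y⟫| ≤ ∫ s in τ..t, ‖f s - p s‖ * ‖y‖ := by
          have := intervalIntegral.norm_integral_le_of_norm_le (μ := volume) ht.1
            (f := fun s => ⟪f s - p s, y⟫)
            (g := fun s => ‖f s - p s‖ * ‖y‖) (ae_of_all _ fun s _ => abs_real_inner_le_norm _ _)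
            (hpt.norm.mul_const _)
          simpa using this
      _ = (∫ s in τ..t, ‖f s - p s‖) * ‖y‖ := intervalIntegral.integral_mul_const _ _
      _ ≤ (∫ s in τ..T, ‖f s - p s‖) * ‖y‖ := by
          gcongr
          exact intervalIntegral.integral_mono_interval le_rfl ht.1 ht.2
            (ae_of_all _ fun s => norm_nonneg _) hpi.norm
      _ ≤ _ := by gcongr

end DispersivePDE

/-! ### Weak compactness and passage to the limit. -/

namespace DispersivePDE

section
variable {H : Type*} [NormedAddCommGroup H] [InnerProductSpace ℝ H]

/-- Weak compactness of bounded sets, along an ultrafilter. -/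
theorem exists_weak_limit [CompleteSpace H] {I : Type*} (U : Ultrafilter I) (W : I → H) {R : ℝ}
    (hW : ∀ i, ‖W i‖ ≤ R) :
    ∃ w : H, ∀ h, Tendsto (fun i => ⟪W i, h⟫) U (𝓝 ⟪w, h⟫) := by
  have hb : ∀ h i, ⟪W i, h⟫ ∈ Icc (-(R * ‖h‖)) (R * ‖h‖) := fun h i => by
    rw [mem_Icc, ← abs_le]
    exact (abs_real_inner_le_norm _ _).trans (by gcongr; exact hW i)
  -- Along an ultrafilter every bounded family of reals converges. Thus the limit functional exists
  -- on all of `H` at once, without separability or a diagonal sequence.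
  have hlim : ∀ h, ∃ a ∈ Icc (-(R * ‖h‖)) (R * ‖h‖), Tendsto (fun i => ⟪W i, h⟫) U (𝓝 a) := by
    intro h
    have := isCompact_Icc.ultrafilter_le_nhds (U.map fun i => ⟪W i, h⟫)
      (by rw [le_principal_iff]; exact Filter.univ_mem' (f := (U : Filter I)) (hb h))
    simpa [Tendsto] using this
  choose L hL hLt using hlim
  let Lc : H →L[ℝ] ℝ := LinearMap.mkContinuous
    { toFun := L
      map_add' := fun x y => tendsto_nhds_unique (hLt (x + y)) (by
        simpa only [inner_add_right] using (hLt x).add (hLt y))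
      map_smul' := fun c x => tendsto_nhds_unique (hLt (c • x)) (by
        simpa only [real_inner_smul_right] using! (hLt x).const_mul c) } R
    (fun x => abs_le.2 (hL x))
  refine ⟨(InnerProductSpace.toDual ℝ H).symm Lc, fun h => ?_⟩
  rw [InnerProductSpace.toDual_symm_apply]
  exact hLt h

theorem tendsto_intervalIntegral_of_tendstoUniformlyOn {I : Type*} {l : Filter I}
    {a b : ℝ} (hab : a ≤ b) {f : I → ℝ → ℝ} {f₀ : ℝ → ℝ} (hf : ∀ i, ContinuousOn (f i) (Icc a b))
    (hf₀ : ContinuousOn f₀ (Icc a b)) (h : TendstoUniformlyOn f f₀ l (Icc a b)) :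
    Tendsto (fun i => ∫ t in a..b, f i t) l (𝓝 (∫ t in a..b, f₀ t)) := by
  rw [Metric.tendsto_nhds]
  intro ε hε
  have hδ : 0 < ε / (b - a + 1) := by have := sub_nonneg.2 hab; positivity
  filter_upwards [Metric.tendstoUniformlyOn_iff.1 h _ hδ] with i hi
  have i1 : IntervalIntegrable (f i) volume a b := by
    apply ContinuousOn.intervalIntegrable; rw [uIcc_of_le hab]; exact hf i
  have i2 : IntervalIntegrable f₀ volume a b := by
    apply ContinuousOn.intervalIntegrable; rwa [uIcc_of_le hab]
  rw [dist_eq_norm, ← intervalIntegral.integral_sub i1 i2]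
  have := intervalIntegral.norm_integral_le_of_norm_le_const (a := a) (b := b)
    (f := fun t => f i t - f₀ t) (C := ε / (b - a + 1)) (fun t ht => by
      rw [uIoc_of_le hab] at ht
      have := hi t (Ioc_subset_Icc_self ht)
      rw [dist_comm, dist_eq_norm] at this
      exact this.le)
  refine this.trans_lt ?_
  rw [abs_of_nonneg (sub_nonneg.2 hab), div_mul_eq_mul_div, div_lt_iff₀ (by linarith)]
  nlinarith

/-- Weak convergence of asymptotically equicontinuous bounded curves is uniform against
continuous curves. -/
theorem tendstoUniformlyOn_inner {I : Type*} {l : Filter I} [l.NeBot] {τ T : ℝ}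
    {W : I → ℝ → H} {w : ℝ → H} {R : ℝ} (hW : ∀ i, ∀ t ∈ Icc τ T, ‖W i t‖ ≤ R)
    (hw : ∀ t ∈ Icc τ T, ∀ h, Tendsto (fun i => ⟪W i t, h⟫) l (𝓝 ⟪w t, h⟫))
    {D : Set H} (hD : Dense D)
    (heq : ∀ ψ ∈ D, ∃ c : ℝ, ∀ ε > 0, ∀ᶠ i in l, ∀ t ∈ Icc τ T, ∀ t' ∈ Icc τ T,
      |⟪W i t', ψ⟫ - ⟪W i t, ψ⟫| ≤ c * |t' - t| + ε)
    {h : ℝ → H} (hh : ContinuousOn h (Icc τ T)) :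
    TendstoUniformlyOn (fun i t => ⟪W i t, h t⟫) (fun t => ⟪w t, h t⟫) l (Icc τ T) := by
  rw [← tendstoLocallyUniformlyOn_iff_tendstoUniformlyOn_of_compact isCompact_Icc,
    Metric.tendstoLocallyUniformlyOn_iff]
  intro ε hε t ht
  obtain ⟨i₀⟩ : Nonempty I := l.nonempty_of_neBot
  have hR : 0 ≤ R := (norm_nonneg _).trans (hW i₀ t ht)
  -- Three errors of size `R δ ≤ ε / 16` and two of size `ε / 32` add up to `ε / 4`.
  set δ : ℝ := ε / (16 * (R + 1)) with hδ
  have hδ0 : 0 < δ := by positivity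
  have hδR : R * δ ≤ ε / 16 := by
    rw [hδ, mul_div_assoc', div_le_div_iff₀ (by positivity) (by norm_num)]; nlinarith
  obtain ⟨ψ, hψD, hψ⟩ := hD.exists_dist_lt (h t) hδ0
  obtain ⟨c, hc⟩ := heq ψ hψD
  rw [dist_eq_norm] at hψ
  have n1 : ∀ᶠ y in 𝓝[Icc τ T] t, ‖h y - h t‖ < δ := by
    have := Metric.tendsto_nhds.1 (hh t ht) δ hδ0
    simpa [dist_eq_norm] using this
  have n2 : ∀ᶠ y in 𝓝[Icc τ T] t, c * |y - t| < ε / 32 := by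
    have h1 : Tendsto (fun y => c * |y - t|) (𝓝 t) (𝓝 (c * |t - t|)) :=
      (by fun_prop : Continuous fun y => c * |y - t|).tendsto t
    rw [sub_self, abs_zero, mul_zero] at h1
    exact (h1.mono_left nhdsWithin_le_nhds).eventually (gt_mem_nhds (by positivity))
  have asym : ∀ᶠ i in l, ∀ y ∈ {y | y ∈ Icc τ T ∧ ‖h y - h t‖ < δ ∧ c * |y - t| < ε / 32},
      |⟪W i y, h y⟫ - ⟪W i t, h t⟫| ≤ ε / 4 := by
    filter_upwards [hc (ε / 32) (by positivity)] with i hi y hy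
    obtain ⟨hy, hy1, hy2⟩ := hy
    have e : ⟪W i y, h y⟫ - ⟪W i t, h t⟫ = ⟪W i y, h y - h t⟫ + ⟪W i y, h t - ψ⟫ -
        ⟪W i t, h t - ψ⟫ + (⟪W i y, ψ⟫ - ⟪W i t, ψ⟫) := by
      simp only [inner_sub_right]; ring
    have b1 : |⟪W i y, h y - h t⟫| ≤ R * δ := (abs_real_inner_le_norm _ _).trans
      (mul_le_mul (hW i y hy) hy1.le (norm_nonneg _) hR)
    have b2 : |⟪W i y, h t - ψ⟫| ≤ R * δ := (abs_real_inner_le_norm _ _).trans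
      (mul_le_mul (hW i y hy) hψ.le (norm_nonneg _) hR)
    have b3 : |⟪W i t, h t - ψ⟫| ≤ R * δ := (abs_real_inner_le_norm _ _).trans
      (mul_le_mul (hW i t ht) hψ.le (norm_nonneg _) hR)
    have b4 := hi t ht y hy
    rw [e]
    rw [abs_le] at *
    constructor <;> linarith
  have asym' : ∀ y ∈ {y | y ∈ Icc τ T ∧ ‖h y - h t‖ < δ ∧ c * |y - t| < ε / 32},
      |⟪w y, h y⟫ - ⟪w t, h t⟫| ≤ ε / 4 := by
    intro y hy
    refine le_of_tendsto (((hw y hy.1 (h y)).sub (hw t ht (h t))).abs) ?_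
    filter_upwards [asym] with i hi using hi y hy
  refine ⟨_, inter_mem self_mem_nhdsWithin (n1.and n2), ?_⟩
  have h3 := Metric.tendsto_nhds.1 (hw t ht (h t)) (ε / 4) (by positivity)
  filter_upwards [asym, h3] with i hi hi3 y hy
  have a1 := hi y hy
  have a2 := asym' y hy
  rw [Real.dist_eq] at hi3 ⊢
  rw [abs_le] at a1 a2
  rw [abs_lt] at hi3 ⊢
  constructor <;> linarith

end

section
variable {H 𝒟 κ : Type*} [NormedAddCommGroup H] [InnerProductSpace ℝ H] [CompleteSpace H]
  [AddCommGroup 𝒟] [Module ℝ 𝒟] {ι : 𝒟 →ₗ[ℝ] H} {τ T q₀ q₁ C : ℝ} {Q Q' A : ℝ → 𝒟 →ₗ[ℝ] H}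
  {g : κ → H}

/-- Existence of weak solutions of dissipative linear evolution problems. -/
theorem EvolutionForm.exists_solution (h : EvolutionForm ι τ T q₀ q₁ C Q Q' A g) (hτ : τ < T)
    (hι : DenseRange ι)
    (hq₀ : 0 < q₀) (hq₁ : 0 ≤ q₁) (hC : 0 ≤ C) (ℓ : 𝒟 →ₗ[ℝ] ℝ) {B₀ : ℝ}
    (hℓ : ∀ v, |ℓ v| ≤ B₀ * ‖ι v‖) (F : ℝ → 𝒟 →ₗ[ℝ] ℝ)
    (hFm : ∀ v, AEStronglyMeasurable (fun t => F t v) (volume.restrict (Icc τ T)))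
    {B : ℝ} (hB : 0 ≤ B) (hF : ∀ᵐ t ∂(volume.restrict (Icc τ T)), ∀ v, |F t v| ≤ B * ‖ι v‖) :
    ∃ w : ℝ → H,
      (∀ t ∈ Icc τ T, ‖w t‖ ^ 2 ≤ q₁ * (Real.exp ((C + 1) * (T - τ)) *
            (B₀ ^ 2 / q₀ + 2 * B ^ 2 * (T - τ) / q₀))) ∧
      (∀ x, ContinuousOn (fun t => ⟪w t, x⟫) (Icc τ T)) ∧
      (∀ t ∈ Icc τ T, ∀ ψ, ⟪w t, ι ψ⟫ = ℓ ψ + ∫ s in τ..t, (⟪w s, A s ψ⟫ + F s ψ)) ∧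
      ∀ s : Finset κ, (∫ r in τ..T, ∑ i ∈ s, ⟪w r, g i⟫ ^ 2) ≤ Real.exp ((C + 1) * (T - τ)) *
            (B₀ ^ 2 / q₀ + 2 * B ^ 2 * (T - τ) / q₀) := by
  classical
  set K : ℝ → ℝ := fun ε => Real.exp ((C + 1) * (T - τ)) *
    (B₀ ^ 2 / q₀ + (2 * B ^ 2 * (T - τ) + 2 * ε ^ 2) / q₀) with hK
  have hK0 : Real.exp ((C + 1) * (T - τ)) * (B₀ ^ 2 / q₀ + 2 * B ^ 2 * (T - τ) / q₀) = K 0 := by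
    simp [hK]
  rw [hK0]
  let e : Finset 𝒟 × ℕ → ℝ := fun i => 1 / ((i.2 : ℝ) + 1)
  have he : ∀ i, 0 < e i := fun i => by positivity
  have he1 : ∀ i, e i ≤ 1 := fun i => by
    rw [div_le_one (by positivity)]; linarith [(Nat.cast_nonneg i.2 : (0 : ℝ) ≤ i.2)]
  choose v hvc hvE hvW using fun i : Finset 𝒟 × ℕ =>
    h.exists_galerkin hτ hq₀ hC ℓ hℓ F hFm hB hF i.1 (he i)
  set W : Finset 𝒟 × ℕ → ℝ → H := fun i t => Q t (v i t) with hWdef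
  have hpos : ∀ i, ∀ t ∈ Icc τ T, 0 ≤ ⟪W i t, ι (v i t)⟫ := fun i t ht =>
    (by positivity : (0 : ℝ) ≤ q₀ * ‖ι (v i t)‖ ^ 2).trans (h.lower t ht _)
  have hWK : ∀ i, ∀ t ∈ Icc τ T, ‖W i t‖ ^ 2 ≤ q₁ * K (e i) := fun i t ht => by
    have h1 := hvE i t ht ∅
    simp only [Finset.sum_empty, intervalIntegral.integral_zero, add_zero] at h1
    exact (h.upper t ht _).trans (mul_le_mul_of_nonneg_left h1 hq₁)
  have hKe : ∀ i, K (e i) ≤ K 1 := fun i => by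
    have := he1 i; have := (he i).le
    simp only [hK]
    gcongr
  set R : ℝ := Real.sqrt (q₁ * K 1) with hR
  have hWR : ∀ i, ∀ t ∈ Icc τ T, ‖W i t‖ ≤ R := fun i t ht => by
    apply Real.le_sqrt_of_sq_le
    exact (hWK i t ht).trans (mul_le_mul_of_nonneg_left (hKe i) hq₁)
  have hR0 : 0 ≤ R := Real.sqrt_nonneg _
  -- Indices are pairs of a finite set of test vectors and a precision. An ultrafilter finer than
  -- `atTop` eventually contains any given test vector, sends the precision to zero, and serves all
  -- times simultaneously.
  let U : Ultrafilter (Finset 𝒟 × ℕ) := Ultrafilter.of atTop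
  have hU : (U : Filter (Finset 𝒟 × ℕ)) ≤ atTop := Ultrafilter.of_le _
  have heU : Tendsto e U (𝓝 0) := by
    have : Tendsto e atTop (𝓝 0) := by
      rw [← prod_atTop_atTop_eq]
      exact tendsto_one_div_add_atTop_nhds_zero_nat.comp tendsto_snd
    exact this.mono_left hU
  have hKU : Tendsto (fun i => K (e i)) U (𝓝 (K 0)) :=
    ((by fun_prop : Continuous K).tendsto 0).comp heU
  have hSU : ∀ ψ, ∀ᶠ i in (U : Filter (Finset 𝒟 × ℕ)), ψ ∈ i.1 := by
    intro ψ
    apply hU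
    filter_upwards [eventually_ge_atTop (({ψ} : Finset 𝒟), 0)] with i hi
    exact hi.1 (Finset.mem_singleton_self ψ)
  have hlim : ∀ t, ∃ w : H, t ∈ Icc τ T → ∀ x, Tendsto (fun i => ⟪W i t, x⟫) U (𝓝 ⟪w, x⟫) := by
    intro t
    by_cases ht : t ∈ Icc τ T
    · obtain ⟨w, hw⟩ := exists_weak_limit U (fun i => W i t) (fun i => hWR i t ht)
      exact ⟨w, fun _ => hw⟩
    · exact ⟨0, fun h => absurd h ht⟩
  choose w hw using hlim
  have hFi : ∀ ψ, ∀ a ∈ Icc τ T, ∀ b ∈ Icc τ T,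
      IntervalIntegrable (fun s => F s ψ) volume a b := by
    intro ψ a ha b hb
    have : IntegrableOn (fun s => F s ψ) (Icc τ T) :=
      Integrable.of_bound (hFm ψ) (B * ‖ι ψ‖)
        (by filter_upwards [hF] with t ht using ht ψ)
    apply IntegrableOn.intervalIntegrable
    exact this.mono_set (uIcc_subset_Icc ha hb)
  have ci : ∀ {f : ℝ → ℝ}, ContinuousOn f (Icc τ T) → ∀ a ∈ Icc τ T, ∀ b ∈ Icc τ T,
      IntervalIntegrable f volume a b := fun hf a ha b hb =>
    (hf.mono (uIcc_subset_Icc ha hb)).intervalIntegrable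
  have τm : τ ∈ Icc τ T := left_mem_Icc.2 hτ.le
  -- The approximate weak equation itself supplies equicontinuity, up to the vanishing Galerkin
  -- error; this is what upgrades weak convergence at each time to uniform convergence in time.
  have heq : ∀ ψ ∈ range ι, ∃ c : ℝ, ∀ ε > 0, ∀ᶠ i in (U : Filter (Finset 𝒟 × ℕ)),
      ∀ t ∈ Icc τ T, ∀ t' ∈ Icc τ T, |⟪W i t', ψ⟫ - ⟪W i t, ψ⟫| ≤ c * |t' - t| + ε := by
    rintro _ ⟨ψ, rfl⟩
    obtain ⟨a, ha⟩ := isCompact_Icc.exists_bound_of_continuousOn (h.contA ψ)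
    refine ⟨R * a + B * ‖ι ψ‖, fun ε hε => ?_⟩
    have h0 : Tendsto (fun i => 2 * (‖ι ψ‖ * (e i * (1 + (T - τ))))) U (𝓝 0) := by
      have := ((heU.mul_const (1 + (T - τ))).const_mul ‖ι ψ‖).const_mul 2
      simpa using this
    filter_upwards [hSU ψ, h0.eventually (gt_mem_nhds hε)] with i hi hie t ht t' ht'
    have e1 := hvW i ψ hi t ht
    have e2 := hvW i ψ hi t' ht'
    have cW : ContinuousOn (fun s => ⟪W i s, A s ψ⟫) (Icc τ T) := (hvc i).inner (h.contA ψ)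
    have hi1 : ∀ b ∈ Icc τ T, IntervalIntegrable (fun s => ⟪W i s, A s ψ⟫ + F s ψ) volume τ b :=
      fun b hb => (ci cW τ τm b hb).add (hFi ψ τ τm b hb)
    have e3 := intervalIntegral.integral_interval_sub_left (hi1 t' ht') (hi1 t ht)
    have e4 : |∫ s in t..t', (⟪W i s, A s ψ⟫ + F s ψ)| ≤ (R * a + B * ‖ι ψ‖) * |t' - t| := by
      rw [← Real.norm_eq_abs]
      apply intervalIntegral.norm_integral_le_of_norm_le_const_ae
      have h1 := (ae_restrict_iff' measurableSet_Icc).1 hF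
      filter_upwards [h1] with s hs hst
      have hs' : s ∈ Icc τ T := uIcc_subset_Icc ht ht' (uIoc_subset_uIcc hst)
      refine (norm_add_le _ _).trans (add_le_add ?_ (hs hs' ψ))
      exact (abs_real_inner_le_norm _ _).trans
        (mul_le_mul (hWR i s hs') (ha s hs') (norm_nonneg _) hR0)
    rw [← e3] at e4
    simp only [hWdef] at e1 e2 e4 ⊢
    rw [abs_le] at e1 e2 e4 ⊢
    constructor <;> linarith
  have unif : ∀ x : ℝ → H, ContinuousOn x (Icc τ T) →
      TendstoUniformlyOn (fun i t => ⟪W i t, x t⟫) (fun t => ⟪w t, x t⟫) U (Icc τ T) :=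
    fun x hx => tendstoUniformlyOn_inner hWR hw hι heq hx
  have wc : ∀ x : ℝ → H, ContinuousOn x (Icc τ T) →
      ContinuousOn (fun t => ⟪w t, x t⟫) (Icc τ T) := fun x hx =>
    (unif x hx).continuousOn (Frequently.of_forall fun i => (hvc i).inner hx)
  have tint : ∀ x : ℝ → H, ContinuousOn x (Icc τ T) → ∀ t ∈ Icc τ T,
      Tendsto (fun i => ∫ s in τ..t, ⟪W i s, x s⟫) U (𝓝 (∫ s in τ..t, ⟪w s, x s⟫)) := by
    intro x hx t ht
    have hsub : Icc τ t ⊆ Icc τ T := Icc_subset_Icc_right ht.2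
    exact tendsto_intervalIntegral_of_tendstoUniformlyOn ht.1
      (fun i => ((hvc i).inner hx).mono hsub) ((wc x hx).mono hsub) ((unif x hx).mono hsub)
  refine ⟨w, fun t ht => ?_, fun x => wc _ continuousOn_const, fun t ht ψ => ?_, fun s => ?_⟩
  -- Weak lower semicontinuity of the norm: `2 ⟪W, w⟫ - ‖w‖² ≤ ‖W‖²`, and the left side is affine in
  -- `W`.
  · have h1 : Tendsto (fun i => 2 * ⟪W i t, w t⟫ - ‖w t‖ ^ 2) U (𝓝 (2 * ⟪w t, w t⟫ - ‖w t‖ ^ 2)) :=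
      ((hw t ht (w t)).const_mul 2).sub_const _
    rw [real_inner_self_eq_norm_sq] at h1
    have h2 := le_of_tendsto_of_tendsto' h1 (hKU.const_mul q₁) (fun i => by
      have h3 := hWK i t ht
      have h4 := norm_sub_sq_real (W i t) (w t)
      nlinarith [sq_nonneg ‖W i t - w t‖])
    linarith
  · have hsplit : ∀ y : ℝ → H, ContinuousOn (fun s => ⟪y s, A s ψ⟫) (Icc τ T) →
        ∫ s in τ..t, (⟪y s, A s ψ⟫ + F s ψ) = (∫ s in τ..t, ⟪y s, A s ψ⟫) + ∫ s in τ..t, F s ψ :=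
      fun y hy => intervalIntegral.integral_add (ci hy τ τm t ht) (hFi ψ τ τm t ht)
    have h1 : Tendsto (fun i => ⟪W i t, ι ψ⟫ - (ℓ ψ + ∫ s in τ..t, (⟪W i s, A s ψ⟫ + F s ψ))) U
        (𝓝 (⟪w t, ι ψ⟫ - (ℓ ψ + ∫ s in τ..t, (⟪w s, A s ψ⟫ + F s ψ)))) := by
      rw [hsplit w (wc _ (h.contA ψ))]
      have h2 : ∀ i, ∫ s in τ..t, (⟪W i s, A s ψ⟫ + F s ψ) =
          (∫ s in τ..t, ⟪W i s, A s ψ⟫) + ∫ s in τ..t, F s ψ :=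
        fun i => hsplit (W i) ((hvc i).inner (h.contA ψ))
      simp only [h2]
      exact (hw t ht _).sub (((tint _ (h.contA ψ) t ht).add_const _).const_add _)
    have h3 : Tendsto (fun i => ⟪W i t, ι ψ⟫ - (ℓ ψ + ∫ s in τ..t, (⟪W i s, A s ψ⟫ + F s ψ))) U
        (𝓝 0) := by
      have h0 : Tendsto (fun i => ‖ι ψ‖ * (e i * (1 + (T - τ)))) U (𝓝 0) := by
        have := (heU.mul_const (1 + (T - τ))).const_mul ‖ι ψ‖
        simpa using this
      apply squeeze_zero_norm' _ h0
      filter_upwards [hSU ψ] with i hi using hvW i ψ hi t ht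
    linarith [tendsto_nhds_unique h1 h3]
  -- The same convexity argument for the dissipation: `∫ ∑ ⟪W, g⟫²` is bounded below by an
  -- expression affine in `W`, whose coefficient `x` is a continuous curve.
  · set x : ℝ → H := fun t => ∑ i ∈ s, ⟪w t, g i⟫ • g i with hx
    have xc : ContinuousOn x (Icc τ T) :=
      continuousOn_finsetSum _ fun i _ => (wc _ continuousOn_const).smul continuousOn_const
    have Tm : T ∈ Icc τ T := right_mem_Icc.2 hτ.le
    have hwx : ∀ y : H, ∀ t, ⟪y, x t⟫ = ∑ i ∈ s, ⟪w t, g i⟫ * ⟪y, g i⟫ := by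
      intro y t
      simp [hx, inner_sum, real_inner_smul_right]
    have hsq : ∀ t, ∑ i ∈ s, ⟪w t, g i⟫ ^ 2 = ⟪w t, x t⟫ := by
      intro t; rw [hwx]; simp only [sq]
    simp only [hsq]
    have h1 := ((tint x xc T Tm).const_mul 2).sub_const (∫ r in τ..T, ⟪w r, x r⟫)
    have h2 := le_of_tendsto_of_tendsto' h1 hKU (fun i => by
      have h3 := hvE i T Tm s
      have h4 := hpos i T Tm
      have c1 : ContinuousOn (fun r => ⟪W i r, x r⟫) (Icc τ T) := (hvc i).inner xc
      have c2 : ContinuousOn (fun r => ∑ j ∈ s, ⟪W i r, g j⟫ ^ 2) (Icc τ T) :=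
        continuousOn_finsetSum _ fun j _ => ((hvc i).inner continuousOn_const).pow 2
      have h5 : (2 * ∫ r in τ..T, ⟪W i r, x r⟫) - (∫ r in τ..T, ⟪w r, x r⟫) ≤
          ∫ r in τ..T, ∑ j ∈ s, ⟪W i r, g j⟫ ^ 2 := by
        rw [← intervalIntegral.integral_const_mul, ← intervalIntegral.integral_sub
          ((ci c1 τ τm T Tm).const_mul 2) (ci (wc x xc) τ τm T Tm)]
        apply intervalIntegral.integral_mono_on hτ.le
          (((ci c1 τ τm T Tm).const_mul 2).sub (ci (wc x xc) τ τm T Tm)) (ci c2 τ τm T Tm)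
        intro r _
        rw [hwx, ← hsq, Finset.mul_sum, ← Finset.sum_sub_distrib]
        apply Finset.sum_le_sum
        intro j _
        nlinarith [sq_nonneg (⟪W i r, g j⟫ - ⟪w r, g j⟫)]
      linarith)
    linarith

end

end DispersivePDE

/-! ### Periodic functions in `L²` and their Fourier coefficients. -/

namespace DispersivePDE

/-- Real square integrable functions on a period. -/
abbrev L2 (M : ℝ) : Type := Lp ℝ 2 (volume.restrict (Ioc 0 M))

/-- The class of a function in `L²`, zero if the function is not square integrable. -/
def toL2 (M : ℝ) (f : ℝ → ℝ) : L2 M :=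
  open scoped Classical in
  if h : MemLp f 2 (volume.restrict (Ioc 0 M)) then h.toLp f else 0

/-- The mean value over a period. -/
def mean (M : ℝ) (f : ℝ → ℝ) : ℝ := (1 / M) * ∫ x in (0 : ℝ)..M, f x

variable {M : ℝ}

theorem memLp_of_continuous {f : ℝ → ℝ} (hf : Continuous f) :
    MemLp f 2 (volume.restrict (Ioc 0 M)) := by
  obtain ⟨C, hC⟩ := isCompact_Icc.exists_bound_of_continuousOn (s := Icc 0 M) hf.continuousOn
  refine MemLp.of_bound hf.aestronglyMeasurable C ?_
  filter_upwards [ae_restrict_mem measurableSet_Ioc] with x hx using hC x (Ioc_subset_Icc_self hx)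

theorem toL2_eq {f : ℝ → ℝ} (hf : MemLp f 2 (volume.restrict (Ioc 0 M))) :
    toL2 M f = hf.toLp f := dif_pos hf

theorem coeFn_toL2 {f : ℝ → ℝ} (hf : MemLp f 2 (volume.restrict (Ioc 0 M))) :
    toL2 M f =ᵐ[volume.restrict (Ioc 0 M)] f := by
  rw [toL2_eq hf]; exact hf.coeFn_toLp

theorem toL2_coe (w : L2 M) : toL2 M w = w := by
  rw [toL2_eq (Lp.memLp w)]; exact Lp.toLp_coeFn w _

theorem toL2_add {f g : ℝ → ℝ} (hf : MemLp f 2 (volume.restrict (Ioc 0 M)))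
    (hg : MemLp g 2 (volume.restrict (Ioc 0 M))) :
    toL2 M (fun x => f x + g x) = toL2 M f + toL2 M g := by
  rw [toL2_eq hf, toL2_eq hg, ← MemLp.toLp_add]; exact toL2_eq (hf.add hg)

theorem toL2_sub {f g : ℝ → ℝ} (hf : MemLp f 2 (volume.restrict (Ioc 0 M)))
    (hg : MemLp g 2 (volume.restrict (Ioc 0 M))) :
    toL2 M (fun x => f x - g x) = toL2 M f - toL2 M g := by
  rw [toL2_eq hf, toL2_eq hg, ← MemLp.toLp_sub]; exact toL2_eq (hf.sub hg)

theorem toL2_const_mul {f : ℝ → ℝ} (hf : MemLp f 2 (volume.restrict (Ioc 0 M))) (c : ℝ) :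
    toL2 M (fun x => c * f x) = c • toL2 M f := by
  rw [toL2_eq hf, ← MemLp.toLp_const_smul]; exact toL2_eq (hf.const_smul c)

theorem inner_toL2_right (hM : 0 < M) (w : L2 M) {g : ℝ → ℝ}
    (hg : MemLp g 2 (volume.restrict (Ioc 0 M))) :
    ⟪w, toL2 M g⟫ = ∫ x in (0 : ℝ)..M, w x * g x := by
  rw [L2.inner_def, intervalIntegral.integral_of_le hM.le]
  apply integral_congr_ae
  filter_upwards [coeFn_toL2 hg] with x hx
  rw [hx]; simp [mul_comm]

theorem inner_toL2 (hM : 0 < M) {f g : ℝ → ℝ} (hf : MemLp f 2 (volume.restrict (Ioc 0 M)))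
    (hg : MemLp g 2 (volume.restrict (Ioc 0 M))) :
    ⟪toL2 M f, toL2 M g⟫ = ∫ x in (0 : ℝ)..M, f x * g x := by
  rw [inner_toL2_right hM _ hg, intervalIntegral.integral_of_le hM.le,
    intervalIntegral.integral_of_le hM.le]
  apply integral_congr_ae
  filter_upwards [coeFn_toL2 hf] with x hx
  rw [hx]

theorem norm_toL2_sq (hM : 0 < M) {f : ℝ → ℝ} (hf : MemLp f 2 (volume.restrict (Ioc 0 M))) :
    ‖toL2 M f‖ ^ 2 = ∫ x in (0 : ℝ)..M, f x ^ 2 := by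
  rw [← real_inner_self_eq_norm_sq, inner_toL2 hM hf hf]; simp only [sq]

theorem norm_sq_eq_integral (hM : 0 < M) (w : L2 M) : ‖w‖ ^ 2 = ∫ x in (0 : ℝ)..M, w x ^ 2 := by
  rw [← norm_toL2_sq hM (Lp.memLp w), toL2_coe]

theorem intervalIntegrable_of_memLp (hM : 0 < M) {f : ℝ → ℝ}
    (hf : MemLp f 2 (volume.restrict (Ioc 0 M))) : IntervalIntegrable f volume 0 M := by
  rw [intervalIntegrable_iff_integrableOn_Ioc_of_le hM.le]
  exact hf.integrable (by simp)

theorem norm_toL2_one_sq (hM : 0 < M) : ‖toL2 M fun _ => (1 : ℝ)‖ ^ 2 = M := by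
  rw [norm_toL2_sq hM (memLp_of_continuous continuous_const)]; simp

/-- A continuous curve of continuous functions is continuous in `L²`. -/
theorem continuousOn_toL2 (hM : 0 < M) {τ T : ℝ} {f : ℝ → ℝ → ℝ}
    (hf : ContinuousOn (Function.uncurry f) (Icc τ T ×ˢ univ)) :
    ContinuousOn (fun t => toL2 M (f t)) (Icc τ T) := by
  have hfx : ∀ t ∈ Icc τ T, Continuous (f t) := fun t ht =>
    continuousOn_univ.1 (hf.comp (by fun_prop : Continuous fun x => (t, x)).continuousOn
      fun x _ => ⟨ht, mem_univ _⟩)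
  intro t ht
  rw [ContinuousWithinAt, Metric.tendsto_nhds]
  intro ε hε
  set δ := ε / (2 * (M + 1)) with hδ
  have hδ0 : 0 < δ := by positivity
  have hcpt : IsCompact (Icc 0 M) := isCompact_Icc
  have h1 : ∀ᶠ s in 𝓝[Icc τ T] t, ∀ x ∈ Icc 0 M, |f s x - f t x| < δ := by
    have huc := (isCompact_Icc.prod hcpt).uniformContinuousOn_of_continuous
      (hf.mono (prod_mono_right (subset_univ _)) : ContinuousOn (Function.uncurry f)
        (Icc τ T ×ˢ Icc 0 M))
    obtain ⟨η, hη, hu⟩ := Metric.uniformContinuousOn_iff.1 huc δ hδ0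
    filter_upwards [self_mem_nhdsWithin, mem_nhdsWithin_of_mem_nhds (Metric.ball_mem_nhds t hη)]
      with s hs hst x hx
    have := hu (s, x) ⟨hs, hx⟩ (t, x) ⟨ht, hx⟩ (by
      rw [Prod.dist_eq, dist_self]; exact max_lt hst hη)
    exact this
  filter_upwards [h1, self_mem_nhdsWithin] with s hs hsm
  have c1 := memLp_of_continuous (M := M) (hfx s hsm)
  have c2 := memLp_of_continuous (M := M) (hfx t ht)
  rw [dist_eq_norm, ← toL2_sub c1 c2]
  have h2 : ‖toL2 M fun x => f s x - f t x‖ ^ 2 ≤ δ ^ 2 * M := by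
    rw [norm_toL2_sq hM (f := fun x => f s x - f t x)
      (memLp_of_continuous ((hfx s hsm).sub (hfx t ht)))]
    have : ∫ x in (0 : ℝ)..M, (f s x - f t x) ^ 2 ≤ ∫ _x in (0 : ℝ)..M, δ ^ 2 := by
      apply intervalIntegral.integral_mono_on hM.le
      · exact (((hfx s hsm).sub (hfx t ht)).pow 2).intervalIntegrable _ _
      · simp
      · intro x hx
        rw [sq_le_sq, abs_of_pos hδ0]; exact (hs x hx).le
    simpa [mul_comm] using this
  apply lt_of_pow_lt_pow_left₀ 2 hε.le
  refine h2.trans_lt ?_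
  rw [hδ, div_pow, div_mul_eq_mul_div, div_lt_iff₀ (by positivity)]
  have : 0 < ε ^ 2 := by positivity
  nlinarith [sq_nonneg M]

/-! ### Fourier coefficients -/

/-- The wave number `2πk/M`. -/
def freq (M : ℝ) (k : ℤ) : ℝ := 2 * Real.pi * k / M

def cosCoeff (M : ℝ) (f : ℝ → ℝ) (k : ℤ) : ℝ :=
  (1 / M) * ∫ x in (0 : ℝ)..M, f x * Real.cos (freq M k * x)

def sinCoeff (M : ℝ) (f : ℝ → ℝ) (k : ℤ) : ℝ :=
  (1 / M) * ∫ x in (0 : ℝ)..M, f x * Real.sin (freq M k * x)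

theorem intervalIntegrable_ofReal {f : ℝ → ℝ} {a b : ℝ} (hf : IntervalIntegrable f volume a b) :
    IntervalIntegrable (fun x => (f x : ℂ)) volume a b := ⟨hf.1.ofReal, hf.2.ofReal⟩

theorem perCoeff_eq {f : ℝ → ℝ} (hf : IntervalIntegrable f volume 0 M) (k : ℤ) :
    perCoeff M f k = (cosCoeff M f k : ℂ) - (sinCoeff M f k : ℂ) * Complex.I := by
  have i1 : IntervalIntegrable (fun x => ((f x * Real.cos (freq M k * x) : ℝ) : ℂ)) volume 0 M :=
    intervalIntegrable_ofReal (hf.mul_continuousOn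
      (by fun_prop : Continuous fun x => Real.cos (freq M k * x)).continuousOn)
  have i2 : IntervalIntegrable (fun x => ((f x * Real.sin (freq M k * x) : ℝ) : ℂ) * Complex.I)
    volume 0 M := (intervalIntegrable_ofReal (hf.mul_continuousOn
      (by fun_prop : Continuous fun x => Real.sin (freq M k * x)).continuousOn)).mul_const _
  have h1 : ∀ x : ℝ, Complex.exp (-(2 * Real.pi * Complex.I * k * x / M)) * (f x : ℂ) =
      ((f x * Real.cos (freq M k * x) : ℝ) : ℂ) -
        ((f x * Real.sin (freq M k * x) : ℝ) : ℂ) * Complex.I := by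
    intro x
    have : -(2 * Real.pi * Complex.I * k * x / M) = (((-(freq M k * x) : ℝ)) : ℂ) * Complex.I := by
      simp only [freq]; push_cast; ring
    rw [this, Complex.exp_mul_I, ← Complex.ofReal_cos, ← Complex.ofReal_sin, Real.cos_neg,
      Real.sin_neg]
    push_cast; ring
  rw [perCoeff]
  simp only [h1]
  rw [intervalIntegral.integral_sub i1 i2, intervalIntegral.integral_mul_const,
    intervalIntegral.integral_ofReal, intervalIntegral.integral_ofReal]
  simp only [cosCoeff, sinCoeff, Complex.real_smul]
  push_cast; ring

theorem norm_perCoeff_sq {f : ℝ → ℝ} (hf : IntervalIntegrable f volume 0 M) (k : ℤ) :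
    ‖perCoeff M f k‖ ^ 2 = cosCoeff M f k ^ 2 + sinCoeff M f k ^ 2 := by
  rw [perCoeff_eq hf, ← Complex.normSq_eq_norm_sq, Complex.normSq_apply]
  simp; ring

theorem perCoeff_congr {f g : ℝ → ℝ} (h : f =ᵐ[volume.restrict (Ioc 0 M)] g) (hM : 0 < M) (k : ℤ) :
    perCoeff M f k = perCoeff M g k := by
  rw [perCoeff, perCoeff, intervalIntegral.integral_of_le hM.le,
    intervalIntegral.integral_of_le hM.le]
  congr 1
  apply integral_congr_ae
  filter_upwards [h] with x hx
  rw [hx]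

theorem perCoeff_add {f g : ℝ → ℝ} (hf : IntervalIntegrable f volume 0 M)
    (hg : IntervalIntegrable g volume 0 M) (k : ℤ) :
    perCoeff M (fun x => f x + g x) k = perCoeff M f k + perCoeff M g k := by
  simp only [perCoeff]
  rw [← smul_add, ← intervalIntegral.integral_add]
  · congr 2; funext x; push_cast; ring
  · exact (intervalIntegrable_ofReal hf).continuousOn_mul (by fun_prop)
  · exact (intervalIntegrable_ofReal hg).continuousOn_mul (by fun_prop)

theorem perCoeff_const_mul (f : ℝ → ℝ) (c : ℝ) (k : ℤ) :
    perCoeff M (fun x => c * f x) k = c * perCoeff M f k := by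
  simp only [perCoeff]
  rw [mul_smul_comm, ← intervalIntegral.integral_const_mul]
  congr 2; funext x; push_cast; ring

theorem perCoeff_sub {f g : ℝ → ℝ} (hf : IntervalIntegrable f volume 0 M)
    (hg : IntervalIntegrable g volume 0 M) (k : ℤ) :
    perCoeff M (fun x => f x - g x) k = perCoeff M f k - perCoeff M g k := by
  have h1 := perCoeff_add hf (hg.const_mul (-1)) k
  rw [perCoeff_const_mul] at h1
  simpa [sub_eq_add_neg] using h1

/-- Parseval's identity. -/
theorem hasSum_perCoeff_sq (hM : 0 < M) {f : ℝ → ℝ} (hf : MemLp f 2 (volume.restrict (Ioc 0 M))) :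
    HasSum (fun k : ℤ => ‖perCoeff M f k‖ ^ 2) ((1 / M) * ∫ x in (0 : ℝ)..M, f x ^ 2) := by
  have h := hasSum_sq_fourierCoeffOn hM (f := fun x => (f x : ℂ)) hf.ofReal
  simp only [← perCoeff_eq_fourierCoeffOn hM] at h
  convert h using 1
  simp

theorem hasSum_perCoeff_coe_sq (hM : 0 < M) (w : L2 M) :
    HasSum (fun k : ℤ => ‖perCoeff M w k‖ ^ 2) ((1 / M) * ‖w‖ ^ 2) := by
  rw [norm_sq_eq_integral hM]; exact hasSum_perCoeff_sq hM (Lp.memLp w)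

/-! ### Smooth periodic functions -/

/-- Smooth `M`-periodic functions. -/
def smoothPer (M : ℝ) : Submodule ℝ (ℝ → ℝ) where
  carrier := {f | ContDiff ℝ ∞ f ∧ Function.Periodic f M}
  add_mem' := fun ha hb => ⟨ha.1.add hb.1, ha.2.add hb.2⟩
  zero_mem' := ⟨contDiff_const, fun _ => rfl⟩
  smul_mem' := fun c _ hf => ⟨contDiff_const.smul hf.1, fun x => by simp [hf.2 x]⟩

theorem smoothPer_continuous (f : smoothPer M) : Continuous (f : ℝ → ℝ) := f.2.1.continuous

theorem smoothPer_memLp (f : smoothPer M) : MemLp (f : ℝ → ℝ) 2 (volume.restrict (Ioc 0 M)) :=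
  memLp_of_continuous (smoothPer_continuous f)

/-- The class in `L²` of a smooth periodic function. -/
def smoothToL2 (M : ℝ) : smoothPer M →ₗ[ℝ] L2 M where
  toFun f := toL2 M f
  map_add' f g := toL2_add (smoothPer_memLp f) (smoothPer_memLp g)
  map_smul' c f := toL2_const_mul (smoothPer_memLp f) c

theorem smoothToL2_apply (f : smoothPer M) : smoothToL2 M f = toL2 M f := rfl

theorem eq_of_ae_eq_of_periodic (hM : 0 < M) {f g : ℝ → ℝ} (hf : Continuous f) (hg : Continuous g)
    (hfp : Function.Periodic f M) (hgp : Function.Periodic g M)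
    (h : f =ᵐ[volume.restrict (Ioc 0 M)] g) : f = g := by
  have h1 : EqOn f g (Ioc 0 M) :=
    Measure.eqOn_Ioc_of_ae_eq volume h hf.continuousOn hg.continuousOn
  funext x
  obtain ⟨y, hy, hxy⟩ := (hfp.sub hgp).exists_mem_Ioc hM x 0
  have hm : y ∈ Ioc 0 M := by simpa using hy
  have h2 : f x - g x = f y - g y := hxy
  have h3 := h1 hm
  linarith

theorem smoothToL2_injective (hM : 0 < M) : Function.Injective (smoothToL2 M) := by
  intro f g h
  apply Subtype.ext
  apply eq_of_ae_eq_of_periodic hM (smoothPer_continuous f) (smoothPer_continuous g) f.2.2 g.2.2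
  have h1 := coeFn_toL2 (smoothPer_memLp f)
  have h2 := coeFn_toL2 (smoothPer_memLp g)
  rw [← smoothToL2_apply, h] at h1
  exact h1.symm.trans h2

theorem freq_mul_period (hM : 0 < M) (k : ℤ) : freq M k * M = k * (2 * Real.pi) := by
  rw [freq]; field_simp

def cosPer (hM : 0 < M) (k : ℤ) : smoothPer M :=
  ⟨fun x => Real.cos (freq M k * x), by fun_prop, fun x => by
    simp only [mul_add, freq_mul_period hM]; exact Real.cos_add_int_mul_two_pi _ _⟩

def sinPer (hM : 0 < M) (k : ℤ) : smoothPer M :=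
  ⟨fun x => Real.sin (freq M k * x), by fun_prop, fun x => by
    simp only [mul_add, freq_mul_period hM]; exact Real.sin_add_int_mul_two_pi _ _⟩

theorem cosCoeff_coe (hM : 0 < M) (w : L2 M) (k : ℤ) :
    cosCoeff M w k = (1 / M) * ⟪w, smoothToL2 M (cosPer hM k)⟫ := by
  rw [smoothToL2_apply, inner_toL2_right hM _ (smoothPer_memLp (cosPer hM k))]; rfl

theorem sinCoeff_coe (hM : 0 < M) (w : L2 M) (k : ℤ) :
    sinCoeff M w k = (1 / M) * ⟪w, smoothToL2 M (sinPer hM k)⟫ := by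
  rw [smoothToL2_apply, inner_toL2_right hM _ (smoothPer_memLp (sinPer hM k))]; rfl

/-- A vector orthogonal to the range is orthogonal to all sines and cosines, so all its Fourier
coefficients vanish and Parseval's identity makes it zero. -/
theorem denseRange_smoothToL2 (hM : 0 < M) : DenseRange (smoothToL2 M) := by
  have h1 : (LinearMap.range (smoothToL2 M)).topologicalClosure = ⊤ := by
    rw [Submodule.topologicalClosure_eq_top_iff, Submodule.eq_bot_iff]
    intro w hw
    have h0 : ∀ ψ, ⟪w, smoothToL2 M ψ⟫ = 0 := fun ψ => by
      rw [real_inner_comm]; exact (Submodule.mem_orthogonal _ _).1 hw _ ⟨ψ, rfl⟩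
    have hP := hasSum_perCoeff_coe_sq hM w
    have hk : ∀ k, ‖perCoeff M w k‖ ^ 2 = 0 := fun k => by
      rw [norm_perCoeff_sq (intervalIntegrable_of_memLp hM (Lp.memLp w)), cosCoeff_coe hM,
        sinCoeff_coe hM, h0, h0]
      simp
    simp only [hk] at hP
    have := hP.unique hasSum_zero
    simpa [hM.ne'] using this
  rw [DenseRange, ← LinearMap.coe_range]
  exact Submodule.dense_iff_topologicalClosure_eq_top.2 h1

end DispersivePDE

/-! ### Periodic integration by parts and the mean-zero antiderivative. -/

namespace DispersivePDE

variable {M : ℝ}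

/-! ### Calculus of periodic functions -/

theorem periodic_deriv {f : ℝ → ℝ} (hf : Function.Periodic f M) : Function.Periodic (deriv f) M := by
  intro x
  have : (fun y => f (y + M)) = f := funext hf
  rw [← deriv_comp_add_const, this]

theorem periodic_iteratedDeriv {f : ℝ → ℝ} (hf : Function.Periodic f M) (n : ℕ) :
    Function.Periodic (iteratedDeriv n f) M := by
  induction n with
  | zero => simpa using hf
  | succ n ih => rw [iteratedDeriv_succ]; exact periodic_deriv ih

theorem contDiff_iteratedDeriv {f : ℝ → ℝ} {k n : ℕ} (hf : ContDiff ℝ (k + n : ℕ) f) :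
    ContDiff ℝ k (iteratedDeriv n f) := by
  rw [iteratedDeriv_eq_iterate]
  apply ContDiff.iterate_deriv' k n
  exact_mod_cast hf

theorem iteratedDeriv_smoothPer (f : smoothPer M) (n : ℕ) :
    iteratedDeriv n (f : ℝ → ℝ) ∈ smoothPer M := by
  refine ⟨?_, periodic_iteratedDeriv f.2.2 n⟩
  rw [contDiff_infty]
  intro k
  exact contDiff_iteratedDeriv (contDiff_infty.1 f.2.1 _)

/-- Integration by parts over a period. -/
theorem integral_mul_deriv_periodic {f g : ℝ → ℝ} (hf : ContDiff ℝ 1 f) (hg : ContDiff ℝ 1 g)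
    (hfp : Function.Periodic f M) (hgp : Function.Periodic g M) :
    ∫ x in (0 : ℝ)..M, f x * deriv g x = -∫ x in (0 : ℝ)..M, deriv f x * g x := by
  rw [intervalIntegral.integral_mul_deriv_eq_deriv_mul (u := f) (v := g) (u' := deriv f)
    (v' := deriv g) (fun x _ => (hf.differentiable (by simp) x).hasDerivAt)
    (fun x _ => (hg.differentiable (by simp) x).hasDerivAt)
    ((hf.continuous_deriv le_rfl).intervalIntegrable _ _)
    ((hg.continuous_deriv le_rfl).intervalIntegrable _ _)]
  have h1 := hfp 0
  have h2 := hgp 0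
  rw [zero_add] at h1 h2
  rw [h1, h2]; ring

theorem integral_mul_iteratedDeriv_periodic (n : ℕ) : ∀ {f g : ℝ → ℝ}, ContDiff ℝ n f →
    ContDiff ℝ n g → Function.Periodic f M → Function.Periodic g M →
    ∫ x in (0 : ℝ)..M, f x * iteratedDeriv n g x =
      (-1) ^ n * ∫ x in (0 : ℝ)..M, iteratedDeriv n f x * g x := by
  induction n with
  | zero => intros; simp
  | succ n ih =>
    intro f g hf hg hfp hgp
    have hg' : ContDiff ℝ n (deriv g) := ((contDiff_succ_iff_deriv (n := n)).1 (by exact_mod_cast hg)).2.2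
    have h1 : ContDiff ℝ 1 (iteratedDeriv n f) :=
      contDiff_iteratedDeriv (k := 1) (by rw [add_comm]; exact hf)
    rw [iteratedDeriv_succ', ih (hf.of_le (by exact_mod_cast n.le_succ)) hg' hfp (periodic_deriv hgp),
      integral_mul_deriv_periodic h1 (hg.of_le (by exact_mod_cast Nat.succ_le_succ n.zero_le))
        (periodic_iteratedDeriv hfp n) hgp, iteratedDeriv_succ, pow_succ]
    ring

/-! ### The mean-zero antiderivative -/

/-- The periodic antiderivative with mean zero of `g - mean g`. -/
def antider (M : ℝ) (g : ℝ → ℝ) (x : ℝ) : ℝ :=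
  ∫ y in (0 : ℝ)..M, (1 / 2 - Int.fract ((x - y) / M)) * g y

theorem abs_half_sub_fract_le (z : ℝ) : |1 / 2 - Int.fract z| ≤ 1 / 2 := by
  rw [abs_le]
  constructor <;> linarith [Int.fract_nonneg z, Int.fract_lt_one z]

theorem measurable_kernel : Measurable fun p : ℝ × ℝ => 1 / 2 - Int.fract ((p.1 - p.2) / M) := by
  fun_prop

theorem intervalIntegrable_kernel {g : ℝ → ℝ} (hg : IntervalIntegrable g volume 0 M) (x : ℝ) :
    IntervalIntegrable (fun y => (1 / 2 - Int.fract ((x - y) / M)) * g y) volume 0 M := by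
  rw [intervalIntegrable_iff] at hg ⊢
  apply Integrable.bdd_mul (c := 1 / 2) hg
  · exact ((measurable_kernel (M := M)).comp measurable_prodMk_left).aestronglyMeasurable
  · exact ae_of_all _ fun y => abs_half_sub_fract_le _

theorem antider_periodic (hM : 0 < M) (g : ℝ → ℝ) : Function.Periodic (antider M g) M := by
  intro x
  simp only [antider]
  congr 1
  funext y
  have : (x + M - y) / M = (x - y) / M + 1 := by field_simp; ring
  rw [this, Int.fract_add_one]

theorem antider_add {f g : ℝ → ℝ} (hf : IntervalIntegrable f volume 0 M)
    (hg : IntervalIntegrable g volume 0 M) (x : ℝ) :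
    antider M (fun y => f y + g y) x = antider M f x + antider M g x := by
  simp only [antider]
  rw [← intervalIntegral.integral_add (intervalIntegrable_kernel hf x)
    (intervalIntegrable_kernel hg x)]
  congr 1; funext y; ring

theorem antider_const_mul (c : ℝ) (f : ℝ → ℝ) (x : ℝ) :
    antider M (fun y => c * f y) x = c * antider M f x := by
  simp only [antider]
  rw [← intervalIntegral.integral_const_mul]
  congr 1; funext y; ring

theorem antider_sub {f g : ℝ → ℝ} (hf : IntervalIntegrable f volume 0 M)
    (hg : IntervalIntegrable g volume 0 M) (x : ℝ) :
    antider M (fun y => f y - g y) x = antider M f x - antider M g x := by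
  have := antider_add hf (hg.const_mul (-1)) x
  rw [antider_const_mul] at this
  simpa [sub_eq_add_neg] using this

theorem antider_congr (hM : 0 < M) {f g : ℝ → ℝ} (h : f =ᵐ[volume.restrict (Ioc 0 M)] g) :
    antider M f = antider M g := by
  funext x
  rw [antider, antider, intervalIntegral.integral_of_le hM.le,
    intervalIntegral.integral_of_le hM.le]
  apply integral_congr_ae
  filter_upwards [h] with y hy
  rw [hy]

theorem integral_abs_le (hM : 0 < M) {g : ℝ → ℝ} (hg : MemLp g 2 (volume.restrict (Ioc 0 M))) :
    ∫ y in (0 : ℝ)..M, |g y| ≤ Real.sqrt M * ‖toL2 M g‖ := by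
  have habs : MemLp (fun y => |g y|) 2 (volume.restrict (Ioc 0 M)) := hg.abs
  have h1 : ∫ y in (0 : ℝ)..M, |g y| = ⟪toL2 M fun _ => (1 : ℝ), toL2 M fun y => |g y|⟫ := by
    rw [inner_toL2 hM (memLp_of_continuous continuous_const) habs]; simp
  have h2 : ‖toL2 M fun y => |g y|‖ = ‖toL2 M g‖ := by
    rw [← sq_eq_sq₀ (norm_nonneg _) (norm_nonneg _), norm_toL2_sq hM habs, norm_toL2_sq hM hg]
    simp
  rw [h1]
  refine (real_inner_le_norm _ _).trans ?_
  rw [h2, ← Real.sqrt_sq (norm_nonneg (toL2 M fun _ => (1 : ℝ))), norm_toL2_one_sq hM]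

theorem abs_antider_le (hM : 0 < M) {g : ℝ → ℝ} (hg : MemLp g 2 (volume.restrict (Ioc 0 M)))
    (x : ℝ) : |antider M g x| ≤ Real.sqrt M / 2 * ‖toL2 M g‖ := by
  have h0 := intervalIntegrable_of_memLp hM hg
  have h1 : |antider M g x| ≤ ∫ y in (0 : ℝ)..M, 1 / 2 * |g y| := by
    rw [antider, ← Real.norm_eq_abs]
    apply intervalIntegral.norm_integral_le_of_norm_le hM.le _ (h0.abs.const_mul _)
    refine ae_of_all _ fun y _ => ?_
    rw [norm_mul]
    exact mul_le_mul_of_nonneg_right (abs_half_sub_fract_le _) (norm_nonneg _)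
  rw [intervalIntegral.integral_const_mul] at h1
  linarith [integral_abs_le hM hg]

/-- Moving the period of integration to `[x - M, x]` unwinds the fractional part to `(x - y) / M`.
The dependence on `x` then sits in explicit factors and end points, where the fundamental theorem of
calculus applies. -/
theorem antider_eq_of_continuous (hM : 0 < M) {g : ℝ → ℝ} (hg : Continuous g)
    (hgp : Function.Periodic g M) (x : ℝ) :
    antider M g x = (1 / 2 - x / M) * (∫ y in (0 : ℝ)..M, g y) +
      (1 / M) * ((∫ y in (0 : ℝ)..x, y * g y) - ∫ y in (0 : ℝ)..(x - M), y * g y) := by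
  have hper : Function.Periodic (fun y => (1 / 2 - Int.fract ((x - y) / M)) * g y) M := by
    intro y
    have : (x - (y + M)) / M = (x - y) / M - 1 := by field_simp; ring
    simp only [this, Int.fract_sub_one, hgp y]
  have h1 : antider M g x =
      ∫ y in (x - M)..x, (1 / 2 - Int.fract ((x - y) / M)) * g y := by
    have := hper.intervalIntegral_add_eq 0 (x - M)
    simpa [antider] using this
  have h2 : ∫ y in (x - M)..x, (1 / 2 - Int.fract ((x - y) / M)) * g y =
      ∫ y in (x - M)..x, ((1 / 2 - x / M) * g y + (1 / M) * (y * g y)) := by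
    apply intervalIntegral.integral_congr_ae
    refine ae_of_all _ fun y hy => ?_
    rw [uIoc_of_le (by linarith)] at hy
    have : Int.fract ((x - y) / M) = (x - y) / M := by
      rw [Int.fract_eq_self]
      exact ⟨div_nonneg (by linarith [hy.2]) hM.le, by rw [div_lt_one hM]; linarith [hy.1]⟩
    rw [this]; field_simp; ring
  have hc1 : Continuous fun y => (1 / M) * (y * g y) := by fun_prop
  have hc2 : Continuous fun y => (1 / 2 - x / M) * g y := by fun_prop
  rw [h1, h2, intervalIntegral.integral_add (hc2.intervalIntegrable _ _)
    (hc1.intervalIntegrable _ _),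
    intervalIntegral.integral_const_mul, intervalIntegral.integral_const_mul]
  have h3 := hgp.intervalIntegral_add_eq 0 (x - M)
  simp only [zero_add, sub_add_cancel] at h3
  have hc : Continuous fun y => y * g y := continuous_id.mul hg
  rw [← h3, intervalIntegral.integral_interval_sub_left (hc.intervalIntegrable _ _)
    (hc.intervalIntegrable _ _)]

theorem hasDerivAt_antider (hM : 0 < M) {g : ℝ → ℝ} (hg : Continuous g)
    (hgp : Function.Periodic g M) (x : ℝ) :
    HasDerivAt (antider M g) (g x - mean M g) x := by
  have hc : Continuous fun y => y * g y := continuous_id.mul hg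
  have hF : ∀ x, HasDerivAt (fun x => ∫ y in (0 : ℝ)..x, y * g y) (x * g x) x :=
    fun x => hc.integral_hasStrictDerivAt 0 x |>.hasDerivAt
  have h1 : HasDerivAt (fun x => (1 / 2 - x / M) * (∫ y in (0 : ℝ)..M, g y) +
      (1 / M) * ((∫ y in (0 : ℝ)..x, y * g y) - ∫ y in (0 : ℝ)..(x - M), y * g y))
      ((-(1 / M)) * (∫ y in (0 : ℝ)..M, g y) + (1 / M) * (x * g x - (x - M) * g (x - M))) x := by
    have h2 : HasDerivAt (fun x : ℝ => 1 / 2 - x / M) (-(1 / M)) x :=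
      ((hasDerivAt_id x).div_const M).const_sub _
    have h3 := (hF (x - M)).comp_sub_const x M
    exact (h2.mul_const _).add (((hF x).sub h3).const_mul _)
  have h4 : antider M g = fun x => (1 / 2 - x / M) * (∫ y in (0 : ℝ)..M, g y) +
      (1 / M) * ((∫ y in (0 : ℝ)..x, y * g y) - ∫ y in (0 : ℝ)..(x - M), y * g y) :=
    funext fun x => antider_eq_of_continuous hM hg hgp x
  rw [h4]
  convert h1 using 1
  rw [hgp.sub_eq, mean]
  field_simp; ring

theorem deriv_antider (hM : 0 < M) {g : ℝ → ℝ} (hg : Continuous g)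
    (hgp : Function.Periodic g M) : deriv (antider M g) = fun x => g x - mean M g :=
  funext fun x => (hasDerivAt_antider hM hg hgp x).deriv

theorem contDiff_antider (hM : 0 < M) {g : ℝ → ℝ} {k : ℕ} (hg : ContDiff ℝ k g)
    (hgp : Function.Periodic g M) : ContDiff ℝ (k + 1 : ℕ) (antider M g) := by
  push_cast
  rw [contDiff_succ_iff_deriv, deriv_antider hM hg.continuous hgp]
  exact ⟨fun x => (hasDerivAt_antider hM hg.continuous hgp x).differentiableAt, by simp,
    hg.sub contDiff_const⟩

theorem antider_smoothPer (hM : 0 < M) (f : smoothPer M) : antider M f ∈ smoothPer M := by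
  refine ⟨contDiff_infty.2 fun k => ?_, antider_periodic hM _⟩
  exact (contDiff_antider hM (contDiff_infty.1 f.2.1 k) f.2.2).of_le (by exact_mod_cast k.le_succ)

/-- The kernel is bounded, so convergence in `L²` becomes uniform convergence of antiderivatives.
Smooth approximations, whose antiderivatives are smooth, pass continuity to the limit. -/
theorem continuous_antider (hM : 0 < M) {g : ℝ → ℝ} (hg : MemLp g 2 (volume.restrict (Ioc 0 M))) :
    Continuous (antider M g) := by
  rw [← antider_congr hM (coeFn_toL2 hg)]
  set w := toL2 M g
  obtain ⟨u, hu, hlim⟩ := mem_closure_iff_seq_limit.1 ((denseRange_smoothToL2 hM) w)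
  choose φ hφ using hu
  have hφ' : ∀ j, antider M (u j) = antider M (φ j) := fun j => by
    rw [← hφ j]; exact antider_congr hM (coeFn_toL2 (smoothPer_memLp _))
  have hunif : TendstoUniformly (fun j => antider M (φ j)) (antider M w) atTop := by
    rw [Metric.tendstoUniformly_iff]
    intro ε hε
    have h1 : Tendsto (fun j => Real.sqrt M / 2 * ‖w - u j‖) atTop (𝓝 0) := by
      have := ((tendsto_const_nhds (x := w)).sub hlim).norm.const_mul (Real.sqrt M / 2)
      simpa using this
    filter_upwards [h1.eventually (gt_mem_nhds hε)] with j hj x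
    have hm1 := Lp.memLp w
    have hm2 := Lp.memLp (u j)
    rw [← hφ' j, Real.dist_eq, ← antider_sub (intervalIntegrable_of_memLp hM hm1)
      (intervalIntegrable_of_memLp hM hm2)]
    refine (abs_antider_le hM (hm1.sub hm2) x).trans_lt ?_
    have : toL2 M (⇑w - ⇑(u j)) = w - u j := by
      rw [show (⇑w - ⇑(u j)) = fun y => w y - u j y from rfl, toL2_sub hm1 hm2, toL2_coe, toL2_coe]
    rwa [this]
  exact hunif.continuous (Frequently.of_forall fun j =>
    (antider_smoothPer hM (φ j)).1.continuous)

theorem memLp_antider (hM : 0 < M) {g : ℝ → ℝ} (hg : MemLp g 2 (volume.restrict (Ioc 0 M))) :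
    MemLp (antider M g) 2 (volume.restrict (Ioc 0 M)) :=
  memLp_of_continuous (continuous_antider hM hg)

theorem norm_toL2_le_of_abs_le (hM : 0 < M) {g : ℝ → ℝ} (hg : Continuous g) {C : ℝ} (hC : 0 ≤ C)
    (h : ∀ x ∈ Icc 0 M, |g x| ≤ C) : ‖toL2 M g‖ ≤ Real.sqrt M * C := by
  rw [← sq_le_sq₀ (norm_nonneg _) (by positivity), norm_toL2_sq hM (memLp_of_continuous hg), mul_pow,
    Real.sq_sqrt hM.le]
  have : ∫ x in (0 : ℝ)..M, g x ^ 2 ≤ ∫ _x in (0 : ℝ)..M, C ^ 2 := by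
    have hg2 : Continuous fun x => g x ^ 2 := by fun_prop
    apply intervalIntegral.integral_mono_on hM.le (hg2.intervalIntegrable _ _) (by simp)
    intro x hx
    rw [sq_le_sq, abs_of_nonneg hC]; exact h x hx
  simpa using this

theorem norm_antider_le (hM : 0 < M) {g : ℝ → ℝ} (hg : MemLp g 2 (volume.restrict (Ioc 0 M))) :
    ‖toL2 M (antider M g)‖ ≤ M / 2 * ‖toL2 M g‖ := by
  refine (norm_toL2_le_of_abs_le hM (continuous_antider hM hg) (by positivity)
    fun x _ => abs_antider_le hM hg x).trans_eq ?_
  have := Real.mul_self_sqrt hM.le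
  rw [← mul_assoc, ← mul_div_assoc, this]

/-- The antiderivative as a bounded operator on `L²`. -/
def antiderL (hM : 0 < M) : L2 M →L[ℝ] L2 M :=
  LinearMap.mkContinuous
    { toFun := fun w => toL2 M (antider M w)
      map_add' := fun v w => by
        have hv := Lp.memLp v
        have hw := Lp.memLp w
        rw [← toL2_add (memLp_antider hM hv) (memLp_antider hM hw),
          antider_congr hM (Lp.coeFn_add v w)]
        congr 1
        funext x
        exact antider_add (intervalIntegrable_of_memLp hM hv) (intervalIntegrable_of_memLp hM hw) x
      map_smul' := fun c w => by
        have hw := Lp.memLp w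
        rw [RingHom.id_apply, ← toL2_const_mul (memLp_antider hM hw),
          antider_congr hM (Lp.coeFn_smul c w)]
        congr 1
        funext x
        exact antider_const_mul c w x } (M / 2)
    (fun w => by
      have := norm_antider_le hM (Lp.memLp w)
      rwa [toL2_coe] at this)

theorem antiderL_toL2 (hM : 0 < M) {g : ℝ → ℝ} (hg : MemLp g 2 (volume.restrict (Ioc 0 M))) :
    antiderL hM (toL2 M g) = toL2 M (antider M g) := by
  change toL2 M (antider M (toL2 M g)) = _
  rw [antider_congr hM (coeFn_toL2 hg)]

end DispersivePDE

/-! ### Iterated antiderivatives, `integ`, and its dual `sharp`. -/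

namespace DispersivePDE

variable {M : ℝ}

theorem integral_kernel (hM : 0 < M) (y : ℝ) :
    ∫ x in (0 : ℝ)..M, (1 / 2 - Int.fract ((x - y) / M)) = 0 := by
  have hper : Function.Periodic (fun x => 1 / 2 - Int.fract ((x - y) / M)) M := by
    intro x
    have : (x + M - y) / M = (x - y) / M + 1 := by field_simp; ring
    simp only [this, Int.fract_add_one]
  have h1 := hper.intervalIntegral_add_eq 0 y
  rw [zero_add] at h1
  rw [h1]
  have h2 : ∫ x in y..(y + M), (1 / 2 - Int.fract ((x - y) / M)) =
      ∫ x in y..(y + M), (1 / 2 - (x - y) / M) := by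
    apply intervalIntegral.integral_congr_Ioo_of_le (by linarith)
    intro x hx
    have : Int.fract ((x - y) / M) = (x - y) / M := by
      rw [Int.fract_eq_self]
      exact ⟨div_nonneg (by linarith [hx.1]) hM.le, by rw [div_lt_one hM]; linarith [hx.2]⟩
    simp only [this]
  rw [h2, intervalIntegral.integral_comp_sub_right (fun x => 1 / 2 - x / M) y]
  simp only [sub_self, add_sub_cancel_left]
  rw [intervalIntegral.integral_sub (by simp) ((by fun_prop : Continuous fun x : ℝ => x / M).intervalIntegrable _ _),
    intervalIntegral.integral_div M (fun x => x), integral_id, intervalIntegral.integral_const]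
  simp only [smul_eq_mul]
  field_simp; ring

/-- Fubini reduces this to the kernel having mean zero. Because of this normalization,
differentiating an iterated antiderivative undoes one step exactly; only the mean of the original
function is lost, and `integ` restores it. -/
theorem mean_antider (hM : 0 < M) {g : ℝ → ℝ} (hg : MemLp g 2 (volume.restrict (Ioc 0 M))) :
    mean M (antider M g) = 0 := by
  rw [mean]
  have hi : Integrable g (volume.restrict (Ioc 0 M)) := hg.integrable (by simp)
  have h1 : ∫ x in (0 : ℝ)..M, antider M g x = 0 := by
    simp only [antider, intervalIntegral.integral_of_le hM.le]
    rw [integral_integral_swap]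
    · have h2 : ∀ y, ∫ x in Ioc 0 M, (1 / 2 - Int.fract ((x - y) / M)) * g y = 0 := fun y => by
        rw [integral_mul_const, ← intervalIntegral.integral_of_le hM.le, integral_kernel hM, zero_mul]
      simp only [h2, integral_zero]
    · apply Integrable.bdd_mul (c := 1 / 2) (hi.comp_snd _)
      · exact measurable_kernel.aestronglyMeasurable
      · exact ae_of_all _ fun p => abs_half_sub_fract_le _
  rw [h1, mul_zero]

theorem mean_add {f g : ℝ → ℝ} (hf : IntervalIntegrable f volume 0 M)
    (hg : IntervalIntegrable g volume 0 M) :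
    mean M (fun x => f x + g x) = mean M f + mean M g := by
  rw [mean, intervalIntegral.integral_add hf hg, mul_add]; rfl

theorem mean_const_mul (c : ℝ) (f : ℝ → ℝ) : mean M (fun x => c * f x) = c * mean M f := by
  rw [mean, intervalIntegral.integral_const_mul, mean]; ring

theorem mean_const (hM : 0 < M) (c : ℝ) : mean M (fun _ => c) = c := by
  rw [mean]; simp; field_simp

theorem integral_eq_mean (hM : 0 < M) (f : ℝ → ℝ) : ∫ x in (0 : ℝ)..M, f x = M * mean M f := by
  rw [mean]; field_simp

theorem mean_congr (hM : 0 < M) {f g : ℝ → ℝ} (h : f =ᵐ[volume.restrict (Ioc 0 M)] g) :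
    mean M f = mean M g := by
  rw [mean, mean, intervalIntegral.integral_of_le hM.le, intervalIntegral.integral_of_le hM.le]
  congr 1
  exact integral_congr_ae h

/-! ### Iterated antiderivatives -/

theorem memLp_iterate_antider (hM : 0 < M) {g : ℝ → ℝ}
    (hg : MemLp g 2 (volume.restrict (Ioc 0 M))) (n : ℕ) :
    MemLp ((antider M)^[n] g) 2 (volume.restrict (Ioc 0 M)) := by
  induction n with
  | zero => exact hg
  | succ n ih => rw [Function.iterate_succ_apply']; exact memLp_antider hM ih

theorem antiderL_pow_toL2 (hM : 0 < M) {g : ℝ → ℝ}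
    (hg : MemLp g 2 (volume.restrict (Ioc 0 M))) (n : ℕ) :
    (antiderL hM ^ n) (toL2 M g) = toL2 M ((antider M)^[n] g) := by
  induction n with
  | zero => rfl
  | succ n ih =>
    rw [pow_succ', Function.iterate_succ_apply', mul_apply_eq_comp, ih,
      antiderL_toL2 hM (memLp_iterate_antider hM hg n)]

theorem iterate_antider_periodic (hM : 0 < M) (g : ℝ → ℝ) (n : ℕ) :
    Function.Periodic ((antider M)^[n + 1] g) M := by
  rw [Function.iterate_succ_apply']; exact antider_periodic hM _

theorem mean_iterate_antider (hM : 0 < M) {g : ℝ → ℝ}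
    (hg : MemLp g 2 (volume.restrict (Ioc 0 M))) (n : ℕ) :
    mean M ((antider M)^[n + 1] g) = 0 := by
  rw [Function.iterate_succ_apply']; exact mean_antider hM (memLp_iterate_antider hM hg n)

theorem contDiff_iterate_antider (hM : 0 < M) {g : ℝ → ℝ}
    (hg : MemLp g 2 (volume.restrict (Ioc 0 M))) (n : ℕ) :
    ContDiff ℝ n ((antider M)^[n + 1] g) := by
  induction n with
  | zero => exact contDiff_zero.2 (continuous_antider hM hg)
  | succ n ih =>
    rw [Function.iterate_succ_apply']
    exact contDiff_antider hM ih (iterate_antider_periodic hM g n)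

theorem contDiff_iterate_antider_of_contDiff (hM : 0 < M) {g : ℝ → ℝ} {k : ℕ}
    (hg : ContDiff ℝ k g) (hgp : Function.Periodic g M) (n : ℕ) :
    ContDiff ℝ (k + n : ℕ) ((antider M)^[n] g) ∧ Function.Periodic ((antider M)^[n] g) M := by
  induction n with
  | zero => exact ⟨hg, hgp⟩
  | succ n ih =>
    rw [Function.iterate_succ_apply']
    exact ⟨contDiff_antider hM ih.1 ih.2, antider_periodic hM _⟩

theorem iteratedDeriv_iterate_antider (hM : 0 < M) {g : ℝ → ℝ}
    (hg : MemLp g 2 (volume.restrict (Ioc 0 M))) (m j : ℕ) :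
    iteratedDeriv j ((antider M)^[m + 1 + j] g) = (antider M)^[m + 1] g := by
  induction j with
  | zero => simp
  | succ j ih =>
    rw [iteratedDeriv_succ', ← add_assoc, Function.iterate_succ_apply', deriv_antider hM]
    · have : mean M ((antider M)^[m + 1 + j] g) = 0 := by
        rw [show m + 1 + j = m + j + 1 by ring]; exact mean_iterate_antider hM hg _
      simpa only [this, sub_zero] using ih
    · rw [show m + 1 + j = m + j + 1 by ring]
      exact (contDiff_iterate_antider hM hg _).continuous
    · rw [show m + 1 + j = m + j + 1 by ring]
      exact iterate_antider_periodic hM _ _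

theorem iteratedDeriv_iterate_antider_self (hM : 0 < M) {g : ℝ → ℝ} (hg : Continuous g)
    (hgp : Function.Periodic g M) (n : ℕ) :
    iteratedDeriv (n + 1) ((antider M)^[n + 1] g) = fun x => g x - mean M g := by
  rw [iteratedDeriv_succ, add_comm n 1]
  have := iteratedDeriv_iterate_antider hM (memLp_of_continuous hg) 0 n
  rw [zero_add] at this
  rw [this]
  exact deriv_antider hM hg hgp

theorem abs_iterate_antider_le (hM : 0 < M) {g : ℝ → ℝ}
    (hg : MemLp g 2 (volume.restrict (Ioc 0 M))) (m : ℕ) (x : ℝ) :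
    |(antider M)^[m + 1] g x| ≤ Real.sqrt M / 2 * (M / 2) ^ m * ‖toL2 M g‖ := by
  have h : ∀ m, ‖toL2 M ((antider M)^[m] g)‖ ≤ (M / 2) ^ m * ‖toL2 M g‖ := by
    intro m
    induction m with
    | zero => simp
    | succ m ih =>
      rw [Function.iterate_succ_apply', pow_succ']
      refine (norm_antider_le hM (memLp_iterate_antider hM hg m)).trans ?_
      rw [mul_assoc]
      gcongr
  rw [Function.iterate_succ_apply', mul_assoc]
  refine (abs_antider_le hM (memLp_iterate_antider hM hg m) x).trans ?_
  gcongr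
  exact h m

/-! ### Recovering a function from its derivative of order `n` and its mean -/

/-- The periodic function with mean value `mean g` whose `n`-th derivative is `g - mean g`. -/
def integ (M : ℝ) (n : ℕ) (g : ℝ → ℝ) (x : ℝ) : ℝ := (antider M)^[n] g x + mean M g

/-- `integ` as a bounded operator on `L²`. -/
def integL (hM : 0 < M) (n : ℕ) : L2 M →L[ℝ] L2 M :=
  antiderL hM ^ n +
    (innerSL ℝ (toL2 M fun _ => (1 : ℝ))).smulRight ((1 / M) • toL2 M fun _ => (1 : ℝ))

theorem memLp_integ (hM : 0 < M) {g : ℝ → ℝ}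
    (hg : MemLp g 2 (volume.restrict (Ioc 0 M))) (n : ℕ) :
    MemLp (integ M n g) 2 (volume.restrict (Ioc 0 M)) :=
  (memLp_iterate_antider hM hg n).add (memLp_of_continuous continuous_const)

theorem integL_toL2 (hM : 0 < M) {g : ℝ → ℝ}
    (hg : MemLp g 2 (volume.restrict (Ioc 0 M))) (n : ℕ) :
    integL hM n (toL2 M g) = toL2 M (integ M n g) := by
  have h1 : toL2 M (integ M n g) = toL2 M ((antider M)^[n] g) + toL2 M (fun _ => mean M g) :=
    toL2_add (memLp_iterate_antider hM hg n) (memLp_of_continuous continuous_const)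
  have h2 := toL2_const_mul (M := M) (f := fun _ => (1 : ℝ)) (memLp_of_continuous continuous_const)
    (mean M g)
  simp only [mul_one] at h2
  rw [h1, h2, integL, _root_.add_apply, antiderL_pow_toL2 hM hg]
  congr 1
  rw [ContinuousLinearMap.smulRight_apply, innerSL_apply_apply,
    inner_toL2 hM (memLp_of_continuous continuous_const) hg, smul_smul]
  simp only [one_mul]
  congr 1
  rw [mean]; ring

theorem integL_apply (hM : 0 < M) (n : ℕ) (w : L2 M) : integL hM n w = toL2 M (integ M n w) := by
  rw [← integL_toL2 hM (Lp.memLp w), toL2_coe]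

theorem integ_periodic (hM : 0 < M) (g : ℝ → ℝ) {n : ℕ} (hn : n ≠ 0) :
    Function.Periodic (integ M n g) M := by
  obtain ⟨m, rfl⟩ := Nat.exists_eq_succ_of_ne_zero hn
  intro x
  simp only [integ, Nat.succ_eq_add_one, iterate_antider_periodic hM g m x]

theorem contDiff_integ (hM : 0 < M) {g : ℝ → ℝ}
    (hg : MemLp g 2 (volume.restrict (Ioc 0 M))) (n : ℕ) : ContDiff ℝ n (integ M (n + 1) g) :=
  (contDiff_iterate_antider hM hg n).add contDiff_const

theorem contDiff_integ_of_contDiff (hM : 0 < M) {g : ℝ → ℝ} {k : ℕ}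
    (hg : ContDiff ℝ k g) (hgp : Function.Periodic g M) (n : ℕ) :
    ContDiff ℝ (k + n : ℕ) (integ M n g) :=
  (contDiff_iterate_antider_of_contDiff hM hg hgp n).1.add contDiff_const

theorem iteratedDeriv_add_const_fun {f : ℝ → ℝ} {n : ℕ} (hn : n ≠ 0) (c : ℝ) :
    iteratedDeriv n (fun x => f x + c) = iteratedDeriv n f := by
  obtain ⟨m, rfl⟩ := Nat.exists_eq_succ_of_ne_zero hn
  simp only [Nat.succ_eq_add_one, iteratedDeriv_succ', deriv_add_const']

theorem iteratedDeriv_integ (hM : 0 < M) {g : ℝ → ℝ}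
    (hg : MemLp g 2 (volume.restrict (Ioc 0 M))) {n j : ℕ} (hj : j < n) (hj0 : j ≠ 0) :
    iteratedDeriv j (integ M n g) = (antider M)^[n - j] g := by
  obtain ⟨m, rfl⟩ : ∃ m, n = m + 1 + j := ⟨n - j - 1, by omega⟩
  have : integ M (m + 1 + j) g = fun x => (antider M)^[m + 1 + j] g x + mean M g := rfl
  rw [this, iteratedDeriv_add_const_fun hj0, iteratedDeriv_iterate_antider hM hg]
  simp

theorem iteratedDeriv_integ_self (hM : 0 < M) {g : ℝ → ℝ} (hg : Continuous g)
    (hgp : Function.Periodic g M) {n : ℕ} (hn : n ≠ 0) :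
    iteratedDeriv n (integ M n g) = fun x => g x - mean M g := by
  obtain ⟨m, rfl⟩ := Nat.exists_eq_succ_of_ne_zero hn
  have : integ M (m + 1) g = fun x => (antider M)^[m + 1] g x + mean M g := rfl
  rw [Nat.succ_eq_add_one, this, iteratedDeriv_add_const_fun (by simp),
    iteratedDeriv_iterate_antider_self hM hg hgp]

theorem iteratedDeriv_integ_add (hM : 0 < M) {g : ℝ → ℝ} (hg : Continuous g)
    (hgp : Function.Periodic g M) {n : ℕ} (hn : n ≠ 0) {i : ℕ} (hi : i ≠ 0) :
    iteratedDeriv (n + i) (integ M n g) = iteratedDeriv i g := by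
  rw [iteratedDeriv_eq_iterate, add_comm, Function.iterate_add_apply, ← iteratedDeriv_eq_iterate,
    ← iteratedDeriv_eq_iterate, iteratedDeriv_integ_self hM hg hgp hn]
  simp only [sub_eq_add_neg]
  exact iteratedDeriv_add_const_fun hi _

theorem abs_mean_le (hM : 0 < M) {g : ℝ → ℝ} (hg : MemLp g 2 (volume.restrict (Ioc 0 M))) :
    |mean M g| ≤ Real.sqrt M / M * ‖toL2 M g‖ := by
  rw [mean, abs_mul, abs_of_pos (by positivity)]
  have h1 : |∫ x in (0 : ℝ)..M, g x| ≤ Real.sqrt M * ‖toL2 M g‖ :=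
    (intervalIntegral.abs_integral_le_integral_abs hM.le).trans (integral_abs_le hM hg)
  calc 1 / M * |∫ x in (0 : ℝ)..M, g x| ≤ 1 / M * (Real.sqrt M * ‖toL2 M g‖) := by gcongr
    _ = _ := by ring

/-- The test function dual to `integ`. -/
def sharp (M : ℝ) (n : ℕ) : smoothPer M →ₗ[ℝ] smoothPer M where
  toFun ψ := ⟨fun x => (-1) ^ n * iteratedDeriv n (ψ : ℝ → ℝ) x + mean M ψ,
    (contDiff_const.mul (iteratedDeriv_smoothPer ψ n).1).add contDiff_const,
    fun x => by simp only [(iteratedDeriv_smoothPer ψ n).2 x]⟩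
  map_add' f g := by
    apply Subtype.ext; funext x
    have h1 : iteratedDeriv n ((f : ℝ → ℝ) + (g : ℝ → ℝ)) x = iteratedDeriv n f x + iteratedDeriv n g x :=
      iteratedDeriv_add (f.2.1.of_le (by exact_mod_cast le_top)).contDiffAt
        (g.2.1.of_le (by exact_mod_cast le_top)).contDiffAt
    have h2 : mean M ((f : ℝ → ℝ) + (g : ℝ → ℝ)) = mean M f + mean M g :=
      mean_add ((smoothPer_continuous f).intervalIntegrable _ _)
        ((smoothPer_continuous g).intervalIntegrable _ _)
    change (-1) ^ n * iteratedDeriv n ((f : ℝ → ℝ) + (g : ℝ → ℝ)) x + mean M ((f : ℝ → ℝ) + (g : ℝ → ℝ)) =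
      ((-1) ^ n * iteratedDeriv n f x + mean M f) + ((-1) ^ n * iteratedDeriv n g x + mean M g)
    rw [h1, h2]; ring
  map_smul' c f := by
    apply Subtype.ext; funext x
    have h1 : iteratedDeriv n (c • (f : ℝ → ℝ)) x = c * iteratedDeriv n f x :=
      iteratedDeriv_const_smul (f.2.1.of_le (by exact_mod_cast le_top)).contDiffAt c
    have h2 : mean M (c • (f : ℝ → ℝ)) = c * mean M f := mean_const_mul c f
    change (-1) ^ n * iteratedDeriv n (c • (f : ℝ → ℝ)) x + mean M (c • (f : ℝ → ℝ)) =
      c * ((-1) ^ n * iteratedDeriv n f x + mean M f)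
    rw [h1, h2]; ring

theorem sharp_apply (n : ℕ) (ψ : smoothPer M) (x : ℝ) :
    (sharp M n ψ : ℝ → ℝ) x = (-1) ^ n * iteratedDeriv n (ψ : ℝ → ℝ) x + mean M ψ := rfl

theorem integral_mul_sharp {f : ℝ → ℝ} {n : ℕ} (hf : ContDiff ℝ n f) (hfp : Function.Periodic f M)
    (ψ : smoothPer M) :
    ∫ x in (0 : ℝ)..M, f x * (sharp M n ψ : ℝ → ℝ) x =
      (∫ x in (0 : ℝ)..M, iteratedDeriv n f x * (ψ : ℝ → ℝ) x) +
        mean M ψ * ∫ x in (0 : ℝ)..M, f x := by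
  have c1 := (iteratedDeriv_smoothPer ψ n).1.continuous
  have c2 := hf.continuous
  have h1 : ∀ x, f x * (sharp M n ψ : ℝ → ℝ) x =
      (-1) ^ n * (f x * iteratedDeriv n (ψ : ℝ → ℝ) x) + mean M ψ * f x := fun x => by
    rw [sharp_apply]; ring
  simp only [h1]
  rw [intervalIntegral.integral_add
    ((by fun_prop : Continuous fun x => (-1) ^ n * (f x * iteratedDeriv n (ψ : ℝ → ℝ) x)).intervalIntegrable _ _)
    ((by fun_prop : Continuous fun x => mean M ψ * f x).intervalIntegrable _ _),
    intervalIntegral.integral_const_mul, intervalIntegral.integral_const_mul,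
    integral_mul_iteratedDeriv_periodic n hf (ψ.2.1.of_le (by exact_mod_cast le_top)) hfp ψ.2.2,
    ← mul_assoc, ← mul_pow]
  simp

theorem integ_smoothPer (hM : 0 < M) (n : ℕ) (φ : smoothPer M) : integ M n φ ∈ smoothPer M := by
  constructor
  · rw [contDiff_infty]
    intro k
    exact (contDiff_integ_of_contDiff hM (contDiff_infty.1 φ.2.1 k) φ.2.2 n).of_le
      (by exact_mod_cast Nat.le_add_right k n)
  · intro x
    simp only [integ, (contDiff_iterate_antider_of_contDiff hM (contDiff_infty.1 φ.2.1 0) φ.2.2 n).2 x]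

theorem mean_integ (hM : 0 < M) {g : ℝ → ℝ}
    (hg : MemLp g 2 (volume.restrict (Ioc 0 M))) {n : ℕ} (hn : n ≠ 0) :
    mean M (integ M n g) = mean M g := by
  obtain ⟨m, rfl⟩ := Nat.exists_eq_succ_of_ne_zero hn
  have : integ M (m + 1) g = fun x => (antider M)^[m + 1] g x + mean M g := rfl
  rw [Nat.succ_eq_add_one, this, mean_add
    (intervalIntegrable_of_memLp hM (memLp_iterate_antider hM hg _)) (by simp),
    mean_iterate_antider hM hg, mean_const hM, zero_add]

/-- Duality between `integ` and `sharp`. -/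
theorem inner_integL_sharp (hM : 0 < M) {n : ℕ} (hn : n ≠ 0) (w : L2 M) (ψ : smoothPer M) :
    ⟪integL hM n w, smoothToL2 M (sharp M n ψ)⟫ = ⟪w, smoothToL2 M ψ⟫ := by
  -- Both sides are continuous in `w`, so it suffices to take `w` smooth, where the claim is
  -- `n`-fold integration by parts plus bookkeeping of means.
  refine (denseRange_smoothToL2 hM).induction_on (p := fun w =>
    ⟪integL hM n w, smoothToL2 M (sharp M n ψ)⟫ = ⟪w, smoothToL2 M ψ⟫) w ?_ fun φ => ?_
  · exact isClosed_eq (by fun_prop) (by fun_prop)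
  · have hφ := smoothPer_memLp φ
    have hc := smoothPer_continuous φ
    have hcψ := smoothPer_continuous ψ
    rw [smoothToL2_apply, smoothToL2_apply, smoothToL2_apply, integL_toL2 hM hφ,
      inner_toL2 hM (memLp_integ hM hφ n) (smoothPer_memLp _), inner_toL2 hM hφ (smoothPer_memLp _),
      integral_mul_sharp ((integ_smoothPer hM n φ).1.of_le (by exact_mod_cast le_top))
        (integ_smoothPer hM n φ).2, iteratedDeriv_integ_self hM hc φ.2.2 hn,
      integral_eq_mean hM (integ M n φ), mean_integ hM hφ hn]
    simp only [sub_mul]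
    rw [intervalIntegral.integral_sub ((by fun_prop : Continuous fun x => φ.1 x * ψ.1 x).intervalIntegrable _ _)
      ((by fun_prop : Continuous fun x => mean M φ * ψ.1 x).intervalIntegrable _ _),
      intervalIntegral.integral_const_mul, integral_eq_mean hM (ψ : ℝ → ℝ)]
    ring

/-- Every smooth periodic function is of the form `sharp ψ`. -/
theorem sharp_surjective (hM : 0 < M) {n : ℕ} (hn : n ≠ 0) : Function.Surjective (sharp M n) := by
  intro η
  have hη := smoothPer_memLp η
  have hc := smoothPer_continuous η
  set φ : smoothPer M := ⟨integ M n η, integ_smoothPer hM n η⟩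
  -- `sharp` of `(-1)ⁿ φ` has the correct mean-zero part but mean `(-1)ⁿ mean η`; constants are
  -- fixed by `sharp`, so adding one repairs the mean.
  refine ⟨(-1 : ℝ) ^ n • φ + ((1 - (-1) ^ n) * mean M η) • ⟨fun _ => 1, contDiff_const, fun _ => rfl⟩, ?_⟩
  rw [map_add, map_smul, map_smul]
  apply Subtype.ext; funext x
  have h1 : (sharp M n φ : ℝ → ℝ) x = (-1) ^ n * (η.1 x - mean M η) + mean M η := by
    rw [sharp_apply]
    change (-1) ^ n * iteratedDeriv n (integ M n η) x + mean M (integ M n η) = _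
    rw [iteratedDeriv_integ_self hM hc η.2.2 hn, mean_integ hM hη hn]
  have h2 : (sharp M n ⟨fun _ => 1, contDiff_const, fun _ => rfl⟩ : ℝ → ℝ) x = 1 := by
    rw [sharp_apply]
    change (-1) ^ n * iteratedDeriv n (fun _ => (1 : ℝ)) x + mean M (fun _ => 1) = 1
    rw [mean_const hM, iteratedDeriv_const]; simp [hn]
  change (-1) ^ n * (sharp M n φ : ℝ → ℝ) x + ((1 - (-1) ^ n) * mean M η) *
    (sharp M n ⟨fun _ => 1, contDiff_const, fun _ => rfl⟩ : ℝ → ℝ) x = η.1 x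
  rw [h1, h2]
  have : ((-1 : ℝ) ^ n) * (-1) ^ n = 1 := by rw [← mul_pow]; simp
  linear_combination (η.1 x - mean M η) * this

end DispersivePDE

/-! ### Sobolev norms through Fourier coefficients. -/

namespace DispersivePDE

/-- Riesz representation for a functional bounded on the range of an injective map. -/
theorem exists_riesz {H 𝒟 : Type*} [NormedAddCommGroup H] [InnerProductSpace ℝ H] [CompleteSpace H]
    [AddCommGroup 𝒟] [Module ℝ 𝒟] {ι : 𝒟 →ₗ[ℝ] H} (hι : Function.Injective ι) (ℓ : 𝒟 →ₗ[ℝ] ℝ)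
    {B : ℝ} (hB : 0 ≤ B) (hℓ : ∀ v, |ℓ v| ≤ B * ‖ι v‖) :
    ∃ w : H, ‖w‖ ≤ B ∧ ∀ v, ⟪w, ι v⟫ = ℓ v := by
  set e := LinearEquiv.ofInjective ι hι
  have he : ∀ x : LinearMap.range ι, ι (e.symm x) = x := fun x => by
    rw [← LinearEquiv.ofInjective_apply (h := hι), LinearEquiv.apply_symm_apply]
  set f : StrongDual ℝ (LinearMap.range ι) := (ℓ ∘ₗ e.symm.toLinearMap).mkContinuous B fun x => by
    have := hℓ (e.symm x)
    rw [he] at this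
    exact this
  obtain ⟨g, hg, hgn⟩ := exists_extension_norm_eq _ f
  refine ⟨(InnerProductSpace.toDual ℝ H).symm g, ?_, fun v => ?_⟩
  · rw [LinearIsometryEquiv.norm_map, hgn]
    exact LinearMap.mkContinuous_norm_le _ hB _
  · rw [InnerProductSpace.toDual_symm_apply]
    have h1 := hg (e v)
    have h2 : ((e v : LinearMap.range ι) : H) = ι v := rfl
    rw [h2] at h1
    rw [h1]
    change ℓ (e.symm (e v)) = ℓ v
    rw [LinearEquiv.symm_apply_apply]

variable {M : ℝ}

/-! ### Fourier coefficients of derivatives -/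

theorem perCoeff_deriv (hM : 0 < M) {f : ℝ → ℝ} (hf : ContDiff ℝ 1 f)
    (hfp : Function.Periodic f M) (k : ℤ) :
    perCoeff M (deriv f) k = (freq M k * Complex.I) * perCoeff M f k := by
  have hd := hf.continuous_deriv le_rfl
  have h1 : cosCoeff M (deriv f) k = freq M k * sinCoeff M f k := by
    have h := integral_mul_deriv_periodic hf ((cosPer hM k).2.1.of_le (by exact_mod_cast le_top))
      hfp (cosPer hM k).2.2
    have hc : deriv (cosPer hM k : ℝ → ℝ) = fun x => -(freq M k * Real.sin (freq M k * x)) := by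
      funext x
      have : HasDerivAt (fun x => Real.cos (freq M k * x))
        (-Real.sin (freq M k * x) * (freq M k * 1)) x :=
        ((hasDerivAt_id x).const_mul (freq M k)).cos
      refine this.deriv.trans (by ring)
    rw [hc] at h
    have h2 : ∀ x, f x * -(freq M k * Real.sin (freq M k * x)) =
      (-freq M k) * (f x * Real.sin (freq M k * x)) := fun x => by ring
    simp only [h2, intervalIntegral.integral_const_mul] at h
    have h3 : ∫ x in (0 : ℝ)..M, deriv f x * Real.cos (freq M k * x) =
      freq M k * ∫ x in (0 : ℝ)..M, f x * Real.sin (freq M k * x) := by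
      have : ∫ x in (0 : ℝ)..M, deriv f x * Real.cos (freq M k * x) =
        ∫ x in (0 : ℝ)..M, deriv f x * (cosPer hM k : ℝ → ℝ) x := rfl
      linarith
    rw [cosCoeff, h3, sinCoeff]; ring
  have h1' : sinCoeff M (deriv f) k = -(freq M k * cosCoeff M f k) := by
    have h := integral_mul_deriv_periodic hf ((sinPer hM k).2.1.of_le (by exact_mod_cast le_top))
      hfp (sinPer hM k).2.2
    have hc : deriv (sinPer hM k : ℝ → ℝ) = fun x => freq M k * Real.cos (freq M k * x) := by
      funext x
      have : HasDerivAt (fun x => Real.sin (freq M k * x))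
        (Real.cos (freq M k * x) * (freq M k * 1)) x :=
        ((hasDerivAt_id x).const_mul (freq M k)).sin
      refine this.deriv.trans (by ring)
    rw [hc] at h
    have h2 : ∀ x, f x * (freq M k * Real.cos (freq M k * x)) =
      freq M k * (f x * Real.cos (freq M k * x)) := fun x => by ring
    simp only [h2, intervalIntegral.integral_const_mul] at h
    have h3 : ∫ x in (0 : ℝ)..M, deriv f x * Real.sin (freq M k * x) =
      -(freq M k * ∫ x in (0 : ℝ)..M, f x * Real.cos (freq M k * x)) := by
      have : ∫ x in (0 : ℝ)..M, deriv f x * Real.sin (freq M k * x) =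
        ∫ x in (0 : ℝ)..M, deriv f x * (sinPer hM k : ℝ → ℝ) x := rfl
      linarith
    rw [sinCoeff, h3, cosCoeff]; ring
  rw [perCoeff_eq (hd.intervalIntegrable _ _), perCoeff_eq (hf.continuous.intervalIntegrable _ _),
    h1, h1']
  push_cast
  linear_combination ((freq M k : ℂ) * sinCoeff M f k) * Complex.I_sq

theorem perCoeff_iteratedDeriv (hM : 0 < M) {n : ℕ} : ∀ {f : ℝ → ℝ}, ContDiff ℝ n f →
    Function.Periodic f M → ∀ k : ℤ,
    perCoeff M (iteratedDeriv n f) k = (freq M k * Complex.I) ^ n * perCoeff M f k := by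
  induction n with
  | zero => intros; simp
  | succ n ih =>
    intro f hf hfp k
    have h1 : ContDiff ℝ 1 (iteratedDeriv n f) :=
      contDiff_iteratedDeriv (k := 1) (by rw [add_comm]; exact hf)
    rw [iteratedDeriv_succ, perCoeff_deriv hM h1 (periodic_iteratedDeriv hfp n),
      ih (hf.of_le (by exact_mod_cast n.le_succ)) hfp, pow_succ]
    ring

theorem freq_ne_zero (hM : 0 < M) {k : ℤ} (hk : k ≠ 0) : freq M k ≠ 0 := by
  have : (k : ℝ) ≠ 0 := by exact_mod_cast hk
  rw [freq]; positivity

theorem perCoeff_const (hM : 0 < M) (c : ℝ) {k : ℤ} (hk : k ≠ 0) :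
    perCoeff M (fun _ => c) k = 0 := by
  have h := perCoeff_deriv hM (f := fun _ => c) contDiff_const (fun _ => rfl) k
  have h0 : perCoeff M (deriv fun _ => c) k = 0 := by simp [perCoeff]
  rw [h0] at h
  have h1 : ((freq M k : ℂ) * Complex.I) ≠ 0 :=
    mul_ne_zero (by exact_mod_cast freq_ne_zero hM hk) Complex.I_ne_zero
  exact (mul_eq_zero.1 h.symm).resolve_left h1

theorem perCoeff_zero {f : ℝ → ℝ} (hf : IntervalIntegrable f volume 0 M) :
    perCoeff M f 0 = mean M f := by
  rw [perCoeff_eq hf]; simp [cosCoeff, sinCoeff, freq, mean]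

theorem perCoeff_coe (hM : 0 < M) (w : L2 M) (k : ℤ) : perCoeff M w k =
    ((1 / M * ⟪w, smoothToL2 M (cosPer hM k)⟫ : ℝ) : ℂ) -
      ((1 / M * ⟪w, smoothToL2 M (sinPer hM k)⟫ : ℝ) : ℂ) * Complex.I := by
  rw [perCoeff_eq (intervalIntegrable_of_memLp hM (Lp.memLp w)), cosCoeff_coe hM, sinCoeff_coe hM]

theorem continuous_perCoeff (hM : 0 < M) (k : ℤ) : Continuous fun w : L2 M => perCoeff M w k := by
  simp only [perCoeff_coe hM]
  fun_prop

theorem perCoeff_antider (hM : 0 < M) (w : L2 M) {k : ℤ} (hk : k ≠ 0) :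
    perCoeff M w k = (freq M k * Complex.I) * perCoeff M (antider M w) k := by
  have h1 : ∀ w : L2 M, perCoeff M (antider M w) k = perCoeff M (antiderL hM w) k := fun w =>
    perCoeff_congr (coeFn_toL2 (memLp_antider hM (Lp.memLp w))).symm hM k
  rw [h1]
  refine (denseRange_smoothToL2 hM).induction_on (p := fun w : L2 M =>
    perCoeff M w k = (freq M k * Complex.I) * perCoeff M (antiderL hM w) k) w ?_ fun φ => ?_
  · exact isClosed_eq (continuous_perCoeff hM k)
      (continuous_const.mul ((continuous_perCoeff hM k).comp (antiderL hM).continuous))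
  · have hφ := smoothPer_memLp φ
    have hc := smoothPer_continuous φ
    rw [smoothToL2_apply, antiderL_toL2 hM hφ, perCoeff_congr (coeFn_toL2 hφ) hM,
      perCoeff_congr (coeFn_toL2 (memLp_antider hM hφ)) hM,
      ← perCoeff_deriv hM ((antider_smoothPer hM φ).1.of_le (by exact_mod_cast le_top))
        (antider_periodic hM _), deriv_antider hM hc φ.2.2,
      perCoeff_sub (hc.intervalIntegrable _ _) (by simp), perCoeff_const hM _ hk, sub_zero]

theorem perCoeff_iterate_antider (hM : 0 < M) {g : ℝ → ℝ}
    (hg : MemLp g 2 (volume.restrict (Ioc 0 M))) (n : ℕ) {k : ℤ} (hk : k ≠ 0) :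
    perCoeff M g k = (freq M k * Complex.I) ^ n * perCoeff M ((antider M)^[n] g) k := by
  induction n with
  | zero => simp
  | succ n ih =>
    have hm := memLp_iterate_antider hM hg n
    have h2 := perCoeff_antider hM (toL2 M ((antider M)^[n] g)) hk
    rw [antider_congr hM (coeFn_toL2 hm), perCoeff_congr (coeFn_toL2 hm) hM] at h2
    rw [Function.iterate_succ_apply', ih, h2, pow_succ]
    ring

theorem perCoeff_integ (hM : 0 < M) {g : ℝ → ℝ}
    (hg : MemLp g 2 (volume.restrict (Ioc 0 M))) (n : ℕ) {k : ℤ} (hk : k ≠ 0) :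
    perCoeff M g k = (freq M k * Complex.I) ^ n * perCoeff M (integ M n g) k := by
  rw [perCoeff_iterate_antider hM hg n hk]
  congr 1
  have : integ M n g = fun x => (antider M)^[n] g x + mean M g := rfl
  rw [this, perCoeff_add (intervalIntegrable_of_memLp hM (memLp_iterate_antider hM hg n)) (by simp),
    perCoeff_const hM _ hk, add_zero]

/-! ### Sobolev norms -/

theorem sobWeight_pos (s : ℝ) (k : ℤ) : 0 < sobWeight M s k := by
  rw [sobWeight]; positivity

theorem sobWeight_nat (n : ℕ) (k : ℤ) : sobWeight M n k = (1 + freq M k ^ 2) ^ n := by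
  rw [sobWeight, Real.rpow_natCast, freq]

theorem sobWeight_mono {s s' : ℝ} (h : s ≤ s') (k : ℤ) : sobWeight M s k ≤ sobWeight M s' k :=
  Real.rpow_le_rpow_of_exponent_le (by nlinarith [sq_nonneg (2 * Real.pi * k / M)]) h

theorem normH_nonneg (s : ℝ) (f : ℝ → ℝ) : 0 ≤ normH M s f := Real.sqrt_nonneg _

theorem normH_sq (hM : 0 < M) (s : ℝ) (f : ℝ → ℝ) :
    normH M s f ^ 2 = M * ∑' k : ℤ, sobWeight M s k * ‖perCoeff M f k‖ ^ 2 := by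
  rw [normH, Real.sq_sqrt]
  exact mul_nonneg hM.le (tsum_nonneg fun k => mul_nonneg (sobWeight_pos s k).le (sq_nonneg _))

theorem MemH.mono {s s' : ℝ} {f : ℝ → ℝ} (hf : MemH M s' f) (h : s ≤ s') : MemH M s f :=
  ⟨hf.1, hf.2, hf.3.of_nonneg_of_le (fun k => mul_nonneg (sobWeight_pos s k).le (sq_nonneg _))
    fun k => mul_le_mul_of_nonneg_right (sobWeight_mono h k) (sq_nonneg _)⟩

theorem normH_mono (hM : 0 < M) {s s' : ℝ} {f : ℝ → ℝ} (hf : MemH M s' f) (h : s ≤ s') :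
    normH M s f ≤ normH M s' f := by
  apply Real.sqrt_le_sqrt
  apply mul_le_mul_of_nonneg_left _ hM.le
  exact (hf.mono h).3.tsum_le_tsum
    (fun k => mul_le_mul_of_nonneg_right (sobWeight_mono h k) (sq_nonneg _)) hf.3

/-- The amplification of Fourier weights by `integ`. -/
theorem sobWeight_mul_perCoeff_integ_le (hM : 0 < M) {R : ℝ} (hR : M ≤ R) {g : ℝ → ℝ}
    (hg : MemLp g 2 (volume.restrict (Ioc 0 M))) {n : ℕ} (hn : n ≠ 0) (k : ℤ) :
    sobWeight M n k * ‖perCoeff M (integ M n g) k‖ ^ 2 ≤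
      (1 + R ^ 2) ^ n * ‖perCoeff M g k‖ ^ 2 := by
  rw [sobWeight_nat]
  by_cases hk : k = 0
  · subst hk
    rw [perCoeff_zero (intervalIntegrable_of_memLp hM (memLp_integ hM hg n)), mean_integ hM hg hn,
      ← perCoeff_zero (intervalIntegrable_of_memLp hM hg)]
    apply mul_le_mul_of_nonneg_right _ (sq_nonneg _)
    apply pow_le_pow_left₀ (by positivity)
    simp [freq, sq_nonneg]
  · rw [perCoeff_integ hM hg n hk, norm_mul, norm_pow, norm_mul, Complex.norm_I, mul_one,
      Complex.norm_real, Real.norm_eq_abs, mul_pow, ← pow_mul, mul_comm n 2, pow_mul, sq_abs,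
      ← mul_assoc, ← mul_pow]
    apply mul_le_mul_of_nonneg_right _ (sq_nonneg _)
    apply pow_le_pow_left₀ (by positivity)
    have h1 : 1 ≤ |(k : ℝ)| := by exact_mod_cast Int.one_le_abs hk
    -- A nonzero frequency is at least `2π / M`. Hence `1 ≤ R² ξ²` and `1 + ξ² ≤ (1 + R²) ξ²`, a
    -- constant that needs no lower bound on `M`.
    have h2 : 1 ≤ R * |freq M k| := by
      rw [freq, abs_div, abs_mul, abs_of_pos hM, abs_of_pos (by positivity : 0 < 2 * Real.pi),
        ← mul_div_assoc, le_div_iff₀ hM]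
      have hp := Real.pi_gt_three
      nlinarith [mul_nonneg hM.le (by linarith : 0 ≤ |(k : ℝ)| - 1),
        mul_nonneg (hM.le.trans hR) (by positivity : 0 ≤ |(k : ℝ)|),
        mul_nonneg (mul_nonneg (hM.le.trans hR) (by positivity : 0 ≤ |(k : ℝ)|)) (by linarith : 0 ≤ Real.pi - 3)]
    have h3 : 1 ≤ (R * |freq M k|) ^ 2 := one_le_pow₀ h2
    rw [mul_pow, sq_abs] at h3
    nlinarith

theorem memH_integ (hM : 0 < M) {g : ℝ → ℝ}
    (hg : MemLp g 2 (volume.restrict (Ioc 0 M))) {n : ℕ} (hn : n ≠ 0) :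
    MemH M n (integ M n g) :=
  ⟨integ_periodic hM g hn, memLp_integ hM hg n,
    ((hasSum_perCoeff_sq hM hg).summable.mul_left _).of_nonneg_of_le
      (fun k => mul_nonneg (sobWeight_pos _ k).le (sq_nonneg _))
      (sobWeight_mul_perCoeff_integ_le hM le_rfl hg hn)⟩

theorem normH_integ_sq_le (hM : 0 < M) {R : ℝ} (hR : M ≤ R) {g : ℝ → ℝ}
    (hg : MemLp g 2 (volume.restrict (Ioc 0 M))) {n : ℕ} (hn : n ≠ 0) :
    normH M n (integ M n g) ^ 2 ≤ (1 + R ^ 2) ^ n * ‖toL2 M g‖ ^ 2 := by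
  have h := hasSum_perCoeff_sq hM hg
  rw [normH_sq hM, norm_toL2_sq hM hg]
  have h1 := (memH_integ hM hg hn).3.tsum_le_tsum
    (sobWeight_mul_perCoeff_integ_le hM hR hg hn) (h.summable.mul_left _)
  rw [tsum_mul_left, h.tsum_eq] at h1
  calc _ ≤ M * ((1 + R ^ 2) ^ n * (1 / M * ∫ x in (0 : ℝ)..M, g x ^ 2)) := by gcongr
    _ = _ := by field_simp

theorem sobWeight_succ (n : ℕ) (k : ℤ) :
    sobWeight M ((n : ℝ) + 1) k = (1 + freq M k ^ 2) * sobWeight M n k := by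
  rw [show (n : ℝ) + 1 = ((n + 1 : ℕ) : ℝ) by push_cast; ring, sobWeight_nat, sobWeight_nat, pow_succ]
  ring

/-! ### The bilinear form of Parseval's identity -/

/-- Polarization of `hasSum_perCoeff_sq`. -/
theorem hasSum_inner_perCoeff (hM : 0 < M) {f g : ℝ → ℝ}
    (hf : MemLp f 2 (volume.restrict (Ioc 0 M))) (hg : MemLp g 2 (volume.restrict (Ioc 0 M))) :
    HasSum (fun k : ℤ => ⟪perCoeff M f k, perCoeff M g k⟫) ((1 / M) * ∫ x in (0 : ℝ)..M, f x * g x) := by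
  have i1 := intervalIntegrable_of_memLp hM hf
  have i2 := intervalIntegrable_of_memLp hM hg
  have h1 := hasSum_perCoeff_sq hM (f := fun x => f x + g x) (hf.add hg)
  have h2 := hasSum_perCoeff_sq hM (f := fun x => f x - g x) (hf.sub hg)
  have h3 := (h1.sub h2).mul_left (1 / 4)
  have s1 : IntervalIntegrable (fun x => (f x + g x) ^ 2) volume 0 M := by
    rw [intervalIntegrable_iff_integrableOn_Ioc_of_le hM.le]; exact (hf.add hg).integrable_sq
  have s2 : IntervalIntegrable (fun x => (f x - g x) ^ 2) volume 0 M := by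
    rw [intervalIntegrable_iff_integrableOn_Ioc_of_le hM.le]; exact (hf.sub hg).integrable_sq
  convert! h3 using 1
  · funext k
    rw [perCoeff_add i1 i2, perCoeff_sub i1 i2, norm_add_sq_real, norm_sub_sq_real]
    ring
  · rw [← mul_sub, ← intervalIntegral.integral_sub s1 s2]
    have : ∀ x, (f x + g x) ^ 2 - (f x - g x) ^ 2 = 4 * (f x * g x) := fun x => by ring
    simp only [this, intervalIntegral.integral_const_mul]
    ring

/-- At nonzero frequencies `sharp` is a multiplier of modulus `|ξ|ⁿ`, and `ξ² ≤ 1 + ξ²`. At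
frequency zero the derivative contributes nothing, since `n ≠ 0`, and the mean term gives the
multiplier `1`. -/
theorem norm_perCoeff_sharp_sq_le (hM : 0 < M) (n : ℕ) (hn : n ≠ 0) (ψ : smoothPer M) (k : ℤ) :
    ‖perCoeff M (sharp M n ψ) k‖ ^ 2 ≤ sobWeight M n k * ‖perCoeff M ψ k‖ ^ 2 := by
  have hcd : ContDiff ℝ n (ψ : ℝ → ℝ) := ψ.2.1.of_le (by exact_mod_cast le_top)
  have hc := (iteratedDeriv_smoothPer ψ n).1.continuous
  have h0 : perCoeff M (sharp M n ψ) k = (-1 : ℝ) ^ n *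
      ((freq M k * Complex.I) ^ n * perCoeff M ψ k) + perCoeff M (fun _ => mean M ψ) k := by
    have : (sharp M n ψ : ℝ → ℝ) = fun x => (-1) ^ n * iteratedDeriv n (ψ : ℝ → ℝ) x + mean M ψ := rfl
    rw [this, perCoeff_add ((by fun_prop : Continuous fun x => (-1) ^ n * iteratedDeriv n (ψ : ℝ → ℝ) x).intervalIntegrable _ _)
      intervalIntegrable_const,
      perCoeff_const_mul, perCoeff_iteratedDeriv hM hcd ψ.2.2]
    push_cast; ring
  rw [sobWeight_nat]
  by_cases hk : k = 0
  · subst hk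
    have h1 : (freq M 0 : ℂ) = 0 := by simp [freq]
    rw [h0, h1, perCoeff_zero (f := fun _ => mean M ψ) intervalIntegrable_const, mean_const hM,
      perCoeff_zero ((smoothPer_continuous ψ).intervalIntegrable _ _)]
    simp [hn, freq]
  · rw [h0, perCoeff_const hM _ hk, add_zero, norm_mul, norm_mul, norm_pow, norm_pow, norm_mul,
      Complex.norm_I, mul_one, Complex.norm_real, Complex.norm_real, norm_neg, norm_one, one_pow,
      one_mul, Real.norm_eq_abs, mul_pow, ← pow_mul, mul_comm n 2, pow_mul, sq_abs]
    apply mul_le_mul_of_nonneg_right _ (sq_nonneg _)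
    apply pow_le_pow_left₀ (by positivity)
    linarith

/-- Cauchy–Schwarz on the Fourier side, with the whole weight placed on `f`. It makes data and
source in `H^n` bounded functionals on the `L²` formulation, with constant one. -/
theorem abs_integral_mul_sharp_le (hM : 0 < M) {n : ℕ} (hn : n ≠ 0) {f : ℝ → ℝ} (hf : MemH M n f)
    (ψ : smoothPer M) :
    |∫ x in (0 : ℝ)..M, f x * (sharp M n ψ : ℝ → ℝ) x| ≤ normH M n f * ‖smoothToL2 M ψ‖ := by
  have hψ := smoothPer_memLp ψ
  have hP := hasSum_perCoeff_sq hM hψ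
  have h1 := hasSum_inner_perCoeff hM hf.2 (smoothPer_memLp (sharp M n ψ))
  set p : ℤ → ℝ := fun k => Real.sqrt (sobWeight M n k) * ‖perCoeff M f k‖
  set q : ℤ → ℝ := fun k => ‖perCoeff M ψ k‖
  have hp2 : ∀ k, p k ^ (2 : ℝ) = sobWeight M n k * ‖perCoeff M f k‖ ^ 2 := fun k => by
    rw [Real.rpow_two, mul_pow, Real.sq_sqrt (sobWeight_pos _ k).le]
  have hq2 : ∀ k, q k ^ (2 : ℝ) = ‖perCoeff M ψ k‖ ^ 2 := fun k => Real.rpow_two _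
  obtain ⟨hs, hCS⟩ := Real.summable_and_inner_le_Lp_mul_Lq_tsum_of_nonneg
    Real.HolderConjugate.two_two (f := p) (g := q) (fun k => by positivity) (fun k => by positivity)
    (by simp only [hp2]; exact hf.3) (by simp only [hq2]; exact hP.summable)
  simp only [hp2, hq2, hP.tsum_eq, ← Real.sqrt_eq_rpow] at hCS
  have h2 : ∀ k, |⟪perCoeff M f k, perCoeff M (sharp M n ψ) k⟫| ≤ p k * q k := fun k => by
    refine (abs_real_inner_le_norm _ _).trans ?_
    have h3 := Real.le_sqrt_of_sq_le (norm_perCoeff_sharp_sq_le hM n hn ψ k)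
    rw [Real.sqrt_mul (sobWeight_pos _ k).le, Real.sqrt_sq (norm_nonneg _)] at h3
    calc _ ≤ ‖perCoeff M f k‖ * (Real.sqrt (sobWeight M n k) * ‖perCoeff M ψ k‖) := by gcongr
      _ = _ := by simp only [p, q]; ring
  have h3 : |(1 / M) * ∫ x in (0 : ℝ)..M, f x * (sharp M n ψ : ℝ → ℝ) x| ≤ ∑' k, p k * q k := by
    rw [← h1.tsum_eq, ← Real.norm_eq_abs]
    exact (norm_tsum_le_tsum_norm (hs.of_nonneg_of_le (fun _ => norm_nonneg _) h2)).trans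
      ((hs.of_nonneg_of_le (fun _ => norm_nonneg _) h2).tsum_le_tsum h2 hs)
  rw [abs_mul, abs_of_pos (by positivity : 0 < 1 / M)] at h3
  have h4 : ‖smoothToL2 M ψ‖ = Real.sqrt (∫ x in (0 : ℝ)..M, (ψ : ℝ → ℝ) x ^ 2) := by
    rw [smoothToL2_apply, ← norm_toL2_sq hM hψ, Real.sqrt_sq (norm_nonneg _)]
  have h5 := h3.trans hCS
  rw [h4, normH, Real.sqrt_mul hM.le]
  rw [Real.sqrt_mul (by positivity), Real.sqrt_div zero_le_one, Real.sqrt_one] at h5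
  have h6 : M = Real.sqrt M * Real.sqrt M := (Real.mul_self_sqrt hM.le).symm
  have h7 : 0 < Real.sqrt M := Real.sqrt_pos.2 hM
  calc _ = M * (1 / M * |∫ x in (0 : ℝ)..M, f x * (sharp M n ψ : ℝ → ℝ) x|) := by field_simp
    _ ≤ _ := mul_le_mul_of_nonneg_left h5 hM.le
    _ = (Real.sqrt M * Real.sqrt M) * (Real.sqrt (∑' k, sobWeight M n k * ‖perCoeff M f k‖ ^ 2) *
        (1 / Real.sqrt M * Real.sqrt (∫ x in (0 : ℝ)..M, (ψ : ℝ → ℝ) x ^ 2))) := by rw [← h6]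
    _ = _ := by field_simp

/-- A function in `H^n` is recovered by `integ` from a square integrable function. -/
theorem MemH.exists_integ (hM : 0 < M) {n : ℕ} (hn : n ≠ 0) {f : ℝ → ℝ} (hf : MemH M n f)
    (hc : Continuous f) : ∃ w : L2 M, ‖w‖ ≤ normH M n f ∧ f = integ M n w := by
  have hi : ∀ ψ : smoothPer M, IntervalIntegrable (fun x => f x * (sharp M n ψ : ℝ → ℝ) x) volume 0 M :=
    fun ψ => (hc.mul (smoothPer_continuous _)).intervalIntegrable _ _
  -- `w` represents pairing of `f` with `sharp ψ`. By the duality `inner_integL_sharp`, `f` and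
  -- `integ M n w` agree against the range of `sharp`, which is all smooth periodic functions.
  obtain ⟨w, hw, h⟩ := exists_riesz (smoothToL2_injective hM)
    { toFun := fun ψ : smoothPer M => ∫ x in (0 : ℝ)..M, f x * (sharp M n ψ : ℝ → ℝ) x
      map_add' := fun φ ψ => by
        rw [← intervalIntegral.integral_add (hi φ) (hi ψ), map_add]
        congr 1; funext x
        change f x * ((sharp M n φ : ℝ → ℝ) x + (sharp M n ψ : ℝ → ℝ) x) = _
        ring
      map_smul' := fun c ψ => by
        rw [RingHom.id_apply, smul_eq_mul, ← intervalIntegral.integral_const_mul, map_smul]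
        congr 1; funext x
        change f x * (c * (sharp M n ψ : ℝ → ℝ) x) = _
        ring } (normH_nonneg n f) (abs_integral_mul_sharp_le hM hn hf)
  refine ⟨w, hw, ?_⟩
  have hwm := Lp.memLp w
  obtain ⟨m, rfl⟩ := Nat.exists_eq_succ_of_ne_zero hn
  apply eq_of_ae_eq_of_periodic hM hc (contDiff_integ hM hwm m).continuous hf.1
    (integ_periodic hM _ hn)
  have h1 : toL2 M f = integL hM (m + 1) w := by
    refine (denseRange_smoothToL2 hM).eq_of_inner_left ℝ fun η => ?_
    obtain ⟨ψ, rfl⟩ := sharp_surjective hM hn η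
    rw [inner_integL_sharp hM hn, h, smoothToL2_apply, inner_toL2 hM hf.2 (smoothPer_memLp _)]
    rfl
  rw [integL_apply] at h1
  exact (coeFn_toL2 hf.2).symm.trans (h1 ▸ coeFn_toL2 (memLp_integ hM hwm _))

end DispersivePDE

/-! ### The coefficients and the construction of the weight. -/

namespace DispersivePDE

/-! ### Integrals depending on a parameter -/

theorem continuous_section {τ T : ℝ} {g : ℝ → ℝ → ℝ}
    (hg : ContinuousOn (Function.uncurry g) (Icc τ T ×ˢ univ)) {t : ℝ} (ht : t ∈ Icc τ T) :
    Continuous (g t) :=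
  continuousOn_univ.1 (hg.comp (by fun_prop : Continuous fun x => (t, x)).continuousOn
    fun x _ => ⟨ht, mem_univ _⟩)

theorem continuousOn_primitive_param {τ T : ℝ} (hτ : τ ≤ T) {g : ℝ → ℝ → ℝ}
    (hg : ContinuousOn (Function.uncurry g) (Icc τ T ×ˢ univ)) :
    ContinuousOn (Function.uncurry fun t x => ∫ y in (0 : ℝ)..x, g t y) (Icc τ T ×ˢ univ) := by
  have h1 : Continuous (Function.uncurry fun (t : Icc τ T) x => g t x) :=
    continuousOn_univ.1 (hg.comp (f := fun p : Icc τ T × ℝ => ((p.1 : ℝ), p.2))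
      (by fun_prop : Continuous fun p : Icc τ T × ℝ => ((p.1 : ℝ), p.2)).continuousOn
      fun p _ => ⟨p.1.2, mem_univ _⟩)
  have h2 : Continuous fun p : ℝ × ℝ => ∫ y in (0 : ℝ)..p.2, g (projIcc τ T hτ p.1) y := by
    have h3 : Continuous (Function.uncurry fun (p : ℝ × ℝ) y => g (projIcc τ T hτ p.1) y) :=
      h1.comp (by fun_prop : Continuous fun q : (ℝ × ℝ) × ℝ => (projIcc τ T hτ q.1.1, q.2))
    exact intervalIntegral.continuous_parametric_intervalIntegral_of_continuous h3 continuous_snd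
  refine h2.continuousOn.congr fun p hp => ?_
  simp only [Function.uncurry, projIcc_of_mem hτ hp.1]

theorem hasDerivAt_integral_param {τ T : ℝ} {g g' : ℝ → ℝ → ℝ}
    (hg : ContinuousOn (Function.uncurry g) (Icc τ T ×ˢ univ))
    (hg' : ContinuousOn (Function.uncurry g') (Icc τ T ×ˢ univ))
    (hd : ∀ t ∈ Ioo τ T, ∀ y, HasDerivAt (fun s => g s y) (g' t y) t) (α β : ℝ) {t : ℝ}
    (ht : t ∈ Ioo τ T) :
    HasDerivAt (fun s => ∫ y in α..β, g s y) (∫ y in α..β, g' t y) t := by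
  obtain ⟨C, hC⟩ := (isCompact_Icc.prod isCompact_uIcc).exists_bound_of_continuousOn
    (hg'.mono (prod_mono_right (subset_univ (uIcc α β))))
  have hmem : ∀ s ∈ Ioo τ T, s ∈ Icc τ T := fun s hs => Ioo_subset_Icc_self hs
  refine (intervalIntegral.hasDerivAt_integral_of_dominated_loc_of_deriv_le (bound := fun _ => C)
    (isOpen_Ioo.mem_nhds ht) ?_ ?_ ?_ ?_ ?_ ?_).2
  · filter_upwards [isOpen_Ioo.mem_nhds ht] with s hs
    exact (continuous_section hg (hmem s hs)).aestronglyMeasurable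
  · exact (continuous_section hg (hmem t ht)).intervalIntegrable _ _
  · exact (continuous_section hg' (hmem t ht)).aestronglyMeasurable
  · exact ae_of_all _ fun y hy s hs => hC (s, y) ⟨hmem s hs, uIoc_subset_uIcc hy⟩
  · simp
  · exact ae_of_all _ fun y _ s hs => hd s hs y

/-! ### The coefficients of the equation -/

/-- The assumptions on the coefficients on a time interval `[τ, T]`; `a'` and `b'` are the time
derivatives of `a` and `b`. -/
structure Coeffs (M τ T : ℝ) (n : ℕ) (R δ : ℝ) (a a' b b' c d : ℝ → ℝ → ℝ) : Prop where
  M_pos : 0 < M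
  M_le : M ≤ R
  lt : τ < T
  len_le : T - τ ≤ R
  one_le : 1 ≤ R
  delta_pos : 0 < δ
  a_per : ∀ t ∈ Icc τ T, Function.Periodic (a t) M
  b_per : ∀ t ∈ Icc τ T, Function.Periodic (b t) M
  c_per : ∀ t ∈ Icc τ T, Function.Periodic (c t) M
  d_per : ∀ t ∈ Icc τ T, Function.Periodic (d t) M
  a'_per : ∀ t ∈ Icc τ T, Function.Periodic (a' t) M
  b'_per : ∀ t ∈ Icc τ T, Function.Periodic (b' t) M
  a_smooth : ∀ t ∈ Icc τ T, ContDiff ℝ (n + 3 : ℕ) (a t)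
  b_smooth : ∀ t ∈ Icc τ T, ContDiff ℝ (n + 2 : ℕ) (b t)
  c_smooth : ∀ t ∈ Icc τ T, ContDiff ℝ n (c t)
  d_smooth : ∀ t ∈ Icc τ T, ContDiff ℝ n (d t)
  a_cont : ∀ j ≤ n + 3, ContinuousOn (Function.uncurry fun t => iteratedDeriv j (a t))
    (Icc τ T ×ˢ univ)
  b_cont : ∀ j ≤ n + 2, ContinuousOn (Function.uncurry fun t => iteratedDeriv j (b t))
    (Icc τ T ×ˢ univ)
  c_cont : ∀ j ≤ n, ContinuousOn (Function.uncurry fun t => iteratedDeriv j (c t))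
    (Icc τ T ×ˢ univ)
  d_cont : ∀ j ≤ n, ContinuousOn (Function.uncurry fun t => iteratedDeriv j (d t))
    (Icc τ T ×ˢ univ)
  a'_cont : ContinuousOn (Function.uncurry a') (Icc τ T ×ˢ univ)
  b'_cont : ContinuousOn (Function.uncurry b') (Icc τ T ×ˢ univ)
  a_deriv : ∀ t ∈ Ioo τ T, ∀ x, HasDerivAt (fun s => a s x) (a' t x) t
  b_deriv : ∀ t ∈ Ioo τ T, ∀ x, HasDerivAt (fun s => b s x) (b' t x) t
  a_le : ∀ t ∈ Icc τ T, ∀ x, ∀ j ≤ n + 3, |iteratedDeriv j (a t) x| ≤ R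
  b_le : ∀ t ∈ Icc τ T, ∀ x, ∀ j ≤ n, |iteratedDeriv j (b t) x| ≤ R
  c_le : ∀ t ∈ Icc τ T, ∀ x, ∀ j ≤ n, |iteratedDeriv j (c t) x| ≤ R
  d_le : ∀ t ∈ Icc τ T, ∀ x, ∀ j ≤ n, |iteratedDeriv j (d t) x| ≤ R
  a'_le : ∀ t ∈ Icc τ T, ∀ x, |a' t x| ≤ R
  b'_le : ∀ t ∈ Icc τ T, ∀ x, |b' t x| ≤ R
  a_inv_le : ∀ t ∈ Icc τ T, ∀ x, |(a t x)⁻¹| ≤ R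
  a_ne : ∀ t ∈ Icc τ T, ∀ x, a t x ≠ 0
  avg_le : ∀ t ∈ Icc τ T, δ ≤ avgDiffusion M a b t

/-- An exponent `r` such that, with the weight `ρ = exp r`, integration by parts turns third order
dispersion and second order diffusion into a definite quadratic form in the first derivative;
`r'` is the time derivative of `r`. -/
structure Weight (M τ T ν δ L : ℝ) (a b r r' : ℝ → ℝ → ℝ) (m : ℝ → ℝ) : Prop where
  per : ∀ t ∈ Icc τ T, Function.Periodic (r t) M
  smooth : ∀ t ∈ Icc τ T, ContDiff ℝ 3 (r t)
  cont : ContinuousOn (Function.uncurry r) (Icc τ T ×ˢ univ)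
  cont' : ContinuousOn (Function.uncurry r') (Icc τ T ×ˢ univ)
  hasDeriv : ∀ t ∈ Ioo τ T, ∀ x, HasDerivAt (fun s => r s x) (r' t x) t
  le : ∀ t ∈ Icc τ T, ∀ x, |r t x| ≤ L
  deriv_le : ∀ t ∈ Icc τ T, ∀ x, |deriv (r t) x| ≤ L
  le' : ∀ t ∈ Icc τ T, ∀ x, |r' t x| ≤ L
  m_le : ∀ t ∈ Icc τ T, |m t| ≤ L
  identity : ∀ t ∈ Icc τ T, ∀ x, 3 / 2 * (deriv (r t) x * a t x + deriv (a t) x) -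
    (ν * deriv (a t) x + b t x) = -(m t * a t x)
  lower : ∀ t ∈ Icc τ T, ∀ x, δ ≤ m t * a t x

namespace Coeffs

variable {M τ T R δ : ℝ} {n : ℕ} {a a' b b' c d : ℝ → ℝ → ℝ}

theorem cont_a (h : Coeffs M τ T n R δ a a' b b' c d) :
    ContinuousOn (Function.uncurry a) (Icc τ T ×ˢ univ) := by
  have := h.a_cont 0 (Nat.zero_le _)
  simpa only [iteratedDeriv_zero] using this

theorem cont_b (h : Coeffs M τ T n R δ a a' b b' c d) :
    ContinuousOn (Function.uncurry b) (Icc τ T ×ˢ univ) := by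
  have := h.b_cont 0 (Nat.zero_le _)
  simpa only [iteratedDeriv_zero] using this

theorem abs_a_le (h : Coeffs M τ T n R δ a a' b b' c d) {t : ℝ} (ht : t ∈ Icc τ T) (x : ℝ) :
    |a t x| ≤ R := by simpa using h.a_le t ht x 0 (Nat.zero_le _)

theorem abs_b_le (h : Coeffs M τ T n R δ a a' b b' c d) {t : ℝ} (ht : t ∈ Icc τ T) (x : ℝ) :
    |b t x| ≤ R := by simpa using h.b_le t ht x 0 (Nat.zero_le _)

theorem inv_le_abs (h : Coeffs M τ T n R δ a a' b b' c d) {t : ℝ} (ht : t ∈ Icc τ T) (x : ℝ) :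
    R⁻¹ ≤ |a t x| := by
  have h1 := h.a_inv_le t ht x
  rw [abs_inv] at h1
  rw [inv_le_comm₀ (by linarith [h.one_le]) (abs_pos.2 (h.a_ne t ht x))]
  exact h1

theorem abs_div_le (h : Coeffs M τ T n R δ a a' b b' c d) {t : ℝ} (ht : t ∈ Icc τ T) (x : ℝ)
    {y C : ℝ} (hy : |y| ≤ C) : |y / a t x| ≤ C * R := by
  rw [div_eq_mul_inv, abs_mul]
  exact mul_le_mul hy (h.a_inv_le t ht x) (abs_nonneg _) ((abs_nonneg _).trans hy)

/-- The mean of `b / a` times `a` is the average diffusion times `|a|`. -/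
theorem mean_mul (h : Coeffs M τ T n R δ a a' b b' c d) {t : ℝ} (ht : t ∈ Icc τ T) (x : ℝ) :
    mean M (fun y => b t y / a t y) * a t x = avgDiffusion M a b t * |a t x| := by
  have hc : Continuous (a t) := (h.a_smooth t ht).continuous
  have hsign : (∀ y, 0 < a t y) ∨ ∀ y, a t y < 0 := by
    by_contra hcon
    push Not at hcon
    obtain ⟨⟨y, hy⟩, z, hz⟩ := hcon
    obtain ⟨w, hw⟩ := mem_range_of_exists_le_of_exists_ge hc ⟨y, hy⟩ ⟨z, hz⟩
    exact h.a_ne t ht w hw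
  rcases hsign with hs | hs
  · simp only [avgDiffusion, mean, abs_of_pos (hs _)]
  · simp only [avgDiffusion, mean, abs_of_neg (hs _), div_neg, intervalIntegral.integral_neg]
    ring

/-- Solving the required identity for the derivative gives `r_x = (2ν/3 - 1) a_x / a + (2/3)(b / a -
m)`. The first term integrates to a multiple of `log |a|`, and the primitive of the second is
periodic exactly for `m = mean (b / a)`. Then `m a` is the average diffusion times `|a|`, at least
`δ / R`. The parameter `ν` is the number of space derivatives taken of the equation, `n` for
existence and `0` for uniqueness. -/
theorem exists_weight (h : Coeffs M τ T n R δ a a' b b' c d) (hn : 1 ≤ n) (ν : ℝ) :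
    ∃ r r' : ℝ → ℝ → ℝ, ∃ m : ℝ → ℝ,
      Weight M τ T ν (δ / R) ((|ν| + 1) * R ^ 2 + 4 * R ^ 5) a b r r' m := by
  have hM := h.M_pos
  have hR := h.one_le
  have hR0 : 0 < R := by linarith
  set g : ℝ → ℝ → ℝ := fun t x => b t x / a t x with hg
  set g' : ℝ → ℝ → ℝ := fun t x => b' t x / a t x - b t x * a' t x / a t x ^ 2 with hg'
  have gc : ContinuousOn (Function.uncurry g) (Icc τ T ×ˢ univ) :=
    h.cont_b.div h.cont_a fun p hp => h.a_ne _ hp.1 _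
  have gc' : ContinuousOn (Function.uncurry g') (Icc τ T ×ˢ univ) :=
    (h.b'_cont.div h.cont_a fun p hp => h.a_ne _ hp.1 _).sub
      ((h.cont_b.mul h.a'_cont).div (h.cont_a.pow 2) fun p hp => pow_ne_zero 2 (h.a_ne _ hp.1 _))
  have gd : ∀ t ∈ Ioo τ T, ∀ y, HasDerivAt (fun s => g s y) (g' t y) t := fun t ht y => by
    have hne := h.a_ne t (Ioo_subset_Icc_self ht) y
    refine ((h.b_deriv t ht y).div (h.a_deriv t ht y) hne).congr_deriv ?_
    simp only [hg']; field_simp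
  have gs : ∀ t ∈ Icc τ T, ContDiff ℝ (n + 2 : ℕ) (g t) := fun t ht =>
    (h.b_smooth t ht).div ((h.a_smooth t ht).of_le (by exact_mod_cast Nat.le_succ _)) (h.a_ne t ht)
  have gp : ∀ t ∈ Icc τ T, Function.Periodic (g t) M := fun t ht x => by
    simp only [hg, h.b_per t ht x, h.a_per t ht x]
  have gle : ∀ t ∈ Icc τ T, ∀ x, |g t x| ≤ R ^ 2 := fun t ht x => by
    rw [sq]; exact h.abs_div_le ht x (h.abs_b_le ht x)
  have gle' : ∀ t ∈ Icc τ T, ∀ x, |g' t x| ≤ R ^ 2 + R ^ 4 := fun t ht x => by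
    have h1 := h.abs_div_le ht x (h.b'_le t ht x)
    have h2 : |b t x * a' t x / a t x ^ 2| ≤ R ^ 4 := by
      have h3 : |b t x * a' t x| ≤ R * R := by
        rw [abs_mul]; exact mul_le_mul (h.abs_b_le ht x) (h.a'_le t ht x) (abs_nonneg _) hR0.le
      have h4 := h.abs_div_le ht x (h.abs_div_le ht x h3)
      rw [div_div, ← sq] at h4
      linarith [show R * R * R * R = R ^ 4 by ring]
    exact (abs_sub _ _).trans (by nlinarith)
  set m : ℝ → ℝ := fun t => mean M (g t) with hm
  set m' : ℝ → ℝ := fun t => mean M (g' t) with hm'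
  have mbound : ∀ (f : ℝ → ℝ) (C : ℝ), (∀ x, |f x| ≤ C) → |mean M f| ≤ C := fun f C hf => by
    rw [mean, abs_mul, abs_of_pos (by positivity)]
    have := intervalIntegral.norm_integral_le_of_norm_le_const (a := 0) (b := M) (f := f) (C := C)
      fun x _ => hf x
    rw [sub_zero, abs_of_pos hM, Real.norm_eq_abs] at this
    calc 1 / M * |∫ x in (0 : ℝ)..M, f x| ≤ 1 / M * (C * M) := by gcongr
      _ = C := by field_simp
  have pbound : ∀ (f : ℝ → ℝ) (C : ℝ), (∀ x, |f x| ≤ C) → ∀ x ∈ Icc 0 M,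
      |∫ y in (0 : ℝ)..x, f y| ≤ C * R := fun f C hf x hx => by
    have := intervalIntegral.norm_integral_le_of_norm_le_const (a := 0) (b := x) (f := f) (C := C)
      fun x _ => hf x
    rw [sub_zero, abs_of_nonneg hx.1, Real.norm_eq_abs] at this
    exact this.trans (mul_le_mul_of_nonneg_left (hx.2.trans h.M_le) ((abs_nonneg _).trans (hf 0)))
  have snd_cont : ContinuousOn (fun p : ℝ × ℝ => p.2) (Icc τ T ×ˢ univ) := continuousOn_snd
  have mc : ∀ {f : ℝ → ℝ → ℝ}, ContinuousOn (Function.uncurry f) (Icc τ T ×ˢ univ) →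
      ContinuousOn (fun p : ℝ × ℝ => mean M (f p.1)) (Icc τ T ×ˢ univ) := fun {f} hf => by
    refine continuousOn_const.mul ((continuousOn_primitive_param h.lt.le hf).comp
      (f := fun p : ℝ × ℝ => (p.1, M)) (by fun_prop) fun p hp => ⟨hp.1, mem_univ _⟩)
  have md : ∀ t ∈ Ioo τ T, HasDerivAt m (m' t) t := fun t ht =>
    (hasDerivAt_integral_param gc gc' gd 0 M ht).const_mul (1 / M)
  set κ : ℝ := 2 * ν / 3 - 1 with hκ
  have hκle : |κ| ≤ |ν| + 1 := by
    rw [hκ]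
    refine (abs_sub _ _).trans ?_
    rw [abs_div, abs_mul]; norm_num
    nlinarith [abs_nonneg ν]
  -- `Real.log` depends only on `|a|`, so both signs of `a` are covered by one formula.
  set r : ℝ → ℝ → ℝ := fun t x => κ * Real.log (a t x) +
    2 / 3 * ((∫ y in (0 : ℝ)..x, g t y) - x * m t) with hr
  set r' : ℝ → ℝ → ℝ := fun t x => κ * (a' t x / a t x) +
    2 / 3 * ((∫ y in (0 : ℝ)..x, g' t y) - x * m' t) with hr'
  have rd : ∀ t ∈ Icc τ T, ∀ x, HasDerivAt (r t) (κ * (deriv (a t) x / a t x) +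
      2 / 3 * (g t x - m t)) x := fun t ht x => by
    have h1 : HasDerivAt (a t) (deriv (a t) x) x :=
      ((h.a_smooth t ht).differentiable (by simp) x).hasDerivAt
    have h2 : HasDerivAt (fun x => ∫ y in (0 : ℝ)..x, g t y) (g t x) x :=
      ((gs t ht).continuous.integral_hasStrictDerivAt 0 x).hasDerivAt
    have h3 : HasDerivAt (fun x => x * m t) (m t) x := by
      simpa using (hasDerivAt_id x).mul_const (m t)
    exact ((h1.log (h.a_ne t ht x)).const_mul κ).add ((h2.sub h3).const_mul _)
  have rper : ∀ t ∈ Icc τ T, Function.Periodic (r t) M := fun t ht x => by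
    have h1 := (gp t ht).intervalIntegral_add_eq 0 x
    rw [zero_add] at h1
    have hgi : ∀ α β, IntervalIntegrable (g t) volume α β := fun α β =>
      (gs t ht).continuous.intervalIntegrable _ _
    have h2 := intervalIntegral.integral_add_adjacent_intervals (hgi 0 x) (hgi x (x + M))
    have h3 := integral_eq_mean hM (g t)
    simp only [hr, h.a_per t ht x, ← h2, ← h1, h3, hm]
    ring
  have rcont : ContinuousOn (Function.uncurry r) (Icc τ T ×ˢ univ) :=
    (continuousOn_const.mul (h.cont_a.log fun p hp => h.a_ne _ hp.1 _)).add
      (continuousOn_const.mul ((continuousOn_primitive_param h.lt.le gc).sub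
        (snd_cont.mul (mc gc))))
  have rcont' : ContinuousOn (Function.uncurry r') (Icc τ T ×ˢ univ) :=
    (continuousOn_const.mul (h.a'_cont.div h.cont_a fun p hp => h.a_ne _ hp.1 _)).add
      (continuousOn_const.mul ((continuousOn_primitive_param h.lt.le gc').sub
        (snd_cont.mul (mc gc'))))
  -- The two halves of `∫₀ˣ g - x m` grow linearly in `x` and only their difference is periodic, so
  -- they are estimated on one period and the bound is then transported.
  have reduce : ∀ (f : ℝ → ℝ) (C : ℝ), Function.Periodic f M → (∀ x ∈ Icc 0 M, |f x| ≤ C) →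
      ∀ x, |f x| ≤ C := fun f C hf hC x => by
    obtain ⟨y, hy, hxy⟩ := hf.exists_mem_Ico₀ hM x
    rw [hxy]; exact hC y (Ico_subset_Icc_self hy)
  have hlog : ∀ t ∈ Icc τ T, ∀ x, |Real.log (a t x)| ≤ R := fun t ht x => by
    rw [← Real.log_abs, abs_le]
    have hpos := abs_pos.2 (h.a_ne t ht x)
    have h1 : Real.log |a t x| ≤ Real.log R := Real.log_le_log hpos (h.abs_a_le ht x)
    have h2 : Real.log R⁻¹ ≤ Real.log |a t x| := Real.log_le_log (by positivity) (h.inv_le_abs ht x)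
    rw [Real.log_inv] at h2
    have h3 := Real.log_le_sub_one_of_pos hR0
    constructor <;> linarith
  have pw : R ≤ R ^ 2 ∧ R ^ 2 ≤ R ^ 3 ∧ R ^ 3 ≤ R ^ 5 ∧ R ^ 2 ≤ R ^ 5 ∧ 0 ≤ R ^ 5 :=
    ⟨by nlinarith, pow_le_pow_right₀ hR (by norm_num), pow_le_pow_right₀ hR (by norm_num),
      pow_le_pow_right₀ hR (by norm_num), by positivity⟩
  obtain ⟨pw1, pw2, pw3, pw4, pw5⟩ := pw
  have hν := abs_nonneg ν
  have tail : ∀ (f : ℝ → ℝ) (C : ℝ), 0 ≤ C → (∀ x, |f x| ≤ C) → ∀ x ∈ Icc 0 M,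
      |2 / 3 * ((∫ y in (0 : ℝ)..x, f y) - x * mean M f)| ≤ 2 * (C * R) := fun f C hC hf x hx => by
    rw [abs_mul]
    have h1 := pbound f C hf x hx
    have h2 : |x * mean M f| ≤ C * R := by
      rw [abs_mul, mul_comm, abs_of_nonneg hx.1]
      exact mul_le_mul (mbound f C hf) (hx.2.trans h.M_le) hx.1 hC
    have h3 := abs_sub (∫ y in (0 : ℝ)..x, f y) (x * mean M f)
    have h4 : (0 : ℝ) ≤ C * R := by positivity
    rw [abs_of_pos (by norm_num : (0 : ℝ) < 2 / 3)]
    linarith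
  refine ⟨r, r', m, rper, fun t ht => ?_, rcont, rcont', fun t ht x => ?_, fun t ht => ?_,
    fun t ht x => ?_, fun t ht x => ?_, fun t ht => ?_, fun t ht x => ?_, fun t ht x => ?_⟩
  · rw [show (3 : WithTop ℕ∞) = 2 + 1 by norm_num, contDiff_succ_iff_deriv]
    refine ⟨fun x => (rd t ht x).differentiableAt, by simp, ?_⟩
    have : deriv (r t) = fun x => κ * (deriv (a t) x / a t x) + 2 / 3 * (g t x - m t) :=
      funext fun x => (rd t ht x).deriv
    rw [this]
    have h1 : ContDiff ℝ 2 (deriv (a t)) := by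
      have := contDiff_iteratedDeriv (k := 2) (n := 1)
        ((h.a_smooth t ht).of_le (by exact_mod_cast (by omega : 2 + 1 ≤ n + 3)))
      rwa [iteratedDeriv_one] at this
    have h2 : ContDiff ℝ 2 (a t) := (h.a_smooth t ht).of_le (by exact_mod_cast (by omega : 2 ≤ n + 3))
    have h3 : ContDiff ℝ 2 (g t) := (gs t ht).of_le (by exact_mod_cast (by omega : 2 ≤ n + 2))
    exact (contDiff_const.mul (h1.div h2 (h.a_ne t ht))).add
      (contDiff_const.mul (h3.sub contDiff_const))
  · have ht' := Ioo_subset_Icc_self ht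
    exact (((h.a_deriv t ht x).log (h.a_ne t ht' x)).const_mul κ).add
      (((hasDerivAt_integral_param gc gc' gd 0 x ht).sub ((md t ht).const_mul x)).const_mul _)
  · apply reduce _ _ (rper t ht)
    intro x hx
    refine (abs_add_le _ _).trans ?_
    rw [abs_mul]
    have h1 := mul_le_mul hκle (hlog t ht x) (abs_nonneg _) (by positivity)
    have h2 := tail _ _ (by positivity) (gle t ht) x hx
    nlinarith
  · rw [(rd t ht x).deriv]
    refine (abs_add_le _ _).trans ?_
    rw [abs_mul, abs_mul, abs_of_pos (by norm_num : (0 : ℝ) < 2 / 3)]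
    have h0 : |deriv (a t) x| ≤ R := by simpa using h.a_le t ht x 1 (by omega)
    have h1 := mul_le_mul hκle (h.abs_div_le ht x h0) (abs_nonneg _) (by positivity)
    have h2 := abs_sub (g t x) (m t)
    have h3 := gle t ht x
    have h4 := mbound _ _ (gle t ht)
    nlinarith
  · have gp' : Function.Periodic (g' t) M := fun x => by
      simp only [hg', h.b_per t ht x, h.a_per t ht x, h.b'_per t ht x, h.a'_per t ht x]
    have rper' : Function.Periodic (r' t) M := fun x => by
      have h1 := gp'.intervalIntegral_add_eq 0 x
      rw [zero_add] at h1
      have hgi : ∀ α β, IntervalIntegrable (g' t) volume α β := fun α β =>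
        (continuous_section gc' ht).intervalIntegrable _ _
      have h2 := intervalIntegral.integral_add_adjacent_intervals (hgi 0 x) (hgi x (x + M))
      have h3 := integral_eq_mean hM (g' t)
      simp only [hr', h.a_per t ht x, h.a'_per t ht x, ← h2, ← h1, h3, hm']
      ring
    apply reduce _ _ rper'
    intro x hx
    refine (abs_add_le _ _).trans ?_
    rw [abs_mul]
    have h1 := mul_le_mul hκle (h.abs_div_le ht x (h.a'_le t ht x)) (abs_nonneg _) (by positivity)
    have h2 := tail _ _ (by positivity) (gle' t ht) x hx
    nlinarith
  · have h4 := mbound _ _ (gle t ht)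
    have : 0 ≤ (|ν| + 1) * R ^ 2 := by positivity
    linarith
  · rw [(rd t ht x).deriv]
    have hne := h.a_ne t ht x
    simp only [hg, hκ]
    field_simp
    ring
  · rw [hm]
    simp only [hg]
    rw [h.mean_mul ht x, div_eq_mul_inv]
    exact mul_le_mul (h.avg_le t ht) (h.inv_le_abs ht x) (by positivity)
      (h.delta_pos.le.trans (h.avg_le t ht))

end Coeffs
end DispersivePDE

/-! ### The spatial operator and the weighted energy identity. -/

namespace DispersivePDE

variable {M : ℝ}

/-! ### The spatial operator -/

/-- The operator `a ∂³ + b ∂² + c ∂ + d`. -/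
def spatial (a b c d u : ℝ → ℝ) (x : ℝ) : ℝ :=
  a x * iteratedDeriv 3 u x + b x * iteratedDeriv 2 u x + c x * deriv u x + d x * u x

/-- The coefficients of the formal adjoint of `spatial`. -/
def adjCoeff (a b c d : ℝ → ℝ) (i : ℕ) (x : ℝ) : ℝ :=
  match i with
  | 0 => -iteratedDeriv 3 a x + iteratedDeriv 2 b x - iteratedDeriv 1 c x + iteratedDeriv 0 d x
  | 1 => -3 * iteratedDeriv 2 a x + 2 * iteratedDeriv 1 b x - iteratedDeriv 0 c x
  | 2 => -3 * iteratedDeriv 1 a x + iteratedDeriv 0 b x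
  | 3 => -iteratedDeriv 0 a x
  | _ => 0

/-- Integration by parts moves every derivative of `u` to the test function and the coefficients.
The right-hand side is continuous in `u` for the `L²` norm, which makes the weak formulation
possible. -/
theorem integral_spatial_mul {a b c d u η : ℝ → ℝ} (ha : ContDiff ℝ 3 a) (hb : ContDiff ℝ 2 b)
    (hc : ContDiff ℝ 1 c) (hd : Continuous d) (hu : ContDiff ℝ 3 u) (hη : ContDiff ℝ 3 η)
    (hap : Function.Periodic a M) (hbp : Function.Periodic b M) (hcp : Function.Periodic c M)
    (hup : Function.Periodic u M) (hηp : Function.Periodic η M) :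
    ∫ x in (0 : ℝ)..M, spatial a b c d u x * η x =
      ∫ x in (0 : ℝ)..M, u x * ∑ i ∈ Finset.range 4, adjCoeff a b c d i x * iteratedDeriv i η x := by
  have hu2 : ContDiff ℝ 2 u := hu.of_le (by norm_num)
  have hu1 : ContDiff ℝ 1 u := hu.of_le (by norm_num)
  have hη2 : ContDiff ℝ 2 η := hη.of_le (by norm_num)
  have hη1 : ContDiff ℝ 1 η := hη.of_le (by norm_num)
  have e3 := integral_mul_iteratedDeriv_periodic (M := M) 3 (f := fun x => a x * η x) (g := u)
    (ha.mul hη) hu (hap.mul hηp) hup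
  have e2 := integral_mul_iteratedDeriv_periodic (M := M) 2 (f := fun x => b x * η x) (g := u)
    (hb.mul hη2) hu2 (hbp.mul hηp) hup
  have e1 := integral_mul_iteratedDeriv_periodic (M := M) 1 (f := fun x => c x * η x) (g := u)
    (by simpa using hc.mul hη1) (by simpa using hu1) (hcp.mul hηp) hup
  have ct3 : ContDiff ℝ 0 (iteratedDeriv 3 fun x => a x * η x) :=
    contDiff_iteratedDeriv (k := 0) (n := 3) (ha.mul hη)
  have ct2 : ContDiff ℝ 0 (iteratedDeriv 2 fun x => b x * η x) :=
    contDiff_iteratedDeriv (k := 0) (n := 2) (hb.mul hη2)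
  have ct1 : ContDiff ℝ 0 (iteratedDeriv 1 fun x => c x * η x) :=
    contDiff_iteratedDeriv (k := 0) (n := 1) (by simpa using hc.mul hη1)
  have cu3 : ContDiff ℝ 0 (iteratedDeriv 3 u) := contDiff_iteratedDeriv (k := 0) (n := 3) hu
  have cu2 : ContDiff ℝ 0 (iteratedDeriv 2 u) := contDiff_iteratedDeriv (k := 0) (n := 2) hu2
  have cu1 : ContDiff ℝ 0 (iteratedDeriv 1 u) :=
    contDiff_iteratedDeriv (k := 0) (n := 1) (by simpa using hu1)
  have l3 : ∀ x, iteratedDeriv 3 (fun x => a x * η x) x = _ := fun x =>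
    iteratedDeriv_fun_mul ha.contDiffAt hη.contDiffAt
  have l2 : ∀ x, iteratedDeriv 2 (fun x => b x * η x) x = _ := fun x =>
    iteratedDeriv_fun_mul hb.contDiffAt hη2.contDiffAt
  have l1 : ∀ x, iteratedDeriv 1 (fun x => c x * η x) x = _ := fun x =>
    iteratedDeriv_fun_mul (n := 1) (by simpa using hc.contDiffAt) (by simpa using hη1.contDiffAt)
  have ca := ha.continuous
  have cb := hb.continuous
  have cc := hc.continuous
  have cu := hu.continuous
  have cη := hη.continuous
  have ii : ∀ {f : ℝ → ℝ}, Continuous f → IntervalIntegrable f volume 0 M := fun hf =>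
    hf.intervalIntegrable _ _
  rw [contDiff_zero] at ct3 ct2 ct1 cu3 cu2 cu1
  calc ∫ x in (0 : ℝ)..M, spatial a b c d u x * η x
      = ∫ x in (0 : ℝ)..M, (((a x * η x * iteratedDeriv 3 u x + b x * η x * iteratedDeriv 2 u x) +
          c x * η x * iteratedDeriv 1 u x) + d x * u x * η x) := by
        congr 1; funext x; simp only [spatial, iteratedDeriv_one]; ring
    _ = ∫ x in (0 : ℝ)..M, (((-(iteratedDeriv 3 (fun x => a x * η x) x * u x) +
          iteratedDeriv 2 (fun x => b x * η x) x * u x) -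
          iteratedDeriv 1 (fun x => c x * η x) x * u x) + d x * u x * η x) := by
        rw [intervalIntegral.integral_add (ii (by fun_prop)) (ii (by fun_prop)),
          intervalIntegral.integral_add (ii (by fun_prop)) (ii (by fun_prop)),
          intervalIntegral.integral_add (ii (by fun_prop)) (ii (by fun_prop)),
          intervalIntegral.integral_add (ii (by fun_prop)) (ii (by fun_prop)),
          intervalIntegral.integral_sub (ii (by fun_prop)) (ii (by fun_prop)),
          intervalIntegral.integral_add (ii (by fun_prop)) (ii (by fun_prop)),
          intervalIntegral.integral_neg, e3, e2, e1]
        ring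
    _ = _ := by
        congr 1; funext x
        rw [l3, l2, l1]
        simp [Finset.sum_range_succ, adjCoeff, Nat.choose]
        ring

/-- Leibniz' rule, with the terms of high order separated. -/
theorem abs_iteratedDeriv_mul_sub_le {f u : ℝ → ℝ} {n p : ℕ} (hp : p ≤ n) (hf : ContDiff ℝ n f)
    (hu : ContDiff ℝ (n + p : ℕ) u) {x R B : ℝ} (hR : 0 ≤ R)
    (hfR : ∀ i ≤ n, |iteratedDeriv i f x| ≤ R) (huB : ∀ i ≤ n, |iteratedDeriv i u x| ≤ B) :
    |iteratedDeriv n (fun y => f y * iteratedDeriv p u y) x -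
      ∑ i ∈ Finset.range p, (n.choose i) * iteratedDeriv i f x * iteratedDeriv (n + p - i) u x| ≤
      2 ^ n * (R * B) := by
  have hB : 0 ≤ B := (abs_nonneg _).trans (huB 0 (Nat.zero_le _))
  have hD : ∀ j, iteratedDeriv j (iteratedDeriv p u) = iteratedDeriv (j + p) u := fun j => by
    simp only [iteratedDeriv_eq_iterate, Function.iterate_add_apply]
  -- Terms with `i < p` involve derivatives of `u` beyond order `n` and cancel against the
  -- subtracted sum. In the others all derivatives are bounded, and the binomial coefficients sum to
  -- at most `2 ^ n`.
  rw [iteratedDeriv_fun_mul hf.contDiffAt (contDiff_iteratedDeriv hu).contDiffAt,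
    ← Finset.sum_range_add_sum_Ico _ (by omega : p ≤ n + 1)]
  have h1 : ∑ i ∈ Finset.range p, (n.choose i) * iteratedDeriv i f x *
      iteratedDeriv (n - i) (iteratedDeriv p u) x =
      ∑ i ∈ Finset.range p, (n.choose i) * iteratedDeriv i f x * iteratedDeriv (n + p - i) u x := by
    refine Finset.sum_congr rfl fun i hi => ?_
    rw [hD, show n - i + p = n + p - i by have := Finset.mem_range.1 hi; omega]
  rw [h1, add_sub_cancel_left]
  refine (Finset.abs_sum_le_sum_abs _ _).trans ?_
  have h2 : ∀ i ∈ Finset.Ico p (n + 1), |(n.choose i) * iteratedDeriv i f x *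
      iteratedDeriv (n - i) (iteratedDeriv p u) x| ≤ (n.choose i) * (R * B) := fun i hi => by
    rw [Finset.mem_Ico] at hi
    rw [hD, mul_assoc, abs_mul, abs_mul, abs_of_nonneg (by positivity : (0 : ℝ) ≤ n.choose i)]
    exact mul_le_mul_of_nonneg_left (mul_le_mul (hfR i (by omega)) (huB _ (by omega))
      (abs_nonneg _) hR) (by positivity)
  refine (Finset.sum_le_sum h2).trans ?_
  rw [← Finset.sum_mul]
  apply mul_le_mul_of_nonneg_right _ (by positivity)
  have h3 : ∑ i ∈ Finset.range (n + 1), (n.choose i : ℝ) = 2 ^ n := by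
    exact_mod_cast Nat.sum_range_choose n
  rw [← h3]
  exact Finset.sum_le_sum_of_subset_of_nonneg (fun i hi => by
    rw [Finset.mem_Ico] at hi; exact Finset.mem_range.2 hi.2) fun _ _ _ => by positivity

/-! ### The weighted energy identity -/

/-- Two integrations by parts, organized as the derivative of a single periodic function. The
hypothesis `hid` says `(e^r a)_x = (2/3) e^r (β - m a)`: it removes the term in `w w_xx` and leaves
exactly `m a` in front of `w_x²`. Only first derivatives of `r`, `a` and `β` occur, which keeps the
constants within the allowed norms. -/
theorem weighted_energy_identity {a β r w : ℝ → ℝ} {m : ℝ} (ha : ContDiff ℝ 1 a)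
    (hβ : ContDiff ℝ 1 β) (hr : ContDiff ℝ 1 r) (hw : ContDiff ℝ 3 w) (hap : Function.Periodic a M)
    (hβp : Function.Periodic β M) (hrp : Function.Periodic r M) (hwp : Function.Periodic w M)
    (hid : ∀ x, 3 / 2 * (deriv r x * a x + deriv a x) - β x = -(m * a x)) :
    ∫ x in (0 : ℝ)..M, Real.exp (r x) * (w x * (a x * iteratedDeriv 3 w x + β x * iteratedDeriv 2 w x)) =
      -∫ x in (0 : ℝ)..M, Real.exp (r x) * ((deriv r x * (β x / 3 + 2 / 3 * m * a x) +
        (deriv β x / 3 + 2 / 3 * m * deriv a x)) * (w x * deriv w x) + m * a x * deriv w x ^ 2) := by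
  have hw2 : ContDiff ℝ 2 (deriv w) := by
    have := contDiff_iteratedDeriv (k := 2) (n := 1) hw; rwa [iteratedDeriv_one] at this
  have hw1 : ContDiff ℝ 1 (iteratedDeriv 2 w) := contDiff_iteratedDeriv (k := 1) (n := 2) hw
  have cw3 : ContDiff ℝ 0 (iteratedDeriv 3 w) := contDiff_iteratedDeriv (k := 0) (n := 3) hw
  rw [contDiff_zero] at cw3
  have d0 : ∀ x, HasDerivAt w (deriv w x) x := fun x => (hw.differentiable (by simp) x).hasDerivAt
  have d1 : ∀ x, HasDerivAt (deriv w) (iteratedDeriv 2 w x) x := fun x => by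
    have := (hw2.differentiable (by simp) x).hasDerivAt
    rwa [show deriv (deriv w) x = iteratedDeriv 2 w x by rw [iteratedDeriv_succ, iteratedDeriv_one]] at this
  have d2 : ∀ x, HasDerivAt (iteratedDeriv 2 w) (iteratedDeriv 3 w x) x := fun x => by
    have := (hw1.differentiable (by simp) x).hasDerivAt
    rwa [← iteratedDeriv_succ] at this
  have da : ∀ x, HasDerivAt a (deriv a x) x := fun x => (ha.differentiable (by simp) x).hasDerivAt
  have dβ : ∀ x, HasDerivAt β (deriv β x) x := fun x => (hβ.differentiable (by simp) x).hasDerivAt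
  have dr : ∀ x, HasDerivAt r (deriv r x) x := fun x => (hr.differentiable (by simp) x).hasDerivAt
  have ca := ha.continuous
  have cb := hβ.continuous
  have cr := hr.continuous
  have cw := hw.continuous
  have ca' := ha.continuous_deriv le_rfl
  have cb' := hβ.continuous_deriv le_rfl
  have cr' := hr.continuous_deriv le_rfl
  have cw1 := hw2.continuous
  have cw2 := hw1.continuous
  set P : ℝ → ℝ := fun x => Real.exp (r x) *
    (w x * (a x * iteratedDeriv 3 w x + β x * iteratedDeriv 2 w x)) with hP
  set S : ℝ → ℝ := fun x => Real.exp (r x) * ((deriv r x * (β x / 3 + 2 / 3 * m * a x) +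
        (deriv β x / 3 + 2 / 3 * m * deriv a x)) * (w x * deriv w x) + m * a x * deriv w x ^ 2) with hS
  -- The factor `β / 3 + 2 / 3 * m * a` is what must be added to `r_x a + a_x = (2/3)(β - m a)` to
  -- produce `β`. The last term cancels `a w_x w_xx`.
  set F : ℝ → ℝ := fun x => Real.exp (r x) * ((a x * w x * iteratedDeriv 2 w x +
    (β x / 3 + 2 / 3 * m * a x) * w x * deriv w x) - 1 / 2 * a x * deriv w x ^ 2) with hF
  have dF : ∀ x, HasDerivAt F (P x + S x) x := fun x => by
    have h1 := (dr x).exp.mul (((((da x).mul (d0 x)).mul (d2 x)).add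
      (((((dβ x).div_const 3).add ((da x).const_mul (2 / 3 * m))).mul (d0 x)).mul (d1 x))).sub
      (((da x).const_mul (1 / 2)).mul ((d1 x).pow 2)))
    refine h1.congr_deriv ?_
    simp only [hP, hS, Pi.mul_apply, Pi.add_apply, Pi.sub_apply, Pi.pow_apply]
    norm_num
    linear_combination Real.exp (r x) * (w x * iteratedDeriv 2 w x * (2 / 3) -
      1 / 3 * deriv w x ^ 2) * hid x
  have cP : Continuous P := by fun_prop
  have cS : Continuous S := by fun_prop
  have h2 := intervalIntegral.integral_eq_sub_of_hasDerivAt (a := 0) (b := M) (fun x _ => dF x)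
    ((cP.add cS).intervalIntegrable _ _)
  have hFp : F M = F 0 := by
    have e : ∀ {f : ℝ → ℝ}, Function.Periodic f M → f M = f 0 := fun hf => by simpa using hf 0
    have p1 := periodic_deriv hwp
    have p2 := periodic_iteratedDeriv hwp 2
    simp only [hF, e hrp, e hap, e hwp, e hβp, e p1, e p2]
  rw [hFp, sub_self, intervalIntegral.integral_add (cP.intervalIntegrable _ _)
    (cS.intervalIntegrable _ _)] at h2
  linarith

/-- The identity yields dissipation `2 m a w_x² ≥ 2 δ w_x²`. One `δ` absorbs the terms in `w w_x` by
Young's inequality, at the cost `(G₁ + G₂)² / δ`, and the other remains for the gain of a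
derivative. -/
theorem weighted_energy_le {a β γ h r w : ℝ → ℝ} {m δ G₁ G₂ : ℝ} (hM : 0 < M) (ha : ContDiff ℝ 1 a)
    (hβ : ContDiff ℝ 1 β) (hγ : Continuous γ) (hh : Continuous h) (hr : ContDiff ℝ 1 r)
    (hw : ContDiff ℝ 3 w) (hap : Function.Periodic a M)
    (hβp : Function.Periodic β M) (hrp : Function.Periodic r M) (hwp : Function.Periodic w M)
    (hid : ∀ x, 3 / 2 * (deriv r x * a x + deriv a x) - β x = -(m * a x)) (hδ : 0 < δ)
    (hma : ∀ x, δ ≤ m * a x) (h1 : ∀ x, |γ x| ≤ G₁)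
    (h2 : ∀ x, |deriv r x * (β x / 3 + 2 / 3 * m * a x) +
      (deriv β x / 3 + 2 / 3 * m * deriv a x)| ≤ G₂) :
    2 * ∫ x in (0 : ℝ)..M, Real.exp (r x) * (w x *
        (a x * iteratedDeriv 3 w x + β x * iteratedDeriv 2 w x + γ x * deriv w x + h x)) ≤
      ∫ x in (0 : ℝ)..M, Real.exp (r x) * ((G₁ + G₂) ^ 2 / δ * w x ^ 2 - δ * deriv w x ^ 2 +
        2 * (w x * h x)) := by
  have hI := weighted_energy_identity ha hβ hr hw hap hβp hrp hwp hid
  have hw2 : ContDiff ℝ 2 (deriv w) := by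
    have := contDiff_iteratedDeriv (k := 2) (n := 1) hw; rwa [iteratedDeriv_one] at this
  have hw1 : ContDiff ℝ 1 (iteratedDeriv 2 w) := contDiff_iteratedDeriv (k := 1) (n := 2) hw
  have cw3 : ContDiff ℝ 0 (iteratedDeriv 3 w) := contDiff_iteratedDeriv (k := 0) (n := 3) hw
  rw [contDiff_zero] at cw3
  have ca := ha.continuous
  have cb := hβ.continuous
  have cr := hr.continuous
  have cw := hw.continuous
  have ca' := ha.continuous_deriv le_rfl
  have cb' := hβ.continuous_deriv le_rfl
  have cr' := hr.continuous_deriv le_rfl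
  have cw1 := hw2.continuous
  have cw2 := hw1.continuous
  have ii : ∀ {f : ℝ → ℝ}, Continuous f → IntervalIntegrable f volume 0 M := fun hf =>
    hf.intervalIntegrable _ _
  set P : ℝ → ℝ := fun x => Real.exp (r x) *
    (w x * (a x * iteratedDeriv 3 w x + β x * iteratedDeriv 2 w x)) with hP
  set S : ℝ → ℝ := fun x => Real.exp (r x) * ((deriv r x * (β x / 3 + 2 / 3 * m * a x) +
        (deriv β x / 3 + 2 / 3 * m * deriv a x)) * (w x * deriv w x) + m * a x * deriv w x ^ 2) with hS
  set V : ℝ → ℝ := fun x => Real.exp (r x) * (w x * (γ x * deriv w x + h x)) with hV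
  have cP : Continuous P := by fun_prop
  have cS : Continuous S := by fun_prop
  have cV : Continuous V := by fun_prop
  have e1 : ∫ x in (0 : ℝ)..M, Real.exp (r x) * (w x *
        (a x * iteratedDeriv 3 w x + β x * iteratedDeriv 2 w x + γ x * deriv w x + h x)) =
      ∫ x in (0 : ℝ)..M, (V x - S x) := by
    rw [intervalIntegral.integral_sub (ii cV) (ii cS), sub_eq_add_neg, ← hI,
      ← intervalIntegral.integral_add (ii cV) (ii cP)]
    congr 1; funext x; simp only [hV, hP]; ring
  rw [e1, ← intervalIntegral.integral_const_mul]
  apply intervalIntegral.integral_mono_on hM.le (ii (by fun_prop)) (ii (by fun_prop))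
  intro x _
  set κ := deriv r x * (β x / 3 + 2 / 3 * m * a x) + (deriv β x / 3 + 2 / 3 * m * deriv a x) with hκ
  have hκ2 := h2 x
  rw [← hκ] at hκ2
  have e2 : 2 * (V x - S x) = Real.exp (r x) * (2 * (γ x - κ) * (w x * deriv w x) -
      2 * (m * a x) * deriv w x ^ 2 + 2 * (w x * h x)) := by
    simp only [hV, hS, hκ]; ring
  rw [e2]
  apply mul_le_mul_of_nonneg_left _ (Real.exp_pos _).le
  have e3 : |γ x - κ| ≤ G₁ + G₂ := (abs_sub _ _).trans (add_le_add (h1 x) hκ2)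
  have e4 : (γ x - κ) ^ 2 ≤ (G₁ + G₂) ^ 2 := by
    rw [← sq_abs]; exact pow_le_pow_left₀ (abs_nonneg _) e3 2
  have e5 : 2 * (γ x - κ) * (w x * deriv w x) ≤ (γ x - κ) ^ 2 / δ * w x ^ 2 + δ * deriv w x ^ 2 := by
    have : 0 ≤ ((γ x - κ) * w x - δ * deriv w x) ^ 2 / δ := by positivity
    have e6 : ((γ x - κ) * w x - δ * deriv w x) ^ 2 / δ = (γ x - κ) ^ 2 / δ * w x ^ 2 +
      δ * deriv w x ^ 2 - 2 * (γ x - κ) * (w x * deriv w x) := by field_simp; ring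
    linarith
  have e7 : (γ x - κ) ^ 2 / δ * w x ^ 2 ≤ (G₁ + G₂) ^ 2 / δ * w x ^ 2 := by gcongr
  have e8 := mul_le_mul_of_nonneg_right (hma x) (sq_nonneg (deriv w x))
  linarith

end DispersivePDE

/-! ### The energy estimate of order `n`. -/

namespace DispersivePDE

variable {M : ℝ}

/-- The exponential growth rate of the weighted energy of order `n`. -/
def energyConst (n : ℕ) (R L δ : ℝ) : ℝ :=
  ((n.choose 2 + n + 1) * R + (L + 1) * ((n + 1 + L) * R)) ^ 2 / δ + L +
    Real.exp (2 * L) * (4 * (2 ^ n * R) * (2 + 2 * (R ^ n + 1)) + 8 * R * (R ^ n + 1))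

/-- A derivative of positive order below `n` is an iterated antiderivative, and each antiderivative
costs at most `M / 2 ≤ R`; the mean contributes only at order zero. Dividing the norm by `√M` keeps
the constant independent of a lower bound for `M`. -/
theorem abs_iteratedDeriv_integ_le (hM : 0 < M) {R : ℝ} (hR : 1 ≤ R) (hMR : M ≤ R) {w : ℝ → ℝ}
    (hw : MemLp w 2 (volume.restrict (Ioc 0 M))) {n j : ℕ} (hj : j < n) (x : ℝ) :
    |iteratedDeriv j (integ M n w) x| ≤ (R ^ n + 1) * (‖toL2 M w‖ / Real.sqrt M) := by
  have hs : 0 < Real.sqrt M := Real.sqrt_pos.2 hM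
  have hs2 : Real.sqrt M * Real.sqrt M = M := Real.mul_self_sqrt hM.le
  set N := ‖toL2 M w‖ / Real.sqrt M with hN
  have hN0 : 0 ≤ N := by positivity
  have hw' : ‖toL2 M w‖ = Real.sqrt M * N := by rw [hN]; field_simp
  have h1 : ∀ m < n, |(antider M)^[m + 1] w x| ≤ R ^ n * N := fun m hm => by
    refine (abs_iterate_antider_le hM hw m x).trans ?_
    rw [hw']
    calc Real.sqrt M / 2 * (M / 2) ^ m * (Real.sqrt M * N)
        = (M / 2) ^ (m + 1) * N := by rw [pow_succ]; linear_combination ((M / 2) ^ m * N / 2) * hs2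
      _ ≤ R ^ (m + 1) * N := by gcongr; linarith
      _ ≤ R ^ n * N := by gcongr; exact hm
  by_cases hj0 : j = 0
  · subst hj0
    rw [iteratedDeriv_zero, integ, add_mul]
    refine (abs_add_le _ _).trans (add_le_add ?_ ?_)
    · obtain ⟨m, rfl⟩ := Nat.exists_eq_succ_of_ne_zero hj.ne'
      exact h1 m (Nat.lt_succ_self m)
    · refine (abs_mean_le hM hw).trans_eq ?_
      rw [hw', one_mul]
      field_simp
      rw [sq, hs2]
  · rw [iteratedDeriv_integ hM hw hj hj0, show n - j = (n - j - 1) + 1 by omega]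
    refine (h1 _ (by omega)).trans ?_
    nlinarith

namespace Coeffs

variable {τ T R δ δ' L : ℝ} {n : ℕ} {a a' b b' c d r r' : ℝ → ℝ → ℝ} {m : ℝ → ℝ}

theorem contDiff_spatial (h : Coeffs M τ T n R δ a a' b b' c d) {t : ℝ} (ht : t ∈ Icc τ T)
    {u : ℝ → ℝ} (hu : ContDiff ℝ (n + 3 : ℕ) u) :
    ContDiff ℝ n (spatial (a t) (b t) (c t) (d t) u) := by
  have u3 : ContDiff ℝ n (iteratedDeriv 3 u) := contDiff_iteratedDeriv hu
  have u2 : ContDiff ℝ n (iteratedDeriv 2 u) :=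
    contDiff_iteratedDeriv (hu.of_le (by exact_mod_cast Nat.le_succ _))
  have u1 : ContDiff ℝ n (deriv u) := by
    rw [← iteratedDeriv_one]
    exact contDiff_iteratedDeriv (hu.of_le (by exact_mod_cast (by omega : n + 1 ≤ n + 3)))
  have u0 : ContDiff ℝ n u := hu.of_le (by exact_mod_cast (by omega : n ≤ n + 3))
  have a0 : ContDiff ℝ n (a t) := (h.a_smooth t ht).of_le (by exact_mod_cast (by omega : n ≤ n + 3))
  have b0 : ContDiff ℝ n (b t) := (h.b_smooth t ht).of_le (by exact_mod_cast (by omega : n ≤ n + 2))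
  exact (((a0.mul u3).add (b0.mul u2)).add ((h.c_smooth t ht).mul u1)).add ((h.d_smooth t ht).mul u0)

theorem periodic_spatial (h : Coeffs M τ T n R δ a a' b b' c d) {t : ℝ} (ht : t ∈ Icc τ T)
    {u : ℝ → ℝ} (hu : Function.Periodic u M) :
    Function.Periodic (spatial (a t) (b t) (c t) (d t) u) M := fun x => by
  simp only [spatial, h.a_per t ht x, h.b_per t ht x, h.c_per t ht x, h.d_per t ht x, hu x,
    periodic_iteratedDeriv hu 3 x, periodic_iteratedDeriv hu 2 x, periodic_deriv hu x]

/-- The part of the `n`-th derivative of the equation containing derivatives of order at most `n`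
is bounded. -/
theorem abs_iteratedDeriv_spatial_sub_le (h : Coeffs M τ T n R δ a a' b b' c d) (hn : 4 ≤ n)
    {t : ℝ} (ht : t ∈ Icc τ T) {u : ℝ → ℝ} (hu : ContDiff ℝ (n + 3 : ℕ) u) {x B : ℝ}
    (hB : ∀ i ≤ n, |iteratedDeriv i u x| ≤ B) :
    |iteratedDeriv n (spatial (a t) (b t) (c t) (d t) u) x -
      (a t x * iteratedDeriv (n + 3) u x +
        (n * deriv (a t) x + b t x) * iteratedDeriv (n + 2) u x +
        (n.choose 2 * iteratedDeriv 2 (a t) x + n * deriv (b t) x + c t x) *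
          iteratedDeriv (n + 1) u x)| ≤ 4 * (2 ^ n * R) * B := by
  have hR : 0 ≤ R := by linarith [h.one_le]
  have u3 : ContDiff ℝ n (iteratedDeriv 3 u) := contDiff_iteratedDeriv hu
  have hu2 : ContDiff ℝ (n + 2 : ℕ) u := hu.of_le (by exact_mod_cast Nat.le_succ _)
  have hu1 : ContDiff ℝ (n + 1 : ℕ) u := hu.of_le (by exact_mod_cast (by omega : n + 1 ≤ n + 3))
  have hu0 : ContDiff ℝ (n + 0 : ℕ) u := hu.of_le (by exact_mod_cast (by omega : n ≤ n + 3))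
  have u2 : ContDiff ℝ n (iteratedDeriv 2 u) := contDiff_iteratedDeriv hu2
  have u1 : ContDiff ℝ n (iteratedDeriv 1 u) := contDiff_iteratedDeriv hu1
  have u0 : ContDiff ℝ n (iteratedDeriv 0 u) := contDiff_iteratedDeriv hu0
  have a0 : ContDiff ℝ n (a t) := (h.a_smooth t ht).of_le (by exact_mod_cast (by omega : n ≤ n + 3))
  have b0 : ContDiff ℝ n (b t) := (h.b_smooth t ht).of_le (by exact_mod_cast (by omega : n ≤ n + 2))
  have c0 := h.c_smooth t ht
  have d0 := h.d_smooth t ht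
  have l3 := abs_iteratedDeriv_mul_sub_le (p := 3) (by omega) a0 hu hR
    (fun i hi => h.a_le t ht x i (by omega)) hB
  have l2 := abs_iteratedDeriv_mul_sub_le (p := 2) (by omega) b0 hu2 hR
    (fun i hi => h.b_le t ht x i (by omega)) hB
  have l1 := abs_iteratedDeriv_mul_sub_le (p := 1) (by omega) c0 hu1 hR
    (fun i hi => h.c_le t ht x i (by omega)) hB
  have l0 := abs_iteratedDeriv_mul_sub_le (p := 0) (by omega) d0 hu0 hR
    (fun i hi => h.d_le t ht x i (by omega)) hB
  have e1 : iteratedDeriv n (spatial (a t) (b t) (c t) (d t) u) x =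
      iteratedDeriv n (fun y => a t y * iteratedDeriv 3 u y) x +
      iteratedDeriv n (fun y => b t y * iteratedDeriv 2 u y) x +
      iteratedDeriv n (fun y => c t y * iteratedDeriv 1 u y) x +
      iteratedDeriv n (fun y => d t y * iteratedDeriv 0 u y) x := by
    have e2 : spatial (a t) (b t) (c t) (d t) u = fun y => ((a t y * iteratedDeriv 3 u y +
      b t y * iteratedDeriv 2 u y) + c t y * iteratedDeriv 1 u y) + d t y * iteratedDeriv 0 u y := by
      funext y; simp only [spatial, iteratedDeriv_one, iteratedDeriv_zero]
    rw [e2, iteratedDeriv_fun_add (((a0.mul u3).add (b0.mul u2)).add (c0.mul u1)).contDiffAt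
      (d0.mul u0).contDiffAt, iteratedDeriv_fun_add ((a0.mul u3).add (b0.mul u2)).contDiffAt
      (c0.mul u1).contDiffAt, iteratedDeriv_fun_add (a0.mul u3).contDiffAt (b0.mul u2).contDiffAt]
  rw [e1]
  simp only [Finset.sum_range_succ, Finset.sum_range_zero, Nat.choose_zero_right, Nat.choose_one_right,
    iteratedDeriv_zero, iteratedDeriv_one, Nat.sub_zero, zero_add, Nat.cast_one,
    one_mul, sub_zero, show n + 3 - 1 = n + 2 by omega, show n + 3 - 2 = n + 1 by omega,
    show n + 2 - 1 = n + 1 by omega] at l3 l2 l1 l0 ⊢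
  rw [abs_le] at l3 l2 l1 l0 ⊢
  constructor <;> linarith [l3.1, l3.2, l2.1, l2.2, l1.1, l1.2, l0.1, l0.2]

set_option maxHeartbeats 1000000 in
/-- The weighted energy inequality of order `n` for `u` with `∂ⁿu = w - mean w`, `w = exp (-r) v`. -/
theorem energy_le (h : Coeffs M τ T n R δ a a' b b' c d) (hn : 4 ≤ n)
    (W : Weight M τ T n δ' L a b r r' m) (hδ' : 0 < δ') {t : ℝ} (ht : t ∈ Icc τ T)
    (v : smoothPer M) {w : ℝ → ℝ} (hwv : ∀ x, w x = Real.exp (-r t x) * (v : ℝ → ℝ) x) :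
    2 * (∫ x in (0 : ℝ)..M, spatial (a t) (b t) (c t) (d t) (integ M n w) x *
        (sharp M n v : ℝ → ℝ) x) + (∫ x in (0 : ℝ)..M, r' t x * (w x * (v : ℝ → ℝ) x)) +
        δ' * Real.exp (-L) * (∫ x in (0 : ℝ)..M, deriv w x ^ 2) ≤
      energyConst n R L δ' * ∫ x in (0 : ℝ)..M, w x * (v : ℝ → ℝ) x := by
  have hM := h.M_pos
  have hR1 := h.one_le
  have hR : 0 ≤ R := by linarith
  have hn0 : n ≠ 0 := by omega
  have rs := W.smooth t ht
  have rp := W.per t ht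
  have vs : ContDiff ℝ 3 (v : ℝ → ℝ) := contDiff_infty.1 v.2.1 3
  have hwe : w = fun x => Real.exp (-r t x) * (v : ℝ → ℝ) x := funext hwv
  have ws : ContDiff ℝ 3 w := by rw [hwe]; exact (rs.neg.exp).mul vs
  have wp : Function.Periodic w M := fun x => by rw [hwv, hwv, rp x, v.2.2 x]
  have hv : ∀ x, (v : ℝ → ℝ) x = Real.exp (r t x) * w x := fun x => by
    rw [hwv, ← mul_assoc, ← Real.exp_add]; simp
  have wc := ws.continuous
  have rc := rs.continuous
  have vc := smoothPer_continuous v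
  have wm := memLp_of_continuous (M := M) wc
  have wd : Continuous (deriv w) := ws.continuous_deriv (by norm_num)
  set u := integ M n w with hu
  have us : ContDiff ℝ (n + 3 : ℕ) u := by
    rw [add_comm]; exact contDiff_integ_of_contDiff hM ws wp n
  have up : Function.Periodic u M := integ_periodic hM w hn0
  have hs : 0 < Real.sqrt M := Real.sqrt_pos.2 hM
  have hs2 : Real.sqrt M ^ 2 = M := Real.sq_sqrt hM.le
  -- The root mean square of `w`. Pointwise bounds in terms of `N` integrate over a period to `M N²
  -- = ‖w‖²`, so no negative power of `M` survives.
  set N := ‖toL2 M w‖ / Real.sqrt M with hN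
  have hN0 : 0 ≤ N := by positivity
  set D := R ^ n + 1 with hD
  have hD0 : 1 ≤ D := by rw [hD]; linarith [pow_nonneg hR n]
  have hwN : ‖toL2 M w‖ ^ 2 = M * N ^ 2 := by rw [hN, div_pow, hs2]; field_simp
  have hmean : ∀ {f : ℝ → ℝ}, Continuous f → |mean M f| ≤ ‖toL2 M f‖ / Real.sqrt M := fun hf => by
    refine (abs_mean_le hM (memLp_of_continuous hf)).trans_eq ?_
    rw [← hs2]; simp only [Real.sqrt_sq hs.le]; field_simp
  have uB : ∀ i < n, ∀ x, |iteratedDeriv i u x| ≤ D * N := fun i hi x =>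
    abs_iteratedDeriv_integ_le hM hR1 h.M_le wm hi x
  have uB' : ∀ x, ∀ i ≤ n, |iteratedDeriv i u x| ≤ |w x| + D * N := fun x i hi => by
    rcases hi.lt_or_eq with hi | rfl
    · linarith [uB i hi x, abs_nonneg (w x)]
    · rw [iteratedDeriv_integ_self hM wc wp hn0]
      have := hmean wc
      rw [← hN] at this
      refine (abs_sub _ _).trans ?_
      nlinarith
  have u3 := iteratedDeriv_integ_add hM wc wp hn0 (i := 3) (by norm_num)
  have u2 := iteratedDeriv_integ_add hM wc wp hn0 (i := 2) (by norm_num)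
  have u1 := iteratedDeriv_integ_add hM wc wp hn0 (i := 1) (by norm_num)
  rw [iteratedDeriv_one] at u1
  set Lu := spatial (a t) (b t) (c t) (d t) u with hLu
  have Lus : ContDiff ℝ n Lu := h.contDiff_spatial ht us
  have Lup : Function.Periodic Lu M := h.periodic_spatial ht up
  set β : ℝ → ℝ := fun x => n * deriv (a t) x + b t x with hβ
  set γ : ℝ → ℝ := fun x => n.choose 2 * iteratedDeriv 2 (a t) x + n * deriv (b t) x + c t x with hγ
  set g : ℝ → ℝ := fun x => iteratedDeriv n Lu x - (a t x * iteratedDeriv 3 w x +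
    β x * iteratedDeriv 2 w x + γ x * deriv w x) with hg
  -- The remainder `g` collects everything in `∂ⁿ(L u)` of order at most `n` in `u`. It is
  -- controlled pointwise by `|w|` and `N`.
  have as3 := h.a_smooth t ht
  have bs3 := h.b_smooth t ht
  have as1 : ContDiff ℝ 1 (a t) := as3.of_le (by exact_mod_cast (by omega : 1 ≤ n + 3))
  have as1' : ContDiff ℝ 1 (deriv (a t)) := by
    have := contDiff_iteratedDeriv (k := 1) (n := 1)
      (as3.of_le (by exact_mod_cast (by omega : 1 + 1 ≤ n + 3)))
    rw [iteratedDeriv_one] at this; exact this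
  have bs1 : ContDiff ℝ 1 (b t) := bs3.of_le (by exact_mod_cast (by omega : 1 ≤ n + 2))
  have βs : ContDiff ℝ 1 β := (contDiff_const.mul as1').add bs1
  have βp : Function.Periodic β M := fun x => by
    simp only [hβ, periodic_deriv (h.a_per t ht) x, h.b_per t ht x]
  have a2c : Continuous (iteratedDeriv 2 (a t)) := by
    have := contDiff_iteratedDeriv (k := 0) (n := 2)
      (as3.of_le (by exact_mod_cast (by omega : 0 + 2 ≤ n + 3)))
    exact this.continuous
  have b1c : Continuous (deriv (b t)) := bs1.continuous_deriv le_rfl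
  have cc : Continuous (c t) := (h.c_smooth t ht).continuous
  have ac : Continuous (a t) := as1.continuous
  have w3c : Continuous (iteratedDeriv 3 w) :=
    (contDiff_iteratedDeriv (k := 0) (n := 3) ws).continuous
  have w2c : Continuous (iteratedDeriv 2 w) :=
    (contDiff_iteratedDeriv (k := 1) (n := 2) ws).continuous
  have βc : Continuous β := βs.continuous
  have γc : Continuous γ := by fun_prop
  have Lnc : Continuous (iteratedDeriv n Lu) :=
    (contDiff_iteratedDeriv (k := 0) (n := n) (by simpa using Lus)).continuous
  have gc : Continuous g := by fun_prop
  have gB : ∀ x, |g x| ≤ 4 * (2 ^ n * R) * (|w x| + D * N) := fun x => by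
    have := h.abs_iteratedDeriv_spatial_sub_le hn ht us (uB' x)
    rwa [u3, u2, u1] at this
  have a1B : ∀ x, |deriv (a t) x| ≤ R := fun x => by simpa using h.a_le t ht x 1 (by omega)
  have b1B : ∀ x, |deriv (b t) x| ≤ R := fun x => by simpa using h.b_le t ht x 1 (by omega)
  have c0B : ∀ x, |c t x| ≤ R := fun x => by simpa using h.c_le t ht x 0 (by omega)
  have d0B : ∀ x, |d t x| ≤ R := fun x => by simpa using h.d_le t ht x 0 (by omega)
  have a2B : ∀ x, |iteratedDeriv 2 (a t) x| ≤ R := fun x => h.a_le t ht x 2 (by omega)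
  have hL0 : 0 ≤ L := (abs_nonneg _).trans (W.le t ht 0)
  have natmul : ∀ (k : ℕ) {y : ℝ}, |y| ≤ R → |(k : ℝ) * y| ≤ k * R := fun k y hy => by
    rw [abs_mul, abs_of_nonneg (by positivity : (0 : ℝ) ≤ k)]
    exact mul_le_mul_of_nonneg_left hy (by positivity)
  have γB : ∀ x, |γ x| ≤ (n.choose 2 + n + 1) * R := fun x => by
    refine (abs_add_three _ _ _).trans ?_
    linarith [natmul (n.choose 2) (a2B x), natmul n (b1B x), c0B x]
  have βd : ∀ x, deriv β x = n * iteratedDeriv 2 (a t) x + deriv (b t) x := fun x => by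
    have h1 : HasDerivAt (deriv (a t)) (iteratedDeriv 2 (a t) x) x := by
      have := (as1'.differentiable (by simp) x).hasDerivAt
      rwa [show deriv (deriv (a t)) x = iteratedDeriv 2 (a t) x by
        rw [iteratedDeriv_succ, iteratedDeriv_one]] at this
    exact ((h1.const_mul (n : ℝ)).add (bs1.differentiable (by simp) x).hasDerivAt).deriv
  have key : ∀ {y z q : ℝ}, |y| ≤ (n + 1) * R → |z| ≤ L → |q| ≤ R →
      |y / 3 + 2 / 3 * z * q| ≤ (n + 1 + L) * R := fun {y z q} hy hz hq => by
    have e1 : |z * q| ≤ L * R := by rw [abs_mul]; exact mul_le_mul hz hq (abs_nonneg _) hL0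
    have e2 : y / 3 + 2 / 3 * z * q = y / 3 + 2 / 3 * (z * q) := by ring
    have hy0 := (abs_nonneg y).trans hy
    have hz0 := (abs_nonneg _).trans e1
    rw [e2, abs_le]
    rw [abs_le] at hy e1
    constructor <;> linarith [hy.1, hy.2, e1.1, e1.2]
  have G2B : ∀ x, |deriv (r t) x * (β x / 3 + 2 / 3 * m t * a t x) +
      (deriv β x / 3 + 2 / 3 * m t * deriv (a t) x)| ≤ (L + 1) * ((n + 1 + L) * R) := fun x => by
    have b1 : |β x| ≤ (n + 1) * R := (abs_add_le _ _).trans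
      (by linarith [natmul n (a1B x), h.abs_b_le ht x])
    have b2 : |deriv β x| ≤ (n + 1) * R := by
      rw [βd]; exact (abs_add_le _ _).trans (by linarith [natmul n (a2B x), b1B x])
    have k1 := key b1 (W.m_le t ht) (h.abs_a_le ht x)
    have k2 := key b2 (W.m_le t ht) (a1B x)
    refine (abs_add_le _ _).trans ?_
    rw [abs_mul]
    have := mul_le_mul (W.deriv_le t ht x) k1 (abs_nonneg _) hL0
    linarith
  have main := weighted_energy_le hM as1 βs γc gc (rs.of_le (by norm_num)) ws (h.a_per t ht) βp rp wp
    (fun x => W.identity t ht x) hδ' (fun x => W.lower t ht x) γB G2B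
  set G := (n.choose 2 + n + 1) * R + (L + 1) * ((n + 1 + L) * R) with hG
  have ii : ∀ {f : ℝ → ℝ}, Continuous f → IntervalIntegrable f volume 0 M := fun hf =>
    hf.intervalIntegrable _ _
  -- Moving `sharp` back gives `∂ⁿ(L u)` against `v = e^r w`, the weighted expression already
  -- estimated, plus a contribution from the zero frequency.
  have e1 : ∫ x in (0 : ℝ)..M, Lu x * (sharp M n v : ℝ → ℝ) x =
      (∫ x in (0 : ℝ)..M, Real.exp (r t x) * (w x * (a t x * iteratedDeriv 3 w x +
        β x * iteratedDeriv 2 w x + γ x * deriv w x + g x))) + mean M v * ∫ x in (0 : ℝ)..M, Lu x := by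
    rw [integral_mul_sharp Lus Lup]
    congr 2; funext x
    rw [hv]; simp only [hg]; ring
  set E := ∫ x in (0 : ℝ)..M, w x * (v : ℝ → ℝ) x with hE
  have eL : ∀ x, Real.exp (r t x) ≤ Real.exp L := fun x =>
    Real.exp_le_exp.2 ((le_abs_self _).trans (W.le t ht x))
  have eL' : ∀ x, Real.exp (-L) ≤ Real.exp (r t x) := fun x =>
    Real.exp_le_exp.2 (neg_le_of_abs_le (W.le t ht x))
  have wE : ‖toL2 M w‖ ^ 2 ≤ Real.exp L * E := by
    rw [norm_toL2_sq hM wm, hE, ← intervalIntegral.integral_const_mul]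
    apply intervalIntegral.integral_mono_on hM.le (ii (by fun_prop)) (ii (by fun_prop))
    intro x _
    have : 1 ≤ Real.exp L * Real.exp (r t x) := by
      rw [← Real.exp_add]; apply Real.one_le_exp; linarith [neg_le_of_abs_le (W.le t ht x)]
    rw [hv]
    nlinarith [sq_nonneg (w x)]
  have vE : ‖toL2 M v‖ ≤ Real.exp L * ‖toL2 M w‖ := by
    rw [← sq_le_sq₀ (norm_nonneg _) (by positivity), mul_pow, norm_toL2_sq hM (smoothPer_memLp v),
      norm_toL2_sq hM wm, ← intervalIntegral.integral_const_mul]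
    apply intervalIntegral.integral_mono_on hM.le (ii (by fun_prop)) (ii (by fun_prop))
    intro x _
    rw [hv, mul_pow]
    have := pow_le_pow_left₀ (Real.exp_pos _).le (eL x) 2
    exact mul_le_mul_of_nonneg_right this (sq_nonneg _)
  have vmean : |mean M v| ≤ Real.exp L * N := by
    refine (hmean vc).trans ?_
    rw [hN, ← mul_div_assoc]
    gcongr
  -- The zero-frequency term involves derivatives up to order three, which are below `n` because `4
  -- ≤ n` and hence bounded pointwise by `D N`.
  have LuB : |∫ x in (0 : ℝ)..M, Lu x| ≤ 4 * (R * (D * N)) * M := by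
    have := intervalIntegral.norm_integral_le_of_norm_le_const (a := 0) (b := M) (f := Lu)
      (C := 4 * (R * (D * N))) fun x _ => ?_
    · rwa [sub_zero, abs_of_pos hM] at this
    · rw [hLu, spatial, Real.norm_eq_abs]
      have t3 := mul_le_mul (h.abs_a_le ht x) (uB 3 (by omega) x) (abs_nonneg _) hR
      have t2 := mul_le_mul (h.abs_b_le ht x) (uB 2 (by omega) x) (abs_nonneg _) hR
      have t1 := mul_le_mul (c0B x) (uB 1 (by omega) x) (abs_nonneg _) hR
      have t0 := mul_le_mul (d0B x) (uB 0 (by omega) x) (abs_nonneg _) hR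
      rw [← abs_mul] at t3 t2 t1 t0
      rw [iteratedDeriv_one] at t1
      rw [iteratedDeriv_zero] at t0
      rw [abs_le] at t3 t2 t1 t0 ⊢
      constructor <;> linarith [t3.1, t3.2, t2.1, t2.2, t1.1, t1.2, t0.1, t0.2]
  have mterm : 2 * (mean M v * ∫ x in (0 : ℝ)..M, Lu x) ≤
      Real.exp L * (8 * R * D) * ‖toL2 M w‖ ^ 2 := by
    have := (le_abs_self _).trans (abs_mul (mean M v) (∫ x in (0 : ℝ)..M, Lu x)).le
    have h2 := mul_le_mul vmean LuB (abs_nonneg _) (by positivity)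
    rw [hwN]
    nlinarith
  have hmono : ∫ x in (0 : ℝ)..M, Real.exp (r t x) * (G ^ 2 / δ' * w x ^ 2 - δ' * deriv w x ^ 2 +
        2 * (w x * g x)) ≤ ∫ x in (0 : ℝ)..M, ((G ^ 2 / δ' * (w x * (v : ℝ → ℝ) x) -
        δ' * Real.exp (-L) * deriv w x ^ 2) +
        Real.exp L * (4 * (2 ^ n * R)) * ((2 + D) * w x ^ 2 + D * N ^ 2)) := by
    apply intervalIntegral.integral_mono_on hM.le (ii (by fun_prop)) (ii (by fun_prop))
    intro x _
    have p1 : Real.exp (r t x) * (δ' * deriv w x ^ 2) ≥ Real.exp (-L) * (δ' * deriv w x ^ 2) := by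
      have := eL' x; gcongr
    have p2 : 2 * (w x * g x) ≤ 4 * (2 ^ n * R) * ((2 + D) * w x ^ 2 + D * N ^ 2) := by
      have q1 := (le_abs_self _).trans (abs_mul (w x) (g x)).le
      have q2 := mul_le_mul_of_nonneg_left (gB x) (abs_nonneg (w x))
      have q3 : 2 * (|w x| * (|w x| + D * N)) ≤ (2 + D) * w x ^ 2 + D * N ^ 2 := by
        rw [← sq_abs (w x)]
        nlinarith [mul_nonneg (by linarith : 0 ≤ D) (sq_nonneg (|w x| - N))]
      have q4 : 0 ≤ 4 * (2 ^ n * R) := by positivity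
      nlinarith [mul_le_mul_of_nonneg_left q3 q4]
    have p3 : 0 ≤ 4 * (2 ^ n * R) * ((2 + D) * w x ^ 2 + D * N ^ 2) := by
      have : 0 ≤ D := by linarith
      positivity
    have p4 := mul_le_mul_of_nonneg_left p2 (Real.exp_pos (r t x)).le
    have p5 := mul_le_mul_of_nonneg_right (eL x) p3
    rw [hv]
    linarith
  have hsplit : ∫ x in (0 : ℝ)..M, ((G ^ 2 / δ' * (w x * (v : ℝ → ℝ) x) -
        δ' * Real.exp (-L) * deriv w x ^ 2) +
        Real.exp L * (4 * (2 ^ n * R)) * ((2 + D) * w x ^ 2 + D * N ^ 2)) =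
      G ^ 2 / δ' * E - δ' * Real.exp (-L) * (∫ x in (0 : ℝ)..M, deriv w x ^ 2) +
        Real.exp L * (4 * (2 ^ n * R)) * ((2 + D) * ‖toL2 M w‖ ^ 2 + D * ‖toL2 M w‖ ^ 2) := by
    rw [intervalIntegral.integral_add (ii (by fun_prop)) (ii (by fun_prop)),
      intervalIntegral.integral_sub (ii (by fun_prop)) (ii (by fun_prop)),
      intervalIntegral.integral_const_mul, intervalIntegral.integral_const_mul,
      intervalIntegral.integral_const_mul,
      intervalIntegral.integral_add (ii (by fun_prop)) (ii (by fun_prop)),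
      intervalIntegral.integral_const_mul, ← norm_toL2_sq hM wm, intervalIntegral.integral_const, hwN]
    simp only [smul_eq_mul, sub_zero, hE]
    ring
  have r'c : Continuous (r' t) := continuous_section W.cont' ht
  have hr' : ∫ x in (0 : ℝ)..M, r' t x * (w x * (v : ℝ → ℝ) x) ≤ L * E := by
    rw [hE, ← intervalIntegral.integral_const_mul]
    apply intervalIntegral.integral_mono_on hM.le (ii (by fun_prop)) (ii (by fun_prop))
    intro x _
    have : 0 ≤ w x * (v : ℝ → ℝ) x := by
      rw [hv, mul_left_comm]
      exact mul_nonneg (Real.exp_pos _).le (mul_self_nonneg _)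
    exact mul_le_mul_of_nonneg_right ((le_abs_self _).trans (W.le' t ht x)) this
  rw [hsplit] at hmono
  -- In the factor `exp (2 L)`, one `exp L` bounds the weight in the remainder and the passage from
  -- `v` to `w` in the zero-frequency term; the other compares `‖w‖²` with the energy.
  rw [e1, energyConst, ← hG, ← hD, two_mul L, Real.exp_add]
  have fin : Real.exp L * (4 * (2 ^ n * R) * (2 + 2 * D) + 8 * R * D) * ‖toL2 M w‖ ^ 2 ≤
      Real.exp L * (4 * (2 ^ n * R) * (2 + 2 * D) + 8 * R * D) * (Real.exp L * E) := by
    have : 0 ≤ D := by linarith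
    gcongr
  linarith

end Coeffs
end DispersivePDE

/-! ### The weak formulation in `L²` as an evolution problem. -/

namespace DispersivePDE

variable {M : ℝ}

/-! ### The weak formulation -/

theorem integ_congr (hM : 0 < M) {f g : ℝ → ℝ} {n : ℕ} (hn : n ≠ 0)
    (h : f =ᵐ[volume.restrict (Ioc 0 M)] g) : integ M n f = integ M n g := by
  obtain ⟨k, rfl⟩ := Nat.exists_eq_succ_of_ne_zero hn
  funext x
  rw [integ, integ, Function.iterate_succ_apply, Function.iterate_succ_apply, antider_congr hM h,
    mean_congr hM h]

theorem memLp_mul {f g : ℝ → ℝ} (hf : Continuous f) (hg : Continuous g) :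
    MemLp (fun x => f x * g x) 2 (volume.restrict (Ioc 0 M)) := memLp_of_continuous (hf.mul hg)

/-- Multiplication by a continuous function, as a map into `L²`; zero if the function is not
continuous. -/
def mulL2 (M : ℝ) (f : ℝ → ℝ) : smoothPer M →ₗ[ℝ] L2 M :=
  open scoped Classical in
  if hf : Continuous f then
    { toFun := fun v => toL2 M fun x => f x * (v : ℝ → ℝ) x
      map_add' := fun v w => by
        have hv := smoothPer_continuous v
        have hw := smoothPer_continuous w
        rw [← toL2_add (memLp_mul hf hv) (memLp_mul hf hw)]
        congr 1; funext x
        exact mul_add _ _ _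
      map_smul' := fun r v => by
        have hv := smoothPer_continuous v
        rw [RingHom.id_apply, ← toL2_const_mul (memLp_mul hf hv)]
        congr 1; funext x
        exact mul_left_comm _ _ _ }
  else 0

theorem mulL2_apply {f : ℝ → ℝ} (hf : Continuous f) (v : smoothPer M) :
    mulL2 M f v = toL2 M fun x => f x * (v : ℝ → ℝ) x := by
  simp only [mulL2, hf, dite_true]; rfl

/-- The `i`-th derivative of smooth periodic functions. -/
def derivPer (M : ℝ) (i : ℕ) : smoothPer M →ₗ[ℝ] smoothPer M where
  toFun v := ⟨iteratedDeriv i (v : ℝ → ℝ), iteratedDeriv_smoothPer v i⟩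
  map_add' f g := by
    apply Subtype.ext; funext x
    exact iteratedDeriv_add (contDiff_infty.1 f.2.1 i).contDiffAt (contDiff_infty.1 g.2.1 i).contDiffAt
  map_smul' c f := by
    apply Subtype.ext; funext x
    exact iteratedDeriv_const_smul (contDiff_infty.1 f.2.1 i).contDiffAt c

/-- The operator dual to `spatial` in the unknown `w` with `u = integ n w`. -/
def dualOp (hM : 0 < M) (n : ℕ) (a b c d : ℝ → ℝ) : smoothPer M →ₗ[ℝ] L2 M :=
  (ContinuousLinearMap.adjoint (integL hM n)).toLinearMap ∘ₗ
    (∑ i ∈ Finset.range 4, mulL2 M (adjCoeff a b c d i) ∘ₗ derivPer M i) ∘ₗ sharp M n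

theorem dualOp_apply (hM : 0 < M) (n : ℕ) (a b c d : ℝ → ℝ) (ψ : smoothPer M) :
    dualOp hM n a b c d ψ = ContinuousLinearMap.adjoint (integL hM n)
      (∑ i ∈ Finset.range 4, mulL2 M (adjCoeff a b c d i) (derivPer M i (sharp M n ψ))) := by
  simp [dualOp]

/-- The functional represented by pairing with `f` in the unknown `w`. -/
def pairing (M : ℝ) (n : ℕ) (f : ℝ → ℝ) : smoothPer M →ₗ[ℝ] ℝ :=
  (innerₛₗ ℝ (toL2 M f)) ∘ₗ smoothToL2 M ∘ₗ sharp M n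

theorem pairing_apply (hM : 0 < M) (n : ℕ) {f : ℝ → ℝ}
    (hf : MemLp f 2 (volume.restrict (Ioc 0 M))) (ψ : smoothPer M) :
    pairing M n f ψ = ∫ x in (0 : ℝ)..M, f x * (sharp M n ψ : ℝ → ℝ) x := by
  rw [← inner_toL2 hM hf (smoothPer_memLp _)]; rfl

/-- The functionals detecting the `L²` norm of the derivative. -/
def derivTest (hM : 0 < M) (κ : ℝ) (i : ℤ × Bool) : L2 M :=
  (Real.sqrt (κ / M) * freq M i.1) • smoothToL2 M (if i.2 then cosPer hM i.1 else sinPer hM i.1)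

/-- The cosine and sine functionals at one frequency together give `|ŵ_k|²`. Their scaling makes the
sum a partial Parseval sum for `κ ‖w_x‖²`, while each functional stays bounded on `L²`. -/
theorem sum_derivTest (hM : 0 < M) {κ : ℝ} (hκ : 0 ≤ κ) (w : L2 M) (S : Finset ℤ) :
    ∑ i ∈ S ×ˢ Finset.univ, ⟪w, derivTest hM κ i⟫ ^ 2 =
      ∑ k ∈ S, κ * M * (freq M k ^ 2 * ‖perCoeff M w k‖ ^ 2) := by
  rw [Finset.sum_product]
  refine Finset.sum_congr rfl fun k _ => ?_
  rw [norm_perCoeff_sq (intervalIntegrable_of_memLp hM (Lp.memLp w)), cosCoeff_coe hM,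
    sinCoeff_coe hM]
  simp only [derivTest, Fintype.sum_bool, inner_smul_right, mul_pow,
    Real.sq_sqrt (by positivity : 0 ≤ κ / M), if_true, Bool.false_eq_true, if_false]
  field_simp

/-- Bessel's inequality for `w_x`, after enlarging the index set to contain both functionals at each
of its frequencies. This replaces the true dissipation by the bounded functionals used in
`EvolutionForm`. -/
theorem sum_derivTest_le (hM : 0 < M) {κ : ℝ} (hκ : 0 ≤ κ) {w : ℝ → ℝ} (hw : ContDiff ℝ 1 w)
    (hwp : Function.Periodic w M) (s : Finset (ℤ × Bool)) :
    ∑ i ∈ s, ⟪toL2 M w, derivTest hM κ i⟫ ^ 2 ≤ κ * ∫ x in (0 : ℝ)..M, deriv w x ^ 2 := by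
  classical
  have h1 : s ⊆ s.image Prod.fst ×ˢ Finset.univ := fun i hi =>
    Finset.mem_product.2 ⟨Finset.mem_image_of_mem _ hi, Finset.mem_univ _⟩
  refine (Finset.sum_le_sum_of_subset_of_nonneg h1 fun _ _ _ => sq_nonneg _).trans ?_
  rw [sum_derivTest hM hκ]
  have hP := hasSum_perCoeff_sq hM (memLp_of_continuous (M := M) (hw.continuous_deriv le_rfl))
  have h2 : ∀ k, freq M k ^ 2 * ‖perCoeff M (toL2 M w) k‖ ^ 2 = ‖perCoeff M (deriv w) k‖ ^ 2 :=
    fun k => by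
      rw [perCoeff_congr (coeFn_toL2 (memLp_of_continuous hw.continuous)) hM,
        perCoeff_deriv hM hw hwp, norm_mul, norm_mul, Complex.norm_I, Complex.norm_real, mul_one,
        Real.norm_eq_abs, mul_pow, sq_abs]
  simp only [h2, ← Finset.mul_sum]
  have h3 := sum_le_hasSum (s.image Prod.fst) (fun _ _ => sq_nonneg _) hP
  calc _ ≤ κ * M * (1 / M * ∫ x in (0 : ℝ)..M, deriv w x ^ 2) := by gcongr
    _ = _ := by field_simp

namespace Coeffs

variable {τ T R δ δ' L : ℝ} {n : ℕ} {a a' b b' c d r r' : ℝ → ℝ → ℝ} {m : ℝ → ℝ}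

theorem continuousOn_adjCoeff (h : Coeffs M τ T n R δ a a' b b' c d) (hn : 1 ≤ n) (i : ℕ) :
    ContinuousOn (Function.uncurry fun t => adjCoeff (a t) (b t) (c t) (d t) i) (Icc τ T ×ˢ univ) := by
  match i with
  | 0 => exact (((h.a_cont 3 (by omega)).neg.add (h.b_cont 2 (by omega))).sub
      (h.c_cont 1 (by omega))).add (h.d_cont 0 (by omega))
  | 1 => exact ((continuousOn_const.mul (h.a_cont 2 (by omega))).add
      (continuousOn_const.mul (h.b_cont 1 (by omega)))).sub (h.c_cont 0 (by omega))
  | 2 => exact (continuousOn_const.mul (h.a_cont 1 (by omega))).add (h.b_cont 0 (by omega))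
  | 3 => exact (h.a_cont 0 (by omega)).neg
  | (k + 4) => exact continuousOn_const

/-- The adjoint of `integL` puts `integ M n w` back into the pairing, and integration by parts
restores `spatial`. It serves both the energy estimate for smooth `w` and the recovery of the
equation for the weak limit, where `4 ≤ n` makes `integ M n w` three times differentiable. -/
theorem inner_dualOp (h : Coeffs M τ T n R δ a a' b b' c d) (hn : 1 ≤ n) {t : ℝ} (ht : t ∈ Icc τ T)
    (w : L2 M) {u : ℝ → ℝ} (hu : integ M n w = u) (hus : ContDiff ℝ 3 u)
    (ψ : smoothPer M) :
    ⟪w, dualOp h.M_pos n (a t) (b t) (c t) (d t) ψ⟫ =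
      ∫ x in (0 : ℝ)..M, spatial (a t) (b t) (c t) (d t) u x * (sharp M n ψ : ℝ → ℝ) x := by
  have hM := h.M_pos
  have hup : Function.Periodic u M := hu ▸ integ_periodic hM _ (by omega)
  have hc : ∀ i, Continuous (adjCoeff (a t) (b t) (c t) (d t) i) := fun i =>
    continuous_section (h.continuousOn_adjCoeff hn i) ht
  rw [dualOp_apply, ContinuousLinearMap.adjoint_inner_right, integL_apply, hu]
  rw [integral_spatial_mul ((h.a_smooth t ht).of_le (by exact_mod_cast (by omega : 3 ≤ n + 3)))
    ((h.b_smooth t ht).of_le (by exact_mod_cast (by omega : 2 ≤ n + 2)))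
    ((h.c_smooth t ht).of_le (by exact_mod_cast hn)) (h.d_smooth t ht).continuous hus
    (contDiff_infty.1 (sharp M n ψ).2.1 3) (h.a_per t ht) (h.b_per t ht) (h.c_per t ht) hup
    (sharp M n ψ).2.2, inner_sum]
  have hη : ∀ i, Continuous (iteratedDeriv i (sharp M n ψ : ℝ → ℝ)) := fun i =>
    (iteratedDeriv_smoothPer _ i).1.continuous
  simp only [Finset.mul_sum]
  have hi : ∀ i, Continuous fun x => u x * (adjCoeff (a t) (b t) (c t) (d t) i x *
      iteratedDeriv i (sharp M n ψ : ℝ → ℝ) x) := fun i => hus.continuous.mul ((hc i).mul (hη i))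
  rw [intervalIntegral.integral_finsetSum fun i _ => (hi i).intervalIntegrable _ _]
  refine Finset.sum_congr rfl fun i _ => ?_
  rw [mulL2_apply (hc i)]
  exact inner_toL2 hM (memLp_of_continuous hus.continuous) (memLp_mul (hc i) (hη i))

theorem continuousOn_dualOp (h : Coeffs M τ T n R δ a a' b b' c d) (hn : 1 ≤ n) (ψ : smoothPer M) :
    ContinuousOn (fun t => dualOp h.M_pos n (a t) (b t) (c t) (d t) ψ) (Icc τ T) := by
  simp only [dualOp_apply]
  refine (ContinuousLinearMap.continuous _).comp_continuousOn ?_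
  refine continuousOn_finsetSum _ fun i _ => ?_
  have h1 := h.continuousOn_adjCoeff hn i
  have h2 : ContinuousOn (fun t => toL2 M fun x => adjCoeff (a t) (b t) (c t) (d t) i x *
      (derivPer M i (sharp M n ψ) : ℝ → ℝ) x) (Icc τ T) :=
    continuousOn_toL2 h.M_pos (h1.mul
      ((smoothPer_continuous (derivPer M i (sharp M n ψ))).comp continuous_snd).continuousOn)
  exact h2.congr fun t ht => mulL2_apply (continuous_section h1 ht) _

/-- The abstract evolution problem for `w`. -/
theorem evolutionForm (h : Coeffs M τ T n R δ a a' b b' c d) (hn : 4 ≤ n)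
    (W : Weight M τ T n δ' L a b r r' m) (hδ' : 0 < δ') :
    EvolutionForm (smoothToL2 M) τ T (Real.exp (-L)) (Real.exp L) (energyConst n R L δ')
      (fun t => mulL2 M fun x => Real.exp (-r t x))
      (fun t => mulL2 M fun x => -r' t x * Real.exp (-r t x))
      (fun t => dualOp h.M_pos n (a t) (b t) (c t) (d t))
      (derivTest h.M_pos (δ' * Real.exp (-L))) := by
  have hM := h.M_pos
  have q_cont : ContinuousOn (Function.uncurry fun t x => Real.exp (-r t x)) (Icc τ T ×ˢ univ) :=
    Real.continuous_exp.comp_continuousOn W.cont.neg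
  have q'_cont : ContinuousOn (Function.uncurry fun t x => -r' t x * Real.exp (-r t x))
    (Icc τ T ×ˢ univ) := W.cont'.neg.mul q_cont
  have qc : ∀ t ∈ Icc τ T, Continuous fun x => Real.exp (-r t x) := fun t ht =>
    continuous_section q_cont ht
  have qc' : ∀ t ∈ Icc τ T, Continuous fun x => -r' t x * Real.exp (-r t x) := fun t ht =>
    continuous_section q'_cont ht
  have q_le : ∀ t ∈ Icc τ T, ∀ x, Real.exp (-r t x) ≤ Real.exp L := fun t ht x =>
    Real.exp_le_exp.2 ((neg_le_abs _).trans (W.le t ht x))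
  have le_q : ∀ t ∈ Icc τ T, ∀ x, Real.exp (-L) ≤ Real.exp (-r t x) := fun t ht x =>
    Real.exp_le_exp.2 (neg_le_neg ((le_abs_self _).trans (W.le t ht x)))
  have ii : ∀ {f : ℝ → ℝ}, Continuous f → IntervalIntegrable f volume 0 M := fun hf =>
    hf.intervalIntegrable _ _
  have form : ∀ {f : ℝ → ℝ}, Continuous f → ∀ v w : smoothPer M,
      ⟪mulL2 M f v, smoothToL2 M w⟫ = ∫ x in (0 : ℝ)..M, f x * (v : ℝ → ℝ) x * (w : ℝ → ℝ) x :=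
    fun hf v w => by
      rw [mulL2_apply hf, smoothToL2_apply, inner_toL2 hM
        (memLp_mul hf (smoothPer_continuous v)) (smoothPer_memLp w)]
  have cL2 : ∀ {f : ℝ → ℝ → ℝ}, ContinuousOn (Function.uncurry f) (Icc τ T ×ˢ univ) →
      ∀ v : smoothPer M, ContinuousOn (fun t => mulL2 M (f t) v) (Icc τ T) := fun {f} hf v => by
    have h2 : ContinuousOn (fun t => toL2 M fun x => f t x * (v : ℝ → ℝ) x) (Icc τ T) :=
      continuousOn_toL2 hM (hf.mul ((smoothPer_continuous v).comp continuous_snd).continuousOn)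
    exact h2.congr fun t ht => mulL2_apply (continuous_section hf ht) _
  refine ⟨smoothToL2_injective hM, fun t ht v w => ?_, fun t ht v => ?_, fun t ht v => ?_,
    cL2 q_cont, cL2 q'_cont, h.continuousOn_dualOp (by omega), fun t ht v w => ?_,
    fun t ht v s => ?_⟩
  · rw [form (qc t ht), form (qc t ht)]
    congr 1; funext x; ring
  · have vc := smoothPer_continuous v
    have := qc t ht
    rw [form (qc t ht), smoothToL2_apply, norm_toL2_sq hM (smoothPer_memLp v),
      ← intervalIntegral.integral_const_mul]
    apply intervalIntegral.integral_mono_on hM.le (ii (by fun_prop)) (ii (by fun_prop))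
    intro x _
    rw [mul_assoc, ← sq]
    exact mul_le_mul_of_nonneg_right (le_q t ht x) (sq_nonneg _)
  · have vc := smoothPer_continuous v
    have qct := qc t ht
    rw [form (qc t ht), mulL2_apply (qc t ht), norm_toL2_sq hM (memLp_mul qct vc),
      ← intervalIntegral.integral_const_mul]
    apply intervalIntegral.integral_mono_on hM.le (ii (by fun_prop)) (ii (by fun_prop))
    intro x _
    have h1 : (Real.exp (-r t x) * (v : ℝ → ℝ) x) ^ 2 =
      Real.exp (-r t x) * (Real.exp (-r t x) * (v : ℝ → ℝ) x * (v : ℝ → ℝ) x) := by ring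
    rw [h1]
    refine mul_le_mul_of_nonneg_right (q_le t ht x) ?_
    rw [mul_assoc]; exact mul_nonneg (Real.exp_pos _).le (mul_self_nonneg _)
  · have ht' := Ioo_subset_Icc_self ht
    have vwc : Continuous fun p : ℝ × ℝ => (v : ℝ → ℝ) p.2 * (w : ℝ → ℝ) p.2 :=
      ((smoothPer_continuous v).comp continuous_snd).mul ((smoothPer_continuous w).comp continuous_snd)
    have h1 := hasDerivAt_integral_param (q_cont.mul vwc.continuousOn)
      (g := fun t x => Real.exp (-r t x) * ((v : ℝ → ℝ) x * (w : ℝ → ℝ) x))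
      (g' := fun t x => -r' t x * Real.exp (-r t x) * ((v : ℝ → ℝ) x * (w : ℝ → ℝ) x))
      (q'_cont.mul vwc.continuousOn) (fun s hs x => ?_) 0 M ht
    · simp only [← mul_assoc] at h1
      rw [form (qc' t ht')]
      refine h1.congr_of_eventuallyEq ?_
      filter_upwards [isOpen_Ioo.mem_nhds ht] with s hs
      exact form (qc s (Ioo_subset_Icc_self hs)) v w
    · have := ((W.hasDeriv s hs x).neg.exp).mul_const ((v : ℝ → ℝ) x * (w : ℝ → ℝ) x)
      refine this.congr_deriv ?_
      simp only [Pi.neg_apply]; ring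
  · have ht' := Ioo_subset_Icc_self ht
    have vc := smoothPer_continuous v
    have qct := qc t ht'
    -- The Galerkin unknown `Q v`. The form `⟪Q v, v⟫` is `∫ w v = ∫ e^r w²`, so the abstract
    -- inequality is exactly `energy_le`.
    set w : ℝ → ℝ := fun x => Real.exp (-r t x) * (v : ℝ → ℝ) x with hw
    have wc : Continuous w := qct.mul vc
    have wm := memLp_of_continuous (M := M) wc
    have ws : ContDiff ℝ 3 w := ((W.smooth t ht').neg.exp).mul (contDiff_infty.1 v.2.1 3)
    have wp : Function.Periodic w M := fun x => by simp only [hw, W.per t ht' x, v.2.2 x]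
    have hE := h.energy_le hn W hδ' ht' v (w := w) fun _ => rfl
    have h1 : integ M n (toL2 M w) = integ M n w := integ_congr hM (by omega) (coeFn_toL2 wm)
    have h2 : ContDiff ℝ 3 (integ M n w) :=
      (contDiff_integ_of_contDiff hM ws wp n).of_le (by exact_mod_cast (by omega : 3 ≤ 3 + n))
    have h3 : ∫ x in (0 : ℝ)..M, -r' t x * Real.exp (-r t x) * (v : ℝ → ℝ) x * (v : ℝ → ℝ) x =
        -∫ x in (0 : ℝ)..M, r' t x * (w x * (v : ℝ → ℝ) x) := by
      rw [← intervalIntegral.integral_neg]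
      congr 1; funext x; simp only [hw]; ring
    have h4 := sum_derivTest_le hM (by positivity : 0 ≤ δ' * Real.exp (-L)) (ws.of_le (by norm_num)) wp s
    rw [form (qc' t ht'), form qct, h3, mulL2_apply qct, h.inner_dualOp (by omega) ht' _ h1 h2]
    linarith

end Coeffs
end DispersivePDE

/-! ### Mollifiers, sources, and weak solutions. -/

namespace DispersivePDE

variable {M : ℝ}

/-- Smooth periodic approximations of the point evaluation at `x₀`. -/
theorem exists_mollifier (hM : 0 < M) (x₀ : ℝ) : ∃ η : ℕ → smoothPer M,
    (∀ j, ∀ f : ℝ → ℝ, Continuous f → ∀ C, (∀ x, |f x| ≤ C) →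
      |∫ x in (0 : ℝ)..M, f x * (η j : ℝ → ℝ) x| ≤ C) ∧
    ∀ f : ℝ → ℝ, Continuous f → Function.Periodic f M →
      Tendsto (fun j => ∫ x in (0 : ℝ)..M, f x * (η j : ℝ → ℝ) x) atTop (𝓝 (f x₀)) := by
  -- Normalized powers of `1 + cos` concentrate at its unique maximum `x₀` on the period centred
  -- there; they are smooth, periodic, nonnegative and of integral one.
  set c : ℝ → ℝ := fun x => 1 + Real.cos (freq M 1 * (x - x₀)) with hc
  have cc : Continuous c := by fun_prop
  have c0 : ∀ x, 0 ≤ c x := fun x => by simp only [hc]; linarith [Real.neg_one_le_cos (freq M 1 * (x - x₀))]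
  have cp : Function.Periodic c M := fun x => by
    have h1 : freq M 1 * (x + M - x₀) = freq M 1 * (x - x₀) + ((1 : ℤ) : ℝ) * (2 * Real.pi) := by
      rw [← freq_mul_period hM]; ring
    simp only [hc, h1, Real.cos_add_int_mul_two_pi]
  have cs : ContDiff ℝ ∞ c := by fun_prop
  set I : ℕ → ℝ := fun j => ∫ x in (0 : ℝ)..M, c x ^ j with hI
  have shift : ∀ {f : ℝ → ℝ}, Function.Periodic f M →
      ∫ x in (0 : ℝ)..M, f x = ∫ x in Icc (x₀ - M / 2) (x₀ + M / 2), f x := fun hf => by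
    have h1 := hf.intervalIntegral_add_eq 0 (x₀ - M / 2)
    rw [zero_add, show x₀ - M / 2 + M = x₀ + M / 2 by ring] at h1
    rw [h1, intervalIntegral.integral_of_le (by linarith), integral_Icc_eq_integral_Ioc]
  have Ipos : ∀ j, 0 < I j := fun j => by
    have h1 := (cp.comp (fun y => y ^ j)).intervalIntegral_add_eq 0 (x₀ - M / 4)
    rw [zero_add] at h1
    have h2 : 0 < ∫ x in (x₀ - M / 4)..(x₀ - M / 4 + M), c x ^ j := by
      apply intervalIntegral.integral_pos (by linarith) (by fun_prop)
        (fun x _ => pow_nonneg (c0 x) j)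
      refine ⟨x₀, ⟨by linarith, by linarith⟩, ?_⟩
      simp [hc]
    exact h2.trans_eq h1.symm
  refine ⟨fun j => ⟨fun x => (I j)⁻¹ * c x ^ j, contDiff_const.mul (cs.pow j), fun x => by
    simp only [cp x]⟩, fun j f hf C hC => ?_, fun f hf hfp => ?_⟩
  · have h1 : ∀ x, ‖f x * ((I j)⁻¹ * c x ^ j)‖ ≤ C * ((I j)⁻¹ * c x ^ j) := fun x => by
      have h2 : 0 ≤ (I j)⁻¹ * c x ^ j := mul_nonneg (inv_nonneg.2 (Ipos j).le) (pow_nonneg (c0 x) j)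
      rw [norm_mul, Real.norm_eq_abs, Real.norm_eq_abs, abs_of_nonneg h2]
      exact mul_le_mul_of_nonneg_right (hC x) h2
    have h3 : Continuous fun x => C * ((I j)⁻¹ * c x ^ j) := by fun_prop
    refine (intervalIntegral.norm_integral_le_of_norm_le hM.le (ae_of_all _ fun x _ => h1 x)
      (h3.intervalIntegrable _ _)).trans_eq ?_
    rw [intervalIntegral.integral_const_mul, intervalIntegral.integral_const_mul]
    change C * ((I j)⁻¹ * I j) = C
    rw [inv_mul_cancel₀ (Ipos j).ne', mul_one]
  · have hpeak := tendsto_setIntegral_pow_smul_of_unique_maximum_of_isCompact_of_continuousOn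
      (μ := volume) (s := Icc (x₀ - M / 2) (x₀ + M / 2)) (x₀ := x₀) (c := c) (g := f) isCompact_Icc
      cc.continuousOn (fun y hy hne => ?_) (fun x _ => c0 x) (by simp [hc])
      (by
        rw [interior_Icc]
        exact subset_closure ⟨by linarith, by linarith⟩) hf.continuousOn
    · refine hpeak.congr fun j => ?_
      have e1 : ∫ x in Icc (x₀ - M / 2) (x₀ + M / 2), c x ^ j = I j :=
        (shift (f := fun x => c x ^ j) fun x => by simp only [cp x]).symm
      have e2 : ∫ x in Icc (x₀ - M / 2) (x₀ + M / 2), c x ^ j • f x =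
          ∫ x in (0 : ℝ)..M, c x ^ j • f x :=
        (shift (f := fun x => c x ^ j • f x) fun x => by simp only [cp x, hfp x]).symm
      rw [e1, e2, smul_eq_mul, ← intervalIntegral.integral_const_mul]
      congr 1; funext x
      simp only [smul_eq_mul]
      ring
    · simp only [hc, sub_self, mul_zero, Real.cos_zero]
      have h1 : freq M 1 * (y - x₀) ≠ 0 := mul_ne_zero (freq_ne_zero hM one_ne_zero) (sub_ne_zero.2 hne)
      have h2 : |freq M 1 * (y - x₀)| ≤ Real.pi := by
        have h3 : |y - x₀| ≤ M / 2 := by rw [abs_le]; constructor <;> linarith [hy.1, hy.2]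
        rw [abs_mul, abs_of_pos (show 0 < freq M 1 by simp [freq]; positivity)]
        calc freq M 1 * |y - x₀| ≤ freq M 1 * (M / 2) := by
              have : 0 < freq M 1 := by simp [freq]; positivity
              gcongr
          _ = Real.pi := by simp [freq]; field_simp
      have h4 : Real.cos (freq M 1 * (y - x₀)) < 1 := by
        refine lt_of_le_of_ne (Real.cos_le_one _) fun h => h1 ?_
        rw [abs_le] at h2
        exact (Real.cos_eq_one_iff_of_lt_of_lt (by linarith [Real.pi_pos]) (by linarith [Real.pi_pos])).1 h
      linarith

/-- Monotone convergence for series of nonnegative functions. -/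
theorem integrable_tsum_of_sum_le {α κ : Type*} [Countable κ] [MeasurableSpace α] {μ : Measure α}
    {f : κ → α → ℝ} (hf0 : ∀ k x, 0 ≤ f k x) (hfi : ∀ k, Integrable (f k) μ) {K : ℝ}
    (hK : ∀ S : Finset κ, ∑ k ∈ S, ∫ x, f k x ∂μ ≤ K) :
    (∀ᵐ x ∂μ, Summable fun k => f k x) ∧ Integrable (fun x => ∑' k, f k x) μ ∧
      ∫ x, ∑' k, f k x ∂μ ≤ K := by
  have hs : Summable fun k => ∫ x, f k x ∂μ :=
    summable_of_sum_le (fun k => integral_nonneg (hf0 k)) hK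
  have h1 := hasSum_integral_of_summable_integral_norm hfi (by
    simpa only [Real.norm_of_nonneg (hf0 _ _)] using hs)
  have hm : ∀ k, AEMeasurable (fun x => ENNReal.ofReal (f k x)) μ := fun k =>
    (hfi k).aestronglyMeasurable.aemeasurable.ennreal_ofReal
  have h2 : ∫⁻ x, ∑' k, ENNReal.ofReal (f k x) ∂μ ≠ ⊤ := by
    rw [lintegral_tsum hm]
    simp only [← ofReal_integral_eq_lintegral_ofReal (hfi _) (ae_of_all _ (hf0 _))]
    rw [← ENNReal.ofReal_tsum_of_nonneg (fun k => integral_nonneg (hf0 k)) hs]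
    exact ENNReal.ofReal_ne_top
  have hmt : AEMeasurable (fun x => ∑' k, ENNReal.ofReal (f k x)) μ := AEMeasurable.tsum hm
  refine ⟨?_, ?_, ?_⟩
  · filter_upwards [ae_lt_top' hmt h2] with x hx
    have := ENNReal.summable_toReal hx.ne
    simpa only [ENNReal.toReal_ofReal (hf0 _ _)] using this
  · have h3 := integrable_toReal_of_lintegral_ne_top hmt h2
    refine h3.congr (ae_of_all _ fun x => ?_)
    beta_reduce
    rw [ENNReal.tsum_toReal_eq fun _ => ENNReal.ofReal_ne_top]
    simp only [ENNReal.toReal_ofReal (hf0 _ _)]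
  · rw [← h1.tsum_eq]
    exact hs.tsum_le_of_sum_le hK

/-- The source term: a bounded measurable function of time with values in `H^n`. -/
structure Source (M τ T : ℝ) (n : ℕ) (B : ℝ) (e : ℝ → ℝ → ℝ) : Prop where
  mem : ∀ᵐ t ∂(volume.restrict (Icc τ T)), MemH M n (e t)
  cont : ∀ᵐ t ∂(volume.restrict (Icc τ T)), Continuous (e t)
  le : ∀ᵐ t ∂(volume.restrict (Icc τ T)), normH M n (e t) ≤ B
  meas : ∀ k : ℤ, AEStronglyMeasurable (fun t => perCoeff M (e t) k) (volume.restrict (Icc τ T))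

/-- Measurability of the source is known only for its Fourier coefficients. Parseval's identity
exhibits the pairing as an almost everywhere limit of finite combinations of them. -/
theorem Source.pairing_meas (hM : 0 < M) {τ T B : ℝ} {n : ℕ} {e : ℝ → ℝ → ℝ} (he : Source M τ T n B e)
    (ψ : smoothPer M) :
    AEStronglyMeasurable (fun t => pairing M n (e t) ψ) (volume.restrict (Icc τ T)) := by
  have h1 : ∀ S : Finset ℤ, AEStronglyMeasurable (fun t => M * ∑ k ∈ S,
      ⟪perCoeff M (e t) k, perCoeff M (sharp M n ψ) k⟫) (volume.restrict (Icc τ T)) := fun S =>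
    (Finset.aestronglyMeasurable_fun_sum S fun k _ =>
      (he.meas k).inner aestronglyMeasurable_const).const_mul M
  refine aestronglyMeasurable_of_tendsto_ae (atTop : Filter (Finset ℤ)) h1 ?_
  filter_upwards [he.mem] with t ht
  have h2 := (hasSum_inner_perCoeff hM ht.2 (smoothPer_memLp (sharp M n ψ))).mul_left M
  rw [← mul_assoc, mul_one_div_cancel hM.ne', one_mul, ← pairing_apply hM n ht.2] at h2
  simpa only [HasSum, Finset.mul_sum] using! h2

/-- A function in `H^n` and its derivatives of order less than `n` are bounded. -/
theorem MemH.abs_iteratedDeriv_le (hM : 0 < M) {R : ℝ} (hR : 1 ≤ R) (hMR : M ≤ R) {f : ℝ → ℝ} {n j : ℕ}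
    (hf : MemH M n f) (hc : Continuous f) (hj : j < n) (x : ℝ) :
    |iteratedDeriv j f x| ≤ (R ^ n + 1) * (normH M n f / Real.sqrt M) := by
  obtain ⟨w, hw, rfl⟩ := hf.exists_integ hM (by omega) hc
  have := abs_iteratedDeriv_integ_le hM hR hMR (Lp.memLp w) hj x
  rw [toL2_coe] at this
  exact this.trans (by gcongr)

/-- `u ∈ L^∞([τ, T]; H^n)` solves the equation on `[τ, T]`. -/
structure SolvesOn (M τ T : ℝ) (n : ℕ) (a b c d e : ℝ → ℝ → ℝ) (u₀ : ℝ → ℝ)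
    (u : ℝ → ℝ → ℝ) : Prop where
  mem : ∀ᵐ t ∂(volume.restrict (Icc τ T)), MemH M n (u t)
  bound : ∃ C : ℝ, ∀ᵐ t ∂(volume.restrict (Icc τ T)), normH M n (u t) ≤ C
  periodic : ∀ t ∈ Icc τ T, Function.Periodic (u t) M
  contDiff : ∀ t ∈ Icc τ T, ContDiff ℝ 3 (u t)
  integrable : ∀ x, IntegrableOn (fun s => rhs a b c d e u s x) (Icc τ T)
  eqn : ∀ t ∈ Icc τ T, ∀ x, u t x = u₀ x + ∫ s in τ..t, rhs a b c d e u s x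

theorem rhs_eq (a b c d e u : ℝ → ℝ → ℝ) (t x : ℝ) :
    rhs a b c d e u t x = spatial (a t) (b t) (c t) (d t) (u t) x + e t x := rfl

namespace Coeffs

variable {τ T R δ : ℝ} {n : ℕ} {a a' b b' c d : ℝ → ℝ → ℝ}

theorem abs_spatial_le (h : Coeffs M τ T n R δ a a' b b' c d) {t : ℝ}
    (ht : t ∈ Icc τ T) {u : ℝ → ℝ} {x B : ℝ} (hB : ∀ j ≤ 3, |iteratedDeriv j u x| ≤ B) :
    |spatial (a t) (b t) (c t) (d t) u x| ≤ 4 * (R * B) := by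
  have hR : 0 ≤ R := by linarith [h.one_le]
  have c0B : |c t x| ≤ R := by simpa using h.c_le t ht x 0 (by omega)
  have d0B : |d t x| ≤ R := by simpa using h.d_le t ht x 0 (by omega)
  have t3 := mul_le_mul (h.abs_a_le ht x) (hB 3 (by omega)) (abs_nonneg _) hR
  have t2 := mul_le_mul (h.abs_b_le ht x) (hB 2 (by omega)) (abs_nonneg _) hR
  have t1 := mul_le_mul c0B (hB 1 (by omega)) (abs_nonneg _) hR
  have t0 := mul_le_mul d0B (hB 0 (by omega)) (abs_nonneg _) hR
  rw [← abs_mul] at t3 t2 t1 t0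
  rw [iteratedDeriv_one] at t1
  rw [iteratedDeriv_zero] at t0
  rw [spatial]
  rw [abs_le] at t3 t2 t1 t0 ⊢
  constructor <;> linarith [t3.1, t3.2, t2.1, t2.2, t1.1, t1.2, t0.1, t0.2]

theorem continuous_spatial (h : Coeffs M τ T n R δ a a' b b' c d) {t : ℝ} (ht : t ∈ Icc τ T)
    {u : ℝ → ℝ} (hu : ContDiff ℝ 3 u) : Continuous (spatial (a t) (b t) (c t) (d t) u) := by
  have u3 : Continuous (iteratedDeriv 3 u) := (contDiff_iteratedDeriv (k := 0) (n := 3) hu).continuous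
  have u2 : Continuous (iteratedDeriv 2 u) := (contDiff_iteratedDeriv (k := 1) (n := 2) hu).continuous
  have u1 : Continuous (deriv u) := hu.continuous_deriv (by norm_num)
  exact ((((h.a_smooth t ht).continuous.mul u3).add ((h.b_smooth t ht).continuous.mul u2)).add
    ((h.c_smooth t ht).continuous.mul u1)).add ((h.d_smooth t ht).continuous.mul hu.continuous)

/-- Existence of a solution in weak form, with the energy bounds. -/
theorem exists_weak (h : Coeffs M τ T n R δ a a' b b' c d) (hn : 4 ≤ n) {L : ℝ}
    (hL : L = ((|(n : ℝ)| + 1) * R ^ 2 + 4 * R ^ 5)) {X : ℝ}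
    (hX : X = Real.exp ((energyConst n R L (δ / R) + 1) * R) * Real.exp L * (1 + 2 * R))
    {u₀ : ℝ → ℝ} (hu₀ : InitialData M n u₀) {e : ℝ → ℝ → ℝ} {B : ℝ} (hB : 0 ≤ B)
    (he : Source M τ T n B e) :
    ∃ w : ℝ → L2 M, (∀ t ∈ Icc τ T, ‖w t‖ ^ 2 ≤ Real.exp L * X * (normH M n u₀ ^ 2 + B ^ 2)) ∧
      (∀ x, ContinuousOn (fun t => ⟪w t, x⟫) (Icc τ T)) ∧
      (∀ t ∈ Icc τ T, ∀ ψ, ⟪w t, smoothToL2 M ψ⟫ = pairing M n u₀ ψ +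
        ∫ s in τ..t, (⟪w s, dualOp h.M_pos n (a s) (b s) (c s) (d s) ψ⟫ + pairing M n (e s) ψ)) ∧
      ∀ S : Finset ℤ, (∫ s in τ..T, ∑ k ∈ S, δ / R * Real.exp (-L) * M *
        (freq M k ^ 2 * ‖perCoeff M (w s) k‖ ^ 2)) ≤ X * (normH M n u₀ ^ 2 + B ^ 2) := by
  have hM := h.M_pos
  have hR := h.one_le
  have hδ' : 0 < δ / R := div_pos h.delta_pos (by linarith)
  -- The parameter is `n` because `n` differentiations turn the coefficient of the second-order term
  -- into `n a_x + b`.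
  obtain ⟨r, r', m, W⟩ := h.exists_weight (by omega) n
  rw [← hL] at W
  have hL0 : 0 ≤ L := (abs_nonneg _).trans (W.le τ ⟨le_rfl, h.lt.le⟩ 0)
  have hC0 : 0 ≤ energyConst n R L (δ / R) := by
    rw [energyConst]; positivity
  have bound_pair : ∀ {f : ℝ → ℝ}, MemH M n f → ∀ {C}, normH M n f ≤ C → ∀ v : smoothPer M,
      |pairing M n f v| ≤ C * ‖smoothToL2 M v‖ := fun hf _ hC v => by
    rw [pairing_apply hM n hf.2]
    exact (abs_integral_mul_sharp_le hM (by omega) hf v).trans (by gcongr)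
  obtain ⟨w, hw1, hw2, hw3, hw4⟩ := (h.evolutionForm hn W hδ').exists_solution h.lt
    (denseRange_smoothToL2 hM) (Real.exp_pos _) (Real.exp_pos _).le hC0 (pairing M n u₀)
    (bound_pair hu₀.1 le_rfl) (fun t => pairing M n (e t)) (he.pairing_meas hM) hB (by
      filter_upwards [he.mem, he.le] with t h1 h2 using bound_pair h1 h2)
  have hlt := h.lt
  have hlen := h.len_le
  -- The length `T - τ` is replaced by its bound `R`, so that the constant is common to all
  -- subintervals and all admissible data.
  have hval : Real.exp ((energyConst n R L (δ / R) + 1) * (T - τ)) *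
      (normH M n u₀ ^ 2 / Real.exp (-L) + 2 * B ^ 2 * (T - τ) / Real.exp (-L)) ≤
      X * (normH M n u₀ ^ 2 + B ^ 2) := by
    have e1 : normH M n u₀ ^ 2 / Real.exp (-L) + 2 * B ^ 2 * (T - τ) / Real.exp (-L) =
      Real.exp L * (normH M n u₀ ^ 2 + 2 * B ^ 2 * (T - τ)) := by
      rw [Real.exp_neg]; field_simp
    have e2 : normH M n u₀ ^ 2 + 2 * B ^ 2 * (T - τ) ≤ (1 + 2 * R) * (normH M n u₀ ^ 2 + B ^ 2) := by
      nlinarith [sq_nonneg (normH M n u₀), sq_nonneg B]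
    have e3 : Real.exp ((energyConst n R L (δ / R) + 1) * (T - τ)) ≤
        Real.exp ((energyConst n R L (δ / R) + 1) * R) := by
      apply Real.exp_le_exp.2; gcongr
    have e4 : 0 ≤ normH M n u₀ ^ 2 + 2 * B ^ 2 * (T - τ) := by
      have : 0 ≤ T - τ := by linarith
      positivity
    rw [e1, hX]
    calc _ ≤ Real.exp ((energyConst n R L (δ / R) + 1) * R) *
          (Real.exp L * ((1 + 2 * R) * (normH M n u₀ ^ 2 + B ^ 2))) := by gcongr
      _ = _ := by ring
  refine ⟨w, fun t ht => (hw1 t ht).trans ?_, hw2, hw3, fun S => ?_⟩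
  · rw [mul_assoc (Real.exp L)]
    exact mul_le_mul_of_nonneg_left hval (Real.exp_pos _).le
  · refine le_trans (le_of_eq ?_) ((hw4 (S ×ˢ Finset.univ)).trans hval)
    congr 1; funext s
    rw [sum_derivTest hM (by positivity)]

end Coeffs
end DispersivePDE

/-! ### Existence with uniform bounds. -/

namespace DispersivePDE

variable {M : ℝ}

/-- The increment of `f` is paired with a bounded vector and vanishes in norm; the remaining
increment has a fixed second argument, where weak continuity applies. -/
theorem continuousOn_inner_of_weak {H : Type*} [NormedAddCommGroup H] [InnerProductSpace ℝ H]
    {S : Set ℝ} {w f : ℝ → H} (hw : ∀ x, ContinuousOn (fun t => ⟪w t, x⟫) S) {C : ℝ}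
    (hC : ∀ t ∈ S, ‖w t‖ ≤ C) (hf : ContinuousOn f S) : ContinuousOn (fun t => ⟪w t, f t⟫) S := by
  intro t ht
  have h1 : Tendsto (fun s => ⟪w s, f s - f t⟫) (𝓝[S] t) (𝓝 0) := by
    have h2 : Tendsto (fun s => C * ‖f s - f t‖) (𝓝[S] t) (𝓝 0) := by
      have := ((hf t ht).sub_const (f t)).norm.const_mul C
      simpa using this
    refine squeeze_zero_norm' ?_ h2
    filter_upwards [self_mem_nhdsWithin] with s hs
    exact (abs_real_inner_le_norm _ _).trans (by gcongr; exact hC s hs)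
  have h3 := h1.add (hw (f t) t ht)
  simp only [zero_add] at h3
  refine h3.congr fun s => ?_
  rw [inner_sub_right]; ring

/-- Existence for the linear equation, with bounds depending only on the data. -/
theorem exists_solvesOn {n : ℕ} (hn : 4 ≤ n) {R δ : ℝ} (hR : 1 ≤ R) (hδ : 0 < δ) :
    ∃ K : ℝ, 0 < K ∧ ∀ {M τ T : ℝ} {a a' b b' c d : ℝ → ℝ → ℝ}, Coeffs M τ T n R δ a a' b b' c d →
      ∀ {u₀ : ℝ → ℝ}, InitialData M n u₀ → ∀ {e : ℝ → ℝ → ℝ} {B : ℝ}, 0 ≤ B → Source M τ T n B e →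
      ∃ u, SolvesOn M τ T n a b c d e u₀ u ∧
        (∀ t ∈ Icc τ T, MemH M n (u t) ∧ normH M n (u t) ^ 2 ≤ K * (normH M n u₀ ^ 2 + B ^ 2)) ∧
        (∀ k, ContinuousOn (fun t => perCoeff M (u t) k) (Icc τ T)) ∧
        (∀ᵐ t ∂(volume.restrict (Icc τ T)), MemH M (n + 1) (u t)) ∧
        IntegrableOn (fun t => normH M (n + 1) (u t) ^ 2) (Icc τ T) ∧
        ∫ t in Icc τ T, normH M (n + 1) (u t) ^ 2 ≤ K * (normH M n u₀ ^ 2 + B ^ 2) := by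
  set L : ℝ := (|(n : ℝ)| + 1) * R ^ 2 + 4 * R ^ 5 with hL
  set X : ℝ := Real.exp ((energyConst n R L (δ / R) + 1) * R) * Real.exp L * (1 + 2 * R) with hX
  set κ : ℝ := δ / R * Real.exp (-L) with hκ
  have hR0 : 0 < R := by linarith
  have hκ0 : 0 < κ := mul_pos (div_pos hδ hR0) (Real.exp_pos _)
  have hX0 : 0 < X := by rw [hX]; positivity
  -- `(1 + R²)ⁿ` is the cost of passing from `w` to `u`. Inside, `exp L * X` bounds `‖w‖²` at each
  -- time, its multiple by `R` bounds the time integral, and `X / κ` bounds `∫ ‖w_x‖²`.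
  refine ⟨(1 + R ^ 2) ^ n * (X * (Real.exp L * (1 + R) + 1 / κ)), by positivity, ?_⟩
  intro M τ T a a' b b' c d h u₀ hu₀ e B hB he
  have hM := h.M_pos
  have hn0 : n ≠ 0 := by omega
  obtain ⟨w, hw1, hw2, hw3, hw4⟩ := h.exists_weak hn hL hX hu₀ hB he
  set Y := normH M n u₀ ^ 2 + B ^ 2 with hY
  have hY0 : 0 ≤ Y := by positivity
  have hs : 0 < Real.sqrt M := Real.sqrt_pos.2 hM
  have wm : ∀ t, MemLp (w t) 2 (volume.restrict (Ioc 0 M)) := fun t => Lp.memLp _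
  set u : ℝ → ℝ → ℝ := fun t => integ M n (w t) with hu
  have us : ∀ t, ContDiff ℝ 3 (u t) := fun t => by
    obtain ⟨k, rfl⟩ : ∃ k, n = k + 1 := ⟨n - 1, by omega⟩
    exact (contDiff_integ hM (wm t) k).of_le (by exact_mod_cast (by omega : 3 ≤ k))
  have up : ∀ t, Function.Periodic (u t) M := fun t => integ_periodic hM _ hn0
  have umem : ∀ t, MemH M n (u t) := fun t => memH_integ hM (wm t) hn0
  have unorm : ∀ t ∈ Icc τ T, normH M n (u t) ^ 2 ≤ (1 + R ^ 2) ^ n * (Real.exp L * X * Y) := fun t ht => by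
    refine (normH_integ_sq_le hM h.M_le (wm t) hn0).trans ?_
    rw [toL2_coe]
    gcongr
    exact hw1 t ht
  set C₁ := Real.sqrt (Real.exp L * X * Y) with hC₁
  have wC : ∀ t ∈ Icc τ T, ‖w t‖ ≤ C₁ := fun t ht => Real.le_sqrt_of_sq_le (hw1 t ht)
  have uB : ∀ t ∈ Icc τ T, ∀ x, ∀ j ≤ 3, |iteratedDeriv j (u t) x| ≤ (R ^ n + 1) * (C₁ / Real.sqrt M) :=
    fun t ht x j hj => by
      have := abs_iteratedDeriv_integ_le hM hR h.M_le (wm t) (show j < n by omega) x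
      rw [toL2_coe] at this
      refine this.trans ?_
      have := wC t ht
      gcongr
  set C₂ := 4 * (R * ((R ^ n + 1) * (C₁ / Real.sqrt M))) + (R ^ n + 1) * (B / Real.sqrt M) with hC₂
  -- At almost every time the right-hand side is a genuine continuous periodic function of `x`,
  -- uniformly bounded, and the weak integrand is its pairing with `sharp ψ`.
  have rhs_prop : ∀ᵐ s ∂(volume.restrict (Icc τ T)), Continuous (rhs a b c d e u s) ∧
      Function.Periodic (rhs a b c d e u s) M ∧ (∀ x, |rhs a b c d e u s x| ≤ C₂) ∧
      ∀ ψ, ⟪w s, dualOp hM n (a s) (b s) (c s) (d s) ψ⟫ + pairing M n (e s) ψ =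
        ∫ x in (0 : ℝ)..M, rhs a b c d e u s x * (sharp M n ψ : ℝ → ℝ) x := by
    filter_upwards [he.mem, he.cont, he.le, ae_restrict_mem measurableSet_Icc] with s e1 e2 e3 hs'
    have sc := h.continuous_spatial hs' (us s)
    have sp := h.periodic_spatial hs' (up s)
    refine ⟨sc.add e2, sp.add e1.1, fun x => ?_, fun ψ => ?_⟩
    · rw [rhs_eq]
      refine (abs_add_le _ _).trans (add_le_add (h.abs_spatial_le hs' (uB s hs' x)) ?_)
      have := e1.abs_iteratedDeriv_le hM hR h.M_le e2 (show 0 < n by omega) x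
      rw [iteratedDeriv_zero] at this
      exact this.trans (by gcongr)
    · have hψ := smoothPer_continuous (sharp M n ψ)
      have i1 : IntervalIntegrable (fun x => spatial (a s) (b s) (c s) (d s) (u s) x *
        (sharp M n ψ : ℝ → ℝ) x) volume 0 M := (sc.mul hψ).intervalIntegrable _ _
      have i2 : IntervalIntegrable (fun x => e s x * (sharp M n ψ : ℝ → ℝ) x) volume 0 M :=
        (e2.mul hψ).intervalIntegrable _ _
      rw [h.inner_dualOp (u := u s) (by omega) hs' (w s) rfl (us s), pairing_apply hM n e1.2,
        ← intervalIntegral.integral_add i1 i2]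
      congr 1; funext x
      rw [rhs_eq]; ring
  have G_meas : ∀ ψ, AEStronglyMeasurable (fun s => ⟪w s, dualOp hM n (a s) (b s) (c s) (d s) ψ⟫ +
      pairing M n (e s) ψ) (volume.restrict (Icc τ T)) := fun ψ =>
    ((continuousOn_inner_of_weak hw2 wC (h.continuousOn_dualOp (by omega) ψ)).aestronglyMeasurable
      measurableSet_Icc).add (he.pairing_meas hM ψ)
  -- By surjectivity of `sharp` the mollifiers at `x₀` are admissible. The weak integrands then
  -- converge boundedly to the right-hand side at `x₀`, which gives both its measurability in time
  -- and, by dominated convergence, the pointwise equation.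
  have moll : ∀ x₀, ∃ ψ : ℕ → smoothPer M,
      (∀ f : ℝ → ℝ, Continuous f → Function.Periodic f M → Tendsto (fun j =>
        ∫ x in (0 : ℝ)..M, f x * (sharp M n (ψ j) : ℝ → ℝ) x) atTop (𝓝 (f x₀))) ∧
      ∀ᵐ s ∂(volume.restrict (Icc τ T)),
        (∀ j, ‖⟪w s, dualOp hM n (a s) (b s) (c s) (d s) (ψ j)⟫ + pairing M n (e s) (ψ j)‖ ≤ C₂) ∧
        Tendsto (fun j => ⟪w s, dualOp hM n (a s) (b s) (c s) (d s) (ψ j)⟫ + pairing M n (e s) (ψ j))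
          atTop (𝓝 (rhs a b c d e u s x₀)) := fun x₀ => by
    obtain ⟨η, hη1, hη2⟩ := exists_mollifier hM x₀
    choose ψ hψ using fun j => sharp_surjective hM hn0 (η j)
    refine ⟨ψ, fun f hf hfp => by simpa only [hψ] using hη2 f hf hfp, ?_⟩
    filter_upwards [rhs_prop] with s hs'
    obtain ⟨r1, r2, r3, r4⟩ := hs'
    simp only [r4, hψ]
    exact ⟨fun j => hη1 j _ r1 _ r3, hη2 _ r1 r2⟩
  have rhs_meas : ∀ x, AEStronglyMeasurable (fun s => rhs a b c d e u s x)
      (volume.restrict (Icc τ T)) := fun x => by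
    obtain ⟨ψ, -, h2⟩ := moll x
    exact aestronglyMeasurable_of_tendsto_ae atTop (fun j => G_meas (ψ j)) (h2.mono fun s hs' => hs'.2)
  have rhs_int : ∀ x, IntegrableOn (fun s => rhs a b c d e u s x) (Icc τ T) := fun x =>
    Integrable.mono' (integrable_const C₂) (rhs_meas x) (rhs_prop.mono fun s hs' => hs'.2.2.1 x)
  have coeff_cont : ∀ k, ContinuousOn (fun t => perCoeff M (u t) k) (Icc τ T) := fun k => by
    have e1 : ∀ t, perCoeff M (u t) k = perCoeff M (integL hM n (w t)) k := fun t => by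
      rw [integL_apply]; exact perCoeff_congr (coeFn_toL2 (memLp_integ hM (wm t) n)).symm hM k
    simp only [e1, perCoeff_coe hM, ← ContinuousLinearMap.adjoint_inner_right]
    have e2 : ∀ x, ContinuousOn (fun t => ((1 / M * ⟪w t, x⟫ : ℝ) : ℂ)) (Icc τ T) := fun x =>
      Complex.continuous_ofReal.comp_continuousOn (continuousOn_const.mul (hw2 x))
    exact (e2 _).sub ((e2 _).mul continuousOn_const)
  have wcoeff_cont : ∀ k, ContinuousOn (fun t => ‖perCoeff M (w t) k‖ ^ 2) (Icc τ T) := fun k => by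
    simp only [perCoeff_coe hM]
    have e2 : ∀ x, ContinuousOn (fun t => ((1 / M * ⟪w t, x⟫ : ℝ) : ℂ)) (Icc τ T) := fun x =>
      Complex.continuous_ofReal.comp_continuousOn (continuousOn_const.mul (hw2 x))
    exact ((e2 _).sub ((e2 _).mul continuousOn_const)).norm.pow 2
  have hlt := h.lt
  set f : ℤ → ℝ → ℝ := fun k t => M * (sobWeight M (n + 1) k * ‖perCoeff M (u t) k‖ ^ 2) with hf
  have f0 : ∀ k t, 0 ≤ f k t := fun k t =>
    mul_nonneg hM.le (mul_nonneg (sobWeight_pos _ k).le (sq_nonneg _))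
  have fc : ∀ k, ContinuousOn (f k) (Icc τ T) := fun k =>
    continuousOn_const.mul (continuousOn_const.mul ((coeff_cont k).norm.pow 2))
  have f_le : ∀ S : Finset ℤ, ∑ k ∈ S, ∫ t in Icc τ T, f k t ≤
      (1 + R ^ 2) ^ n * (X * (Real.exp L * R + 1 / κ)) * Y := fun S => by
    rw [← integral_finsetSum _ fun k _ => (fc k).integrableOn_Icc]
    set D : ℝ → ℝ := fun s => ∑ k ∈ S, κ * M * (freq M k ^ 2 * ‖perCoeff M (w s) k‖ ^ 2) with hD
    have Dc : ContinuousOn D (Icc τ T) := continuousOn_finsetSum _ fun k _ =>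
      continuousOn_const.mul (continuousOn_const.mul (wcoeff_cont k))
    have hDint : ∫ s in Icc τ T, D s ≤ X * Y := by
      rw [integral_Icc_eq_integral_Ioc, ← intervalIntegral.integral_of_le hlt.le]
      exact hw4 S
    have pt : ∀ t ∈ Icc τ T, ∑ k ∈ S, f k t ≤ (1 + R ^ 2) ^ n * (Real.exp L * X * Y + 1 / κ * D t) :=
      fun t ht => by
      -- One factor `1 + ξ²` of the weight splits into a part controlled by `‖w‖²` and a part
      -- controlled by the dissipation.
      have e1 : ∀ k, f k t ≤ (1 + R ^ 2) ^ n * (M * ‖perCoeff M (w t) k‖ ^ 2 +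
          1 / κ * (κ * M * (freq M k ^ 2 * ‖perCoeff M (w t) k‖ ^ 2))) := fun k => by
        have e2 := sobWeight_mul_perCoeff_integ_le hM h.M_le (wm t) hn0 k
        simp only [hf]
        rw [sobWeight_succ]
        have e3 : 0 ≤ M * (1 + freq M k ^ 2) := by positivity
        calc _ = M * (1 + freq M k ^ 2) * (sobWeight M n k * ‖perCoeff M (u t) k‖ ^ 2) := by ring
          _ ≤ M * (1 + freq M k ^ 2) * ((1 + R ^ 2) ^ n * ‖perCoeff M (w t) k‖ ^ 2) := by gcongr
          _ = _ := by field_simp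
      refine (Finset.sum_le_sum fun k _ => e1 k).trans ?_
      rw [← Finset.mul_sum, Finset.sum_add_distrib, ← Finset.mul_sum, ← Finset.mul_sum]
      refine mul_le_mul_of_nonneg_left (add_le_add ?_ le_rfl) (by positivity)
      have e4 := sum_le_hasSum S (fun _ _ => sq_nonneg _) (hasSum_perCoeff_coe_sq hM (w t))
      calc M * ∑ k ∈ S, ‖perCoeff M (w t) k‖ ^ 2 ≤ M * (1 / M * ‖w t‖ ^ 2) := by gcongr
        _ = ‖w t‖ ^ 2 := by field_simp
        _ ≤ _ := hw1 t ht
    have e5 : ∫ t in Icc τ T, ∑ k ∈ S, f k t ≤ ∫ t in Icc τ T,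
        (1 + R ^ 2) ^ n * (Real.exp L * X * Y + 1 / κ * D t) := by
      apply setIntegral_mono_on (integrable_finsetSum _ fun k _ => (fc k).integrableOn_Icc) ?_
        measurableSet_Icc pt
      exact (continuousOn_const.mul (continuousOn_const.add
        (continuousOn_const.mul Dc))).integrableOn_Icc
    refine e5.trans ?_
    rw [integral_const_mul, integral_add (integrable_const _) (Dc.integrableOn_Icc.const_mul _),
      setIntegral_const, smul_eq_mul, integral_const_mul (1 / κ)]
    have e6 : volume.real (Icc τ T) = T - τ := by rw [Real.volume_real_Icc_of_le hlt.le]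
    rw [e6]
    have hlen := h.len_le
    have e7 : (T - τ) * (Real.exp L * X * Y) ≤ R * (Real.exp L * X * Y) := by gcongr
    have e8 : 1 / κ * ∫ s in Icc τ T, D s ≤ 1 / κ * (X * Y) := by gcongr
    calc _ ≤ (1 + R ^ 2) ^ n * (R * (Real.exp L * X * Y) + 1 / κ * (X * Y)) :=
        mul_le_mul_of_nonneg_left (add_le_add e7 e8) (by positivity)
      _ = _ := by ring
  obtain ⟨g1, g2, g3⟩ := integrable_tsum_of_sum_le f0 (fun k => (fc k).integrableOn_Icc) f_le
  have hnorm : ∀ t, normH M (n + 1) (u t) ^ 2 = ∑' k, f k t := fun t => by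
    rw [normH_sq hM, ← tsum_mul_left]
  refine ⟨u, ⟨ae_of_all _ umem, ⟨Real.sqrt ((1 + R ^ 2) ^ n * (Real.exp L * X * Y)), ?_⟩,
    fun t _ => up t, fun t _ => us t, rhs_int, fun t ht x => ?_⟩, fun t ht => ⟨umem t,
      (unorm t ht).trans ?_⟩, coeff_cont, ?_, ?_, ?_⟩
  · filter_upwards [ae_restrict_mem measurableSet_Icc] with t ht
    exact Real.le_sqrt_of_sq_le (unorm t ht)
  · obtain ⟨ψ, k1, k2⟩ := moll x
    have sub : uIoc τ t ⊆ Icc τ T := by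
      rw [uIoc_of_le ht.1]; exact Ioc_subset_Icc_self.trans (Icc_subset_Icc_right ht.2)
    have k2' := ae_restrict_of_ae_restrict_of_subset sub k2
    rw [ae_restrict_iff' measurableSet_uIoc] at k2'
    have lim1 := intervalIntegral.tendsto_integral_filter_of_dominated_convergence (l := atTop)
      (a := τ) (b := t) (μ := volume)
      (F := fun j s => ⟪w s, dualOp hM n (a s) (b s) (c s) (d s) (ψ j)⟫ + pairing M n (e s) (ψ j))
      (f := fun s => rhs a b c d e u s x) (fun _ => C₂)
      (Eventually.of_forall fun j => (G_meas (ψ j)).mono_measure (Measure.restrict_mono sub le_rfl))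
      (Eventually.of_forall fun j => k2'.mono fun s hs' hm => (hs' hm).1 j) (by simp)
      (k2'.mono fun s hs' hm => (hs' hm).2)
    have lim2 := k1 u₀ hu₀.2 hu₀.1.1
    have lim3 := k1 (u t) (us t).continuous (up t)
    refine tendsto_nhds_unique lim3 ((lim2.add lim1).congr fun j => ?_)
    rw [← pairing_apply hM n hu₀.1.2, ← hw3 t ht, ← inner_integL_sharp hM hn0, integL_apply,
      smoothToL2_apply, inner_toL2 hM (memLp_integ hM (wm t) n) (smoothPer_memLp _)]
  · have e9 : 0 ≤ (1 + R ^ 2) ^ n * (X * (Real.exp L * R + 1 / κ)) * Y := by positivity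
    linarith
  · filter_upwards [g1] with t ht
    exact ⟨up t, (umem t).2, (summable_mul_left_iff hM.ne').1 ht⟩
  · simp only [hnorm]; exact g2
  · simp only [hnorm]
    have e9 : 0 ≤ (1 + R ^ 2) ^ n * (X * Real.exp L) * Y := by positivity
    linarith

end DispersivePDE

/-! ### Evolution of weighted norms for solutions in integrated form. -/

namespace DispersivePDE

variable {M : ℝ}

/-- `z` is merely absolutely continuous in time, so the product rule holds almost everywhere and the
fundamental theorem is used in its absolutely continuous form. -/
theorem mul_sq_eq_integral {τ t : ℝ} (ht : τ ≤ t) {p p' z g : ℝ → ℝ} (hp : ContinuousOn p (Icc τ t))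
    (hp' : ContinuousOn p' (Icc τ t)) (hd : ∀ s ∈ Ioo τ t, HasDerivAt p (p' s) s)
    (hg : IntervalIntegrable g volume τ t) (hz : ∀ s ∈ Icc τ t, z s = ∫ r in τ..s, g r) :
    p t * z t ^ 2 = ∫ s in τ..t, (p' s * z s ^ 2 + 2 * (p s * (z s * g s))) := by
  have hI : uIcc τ t = Icc τ t := uIcc_of_le ht
  have ip' : IntervalIntegrable p' volume τ t := by
    apply ContinuousOn.intervalIntegrable; rwa [hI]
  -- `p` is differentiable only in the open interval. Writing it as a primitive makes its absolute
  -- continuity immediate.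
  set P : ℝ → ℝ := fun s => p τ + ∫ r in τ..s, p' r with hP
  set Z : ℝ → ℝ := fun s => ∫ r in τ..s, g r with hZ
  have hPp : ∀ s ∈ Icc τ t, P s = p s := fun s hs => by
    have hsub : Icc τ s ⊆ Icc τ t := Icc_subset_Icc_right hs.2
    have := intervalIntegral.integral_eq_sub_of_hasDerivAt_of_le hs.1 (hp.mono hsub)
      (fun r hr => hd r ⟨hr.1, hr.2.trans_le hs.2⟩)
      (ip'.mono_set (by rw [hI, uIcc_of_le hs.1]; exact hsub))
    simp only [hP, this]; ring
  have acP : AbsolutelyContinuousOnInterval P τ t :=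
    ((LipschitzWith.const (p τ)).lipschitzOnWith (s := uIcc τ t)).absolutelyContinuousOnInterval.add
      (ip'.absolutelyContinuousOnInterval_intervalIntegral left_mem_uIcc)
  have acZ : AbsolutelyContinuousOnInterval Z τ t :=
    hg.absolutelyContinuousOnInterval_intervalIntegral left_mem_uIcc
  have key := (acP.mul (acZ.mul acZ)).integral_deriv_eq_sub
  have hZτ : Z τ = 0 := by simp [hZ]
  have htm : t ∈ Icc τ t := ⟨ht, le_rfl⟩
  simp only [Pi.mul_apply, hZτ, mul_zero, sub_zero, hPp t htm] at key
  rw [hz t htm, sq, ← key]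
  apply intervalIntegral.integral_congr_ae
  filter_upwards [ip'.ae_hasDerivAt_integral, hg.ae_hasDerivAt_integral] with s h1 h2 hs
  have hs' : s ∈ uIcc τ t := uIoc_subset_uIcc hs
  have d1 := (h1 hs' τ left_mem_uIcc).const_add (p τ)
  have d2 := h2 hs' τ left_mem_uIcc
  have d3 := d1.mul (d2.mul d2)
  rw [hI] at hs'
  have e1 := hPp s hs'
  simp only [hP] at e1
  rw [d3.deriv, hz s hs']
  simp only [Pi.mul_apply, e1]
  ring

/-- The derivative is the pointwise limit of difference quotients along a fixed sequence of
increments, each jointly measurable. Joint measurability is what Fubini's theorem later requires. -/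
theorem measurable_deriv_uncurry {f : ℝ → ℝ → ℝ} (hf : Measurable (Function.uncurry f))
    (hd : ∀ t, Differentiable ℝ (f t)) : Measurable (Function.uncurry fun t => deriv (f t)) := by
  set ε : ℕ → ℝ := fun j => 1 / ((j : ℝ) + 1) with hε
  have h1 : Tendsto ε atTop (𝓝[≠] 0) := by
    refine tendsto_nhdsWithin_iff.2 ⟨tendsto_one_div_add_atTop_nhds_zero_nat, ?_⟩
    exact Eventually.of_forall fun j => (by positivity : ε j ≠ 0)
  refine measurable_of_tendsto_metrizable
    (f := fun j (p : ℝ × ℝ) => (ε j)⁻¹ • (Function.uncurry f (p.1, p.2 + ε j) - Function.uncurry f p))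
    (fun j => ?_) (tendsto_pi_nhds.2 fun p => ?_)
  · simp only [smul_eq_mul]
    exact ((hf.comp (by fun_prop : Measurable fun p : ℝ × ℝ => (p.1, p.2 + ε j))).sub hf).const_mul _
  · exact ((hd p.1 p.2).hasDerivAt.tendsto_slope_zero).comp h1

theorem measurable_iteratedDeriv_uncurry {f : ℝ → ℝ → ℝ} {n : ℕ} (hf : Measurable (Function.uncurry f))
    (hd : ∀ t, ContDiff ℝ n (f t)) :
    Measurable (Function.uncurry fun t => iteratedDeriv n (f t)) := by
  induction n with
  | zero => simpa only [iteratedDeriv_zero] using hf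
  | succ n ih =>
    simp only [iteratedDeriv_succ]
    refine measurable_deriv_uncurry (ih fun t => (hd t).of_le (by exact_mod_cast Nat.le_succ n)) fun t => ?_
    exact (hd t).differentiable_iteratedDeriv n (by exact_mod_cast Nat.lt_succ_self n)

/-- The evolution of a weighted `L²` norm. -/
theorem weighted_norm_eq_integral (hM : 0 < M) {τ T : ℝ} {p p' z g : ℝ → ℝ → ℝ}
    (hp : Continuous (Function.uncurry p)) (hp' : Continuous (Function.uncurry p'))
    (hd : ∀ s ∈ Ioo τ T, ∀ x, HasDerivAt (fun s => p s x) (p' s x) s)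
    (hzm : Measurable (Function.uncurry z)) (hg : Measurable (Function.uncurry g)) {C : ℝ}
    (hgC : ∀ᵐ s ∂(volume.restrict (Icc τ T)), ∀ x, |g s x| ≤ C)
    (hz : ∀ t ∈ Icc τ T, ∀ x, z t x = ∫ s in τ..t, g s x) :
    (IntegrableOn (fun s => ∫ x in (0 : ℝ)..M, (p' s x * z s x ^ 2 + 2 * (p s x * (z s x * g s x))))
      (Icc τ T)) ∧
    ∀ t ∈ Icc τ T, ∫ x in (0 : ℝ)..M, p t x * z t x ^ 2 =
      ∫ s in τ..t, ∫ x in (0 : ℝ)..M, (p' s x * z s x ^ 2 + 2 * (p s x * (z s x * g s x))) := by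
  set H : ℝ → ℝ → ℝ := fun s x => p' s x * z s x ^ 2 + 2 * (p s x * (z s x * g s x)) with hH
  have hHm : Measurable (Function.uncurry H) :=
    (hp'.measurable.mul (hzm.pow_const 2)).add ((hp.measurable.mul (hzm.mul hg)).const_mul 2)
  have gi : ∀ x, IntegrableOn (fun s => g s x) (Icc τ T) := fun x =>
    Integrable.mono' (integrable_const C) (hg.comp (by fun_prop : Measurable fun s => (s, x))).aestronglyMeasurable
      (hgC.mono fun s hs => hs x)
  have hzC : ∀ t ∈ Icc τ T, ∀ x, |z t x| ≤ C * (T - τ) := fun t ht x => by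
    -- The almost everywhere bound forces `C` to be nonnegative unless the time interval is a single
    -- point.
    have hC : 0 ≤ C ∨ τ = T := by
      rcases (ht.1.trans ht.2).eq_or_lt with h | h
      · exact Or.inr h
      · left
        have : (volume.restrict (Icc τ T)) ≠ 0 := by
          rw [Ne, Measure.restrict_eq_zero, Real.volume_Icc]; simpa using h
        have : NeBot (ae (volume.restrict (Icc τ T))) := ae_neBot.2 this
        obtain ⟨s, hs⟩ := hgC.exists
        exact (abs_nonneg _).trans (hs 0)
    rw [hz t ht x]
    have h1 := intervalIntegral.norm_integral_le_of_norm_le (a := τ) (b := t) (μ := volume)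
      (f := fun s => g s x) (g := fun _ => C) ht.1 (by
        have := (ae_restrict_iff' measurableSet_Icc).1 hgC
        filter_upwards [this] with s hs hs'
        exact hs ⟨hs'.1.le, hs'.2.trans ht.2⟩ x) (by simp)
    rw [intervalIntegral.integral_const, smul_eq_mul, mul_comm, Real.norm_eq_abs] at h1
    refine h1.trans ?_
    rcases hC with hC | hC
    · exact mul_le_mul_of_nonneg_left (by linarith [ht.2]) hC
    · have : t = T := le_antisymm ht.2 (hC ▸ ht.1)
      rw [this]
  obtain ⟨B, hB⟩ := (isCompact_Icc (a := τ) (b := T)).prod (isCompact_Icc (a := (0 : ℝ)) (b := M))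
    |>.exists_bound_of_continuousOn hp.continuousOn
  obtain ⟨B', hB'⟩ := (isCompact_Icc (a := τ) (b := T)).prod (isCompact_Icc (a := (0 : ℝ)) (b := M))
    |>.exists_bound_of_continuousOn hp'.continuousOn
  have hHC : ∀ᵐ s ∂(volume.restrict (Icc τ T)), ∀ x ∈ Icc 0 M, ‖H s x‖ ≤
      B' * (C * (T - τ)) ^ 2 + 2 * (B * (C * (T - τ) * C)) := by
    filter_upwards [hgC, ae_restrict_mem measurableSet_Icc] with s h1 h2 x hx
    have e1 := hB (s, x) ⟨h2, hx⟩
    have e2 := hB' (s, x) ⟨h2, hx⟩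
    have e3 := hzC s h2 x
    have e4 := h1 x
    have n3 := (abs_nonneg _).trans e3
    have n4 := (abs_nonneg _).trans e4
    have n1 := (norm_nonneg _).trans e1
    have n2 := (norm_nonneg _).trans e2
    simp only [hH, Real.norm_eq_abs, Function.uncurry] at e1 e2 ⊢
    refine (abs_add_le _ _).trans ?_
    rw [abs_mul, abs_mul 2, abs_mul, abs_mul, abs_pow, abs_two]
    gcongr
  have hfin : IsFiniteMeasure ((volume.restrict (Icc τ T)).prod (volume.restrict (Ioc (0 : ℝ) M))) :=
    inferInstance
  have hint : Integrable (Function.uncurry H)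
      ((volume.restrict (Icc τ T)).prod (volume.restrict (Ioc (0 : ℝ) M))) := by
    refine Integrable.mono' (integrable_const (B' * (C * (T - τ)) ^ 2 + 2 * (B * (C * (T - τ) * C))))
      hHm.aestronglyMeasurable ?_
    rw [Measure.ae_prod_iff_ae_ae (measurableSet_le (by fun_prop) (by fun_prop))]
    filter_upwards [hHC] with s hs
    filter_upwards [ae_restrict_mem measurableSet_Ioc] with x hx
    exact hs x (Ioc_subset_Icc_self hx)
  refine ⟨?_, fun t ht => ?_⟩
  · have := hint.integral_prod_left
    simpa only [intervalIntegral.integral_of_le hM.le] using! this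
  · have e1 : ∀ x, p t x * z t x ^ 2 = ∫ s in τ..t, H s x := fun x => by
      have c1 : ∀ {f : ℝ → ℝ → ℝ}, Continuous (Function.uncurry f) → ContinuousOn (fun s => f s x) (Icc τ t) :=
        fun hf => (hf.comp (by fun_prop : Continuous fun s : ℝ => (s, x))).continuousOn
      refine mul_sq_eq_integral ht.1 (c1 hp) (c1 hp')
        (fun s hs => hd s ⟨hs.1, hs.2.trans_le ht.2⟩ x) ?_ fun s hs => hz s ⟨hs.1, hs.2.trans ht.2⟩ x
      rw [intervalIntegrable_iff_integrableOn_Icc_of_le ht.1]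
      exact (gi x).mono_set (Icc_subset_Icc_right ht.2)
    simp only [e1, intervalIntegral.integral_of_le hM.le]
    rw [intervalIntegral_integral_swap]
    refine hint.mono_measure (Measure.prod_mono (Measure.restrict_mono ?_ le_rfl) le_rfl)
    rw [uIoc_of_le ht.1]
    exact Ioc_subset_Icc_self.trans (Icc_subset_Icc_right ht.2)

/-- Gronwall in integral form: `e^{-Kt} ∫ E` is nonincreasing, vanishes at `τ`, and is nonnegative,
so the integral is zero and the bound on `E` closes. -/
theorem eq_zero_of_le_integral {τ T K : ℝ} {E : ℝ → ℝ} (hE : ContinuousOn E (Icc τ T))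
    (h0 : ∀ t ∈ Icc τ T, 0 ≤ E t) (hK : ∀ t ∈ Icc τ T, E t ≤ K * ∫ s in τ..t, E s) {t : ℝ}
    (ht : t ∈ Icc τ T) : E t = 0 := by
  have hτ := ht.1.trans ht.2
  have anti : AntitoneOn (fun s => Real.exp (-(K * s)) * ∫ r in τ..s, E r) (Icc τ T) := by
    apply antitoneOn_of_hasDerivWithinAt_nonpos (convex_Icc τ T)
      (f' := fun s => -K * Real.exp (-(K * s)) * (∫ r in τ..s, E r) + Real.exp (-(K * s)) * E s)
    · exact (by fun_prop : Continuous fun s => Real.exp (-(K * s))).continuousOn.mul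
        (continuousOn_primitive hτ hE)
    · intro s hs
      rw [interior_Icc] at hs
      have h1 : HasDerivAt (fun s => Real.exp (-(K * s))) (-K * Real.exp (-(K * s))) s := by
        convert! ((hasDerivAt_id s).const_mul K).neg.exp using 1
        simp; ring
      exact (h1.mul (hasDerivAt_primitive hE hs)).hasDerivWithinAt
    · intro s hs
      rw [interior_Icc] at hs
      have := hK s (Ioo_subset_Icc_self hs)
      have := mul_le_mul_of_nonneg_left this (Real.exp_pos (-(K * s))).le
      linarith
  have h1 := anti ⟨le_rfl, hτ⟩ ht ht.1
  simp only [intervalIntegral.integral_same, mul_zero] at h1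
  have h2 : 0 ≤ ∫ r in τ..t, E r := intervalIntegral.integral_nonneg ht.1 fun r hr =>
    h0 r ⟨hr.1, hr.2.trans ht.2⟩
  have h3 : ∫ r in τ..t, E r = 0 := le_antisymm (by
    by_contra hcon
    push Not at hcon
    have := mul_pos (Real.exp_pos (-(K * t))) hcon
    linarith) h2
  have := hK t ht
  rw [h3, mul_zero] at this
  exact le_antisymm this (h0 t ht)

end DispersivePDE

/-! ### Uniqueness. -/

namespace DispersivePDE

variable {M : ℝ}

theorem spatial_sub {a b c d u v : ℝ → ℝ} (hu : ContDiff ℝ 3 u) (hv : ContDiff ℝ 3 v) (x : ℝ) :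
    spatial a b c d (fun y => u y - v y) x = spatial a b c d u x - spatial a b c d v x := by
  have e : ∀ j : ℕ, j ≤ 3 → iteratedDeriv j (fun y => u y - v y) x =
      iteratedDeriv j u x - iteratedDeriv j v x := fun j hj =>
    iteratedDeriv_fun_sub (hu.of_le (by exact_mod_cast hj)).contDiffAt
      (hv.of_le (by exact_mod_cast hj)).contDiffAt
  have e1 := e 1 (by norm_num)
  simp only [iteratedDeriv_one] at e1
  rw [spatial, e 3 le_rfl, e 2 (by norm_num), e1, spatial, spatial]
  ring

namespace Coeffs

variable {τ T R δ : ℝ} {n : ℕ} {a a' b b' c d : ℝ → ℝ → ℝ}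

/-- No space derivative is taken of the equation, so the coefficient of `z_xx` is `b` alone and the
weight has parameter `0`. The dissipation is discarded, since only growth matters for uniqueness. -/
theorem energy_le_zero_order (h : Coeffs M τ T n R δ a a' b b' c d) (hn : 1 ≤ n) {r r' : ℝ → ℝ → ℝ}
    {m : ℝ → ℝ} {L : ℝ} (W : Weight M τ T 0 (δ / R) L a b r r' m) {t : ℝ} (ht : t ∈ Icc τ T)
    {z : ℝ → ℝ} (hz : ContDiff ℝ 3 z) (hzp : Function.Periodic z M) :
    ∫ x in (0 : ℝ)..M, (r' t x * Real.exp (r t x) * z x ^ 2 + 2 * (Real.exp (r t x) *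
      (z x * spatial (a t) (b t) (c t) (d t) z x))) ≤
    ((R + ((L + 1) * (R / 3 + 2 / 3 * L * R))) ^ 2 / (δ / R) + 2 * R + L) *
      ∫ x in (0 : ℝ)..M, Real.exp (r t x) * z x ^ 2 := by
  have hR : 0 < R := by linarith [h.one_le]
  have hδ : 0 < δ / R := div_pos h.delta_pos hR
  have hM := h.M_pos
  set G : ℝ := (L + 1) * (R / 3 + 2 / 3 * L * R) with hG
  have hid : ∀ x, 3 / 2 * (deriv (r t) x * a t x + deriv (a t) x) - b t x = -(m t * a t x) := fun x => by
    have := W.identity t ht x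
    rwa [zero_mul, zero_add] at this
  have hκ : ∀ x, |deriv (r t) x * (b t x / 3 + 2 / 3 * m t * a t x) +
      (deriv (b t) x / 3 + 2 / 3 * m t * deriv (a t) x)| ≤ G := fun x => by
    have k1 := W.deriv_le t ht x
    have k2 := W.m_le t ht
    have hL : 0 ≤ L := (abs_nonneg _).trans k1
    have aux : ∀ p q : ℝ, |p| ≤ R → |q| ≤ R → |p / 3 + 2 / 3 * m t * q| ≤ R / 3 + 2 / 3 * L * R :=
      fun p q hp hq => by
        refine (abs_add_le _ _).trans ?_
        rw [abs_div, abs_mul, abs_mul, abs_of_pos (by norm_num : (0 : ℝ) < 3),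
          abs_of_pos (by norm_num : (0 : ℝ) < 2 / 3)]
        gcongr
    have da : |deriv (a t) x| ≤ R := by simpa using h.a_le t ht x 1 (by omega)
    have db : |deriv (b t) x| ≤ R := by simpa using h.b_le t ht x 1 (by omega)
    refine (abs_add_le _ _).trans ?_
    rw [abs_mul, hG, add_mul, one_mul]
    exact add_le_add (mul_le_mul k1 (aux _ _ (h.abs_b_le ht x) (h.abs_a_le ht x)) (abs_nonneg _) hL)
      (aux _ _ db da)
  have hcR : ∀ x, |c t x| ≤ R := fun x => by simpa using h.c_le t ht x 0 (by omega)
  have hdR : ∀ x, |d t x| ≤ R := fun x => by simpa using h.d_le t ht x 0 (by omega)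
  have cd := (h.d_smooth t ht).continuous
  have cz := hz.continuous
  have ce := (W.smooth t ht).continuous
  have cr' := continuous_section W.cont' ht
  have cL := h.continuous_spatial ht hz
  have cz1 : Continuous (deriv z) := hz.continuous_deriv (by norm_num)
  have key := weighted_energy_le hM (a := a t) (β := b t) (γ := c t) (h := fun x => d t x * z x)
    (r := r t) (w := z) (m := m t) ((h.a_smooth t ht).of_le (by exact_mod_cast (by omega : 1 ≤ n + 3)))
    ((h.b_smooth t ht).of_le (by exact_mod_cast (by omega : 1 ≤ n + 2)))
    (h.c_smooth t ht).continuous (cd.mul cz) ((W.smooth t ht).of_le (by norm_num)) hz (h.a_per t ht)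
    (h.b_per t ht) (W.per t ht) hzp hid hδ (W.lower t ht) hcR hκ
  have i1 : ∫ x in (0 : ℝ)..M, (r' t x * Real.exp (r t x) * z x ^ 2 + 2 * (Real.exp (r t x) *
      (z x * spatial (a t) (b t) (c t) (d t) z x))) =
      (∫ x in (0 : ℝ)..M, r' t x * Real.exp (r t x) * z x ^ 2) + 2 * ∫ x in (0 : ℝ)..M,
        Real.exp (r t x) * (z x * (a t x * iteratedDeriv 3 z x + b t x * iteratedDeriv 2 z x +
          c t x * deriv z x + d t x * z x)) := by
    rw [← intervalIntegral.integral_const_mul, ← intervalIntegral.integral_add]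
    · rfl
    · exact (by fun_prop : Continuous fun x => r' t x * Real.exp (r t x) * z x ^ 2).intervalIntegrable _ _
    · exact (by fun_prop : Continuous fun x => 2 * (Real.exp (r t x) *
        (z x * spatial (a t) (b t) (c t) (d t) z x))).intervalIntegrable _ _
  rw [i1]
  refine (add_le_add_right key _).trans ?_
  rw [← intervalIntegral.integral_add, ← intervalIntegral.integral_const_mul]
  · apply intervalIntegral.integral_mono_on hM.le
    · exact (by fun_prop : Continuous fun x => r' t x * Real.exp (r t x) * z x ^ 2 +
        Real.exp (r t x) * ((R + G) ^ 2 / (δ / R) * z x ^ 2 - δ / R * deriv z x ^ 2 +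
          2 * (z x * (d t x * z x)))).intervalIntegrable _ _
    · exact (by fun_prop : Continuous fun x => ((R + G) ^ 2 / (δ / R) + 2 * R + L) *
        (Real.exp (r t x) * z x ^ 2)).intervalIntegrable _ _
    intro x _
    have k1 := (abs_le.1 (W.le' t ht x)).2
    have k2 := (abs_le.1 (hdR x)).2
    have e0 := (Real.exp_pos (r t x)).le
    have e1 : r' t x * (Real.exp (r t x) * z x ^ 2) ≤ L * (Real.exp (r t x) * z x ^ 2) := by gcongr
    have e2 : d t x * (Real.exp (r t x) * z x ^ 2) ≤ R * (Real.exp (r t x) * z x ^ 2) := by gcongr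
    have e3 : 0 ≤ Real.exp (r t x) * (δ / R * deriv z x ^ 2) := by positivity
    linarith
  · exact (by fun_prop : Continuous fun x => r' t x * Real.exp (r t x) * z x ^ 2).intervalIntegrable _ _
  · exact (by fun_prop : Continuous fun x =>
        Real.exp (r t x) * ((R + G) ^ 2 / (δ / R) * z x ^ 2 - δ / R * deriv z x ^ 2 +
          2 * (z x * (d t x * z x)))).intervalIntegrable _ _

/-- The difference `z` solves the homogeneous equation from zero data, and its weighted `L²` energy
satisfies `E ≤ K ∫ E`. Since the equation is only integrated in time, pointwise in `x`, the energy
identity comes from `weighted_norm_eq_integral` and not from differentiation. -/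
theorem unique (h : Coeffs M τ T n R δ a a' b b' c d) (hn : 4 ≤ n) {e : ℝ → ℝ → ℝ} {u₀ : ℝ → ℝ}
    {u v : ℝ → ℝ → ℝ} (hu : SolvesOn M τ T n a b c d e u₀ u) (hv : SolvesOn M τ T n a b c d e u₀ v)
    {t : ℝ} (ht : t ∈ Icc τ T) : u t = v t := by
  have hM := h.M_pos
  have hτ := h.lt.le
  have hR := h.one_le
  obtain ⟨r, r', m, W⟩ := h.exists_weight (by omega) 0
  set L : ℝ := (|(0 : ℝ)| + 1) * R ^ 2 + 4 * R ^ 5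
  -- Composing with the projection onto `[τ, T]` makes all functions well behaved on the whole
  -- plane, so joint continuity and measurability need no restriction to the time interval.
  set P : ℝ → ℝ := fun t => projIcc τ T hτ t with hP
  have Pm : ∀ t, P t ∈ Icc τ T := fun t => (projIcc τ T hτ t).2
  have Pc : Continuous P := continuous_subtype_val.comp continuous_projIcc
  have Pe : ∀ t ∈ Icc τ T, P t = t := fun t ht => by simp only [hP, projIcc_of_mem hτ ht]
  set z : ℝ → ℝ → ℝ := fun t x => u t x - v t x with hz
  have zs : ∀ t ∈ Icc τ T, ContDiff ℝ 3 (z t) := fun t ht => (hu.contDiff t ht).sub (hv.contDiff t ht)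
  have zp : ∀ t ∈ Icc τ T, Function.Periodic (z t) M := fun t ht x => by
    simp only [hz, hu.periodic t ht x, hv.periodic t ht x]
  set g : ℝ → ℝ → ℝ := fun t => spatial (a t) (b t) (c t) (d t) (z t) with hg
  have gr : ∀ s ∈ Icc τ T, ∀ x, g s x = rhs a b c d e u s x - rhs a b c d e v s x := fun s hs x => by
    simp only [hg, hz, rhs_eq, spatial_sub (hu.contDiff s hs) (hv.contDiff s hs)]; ring
  have ze : ∀ t ∈ Icc τ T, ∀ x, z t x = ∫ s in τ..t, g s x := fun t ht x => by
    have hsub : uIcc τ t ⊆ Icc τ T := by rw [uIcc_of_le ht.1]; exact Icc_subset_Icc_right ht.2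
    have ii : ∀ {f : ℝ → ℝ}, IntegrableOn f (Icc τ T) → IntervalIntegrable f volume τ t := fun hf =>
      (hf.mono_set hsub).intervalIntegrable
    rw [intervalIntegral.integral_congr fun s hs => gr s (hsub hs) x,
      intervalIntegral.integral_sub (ii (hu.integrable x)) (ii (hv.integrable x))]
    simp only [hz, hu.eqn t ht x, hv.eqn t ht x]; ring
  obtain ⟨Cu, hCu⟩ := hu.bound
  obtain ⟨Cv, hCv⟩ := hv.bound
  -- Since `4 ≤ n`, the `H^n` bounds control derivatives up to order three pointwise.
  have gb : ∀ᵐ s ∂(volume.restrict (Icc τ T)), ∀ x, |g s x| ≤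
      4 * (R * ((R ^ n + 1) * (Cu / Real.sqrt M) + (R ^ n + 1) * (Cv / Real.sqrt M))) := by
    filter_upwards [hu.mem, hv.mem, hCu, hCv, ae_restrict_mem measurableSet_Icc] with s u1 v1 u2 v2 hs x
    have hs0 : 0 < Real.sqrt M := Real.sqrt_pos.2 hM
    refine h.abs_spatial_le hs fun j hj => ?_
    have e1 : iteratedDeriv j (z s) x = iteratedDeriv j (u s) x - iteratedDeriv j (v s) x :=
      iteratedDeriv_fun_sub ((hu.contDiff s hs).of_le (by exact_mod_cast hj)).contDiffAt
        ((hv.contDiff s hs).of_le (by exact_mod_cast hj)).contDiffAt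
    rw [e1]
    refine (abs_sub _ _).trans (add_le_add ?_ ?_)
    · refine (u1.abs_iteratedDeriv_le hM hR h.M_le (hu.contDiff s hs).continuous (by omega) x).trans ?_
      gcongr
    · refine (v1.abs_iteratedDeriv_le hM hR h.M_le (hv.contDiff s hs).continuous (by omega) x).trans ?_
      gcongr
  have zt : ∀ x, Continuous fun t => z (P t) x := fun x => by
    have c1 : ContinuousOn (fun t => ∫ s in τ..t, g s x) (Icc τ T) := by
      have := intervalIntegral.continuousOn_primitive_interval (μ := volume) (f := fun s => g s x)
        (a := τ) (b := T) (by
          rw [uIcc_of_le hτ]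
          exact (((hu.integrable x).sub (hv.integrable x)).congr_fun (fun s hs => (gr s hs x).symm)
            measurableSet_Icc))
      rwa [uIcc_of_le hτ] at this
    have c2 := c1.comp_continuous Pc Pm
    exact c2.congr fun t => (ze _ (Pm t) x).symm
  -- A Carathéodory function: continuous in time for each `x` by the integral equation, and
  -- continuous in `x` for each time.
  have zm : Measurable (Function.uncurry fun t => z (P t)) := by
    have := stronglyMeasurable_uncurry_of_continuous_of_stronglyMeasurable
      (u := fun t x => z (P t) x) (fun x => zt x)
      (fun t => (zs _ (Pm t)).continuous.stronglyMeasurable)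
    exact this.measurable
  have cc : ∀ {f : ℝ → ℝ → ℝ}, ContinuousOn (Function.uncurry f) (Icc τ T ×ˢ univ) →
      Continuous (Function.uncurry fun t => f (P t)) := fun hf =>
    hf.comp_continuous (f := fun p : ℝ × ℝ => (P p.1, p.2)) (by fun_prop) fun p => ⟨Pm _, mem_univ _⟩
  have gm : Measurable (Function.uncurry fun t => g (P t)) := by
    have d3 := measurable_iteratedDeriv_uncurry (n := 3) zm fun t => zs _ (Pm t)
    have d2 := measurable_iteratedDeriv_uncurry (n := 2) zm fun t => (zs _ (Pm t)).of_le (by norm_num)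
    have d1 := measurable_deriv_uncurry zm fun t => (zs _ (Pm t)).differentiable (by norm_num)
    have ca := (cc h.cont_a).measurable
    have cb := (cc h.cont_b).measurable
    have c0 := (cc (h.c_cont 0 (Nat.zero_le _))).measurable
    have d0 := (cc (h.d_cont 0 (Nat.zero_le _))).measurable
    simp only [iteratedDeriv_zero] at c0 d0
    exact (((ca.mul d3).add (cb.mul d2)).add (c0.mul d1)).add (d0.mul zm)
  have Pn : ∀ s ∈ Ioo τ T, ∀ᶠ y in 𝓝 s, P y = y := fun s hs => by
    filter_upwards [isOpen_Ioo.mem_nhds hs] with y hy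
    exact Pe y (Ioo_subset_Icc_self hy)
  obtain ⟨k1, k2⟩ := weighted_norm_eq_integral hM (τ := τ) (T := T)
    (p := fun t x => Real.exp (r (P t) x)) (p' := fun t x => r' (P t) x * Real.exp (r (P t) x))
    (z := fun t => z (P t)) (g := fun t => g (P t)) (cc W.cont).rexp ((cc W.cont').mul (cc W.cont).rexp)
    (fun s hs x => by
      have e1 : (fun y => Real.exp (r (P y) x)) =ᶠ[𝓝 s] fun y => Real.exp (r y x) := by
        filter_upwards [Pn s hs] with y hy
        rw [hy]
      rw [Pe s (Ioo_subset_Icc_self hs), mul_comm]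
      exact (W.hasDeriv s hs x).exp.congr_of_eventuallyEq e1) zm gm
    (by
      filter_upwards [gb, ae_restrict_mem measurableSet_Icc] with s h1 hs
      rw [Pe s hs]; exact h1)
    (fun t ht x => by
      rw [Pe t ht, ze t ht x]
      refine intervalIntegral.integral_congr fun s hs => ?_
      rw [uIcc_of_le ht.1] at hs
      rw [Pe s ⟨hs.1, hs.2.trans ht.2⟩])
  set E : ℝ → ℝ := fun t => ∫ x in (0 : ℝ)..M, Real.exp (r (P t) x) * z (P t) x ^ 2 with hE
  set F : ℝ → ℝ := fun s => ∫ x in (0 : ℝ)..M, (r' (P s) x * Real.exp (r (P s) x) * z (P s) x ^ 2 +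
    2 * (Real.exp (r (P s) x) * (z (P s) x * g (P s) x))) with hF
  have Ec : ContinuousOn E (Icc τ T) := by
    have := intervalIntegral.continuousOn_primitive_interval (μ := volume) (f := F)
        (a := τ) (b := T) (by rw [uIcc_of_le hτ]; exact k1)
    rw [uIcc_of_le hτ] at this
    exact this.congr k2
  have E0 : ∀ t, 0 ≤ E t := fun t => intervalIntegral.integral_nonneg hM.le fun x _ => by positivity
  set K : ℝ := (R + ((L + 1) * (R / 3 + 2 / 3 * L * R))) ^ 2 / (δ / R) + 2 * R + L
  have FE : ∀ s, F s ≤ K * E s := fun s => h.energy_le_zero_order (by omega) W (Pm s) (zs _ (Pm s)) (zp _ (Pm s))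
  have hzero := eq_zero_of_le_integral (K := K) Ec (fun t _ => E0 t) (fun t ht => by
    rw [← intervalIntegral.integral_const_mul, hE]
    beta_reduce
    rw [k2 t ht]
    refine intervalIntegral.integral_mono_on ht.1 ?_ ?_ fun s _ => FE s
    · rw [intervalIntegrable_iff_integrableOn_Icc_of_le ht.1]
      exact k1.mono_set (Icc_subset_Icc_right ht.2)
    · apply ContinuousOn.intervalIntegrable
      rw [uIcc_of_le ht.1]
      exact continuousOn_const.mul (Ec.mono (Icc_subset_Icc_right ht.2))) ht
  simp only [hE, Pe t ht] at hzero
  have cr := (W.smooth t ht).continuous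
  have cz := (zs t ht).continuous
  have z0 : ∀ x ∈ Ico 0 M, z t x = 0 := fun x hx => by
    by_contra hne
    have : 0 < ∫ x in (0 : ℝ)..M, Real.exp (r t x) * z t x ^ 2 :=
      intervalIntegral.integral_pos hM (by fun_prop) (fun x _ => by positivity)
        ⟨x, Ico_subset_Icc_self hx, by positivity⟩
    exact this.ne' hzero
  funext x
  obtain ⟨y, hy, hxy⟩ := (zp t ht).exists_mem_Ico₀ hM x
  exact sub_eq_zero.1 (hxy.trans (z0 y hy))

end Coeffs
end DispersivePDE

/-! ### Density of smooth functions and convergence in weaker Sobolev norms. -/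

namespace DispersivePDE

variable {M : ℝ}

/-! ### Approximation and convergence in Sobolev spaces -/

theorem sobWeight_mul_perCoeff_sub_le {s : ℝ} {f g : ℝ → ℝ} (hM : 0 < M) (hf : MemH M s f)
    (hg : MemH M s g) (k : ℤ) : sobWeight M s k * ‖perCoeff M (fun x => f x - g x) k‖ ^ 2 ≤
      2 * (sobWeight M s k * ‖perCoeff M f k‖ ^ 2) + 2 * (sobWeight M s k * ‖perCoeff M g k‖ ^ 2) := by
  rw [perCoeff_sub (intervalIntegrable_of_memLp hM hf.2) (intervalIntegrable_of_memLp hM hg.2)]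
  have h1 : ‖perCoeff M f k - perCoeff M g k‖ ^ 2 ≤
      2 * ‖perCoeff M f k‖ ^ 2 + 2 * ‖perCoeff M g k‖ ^ 2 := by
    have := norm_sub_le (perCoeff M f k) (perCoeff M g k)
    nlinarith [norm_nonneg (perCoeff M f k - perCoeff M g k),
      sq_nonneg (‖perCoeff M f k‖ - ‖perCoeff M g k‖)]
  have := mul_le_mul_of_nonneg_left h1 (sobWeight_pos (M := M) s k).le
  linarith

theorem MemH.sub {s : ℝ} {f g : ℝ → ℝ} (hM : 0 < M) (hf : MemH M s f) (hg : MemH M s g) :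
    MemH M s fun x => f x - g x :=
  ⟨fun x => by simp only [hf.1 x, hg.1 x], hf.2.sub hg.2,
    ((hf.3.mul_left 2).add (hg.3.mul_left 2)).of_nonneg_of_le
      (fun k => mul_nonneg (sobWeight_pos s k).le (sq_nonneg _))
      (sobWeight_mul_perCoeff_sub_le hM hf hg)⟩

theorem normH_sub_sq_le {s : ℝ} {f g : ℝ → ℝ} (hM : 0 < M) (hf : MemH M s f) (hg : MemH M s g) :
    normH M s (fun x => f x - g x) ^ 2 ≤ 2 * normH M s f ^ 2 + 2 * normH M s g ^ 2 := by
  have h := (hf.sub hM hg).3.tsum_le_tsum (sobWeight_mul_perCoeff_sub_le hM hf hg)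
    ((hf.3.mul_left 2).add (hg.3.mul_left 2))
  rw [(hf.3.mul_left 2).tsum_add (hg.3.mul_left 2), tsum_mul_left, tsum_mul_left] at h
  rw [normH_sq hM, normH_sq hM, normH_sq hM]
  have := mul_le_mul_of_nonneg_left h hM.le
  linarith

theorem normH_congr (hM : 0 < M) {s : ℝ} {f g : ℝ → ℝ} (h : f =ᵐ[volume.restrict (Ioc 0 M)] g) :
    normH M s f = normH M s g := by
  simp only [normH, perCoeff_congr h hM]

theorem normH_zero (s : ℝ) : normH M s (fun _ => 0) = 0 := by
  simp [normH, perCoeff]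

theorem memH_of_contDiff (hM : 0 < M) {f : ℝ → ℝ} {n : ℕ} (hf : ContDiff ℝ n f)
    (hfp : Function.Periodic f M) : MemH M n f := by
  have h1 : MemLp f 2 (volume.restrict (Ioc 0 M)) := memLp_of_continuous hf.continuous
  have h2 : MemLp (iteratedDeriv n f) 2 (volume.restrict (Ioc 0 M)) :=
    memLp_of_continuous (contDiff_iteratedDeriv (k := 0) (by rwa [zero_add])).continuous
  refine ⟨hfp, h1, (((hasSum_perCoeff_sq hM h1).summable.add
    (hasSum_perCoeff_sq hM h2).summable).mul_left (2 ^ (n - 1))).of_nonneg_of_le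
      (fun k => mul_nonneg (sobWeight_pos _ k).le (sq_nonneg _)) fun k => ?_⟩
  rw [perCoeff_iteratedDeriv hM hf hfp, sobWeight_nat, norm_mul, norm_pow, norm_mul, Complex.norm_I,
    mul_one, Complex.norm_real, Real.norm_eq_abs, mul_pow, ← pow_mul, mul_comm n 2, pow_mul, sq_abs]
  have h3 := add_pow_le (zero_le_one' ℝ) (sq_nonneg (freq M k)) n
  rw [one_pow] at h3
  have := mul_le_mul_of_nonneg_right h3 (sq_nonneg ‖perCoeff M f k‖)
  linarith

/-- Writing `f = integ M n w`, it suffices to approximate `w` in `L²` by smooth functions: `integ`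
is bounded from `L²` to `H^n` and preserves smoothness. -/
theorem InitialData.exists_approx (hM : 0 < M) {n : ℕ} (hn : n ≠ 0) {f : ℝ → ℝ}
    (hf : InitialData M n f) {ε : ℝ} (hε : 0 < ε) :
    ∃ g, (∀ m : ℕ, InitialData M m g) ∧ normH M n (fun x => f x - g x) ^ 2 ≤ ε := by
  obtain ⟨w, -, hw⟩ := hf.1.exists_integ hM hn hf.2
  have hA : 0 < (1 + M ^ 2) ^ n := by positivity
  obtain ⟨ψ, hψ⟩ := (denseRange_smoothToL2 hM).exists_dist_lt w
    (Real.sqrt_pos.2 (div_pos hε hA))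
  have hg := integ_smoothPer hM n ψ
  refine ⟨integ M n ψ, fun m => ⟨memH_of_contDiff hM (contDiff_infty.1 hg.1 m) hg.2,
    hg.1.continuous⟩, ?_⟩
  set v := w - smoothToL2 M ψ with hv
  have gm : MemLp (integ M n ψ) 2 (volume.restrict (Ioc 0 M)) := memLp_of_continuous hg.1.continuous
  have vm := memLp_integ hM (Lp.memLp v) n
  have e1 : toL2 M (fun x => f x - integ M n ψ x) = toL2 M (integ M n v) := by
    rw [toL2_sub hf.1.2 gm, ← integL_apply hM, hv, map_sub, integL_apply, ← hw, smoothToL2_apply,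
      integL_toL2 hM (smoothPer_memLp ψ)]
  have e2 := (coeFn_toL2 (hf.1.2.sub gm)).symm.trans ((e1 ▸ coeFn_toL2 vm :))
  have e3 : normH M n (fun x => f x - integ M n ψ x) = normH M n (integ M n v) := normH_congr hM e2
  rw [e3]
  refine (normH_integ_sq_le hM le_rfl (Lp.memLp v) hn).trans ?_
  rw [toL2_coe]
  rw [dist_eq_norm] at hψ
  have e4 : ‖v‖ ^ 2 ≤ ε / (1 + M ^ 2) ^ n := by
    rw [← Real.sq_sqrt (div_pos hε hA).le]
    exact pow_le_pow_left₀ (norm_nonneg _) hψ.le 2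
  calc _ ≤ (1 + M ^ 2) ^ n * (ε / (1 + M ^ 2) ^ n) := by gcongr
    _ = ε := by field_simp

theorem tendsto_cofinite_sobWeight (hM : 0 < M) {s : ℝ} (hs : s < 0) :
    Tendsto (sobWeight M s) cofinite (𝓝 0) := by
  have h1 : Tendsto (fun k : ℤ => 1 + (2 * Real.pi * k / M) ^ 2) cofinite atTop := by
    apply tendsto_atTop_add_const_left
    have h2 : Tendsto (fun k : ℤ => |(k : ℝ)|) cofinite atTop := by
      have := Int.tendsto_coe_cofinite
      exact tendsto_norm_cocompact_atTop.comp this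
    have h3 := (h2.const_mul_atTop (by positivity : 0 < 2 * Real.pi / M))
    refine ((tendsto_pow_atTop two_ne_zero).comp h3).congr fun k => ?_
    simp only [Function.comp_apply, mul_pow, sq_abs]
    ring
  have h2 := (tendsto_rpow_neg_atTop (neg_pos.2 hs)).comp h1
  simpa only [neg_neg] using! h2

/-- Bounded convergence of the coefficients implies convergence in the weaker Sobolev spaces. -/
theorem tendsto_normH_sub (hM : 0 < M) {σ s : ℝ} (hs : s < σ) {α : Type*} {l : Filter α}
    {u : α → ℝ → ℝ} {v : ℝ → ℝ} {C : ℝ} (hv : MemH M σ v)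
    (hu : ∀ᶠ t in l, MemH M σ (u t) ∧ normH M σ (u t) ^ 2 ≤ C)
    (hc : ∀ k, Tendsto (fun t => perCoeff M (u t) k) l (𝓝 (perCoeff M v k))) :
    Tendsto (fun t => normH M s fun x => u t x - v x) l (𝓝 0) := by
  set D : ℝ := 2 * |C| + 2 * normH M σ v ^ 2 + 1 with hD
  have hD0 : 0 < D := by positivity
  have hsq : Tendsto (fun t => normH M s (fun x => u t x - v x) ^ 2) l (𝓝 0) := by
    rw [tendsto_order]
    refine ⟨fun a ha => Eventually.of_forall fun t => ha.trans_le (sq_nonneg _), fun ε hε => ?_⟩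
    -- Outside a finite set of frequencies the ratio of the two weights is small, and the uniform
    -- `H^σ` bound controls the tail. On the finite set, convergence of the coefficients suffices.
    have hfin : {k : ℤ | ¬ sobWeight M (s - σ) k < ε / (2 * D)}.Finite :=
      (tendsto_cofinite_sobWeight hM (sub_neg.2 hs)).eventually (gt_mem_nhds (by positivity))
    set F := hfin.toFinset with hF
    have hlim : Tendsto (fun t => M * ∑ k ∈ F, sobWeight M s k * ‖perCoeff M (u t) k - perCoeff M v k‖ ^ 2)
        l (𝓝 0) := by
      have : Tendsto (fun t => M * ∑ k ∈ F, sobWeight M s k * ‖perCoeff M (u t) k - perCoeff M v k‖ ^ 2)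
          l (𝓝 (M * ∑ k ∈ F, sobWeight M s k * ‖perCoeff M v k - perCoeff M v k‖ ^ 2)) :=
        (tendsto_finsetSum _ fun k _ => ((((hc k).sub_const _).norm).pow 2).const_mul _).const_mul M
      simpa using this
    filter_upwards [hu, hlim.eventually (gt_mem_nhds (half_pos hε))] with t ht hsum
    have hd := ht.1.sub hM hv
    have hds := hd.mono hs.le
    have hnorm := normH_sub_sq_le hM ht.1 hv
    have hle : normH M σ (fun x => u t x - v x) ^ 2 < D := by
      have := le_abs_self C
      linarith [ht.2]
    rw [normH_sq hM] at hle ⊢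
    have split := hds.3.sum_add_tsum_compl (s := F)
    have eF : ∑ k ∈ F, sobWeight M s k * ‖perCoeff M (fun x => u t x - v x) k‖ ^ 2 =
        ∑ k ∈ F, sobWeight M s k * ‖perCoeff M (u t) k - perCoeff M v k‖ ^ 2 := by
      simp only [perCoeff_sub (intervalIntegrable_of_memLp hM ht.1.2) (intervalIntegrable_of_memLp hM hv.2)]
    have tail : ∑' k : ((F : Set ℤ)ᶜ : Set ℤ), sobWeight M s k * ‖perCoeff M (fun x => u t x - v x) k‖ ^ 2 ≤
        ε / (2 * D) * ∑' k : ℤ, sobWeight M σ k * ‖perCoeff M (fun x => u t x - v x) k‖ ^ 2 := by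
      rw [← tsum_mul_left]
      refine ((hds.3.subtype _).tsum_le_tsum (g := fun k : ((F : Set ℤ)ᶜ : Set ℤ) => ε / (2 * D) *
        (sobWeight M σ k * ‖perCoeff M (fun x => u t x - v x) k‖ ^ 2)) (fun k => ?_)
        ((hd.3.mul_left _).subtype _)).trans ((hd.3.mul_left _).tsum_subtype_le _ _ fun k => ?_)
      · have hk : sobWeight M (s - σ) k < ε / (2 * D) := by
          have := k.2
          simpa [hF] using this
        have e1 : sobWeight M s k = sobWeight M (s - σ) k * sobWeight M σ k := by
          rw [sobWeight, sobWeight, sobWeight, ← Real.rpow_add (by positivity), sub_add_cancel]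
        simp only [Function.comp_apply]
        rw [e1, mul_assoc]
        exact mul_le_mul_of_nonneg_right hk.le (mul_nonneg (sobWeight_pos _ _).le (sq_nonneg _))
      · have := (sobWeight_pos (M := M) σ k).le
        positivity
    rw [← split, eF, mul_add]
    have t1 := mul_le_mul_of_nonneg_left tail hM.le
    have t2 : M * (ε / (2 * D) * ∑' k : ℤ, sobWeight M σ k * ‖perCoeff M (fun x => u t x - v x) k‖ ^ 2) ≤
        ε / 2 := by
      calc _ = ε / (2 * D) * (M * ∑' k : ℤ, sobWeight M σ k * ‖perCoeff M (fun x => u t x - v x) k‖ ^ 2) := by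
            ring
        _ ≤ ε / (2 * D) * D := by gcongr
        _ = ε / 2 := by field_simp
    linarith
  have := (Real.continuous_sqrt.tendsto 0).comp hsq
  rw [Real.sqrt_zero] at this
  exact this.congr fun t => Real.sqrt_sq (normH_nonneg _ _)

end DispersivePDE

/-! ### From the regularity hypotheses to the working assumptions; operations on solutions. -/

namespace DispersivePDE

variable {M T : ℝ}

/-! ### Regular coefficients -/

theorem ContCk.continuousOn_uncurry {k : ℕ} {f : ℝ → ℝ → ℝ} (hf : ContCk M T k f) {j : ℕ} (hj : j ≤ k) :
    ContinuousOn (Function.uncurry fun t => iteratedDeriv j (f t)) (Icc 0 T ×ˢ univ) := by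
  rintro ⟨t, x⟩ ⟨ht, -⟩
  have hc : Continuous (iteratedDeriv j (f t)) :=
    (hf.contDiff t ht).continuous_iteratedDeriv j (by exact_mod_cast hj)
  have hu := hf.tendsto t ht j hj
  rw [ContinuousWithinAt, Metric.tendsto_nhds]
  intro ε hε
  rw [nhdsWithin_prod_eq, nhdsWithin_univ]
  filter_upwards [prod_mem_prod (Metric.tendstoUniformly_iff.1 hu (ε / 2) (half_pos hε))
    (Metric.tendsto_nhds.1 (hc.tendsto x) (ε / 2) (half_pos hε))] with p hp
  have h1 := hp.1 p.2
  have h2 := hp.2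
  rw [dist_comm] at h1
  calc _ ≤ _ := dist_triangle _ (iteratedDeriv j (f t) p.2) _
    _ < ε / 2 + ε / 2 := add_lt_add h1 h2
    _ = ε := add_halves ε

theorem BoundWk.mono {k l : ℕ} {R S : ℝ} {f : ℝ → ℝ → ℝ} (h : BoundWk T k R f) (hl : l ≤ k)
    (hR : R ≤ S) : BoundWk T l S f :=
  fun t ht x j hj => (h t ht x j (hj.trans hl)).trans hR

theorem ContCk.eventually_bound (hM : 0 < M) {k : ℕ} {f : ℝ → ℝ → ℝ} (hf : ContCk M T k f) :
    ∀ᶠ R in atTop, BoundWk T k R f := by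
  have h1 : ∀ j, ∃ C, j ≤ k → ∀ t ∈ Icc 0 T, ∀ x, |iteratedDeriv j (f t) x| ≤ C := fun j => by
    by_cases hj : j ≤ k
    · obtain ⟨C, hC⟩ := ((isCompact_Icc (a := (0 : ℝ)) (b := T)).prod
        (isCompact_Icc (a := (0 : ℝ)) (b := M))).exists_bound_of_continuousOn
          ((hf.continuousOn_uncurry hj).mono (prod_mono_right (subset_univ _)))
      refine ⟨C, fun _ t ht x => ?_⟩
      obtain ⟨y, hy, hxy⟩ := (periodic_iteratedDeriv (hf.periodic t ht) j).exists_mem_Ico₀ hM x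
      rw [hxy]
      exact hC (t, y) ⟨ht, Ico_subset_Icc_self hy⟩
    · exact ⟨0, fun h => absurd h hj⟩
  choose C hC using h1
  filter_upwards [eventually_ge_atTop (∑ j ∈ Finset.range (k + 1), |C j|)] with R hR t ht x j hj
  refine ((hC j hj t ht x).trans (le_abs_self _)).trans (le_trans ?_ hR)
  exact Finset.single_le_sum (f := fun j => |C j|) (fun _ _ => abs_nonneg _)
    (Finset.mem_range.2 (Nat.lt_succ_of_le hj))

variable {n : ℕ} {a b c d e : ℝ → ℝ → ℝ}

/-- Compactness in time and periodicity in space bound every continuous coefficient. This supplies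
some `R`, including one at level `n + 1`, for the continuity statements, where constants need not be
uniform in the data. -/
theorem Regular.exists_dataBound (h : Regular M T n a b c d e) (hn : 1 ≤ n) (hM : 0 < M)
    (ha : NonDegenerate T a) : ∃ R, DataBound M T n R a b c d e := by
  obtain ⟨a₀, ha₀, ha⟩ := ha
  obtain ⟨E, hE⟩ := h.e_reg.bound
  have mono : ∀ {k l : ℕ} {f : ℝ → ℝ → ℝ}, l ≤ k → (∀ᶠ R in atTop, BoundWk T k R f) →
      ∀ᶠ R in atTop, BoundWk T l R f := fun hl hf => hf.mono fun R hR => hR.mono hl le_rfl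
  have ht := h.a_t_reg.contCk.eventually_bound hM
  obtain ⟨R, h1, h2, h3, h4, h5, h6, h7, h8, h9, h10⟩ := ((eventually_ge_atTop M).and
    ((eventually_ge_atTop T).and ((h.a_reg.eventually_bound hM).and ((mono hn ht).and
    ((eventually_ge_atTop a₀⁻¹).and ((mono (Nat.le_add_right n 2) (h.b_reg.eventually_bound hM)).and
    ((mono (Nat.zero_le n) (h.b_t_reg.contCk.eventually_bound hM)).and
    ((h.c_reg.eventually_bound hM).and ((h.d_reg.eventually_bound hM).and
    (eventually_ge_atTop E)))))))))).exists
  refine ⟨R, h1, h2, h3, h4, fun t ht x => ?_, h6, h7, h8, h9, hE.mono fun t ht => ht.trans h10⟩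
  rw [abs_inv]
  exact (inv_anti₀ ha₀ (ha t ht x)).trans h5

/-- `max R 1` is used because the estimates compare powers of the bound. The same constants serve
every later starting time `τ`, which is what restarting the equation needs. -/
theorem Regular.coeffs (h : Regular M T n a b c d e) (hM : 0 < M) {R δ : ℝ}
    (hδ : 0 < δ) (ha : NonDegenerate T a) (hR : DataBound M T n R a b c d e)
    (havg : ∀ t ∈ Icc 0 T, δ ≤ avgDiffusion M a b t) {τ : ℝ} (h0 : 0 ≤ τ) (hτ : τ < T) :
    Coeffs M τ T n (max R 1) δ a (timeDeriv T a) b (timeDeriv T b) c d := by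
  obtain ⟨a₀, ha₀, ha⟩ := ha
  have sub : Icc τ T ⊆ Icc 0 T := Icc_subset_Icc_left h0
  have sub' : Icc τ T ×ˢ univ ⊆ Icc 0 T ×ˢ (univ : Set ℝ) := prod_mono_left sub
  have hmax : R ≤ max R 1 := le_max_left _ _
  have deriv_at : ∀ {f : ℝ → ℝ → ℝ} {k : ℕ}, TimeDerivContCk M T k f → ∀ t ∈ Ioo τ T, ∀ x,
      HasDerivAt (fun s => f s x) (timeDeriv T f t x) t := fun hf t ht x =>
    ((hf.differentiable x t (sub (Ioo_subset_Icc_self ht))).hasDerivWithinAt).hasDerivAt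
      (Icc_mem_nhds (h0.trans_lt ht.1) ht.2)
  have zero_cont : ∀ {f : ℝ → ℝ → ℝ} {k : ℕ}, ContCk M T k f →
      ContinuousOn (Function.uncurry f) (Icc τ T ×ˢ univ) := fun hf => by
    have := (hf.continuousOn_uncurry (Nat.zero_le _)).mono sub'
    simpa only [iteratedDeriv_zero] using this
  have zero_le : ∀ {f : ℝ → ℝ → ℝ} {k : ℕ}, BoundWk T k R f → ∀ t ∈ Icc τ T, ∀ x,
      |f t x| ≤ max R 1 := fun hf t ht x => by
    simpa using (hf t (sub ht) x 0 (Nat.zero_le _)).trans hmax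
  exact {
    M_pos := hM
    M_le := hR.M_le.trans hmax
    lt := hτ
    len_le := by linarith [hR.T_le]
    one_le := le_max_right _ _
    delta_pos := hδ
    a_per := fun t ht => h.a_reg.periodic t (sub ht)
    b_per := fun t ht => h.b_reg.periodic t (sub ht)
    c_per := fun t ht => h.c_reg.periodic t (sub ht)
    d_per := fun t ht => h.d_reg.periodic t (sub ht)
    a'_per := fun t ht => h.a_t_reg.contCk.periodic t (sub ht)
    b'_per := fun t ht => h.b_t_reg.contCk.periodic t (sub ht)
    a_smooth := fun t ht => h.a_reg.contDiff t (sub ht)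
    b_smooth := fun t ht => h.b_reg.contDiff t (sub ht)
    c_smooth := fun t ht => h.c_reg.contDiff t (sub ht)
    d_smooth := fun t ht => h.d_reg.contDiff t (sub ht)
    a_cont := fun j hj => (h.a_reg.continuousOn_uncurry hj).mono sub'
    b_cont := fun j hj => (h.b_reg.continuousOn_uncurry hj).mono sub'
    c_cont := fun j hj => (h.c_reg.continuousOn_uncurry hj).mono sub'
    d_cont := fun j hj => (h.d_reg.continuousOn_uncurry hj).mono sub'
    a'_cont := zero_cont h.a_t_reg.contCk
    b'_cont := zero_cont h.b_t_reg.contCk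
    a_deriv := deriv_at h.a_t_reg
    b_deriv := deriv_at h.b_t_reg
    a_le := fun t ht x j hj => (hR.a_le t (sub ht) x j hj).trans hmax
    b_le := fun t ht x j hj => (hR.b_le t (sub ht) x j hj).trans hmax
    c_le := fun t ht x j hj => (hR.c_le t (sub ht) x j hj).trans hmax
    d_le := fun t ht x j hj => (hR.d_le t (sub ht) x j hj).trans hmax
    a'_le := zero_le hR.a_t_le
    b'_le := zero_le hR.b_t_le
    a_inv_le := fun t ht x => (hR.a_inv_le t (sub ht) x).trans hmax
    a_ne := fun t ht x => abs_pos.1 (ha₀.trans_le (ha t (sub ht) x))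
    avg_le := fun t ht => havg t (sub ht) }

theorem Regular.source (h : Regular M T n a b c d e) {B : ℝ}
    (hB : ∀ᵐ t ∂(volume.restrict (Icc 0 T)), normH M n (e t) ≤ B) {τ : ℝ} (h0 : 0 ≤ τ) :
    Source M τ T n B e := by
  have sub : Icc τ T ⊆ Icc 0 T := Icc_subset_Icc_left h0
  exact ⟨ae_restrict_of_ae_restrict_of_subset sub h.e_reg.mem,
    ae_restrict_of_ae_restrict_of_subset sub h.e_cont, ae_restrict_of_ae_restrict_of_subset sub hB,
    fun k => (h.e_reg.meas k).mono_measure (Measure.restrict_mono sub le_rfl)⟩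

theorem source_zero (M τ T : ℝ) (n : ℕ) : Source M τ T n 0 fun _ _ => 0 := by
  refine ⟨ae_of_all _ fun _ => ⟨fun _ => rfl, MemLp.zero, ?_⟩, ae_of_all _ fun _ => continuous_const,
    ae_of_all _ fun _ => (normH_zero _).le, fun k => aestronglyMeasurable_const⟩
  simp [perCoeff]

/-! ### Solutions on subintervals -/

variable {u₀ : ℝ → ℝ} {u v : ℝ → ℝ → ℝ} {τ : ℝ}

theorem SolvesOn.restrict (h : SolvesOn M 0 T n a b c d e u₀ u) (hτ : τ ∈ Icc 0 T) :
    SolvesOn M τ T n a b c d e (u τ) u := by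
  have sub : Icc τ T ⊆ Icc 0 T := Icc_subset_Icc_left hτ.1
  refine ⟨ae_restrict_of_ae_restrict_of_subset sub h.mem,
    h.bound.imp fun C hC => ae_restrict_of_ae_restrict_of_subset sub hC,
    fun t ht => h.periodic t (sub ht), fun t ht => h.contDiff t (sub ht),
    fun x => (h.integrable x).mono_set sub, fun t ht x => ?_⟩
  have ii : ∀ α ∈ Icc 0 T, ∀ β ∈ Icc 0 T, IntervalIntegrable (fun s => rhs a b c d e u s x) volume α β :=
    fun α hα β hβ => ((h.integrable x).mono_set (by
      rw [uIcc]; exact Icc_subset_Icc (le_min hα.1 hβ.1) (max_le hα.2 hβ.2))).intervalIntegrable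
  have h0 : (0 : ℝ) ∈ Icc 0 T := ⟨le_rfl, hτ.1.trans hτ.2⟩
  rw [h.eqn t (sub ht) x, h.eqn τ hτ x, add_assoc,
    intervalIntegral.integral_add_adjacent_intervals (ii 0 h0 τ hτ) (ii τ hτ t (sub ht))]

theorem SolvesOn.of_succ (hM : 0 < M) (h : SolvesOn M τ T (n + 1) a b c d e u₀ u) :
    SolvesOn M τ T n a b c d e u₀ u := by
  have hle : (n : ℝ) ≤ ((n + 1 : ℕ) : ℝ) := by exact_mod_cast Nat.le_succ n
  refine ⟨h.mem.mono fun t ht => ht.mono hle, ?_, h.periodic, h.contDiff, h.integrable, h.eqn⟩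
  obtain ⟨C, hC⟩ := h.bound
  refine ⟨C, ?_⟩
  filter_upwards [h.mem, hC] with t h1 h2
  exact (normH_mono hM h1 hle).trans h2

theorem SolvesOn.sub (hM : 0 < M) {v₀ : ℝ → ℝ} (hu : SolvesOn M τ T n a b c d e u₀ u)
    (hv : SolvesOn M τ T n a b c d e v₀ v) :
    SolvesOn M τ T n a b c d (fun _ _ => 0) (fun x => u₀ x - v₀ x) fun t x => u t x - v t x := by
  have hr : ∀ s ∈ Icc τ T, ∀ x, rhs a b c d (fun _ _ => 0) (fun t x => u t x - v t x) s x =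
      rhs a b c d e u s x - rhs a b c d e v s x := fun s hs x => by
    simp only [rhs_eq, spatial_sub (hu.contDiff s hs) (hv.contDiff s hs)]; ring
  refine ⟨?_, ?_, fun t ht x => by simp only [hu.periodic t ht x, hv.periodic t ht x],
    fun t ht => (hu.contDiff t ht).sub (hv.contDiff t ht),
    fun x => ((hu.integrable x).sub (hv.integrable x)).congr_fun (fun s hs => (hr s hs x).symm)
      measurableSet_Icc, fun t ht x => ?_⟩
  · filter_upwards [hu.mem, hv.mem] with t h1 h2 using h1.sub hM h2
  · obtain ⟨C, hC⟩ := hu.bound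
    obtain ⟨D, hD⟩ := hv.bound
    refine ⟨Real.sqrt (2 * C ^ 2 + 2 * D ^ 2), ?_⟩
    filter_upwards [hu.mem, hv.mem, hC, hD] with t h1 h2 h3 h4
    refine Real.le_sqrt_of_sq_le ((normH_sub_sq_le hM h1 h2).trans ?_)
    have := pow_le_pow_left₀ (normH_nonneg _ _) h3 2
    have := pow_le_pow_left₀ (normH_nonneg _ _) h4 2
    linarith
  · have hsub : uIcc τ t ⊆ Icc τ T := by rw [uIcc_of_le ht.1]; exact Icc_subset_Icc_right ht.2
    have ii : ∀ {f : ℝ → ℝ}, IntegrableOn f (Icc τ T) → IntervalIntegrable f volume τ t := fun hf =>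
      (hf.mono_set hsub).intervalIntegrable
    rw [intervalIntegral.integral_congr fun s hs => hr s (hsub hs) x,
      intervalIntegral.integral_sub (ii (hu.integrable x)) (ii (hv.integrable x))]
    simp only [hu.eqn t ht x, hv.eqn t ht x]; ring

theorem IsSolution.solvesOn (h : IsSolution M T n a b c d e u₀ u) : SolvesOn M 0 T n a b c d e u₀ u :=
  ⟨h.memLinftyH.mem, h.memLinftyH.bound, h.periodic, h.contDiff, h.integrable, h.eqn⟩

theorem SolvesOn.isSolution (h : SolvesOn M 0 T n a b c d e u₀ u)
    (hc : ∀ k, ContinuousOn (fun t => perCoeff M (u t) k) (Icc 0 T)) :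
    IsSolution M T n a b c d e u₀ u :=
  ⟨⟨⟨h.mem, fun k => (hc k).aestronglyMeasurable measurableSet_Icc⟩, h.bound⟩, h.periodic, h.contDiff,
    h.integrable, h.eqn⟩

end DispersivePDE

/-! ### Continuity in time. -/

namespace DispersivePDE

variable {M T : ℝ} {n : ℕ} {a b c d e : ℝ → ℝ → ℝ}

/-! ### Continuity of solutions -/

/-- Propagation of regularity. -/
theorem SolvesOn.exists_bound_succ (hn : 4 ≤ n) (hM : 0 < M) {δ : ℝ} (hδ : 0 < δ)
    (h : Regular M T (n + 1) a b c d e) (ha : NonDegenerate T a)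
    (havg : ∀ t ∈ Icc 0 T, δ ≤ avgDiffusion M a b t) {u₀ : ℝ → ℝ} {u : ℝ → ℝ → ℝ}
    (hu : SolvesOn M 0 T n a b c d e u₀ u) {τ : ℝ} (h0 : 0 ≤ τ) (hτ : τ < T)
    (hm : MemH M (n + 1 : ℕ) (u τ)) :
    ∃ C, ∀ t ∈ Icc τ T, MemH M (n + 1 : ℕ) (u t) ∧ normH M (n + 1 : ℕ) (u t) ^ 2 ≤ C := by
  obtain ⟨R, hR⟩ := h.exists_dataBound (by omega) hM ha
  have hc := h.coeffs hM hδ ha hR havg h0 hτ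
  obtain ⟨K, -, hK⟩ := exists_solvesOn (n := n + 1) (by omega) (le_max_right R 1) hδ
  obtain ⟨v, hv, hvb, -⟩ := hK hc ⟨hm, (hu.contDiff τ ⟨h0, hτ.le⟩).continuous⟩ (B := max R 0)
    (le_max_right _ _) (h.source (hR.e_le.mono fun t ht => ht.trans (le_max_left _ _)) h0)
  -- The solution `v` built at level `n + 1` must be compared with `u`, known only at level `n`, so
  -- uniqueness is applied with the coefficients regarded at the lower level.
  have hcn : Coeffs M τ T n (max R 1) δ a (timeDeriv T a) b (timeDeriv T b) c d :=
    { hc with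
      a_smooth := fun t ht => (hc.a_smooth t ht).of_le (by exact_mod_cast (by omega))
      b_smooth := fun t ht => (hc.b_smooth t ht).of_le (by exact_mod_cast (by omega))
      c_smooth := fun t ht => (hc.c_smooth t ht).of_le (by exact_mod_cast (by omega))
      d_smooth := fun t ht => (hc.d_smooth t ht).of_le (by exact_mod_cast (by omega))
      a_cont := fun j hj => hc.a_cont j (by omega)
      b_cont := fun j hj => hc.b_cont j (by omega)
      c_cont := fun j hj => hc.c_cont j (by omega)
      d_cont := fun j hj => hc.d_cont j (by omega)
      a_le := fun t ht x j hj => hc.a_le t ht x j (by omega)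
      b_le := fun t ht x j hj => hc.b_le t ht x j (by omega)
      c_le := fun t ht x j hj => hc.c_le t ht x j (by omega)
      d_le := fun t ht x j hj => hc.d_le t ht x j (by omega) }
  refine ⟨K * (normH M (n + 1 : ℕ) (u τ) ^ 2 + max R 0 ^ 2), fun t ht => ?_⟩
  rw [hcn.unique hn (hu.restrict ⟨h0, hτ.le⟩) (hv.of_succ hM) ht]
  exact hvb t ht

/-- Almost every time has `u ∈ H^{n+1}`, so before any `t > 0` there is such a `τ`. From there `u`
is bounded in `H^{n+1}`, and continuity of the Fourier coefficients upgrades to continuity in every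
`H^s` with `s < n + 1`. -/
theorem SolvesOn.contH_Ioc (hn : 4 ≤ n) (hM : 0 < M) {δ : ℝ} (hδ : 0 < δ)
    (h : Regular M T (n + 1) a b c d e) (ha : NonDegenerate T a)
    (havg : ∀ t ∈ Icc 0 T, δ ≤ avgDiffusion M a b t) {u₀ : ℝ → ℝ} {u : ℝ → ℝ → ℝ}
    (hu : SolvesOn M 0 T n a b c d e u₀ u)
    (hc : ∀ k, ContinuousOn (fun t => perCoeff M (u t) k) (Icc 0 T))
    (hm : ∀ᵐ t ∂(volume.restrict (Icc 0 T)), MemH M (n + 1 : ℕ) (u t)) {s : ℝ} (hs : s < n + 1) :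
    ContH M s (Ioc 0 T) u := by
  have hs' : s < ((n + 1 : ℕ) : ℝ) := by push_cast; exact hs
  have key : ∀ t ∈ Ioc 0 T, ∃ τ, 0 ≤ τ ∧ τ < t ∧ ∃ C, ∀ r ∈ Icc τ T,
      MemH M (n + 1 : ℕ) (u r) ∧ normH M (n + 1 : ℕ) (u r) ^ 2 ≤ C := fun t ht => by
    have sub : Ioo 0 t ⊆ Icc 0 T := Ioo_subset_Icc_self.trans (Icc_subset_Icc_right ht.2)
    have hm' := (ae_restrict_of_ae_restrict_of_subset sub hm).and (ae_restrict_mem measurableSet_Ioo)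
    have hne : volume.restrict (Ioo 0 t) ≠ 0 := by
      rw [Ne, Measure.restrict_eq_zero, Real.volume_Ioo]; simpa using ht.1
    have : NeBot (ae (volume.restrict (Ioo 0 t))) := ae_neBot.2 hne
    obtain ⟨τ, h1, h2⟩ := hm'.exists
    exact ⟨τ, h2.1.le, h2.2, hu.exists_bound_succ hn hM hδ h ha havg h2.1.le (h2.2.trans_le ht.2) h1⟩
  refine ⟨fun t ht => ?_, fun t ht => ?_⟩
  · obtain ⟨τ, h0, h1, C, hC⟩ := key t ht
    exact (hC t ⟨h1.le, ht.2⟩).1.mono hs'.le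
  · obtain ⟨τ, h0, h1, C, hC⟩ := key t ht
    refine tendsto_normH_sub hM hs' (C := C) (hC t ⟨h1.le, ht.2⟩).1 ?_ fun k =>
      ((hc k) t ⟨ht.1.le, ht.2⟩).mono Ioc_subset_Icc_self
    filter_upwards [self_mem_nhdsWithin, mem_nhdsWithin_of_mem_nhds (Ioi_mem_nhds h1)] with r hr hr'
    exact hC r ⟨hr'.le, hr.2⟩

/-- Only `t = 0` is new. The datum is approximated in `H^n` by a smooth one, whose solution `v` is
bounded in `H^{n+1}` up to time zero and hence continuous there in `H^n`. The difference `u - v`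
solves the equation without source and stays small by the a priori bound, whose constant does not
depend on the approximation. -/
theorem SolvesOn.contH_Icc (hn : 4 ≤ n) (hM : 0 < M) (hT : 0 < T) {δ : ℝ} (hδ : 0 < δ)
    (h' : Regular M T n a b c d e) (h : Regular M T (n + 1) a b c d e) (ha : NonDegenerate T a)
    (havg : ∀ t ∈ Icc 0 T, δ ≤ avgDiffusion M a b t) {u₀ : ℝ → ℝ} {u : ℝ → ℝ → ℝ}
    (hu₀ : InitialData M n u₀) (hu : SolvesOn M 0 T n a b c d e u₀ u)
    (hmem : ∀ t ∈ Icc 0 T, MemH M n (u t))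
    (hc : ∀ k, ContinuousOn (fun t => perCoeff M (u t) k) (Icc 0 T))
    (hm : ∀ᵐ t ∂(volume.restrict (Icc 0 T)), MemH M (n + 1 : ℕ) (u t)) :
    ContH M n (Icc 0 T) u := by
  refine ⟨hmem, fun t ht => ?_⟩
  rcases ht.1.eq_or_lt with rfl | hpos
  · obtain ⟨R, hR⟩ := h'.exists_dataBound (by omega) hM ha
    have hco := h'.coeffs hM hδ ha hR havg le_rfl hT
    obtain ⟨K, hK0, hK⟩ := exists_solvesOn hn (le_max_right R 1) hδ
    have u0 : u 0 = u₀ := by funext x; simpa using hu.eqn 0 ht x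
    have hsq : Tendsto (fun t => normH M n (fun x => u t x - u 0 x) ^ 2) (𝓝[Icc 0 T] 0) (𝓝 0) := by
      rw [tendsto_order]
      refine ⟨fun a ha => Eventually.of_forall fun t => ha.trans_le (sq_nonneg _), fun ε hε => ?_⟩
      -- With this choice `‖u - v‖²`, `‖u₀ - v₀‖²` and `‖v - v₀‖²` are each at most `ε / 16`. Two
      -- uses of `‖f - g‖² ≤ 2‖f‖² + 2‖g‖²` give at most `10 ε / 16`.
      obtain ⟨v₀, hv₀, hd⟩ := hu₀.exists_approx hM (by omega) (ε := ε / (16 * (K + 1))) (by positivity)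
      obtain ⟨v, hv, hvb, hvc, -⟩ := hK hco (hv₀ n) (B := max R 0) (le_max_right _ _)
        (h'.source (hR.e_le.mono fun t ht => ht.trans (le_max_left _ _)) le_rfl)
      have v0 : v 0 = v₀ := by funext x; simpa using hv.eqn 0 ht x
      have hd0 : InitialData M n fun x => u₀ x - v₀ x :=
        ⟨hu₀.1.sub hM (hv₀ n).1, hu₀.2.sub (hv₀ n).2⟩
      obtain ⟨w, hw, hwb, -⟩ := hK hco hd0 le_rfl (source_zero M 0 T n)
      have huv := hu.sub hM hv
      obtain ⟨C, hC⟩ := hv.exists_bound_succ hn hM hδ h ha havg le_rfl hT (v0 ▸ (hv₀ (n + 1)).1)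
      have hvt : Tendsto (fun t => normH M n fun x => v t x - v 0 x) (𝓝[Icc 0 T] 0) (𝓝 0) := by
        refine tendsto_normH_sub hM (by exact_mod_cast Nat.lt_succ_self n) (C := C) (hC 0 ht).1 ?_
          fun k => hvc k 0 ht
        filter_upwards [self_mem_nhdsWithin] with r hr using hC r hr
      have hvt2 := (hvt.pow 2).eventually (gt_mem_nhds (show (0 : ℝ) ^ 2 < ε / 16 by simpa using hε))
      filter_upwards [self_mem_nhdsWithin, hvt2] with t ht' h4
      have m1 := hmem t ht'
      have m2 := (hvb t ht').1
      have m3 := hmem 0 ht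
      have m4 := (hvb 0 ht).1
      have n1 : normH M n (fun x => u t x - v t x) ^ 2 ≤ K * (ε / (16 * (K + 1))) := by
        have e1 : (fun x => u t x - v t x) = w t := hco.unique hn huv hw ht'
        rw [e1]
        refine (hwb t ht').2.trans ?_
        rw [zero_pow two_ne_zero, add_zero]
        gcongr
      have n2 := normH_sub_sq_le hM (m1.sub hM m2) (m3.sub hM m2)
      have n3 := normH_sub_sq_le hM (m3.sub hM m4) (m2.sub hM m4)
      have e2 : (fun x => (u t x - v t x) - (u 0 x - v t x)) = fun x => u t x - u 0 x := by
        funext x; ring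
      have e3 : (fun x => (u 0 x - v 0 x) - (v t x - v 0 x)) = fun x => u 0 x - v t x := by
        funext x; ring
      rw [e2] at n2
      rw [e3] at n3
      rw [u0, v0] at n3
      rw [v0] at h4
      rw [u0] at n2 ⊢
      have e4 : ε / (16 * (K + 1)) ≤ ε / 16 := by
        apply div_le_div_of_nonneg_left hε.le (by norm_num); linarith
      have e5 : K * (ε / (16 * (K + 1))) ≤ ε / 16 := by
        rw [← mul_div_assoc, div_le_div_iff₀ (by positivity) (by norm_num)]
        nlinarith
      linarith
    have := (Real.continuous_sqrt.tendsto 0).comp hsq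
    rw [Real.sqrt_zero] at this
    exact this.congr fun t => Real.sqrt_sq (normH_nonneg _ _)
  · have h1 := (hu.contH_Ioc hn hM hδ h ha havg hc hm (s := n) (by simp)).tendsto t ⟨hpos, ht.2⟩
    refine h1.mono_left (nhdsWithin_le_iff.2 ?_)
    filter_upwards [self_mem_nhdsWithin, mem_nhdsWithin_of_mem_nhds (Ioi_mem_nhds hpos)] with r hr hr'
    exact ⟨hr', hr.2⟩

end DispersivePDE

end

/-! ### The main theorem. -/

theorem theorem2p2 (n : ℕ) (hn : 4 ≤ n) (R δ₀ : ℝ) (hδ₀ : 0 < δ₀) :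
    ∃ K : ℝ, 0 < K ∧
      ∀ (M T : ℝ) (a b c d e : ℝ → ℝ → ℝ), 0 < M → 0 < T →
        DispersivePDE.Regular M T n a b c d e →
        DispersivePDE.NonDegenerate T a →
        DispersivePDE.DataBound M T n R a b c d e →
        (∀ t ∈ Set.Icc 0 T, δ₀ ≤ DispersivePDE.avgDiffusion M a b t) →
        ∃ Ψ : (ℝ → ℝ) → ℝ → ℝ → ℝ,
          DispersivePDE.IsSolutionMap M T n a b c d e Ψ ∧
          (∀ u₀, DispersivePDE.InitialData M n u₀ →
            DispersivePDE.MemL2H M T (n + 1) (Ψ u₀) ∧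
            DispersivePDE.normL2H M T (n + 1) (Ψ u₀) ≤ K * (DispersivePDE.normH M n u₀ + 1) ∧
            ((∀ t ∈ Set.Icc 0 T, ∀ x, e t x = 0) →
              DispersivePDE.normL2H M T (n + 1) (Ψ u₀) ≤ K * DispersivePDE.normH M n u₀)) ∧
          (DispersivePDE.Regular M T (n + 1) a b c d e →
            ∀ u₀, DispersivePDE.InitialData M n u₀ →
              DispersivePDE.ContH M n (Set.Icc 0 T) (Ψ u₀) ∧
              ∀ s : ℝ, 0 ≤ s → s < n + 1 →
                DispersivePDE.ContH M s (Set.Ioc 0 T) (Ψ u₀)) := by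
  obtain ⟨K, hK0, hK⟩ := DispersivePDE.exists_solvesOn hn (le_max_right R 1) hδ₀
  have hR1 : 1 ≤ max R 1 := le_max_right _ _
  -- For `μ = max R 1 ≥ 1` and `N ≥ 0` one has `√(N² + μ²) ≤ μ (N + 1)`, so this constant covers
  -- both bounds.
  refine ⟨Real.sqrt K * max R 1, by positivity, fun M T a b c d e hM hT hreg ha hdata havg => ?_⟩
  have hco := hreg.coeffs hM hδ₀ ha hdata havg le_rfl hT
  have hsrc : DispersivePDE.Source M 0 T n (max R 1) e :=
    hreg.source (hdata.e_le.mono fun t ht => ht.trans (le_max_left _ _)) le_rfl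
  have hmax0 : 0 ≤ max R 1 := by linarith
  choose! Ψ hΨ using fun u₀ (hu₀ : DispersivePDE.InitialData M n u₀) => hK hco hu₀ hmax0 hsrc
  refine ⟨Ψ, fun u₀ hu₀ => ?_, fun u₀ hu₀ => ?_, fun hreg' u₀ hu₀ => ?_⟩
  · obtain ⟨s1, s2, s3, -⟩ := hΨ u₀ hu₀
    exact ⟨s1.isSolution s3, fun v hv t ht x => congrFun (hco.unique hn hv.solvesOn s1 ht) x⟩
  · obtain ⟨s1, s2, s3, s4, s5, s6⟩ := hΨ u₀ hu₀
    have hN := DispersivePDE.normH_nonneg (M := M) n u₀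
    refine ⟨⟨⟨s4, fun k => (s3 k).aestronglyMeasurable measurableSet_Icc⟩, s5⟩, ?_, fun he0 => ?_⟩
    · rw [DispersivePDE.normL2H]
      refine (Real.sqrt_le_sqrt s6).trans ?_
      rw [Real.sqrt_mul hK0.le, mul_assoc]
      refine mul_le_mul_of_nonneg_left ?_ (Real.sqrt_nonneg _)
      refine Real.sqrt_le_iff.2 ⟨by positivity, ?_⟩
      nlinarith [mul_nonneg hmax0 hN, sq_nonneg (DispersivePDE.normH M n u₀), mul_nonneg (mul_nonneg hmax0 hmax0) hN,
        mul_nonneg (by linarith : 0 ≤ max R 1 - 1) (sq_nonneg (DispersivePDE.normH M n u₀)),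
        mul_nonneg (mul_nonneg (by linarith : 0 ≤ max R 1 - 1) hmax0) (sq_nonneg (DispersivePDE.normH M n u₀))]
    -- The solution was produced with source bound `max R 1`. When `e` vanishes the existence result
    -- applies with bound `0`, and uniqueness transfers the sharper estimate to `Ψ u₀`.
    · have hz : DispersivePDE.Source M 0 T n 0 e := hreg.source (by
        filter_upwards [ae_restrict_mem measurableSet_Icc] with t ht
        have : e t = fun _ => 0 := funext fun x => he0 t ht x
        rw [this, DispersivePDE.normH_zero]) le_rfl
      obtain ⟨v, hv, -, -, -, -, hv6⟩ := hK hco hu₀ le_rfl hz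
      have e1 : DispersivePDE.normL2H M T (n + 1) (Ψ u₀) = DispersivePDE.normL2H M T (n + 1) v := by
        rw [DispersivePDE.normL2H, DispersivePDE.normL2H, setIntegral_congr_fun measurableSet_Icc fun t ht => by
          rw [hco.unique hn s1 hv ht]]
      rw [e1, DispersivePDE.normL2H]
      refine (Real.sqrt_le_sqrt hv6).trans ?_
      rw [zero_pow two_ne_zero, add_zero, Real.sqrt_mul hK0.le, Real.sqrt_sq hN, mul_assoc]
      refine mul_le_mul_of_nonneg_left ?_ (Real.sqrt_nonneg _)
      nlinarith
  · obtain ⟨s1, s2, s3, s4, -⟩ := hΨ u₀ hu₀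
    have s4' : ∀ᵐ t ∂(volume.restrict (Icc 0 T)), DispersivePDE.MemH M (n + 1 : ℕ) (Ψ u₀ t) := by
      push_cast; exact s4
    exact ⟨s1.contH_Icc hn hM hT hδ₀ hreg hreg' ha havg hu₀ (fun t ht => (s2 t ht).1) s3 s4',
      fun s _ hs => s1.contH_Ioc hn hM hδ₀ hreg' ha havg s3 s4' hs⟩
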